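/- **Machine model.** Algorithms are programs of a random access machine with integer registers and indirectly addressed memories, with the operations $+$, $-$, $\times$, halving, loading, storing and tests. An operation on numbers (operands, addresses, stored values) of at most $b$ bits takes time $i_\times(b)$ if it is a multiplication and $i_+(b)$ otherwise. The times $i_+,i_\times$ may depend on the word size of the machine; we assume only that, for some constant $D$, $i_\times$ is non-decreasing, $i_+(b)\le D\, i_\times(b)$ and $i_\times(2b)\le D\, i_\times(b)$ for all $b$. **Matrix multiplication.** Let $\omega$ be a real number such that two $N\times N$ matrices can be multiplied in $O(N^{\omega})$ time; that is, some program of this machine multiplies any two $N\times N$ integer matrices ($N\ge 1$) with entries of at most $b$ bits in time $O(N^{\omega}\, i_\times(b+\log N))$ for all such $i_+,i_\times$ and irrespective of the other contents of the memory, where the constant depends only on the program and on $D$. (The smallest such $\omega$, if there is one, is the matrix multiplication constant.) **Branch decompositions.** A branch decomposition of a finite simple graph $G=(V,E)$ is a tree $T$ in which each internal node has degree three, together with a bijection between the leaves of $T$ and $E$ (the node of a one-node tree is a leaf). Removing an edge $e$ of $T$ splits $E$ into two classes $E_1,E_2$; the middle set of $e$ is the set of vertices that are an endpoint both of an edge in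 $E_1$ and of an edge in $E_2$. The width of $T$ is the size of a largest middle set ($0$ if $T$ has no edge). **Theorem.** There is an algorithm that, given a branch decomposition $T$ of width at most $k$, $k\ge 2$, of a graph $G$ with $n$ vertices and $m$ edges, computes the number of perfect matchings in $G$ in time $$O\bigl(m\,k^{2}\,2^{\frac{\omega}{2}k}\, i_\times(n\log k)\bigr).$$ Moreover, for every constant $a$, on the inputs for which $G$ has at most $n^{ak}$ matchings (of any size), the same algorithm runs in time $$O\bigl(m\,k^{2}\,2^{\frac{\omega}{2}k}\, i_\times(k\log n)\bigr).$$ The input consists of $n$, the adjacency lists of $T$, and the two endpoints of the edge of $G$ assigned to each leaf of $T$. The implied constants depend only on $\omega$, the algorithm, $D$ and $a$. -/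

import Mathlib

/-! ### Random access machines over the integers, with bit-dependent charges -/

namespace RAM

/-- Memory configuration: integer registers, and finitely or countably many addressable memories
(a given program names only finitely many of each). -/
structure State where
  reg : ℕ → ℤ
  mem : ℕ → ℤ → ℤ

/-- Structured programs of the random access machine.  Register and memory names are literals of
the program; addresses are register contents (indirect addressing). -/
inductive Prog where
  | skip : Prog
  | const (r : ℕ) (c : ℤ) : Prog
  | add (r x y : ℕ) : Prog
  | sub (r x y : ℕ) : Prog
  | mul (r x y : ℕ) : Prog
  | half (r x : ℕ) : Prog
  | load (r a i : ℕ) : Prog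
  | store (a i x : ℕ) : Prog
  | seq (p q : Prog) : Prog
  | ifPos (x : ℕ) (p q : Prog) : Prog
  | whilePos (x : ℕ) (p : Prog) : Prog

/-- The state after writing `v` into register `r`. -/
def State.setReg (s : State) (r : ℕ) (v : ℤ) : State :=
  { s with reg := Function.update s.reg r v }

/-- The state after writing `v` into memory `a` at address `i`. -/
def State.setMem (s : State) (a : ℕ) (i v : ℤ) : State :=
  { s with mem := Function.update s.mem a (Function.update (s.mem a) i v) }

/-- Number of bits of (the absolute value of) an integer. -/
def bits (x : ℤ) : ℕ := x.natAbs.size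

/-- `Exec ip im p s t s'`: started in state `s`, the program `p` halts in state `s'` after time `t`.
An instruction that handles numbers (operands, addresses, stored values) of at most `b` bits takes
time `im b` if it is a multiplication and time `ip b` otherwise. -/
inductive Exec (ip im : ℕ → ℕ) : Prog → State → ℕ → State → Prop where
  | skip (s : State) : Exec ip im .skip s 0 s
  | const (s : State) (r : ℕ) (c : ℤ) :
      Exec ip im (.const r c) s (ip (bits c)) (s.setReg r c)
  | add (s : State) (r x y : ℕ) :
      Exec ip im (.add r x y) s (ip (max (bits (s.reg x)) (bits (s.reg y))))
        (s.setReg r (s.reg x + s.reg y))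
  | sub (s : State) (r x y : ℕ) :
      Exec ip im (.sub r x y) s (ip (max (bits (s.reg x)) (bits (s.reg y))))
        (s.setReg r (s.reg x - s.reg y))
  | mul (s : State) (r x y : ℕ) :
      Exec ip im (.mul r x y) s (im (max (bits (s.reg x)) (bits (s.reg y))))
        (s.setReg r (s.reg x * s.reg y))
  | half (s : State) (r x : ℕ) :
      Exec ip im (.half r x) s (ip (bits (s.reg x))) (s.setReg r (s.reg x / 2))
  | load (s : State) (r a i : ℕ) :
      Exec ip im (.load r a i) s (ip (max (bits (s.reg i)) (bits (s.mem a (s.reg i)))))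
        (s.setReg r (s.mem a (s.reg i)))
  | store (s : State) (a i x : ℕ) :
      Exec ip im (.store a i x) s (ip (max (bits (s.reg i)) (bits (s.reg x))))
        (s.setMem a (s.reg i) (s.reg x))
  | seq {p q : Prog} {s s' s'' : State} {t t' : ℕ} :
      Exec ip im p s t s' → Exec ip im q s' t' s'' → Exec ip im (.seq p q) s (t + t') s''
  | ifTrue {x : ℕ} {p q : Prog} {s s' : State} {t : ℕ} :
      0 < s.reg x → Exec ip im p s t s' →
        Exec ip im (.ifPos x p q) s (ip (bits (s.reg x)) + t) s'
  | ifFalse {x : ℕ} {p q : Prog} {s s' : State} {t : ℕ} :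
      ¬ 0 < s.reg x → Exec ip im q s t s' →
        Exec ip im (.ifPos x p q) s (ip (bits (s.reg x)) + t) s'
  | whileTrue {x : ℕ} {p : Prog} {s s' s'' : State} {t t' : ℕ} :
      0 < s.reg x → Exec ip im p s t s' → Exec ip im (.whilePos x p) s' t' s'' →
        Exec ip im (.whilePos x p) s (ip (bits (s.reg x)) + t + t') s''
  | whileFalse {x : ℕ} {p : Prog} {s : State} :
      ¬ 0 < s.reg x → Exec ip im (.whilePos x p) s (ip (bits (s.reg x))) s

/-- Regularity of the time `ip b` of additive operations and the time `im b` of multiplications on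
`b`-bit numbers: longer numbers are not faster to multiply, additive operations are not slower than
multiplication (up to the factor `D`), and multiplication of `O(b)`-bit numbers takes time
`O(im b)`.  The functions may vary with the word size of the machine, as long as `D` is fixed. -/
structure RegularTimes (D : ℕ) (ip im : ℕ → ℕ) : Prop where
  mono : Monotone im
  add_le : ∀ b, ip b ≤ D * im b
  double : ∀ b, im (2 * b) ≤ D * im b

/-- `MatMulTime τ`: two `N × N` integer matrices can be multiplied in `O(N ^ τ)` arithmetic time.
There is a routine that, started in any state in which register `0` holds `N ≥ 1` and the
memories `0` and `1` hold (row by row) two matrices with entries of at most `b` bits, puts their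
product into memory `2`, using `O(N ^ τ)` operations each at the price of a multiplication of
`(b + log N)`-bit numbers. -/
def MatMulTime (τ : ℝ) : Prop :=
  ∃ P : Prog, ∀ D : ℕ, ∃ C : ℝ, ∀ ip im : ℕ → ℕ, RegularTimes D ip im →
    ∀ (N b : ℕ), 1 ≤ N → ∀ A B : Matrix (Fin N) (Fin N) ℤ,
      (∀ i j, bits (A i j) ≤ b ∧ bits (B i j) ≤ b) →
      ∀ s : State, s.reg 0 = N →
        (∀ i j : Fin N, s.mem 0 ((N : ℤ) * (i : ℕ) + (j : ℕ)) = A i j) →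
        (∀ i j : Fin N, s.mem 1 ((N : ℤ) * (i : ℕ) + (j : ℕ)) = B i j) →
        ∃ (t : ℕ) (s' : State), Exec ip im P s t s' ∧
          (∀ i j : Fin N, s'.mem 2 ((N : ℤ) * (i : ℕ) + (j : ℕ)) = (A * B) i j) ∧
          (t : ℝ) ≤ C * (N : ℝ) ^ τ * (im (b + N.size) : ℝ)

end RAM

/-! ### Branch decompositions -/

/-- A branch decomposition of `G` with node set `ι`: a tree in which every node that is not a leaf
has degree three, with a bijection from its leaves to the edges of `G`.  (The only node of a
one-node tree counts as a leaf.) -/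
structure BranchDecomposition {V : Type*} (G : SimpleGraph V) (ι : Type*) [Finite ι] where
  tree : SimpleGraph ι
  isTree : tree.IsTree
  degree : ∀ x, (tree.neighborSet x).ncard ≤ 1 ∨ (tree.neighborSet x).ncard = 3
  leafEdge : {x // (tree.neighborSet x).ncard ≤ 1} ≃ G.edgeSet

namespace BranchDecomposition

variable {V : Type*} {G : SimpleGraph V} {ι : Type*} [Finite ι]

/-- The endpoints of the edges of `G` assigned to the leaves on the side of `x` when the tree edge
`xy` is removed. -/
def side (T : BranchDecomposition G ι) (x y : ι) : Set V :=
  {v | ∃ a : {a // (T.tree.neighborSet a).ncard ≤ 1},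
    (T.tree.deleteEdges {s(x, y)}).Reachable x a ∧ v ∈ (T.leafEdge a : Sym2 V)}

/-- The middle set of the tree edge `xy`. -/
def middleSet (T : BranchDecomposition G ι) (x y : ι) : Set V := T.side x y ∩ T.side y x

/-- The size of a largest middle set (`0` if the tree has no edge). -/
noncomputable def width (T : BranchDecomposition G ι) : ℕ :=
  sSup {c | ∃ x y, T.tree.Adj x y ∧ (T.middleSet x y).ncard = c}

end BranchDecomposition

/-- The state `s` is an input for the `n`-vertex graph `G` with branch decomposition `T` on `N`
nodes: the registers `0`, `1` hold `n`, `N`; for a tree node `x`, memory `0` holds its degree at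
address `x`, memory `1` lists its neighbours (in any order) from address `3 x` on and, if `x` is a
leaf, memory `2` holds the endpoints of its edge of `G` at the addresses `2 x`, `2 x + 1`.  The
other registers and memories are `0`. -/
structure IsInput {n N : ℕ} {G : SimpleGraph (Fin n)} (T : BranchDecomposition G (Fin N))
    (s : RAM.State) : Prop where
  vertices : s.reg 0 = n
  nodes : s.reg 1 = N
  reg_zero : ∀ r, 2 ≤ r → s.reg r = 0
  degree : ∀ x : Fin N, s.mem 0 (x : ℕ) = (T.tree.neighborSet x).ncard
  neighbours : ∀ x : Fin N, ∃ f : Fin (T.tree.neighborSet x).ncard → Fin N,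
    Function.Injective f ∧ Set.range f = T.tree.neighborSet x ∧
      ∀ i : Fin (T.tree.neighborSet x).ncard,
        s.mem 1 (3 * (x : ℕ) + (i : ℕ)) = ((f i : ℕ) : ℤ)
  leaves : ∀ x : {x // (T.tree.neighborSet x).ncard ≤ 1}, ∃ u v : Fin n,
    (T.leafEdge x : Sym2 (Fin n)) = s(u, v) ∧
      s.mem 2 (2 * (x.1 : ℕ)) = (u : ℕ) ∧ s.mem 2 (2 * (x.1 : ℕ) + 1) = (v : ℕ)
  mem_zero : ∀ a, 3 ≤ a → ∀ i, s.mem a i = 0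

/-- The number of matchings of `G`. -/
noncomputable def numMatchings {V : Type*} (G : SimpleGraph V) : ℕ :=
  {M : G.Subgraph | M.IsMatching}.ncard

/-- The number of perfect matchings of `G`. -/
noncomputable def numPerfectMatchings {V : Type*} (G : SimpleGraph V) : ℕ :=
  {M : G.Subgraph | M.IsPerfectMatching}.ncard

set_option linter.unusedSectionVars false
set_option linter.constructorNameAsVariable false

namespace RAM

/-! ### A small imperative language on top of the random access machine -/

/-- Integer expressions over variables `V` and arrays `A`. -/
inductive Ex (V A : Type) where
  | const (c : ℤ) : Ex V A
  | var (x : V) : Ex V A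
  | rd (a : A) (i : Ex V A) : Ex V A
  | add (e f : Ex V A) : Ex V A
  | sub (e f : Ex V A) : Ex V A
  | mul (e f : Ex V A) : Ex V A
  | half (e : Ex V A) : Ex V A

/-- States: values of the variables, of the arrays, and of the three memories that are shared with
the environment (the input and the matrix multiplication routine). -/
structure St (V A : Type) where
  v : V → ℤ
  m : A → ℤ → ℤ
  lo : Fin 3 → ℤ → ℤ

/-- Commands. -/
inductive Cmd (V A : Type) where
  | skip : Cmd V A
  | set (x : V) (e : Ex V A) : Cmd V A
  | put (a : A) (i e : Ex V A) : Cmd V A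
  | loadLo (x : V) (a : Fin 3) (i : Ex V A) : Cmd V A
  | storeLo (a : Fin 3) (i e : Ex V A) : Cmd V A
  | call (e : Ex V A) : Cmd V A
  | seq (p q : Cmd V A) : Cmd V A
  | ite (e : Ex V A) (p q : Cmd V A) : Cmd V A
  | loop (x : V) (e : Ex V A) (p : Cmd V A) : Cmd V A

section lang

variable {V A : Type}

namespace Ex

instance : Add (Ex V A) := ⟨Ex.add⟩
instance : Sub (Ex V A) := ⟨Ex.sub⟩
instance : Mul (Ex V A) := ⟨Ex.mul⟩
instance (k : ℕ) : OfNat (Ex V A) k := ⟨Ex.const k⟩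

/-- The value of an expression. -/
def eval (s : St V A) : Ex V A → ℤ
  | const c => c
  | var x => s.v x
  | rd a i => s.m a (i.eval s)
  | add e f => e.eval s + f.eval s
  | sub e f => e.eval s - f.eval s
  | mul e f => e.eval s * f.eval s
  | half e => e.eval s / 2

variable (s : St V A)

@[simp] theorem eval_const (c : ℤ) : (const c : Ex V A).eval s = c := rfl
@[simp] theorem eval_zero : (0 : Ex V A).eval s = 0 := rfl
@[simp] theorem eval_one : (1 : Ex V A).eval s = 1 := rfl
@[simp] theorem eval_two : (2 : Ex V A).eval s = 2 := rfl
@[simp] theorem eval_three : (3 : Ex V A).eval s = 3 := rfl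
@[simp] theorem eval_var (x : V) : (var x : Ex V A).eval s = s.v x := rfl
@[simp] theorem eval_rd (a : A) (i : Ex V A) : (rd a i).eval s = s.m a (i.eval s) := rfl
@[simp] theorem eval_add (e f : Ex V A) : (e + f).eval s = e.eval s + f.eval s := rfl
@[simp] theorem eval_sub (e f : Ex V A) : (e - f).eval s = e.eval s - f.eval s := rfl
@[simp] theorem eval_mul (e f : Ex V A) : (e * f).eval s = e.eval s * f.eval s := rfl
@[simp] theorem eval_half (e : Ex V A) : (half e).eval s = e.eval s / 2 := rfl

/-- All values met in the evaluation have at most `e.bd` times as many bits as the state. -/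
def bd : Ex V A → ℕ
  | const c => bits c + 1
  | var _ => 1
  | rd _ i => 1 + i.bd
  | add e f => e.bd + f.bd
  | sub e f => e.bd + f.bd
  | mul e f => e.bd + f.bd
  | half e => e.bd

/-- The number of instructions an expression compiles to. -/
def len : Ex V A → ℕ
  | const _ => 1
  | var _ => 2
  | rd _ i => i.len + 1
  | add e f => e.len + f.len + 1
  | sub e f => e.len + f.len + 1
  | mul e f => e.len + f.len + 1
  | half e => e.len + 1

end Ex

namespace Cmd

/-- A common bound of `Ex.bd` for the expressions of a command. -/
def bd : Cmd V A → ℕ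
  | skip => 0
  | set _ e => e.bd
  | put _ i e => i.bd + e.bd
  | loadLo _ _ i => i.bd + 1
  | storeLo _ i e => i.bd + e.bd
  | call e => e.bd
  | seq p q => p.bd + q.bd
  | ite e p q => e.bd + p.bd + q.bd
  | loop _ e p => e.bd + 2 + p.bd

/-- A bound for the number of instructions in any single step of a command. -/
def len : Cmd V A → ℕ
  | skip => 1
  | set _ e => e.len + 2
  | put _ i e => i.len + e.len + 1
  | loadLo _ _ i => i.len + 3
  | storeLo _ i e => i.len + e.len + 1
  | call e => e.len + 2
  | seq p q => p.len + q.len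
  | ite e p q => e.len + 1 + p.len + q.len
  | loop _ e p => e.len + 10 + p.len

/-- The variables a command may write. -/
def wv : Cmd V A → List V
  | skip => []
  | set x _ => [x]
  | put _ _ _ => []
  | loadLo x _ _ => [x]
  | storeLo _ _ _ => []
  | call _ => []
  | seq p q => p.wv ++ q.wv
  | ite _ p q => p.wv ++ q.wv
  | loop x _ p => x :: p.wv

/-- The arrays a command may write. -/
def wa : Cmd V A → List A
  | skip => []
  | set _ _ => []
  | put a _ _ => [a]
  | loadLo _ _ _ => []
  | storeLo _ _ _ => []
  | call _ => []
  | seq p q => p.wa ++ q.wa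
  | ite _ p q => p.wa ++ q.wa
  | loop _ _ p => p.wa

end Cmd

/-- The values of all variables and arrays are bounded by `M`. -/
def Bd (M : ℤ) (s : St V A) : Prop := (∀ x, |s.v x| ≤ M) ∧ ∀ a i, |s.m a i| ≤ M

/-- `s'` agrees with `s` on what the command `c` does not write. -/
def Frame (c : Cmd V A) (s s' : St V A) : Prop :=
  (∀ x, x ∉ c.wv → s'.v x = s.v x) ∧ ∀ a, a ∉ c.wa → s'.m a = s.m a

variable [DecidableEq V] [DecidableEq A]

variable {c : Cmd V A} {s s' : St V A}

theorem Frame.v (h : Frame c s s') (x : V) (hx : x ∉ c.wv := by decide) : s'.v x = s.v x := h.1 x hx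

theorem Frame.m (h : Frame c s s') (a : A) (ha : a ∉ c.wa := by decide) : s'.m a = s.m a := h.2 a ha

theorem Frame.vs (h : Frame c s s') {l : List V} (hl : ∀ x ∈ l, x ∉ c.wv := by decide) :
    ∀ x ∈ l, s'.v x = s.v x := fun x hx => h.1 x (hl x hx)

theorem Frame.ms (h : Frame c s s') {l : List A} (hl : ∀ a ∈ l, a ∉ c.wa := by decide) :
    ∀ a ∈ l, s'.m a = s.m a := fun a ha => h.2 a (hl a ha)

namespace St

/-- Assignment to a variable. -/
def setV (s : St V A) (x : V) (z : ℤ) : St V A := { s with v := Function.update s.v x z }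

/-- Assignment to an array element. -/
def setM (s : St V A) (a : A) (i z : ℤ) : St V A :=
  { s with m := Function.update s.m a (Function.update (s.m a) i z) }

/-- Assignment to an element of a shared memory. -/
def setLo (s : St V A) (a : Fin 3) (i z : ℤ) : St V A :=
  { s with lo := Function.update s.lo a (Function.update (s.lo a) i z) }

variable (s : St V A)

theorem setV_v (x y : V) (z : ℤ) : (s.setV x z).v y = if y = x then z else s.v y := by
  simp [setV, Function.update_apply]
@[simp] theorem setV_v_self (x : V) (z : ℤ) : (s.setV x z).v x = z := by simp [setV]
@[simp] theorem setV_v_ne {x y : V} (h : y ≠ x) (z : ℤ) : (s.setV x z).v y = s.v y := by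
  simp [setV, h]
@[simp] theorem setV_m (x : V) (z : ℤ) : (s.setV x z).m = s.m := rfl
@[simp] theorem setV_lo (x : V) (z : ℤ) : (s.setV x z).lo = s.lo := rfl
@[simp] theorem setM_v (a : A) (i z : ℤ) : (s.setM a i z).v = s.v := rfl
@[simp] theorem setM_lo (a : A) (i z : ℤ) : (s.setM a i z).lo = s.lo := rfl
theorem setM_m_self (a : A) (i z j : ℤ) :
    (s.setM a i z).m a j = if j = i then z else s.m a j := by
  simp [setM, Function.update_apply]
@[simp] theorem setM_m_ne {a b : A} (h : b ≠ a) (i z : ℤ) : (s.setM a i z).m b = s.m b := by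
  simp [setM, h]
theorem setLo_lo_self (a : Fin 3) (i z j : ℤ) :
    (s.setLo a i z).lo a j = if j = i then z else s.lo a j := by
  simp [setLo, Function.update_apply]
@[simp] theorem setLo_lo_ne {a b : Fin 3} (h : b ≠ a) (i z : ℤ) :
    (s.setLo a i z).lo b = s.lo b := by
  simp [setLo, h]

end St

/-- `Run M mm c s t Q`: from the state `s` the command `c` terminates within `t` steps in a state
with `Q`, while variables and arrays stay bounded by `M`.  A call of the matrix multiplication
routine for `N × N` matrices is charged `mm N` steps. -/
inductive Run (M : ℤ) (mm : ℕ → ℕ) : Cmd V A → St V A → ℕ → (St V A → Prop) → Prop where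
  | skip {s : St V A} {Q : St V A → Prop} : Q s → Run M mm .skip s 0 Q
  | set {s : St V A} {Q : St V A → Prop} {x : V} {e : Ex V A} :
      |e.eval s| ≤ M → Q (s.setV x (e.eval s)) → Run M mm (.set x e) s 1 Q
  | put {s : St V A} {Q : St V A → Prop} {a : A} {i e : Ex V A} :
      |e.eval s| ≤ M → Q (s.setM a (i.eval s) (e.eval s)) → Run M mm (.put a i e) s 1 Q
  | loadLo {s : St V A} {Q : St V A → Prop} {x : V} {a : Fin 3} {i : Ex V A} :
      |s.lo a (i.eval s)| ≤ M → Q (s.setV x (s.lo a (i.eval s))) →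
        Run M mm (.loadLo x a i) s 1 Q
  | storeLo {s : St V A} {Q : St V A → Prop} {a : Fin 3} {i e : Ex V A} :
      Q (s.setLo a (i.eval s) (e.eval s)) → Run M mm (.storeLo a i e) s 1 Q
  | call {s : St V A} {Q : St V A → Prop} {e : Ex V A} (N : ℕ) (X Y : Matrix (Fin N) (Fin N) ℤ) :
      e.eval s = N → 1 ≤ N → (N : ℤ) ≤ M → (∀ i j, |X i j| ≤ M ∧ |Y i j| ≤ M) →
      (∀ i j : Fin N, s.lo 0 ((N : ℤ) * (i : ℕ) + (j : ℕ)) = X i j) →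
      (∀ i j : Fin N, s.lo 1 ((N : ℤ) * (i : ℕ) + (j : ℕ)) = Y i j) →
      (∀ lo : Fin 3 → ℤ → ℤ,
        (∀ i j : Fin N, lo 2 ((N : ℤ) * (i : ℕ) + (j : ℕ)) = (X * Y) i j) →
          Q { s with lo := lo }) →
      Run M mm (.call e) s (mm N + 1) Q
  | seq {s : St V A} {R Q : St V A → Prop} {p q : Cmd V A} {t t' : ℕ} :
      Run M mm p s t R → (∀ s', R s' → Run M mm q s' t' Q) → Run M mm (.seq p q) s (t + t') Q
  | ite {s : St V A} {Q : St V A → Prop} {e : Ex V A} {p q : Cmd V A} {t : ℕ} :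
      (0 < e.eval s → Run M mm p s t Q) → (¬ 0 < e.eval s → Run M mm q s t Q) →
        Run M mm (.ite e p q) s (t + 1) Q
  | loop {s : St V A} {Q : St V A → Prop} {x : V} {e : Ex V A} {p : Cmd V A} {t : ℕ} (n : ℕ)
      (Inv : ℕ → St V A → Prop) :
      e.eval s = n → (n : ℤ) ≤ M → Inv 0 s →
      (∀ i < n, ∀ s', Inv i s' → Run M mm p (s'.setV x i) t (Inv (i + 1))) →
      (∀ s', Inv n s' → Q s') → Run M mm (.loop x e p) s (n * (t + 1) + 1) Q
  | conseq {s : St V A} {R Q : St V A → Prop} {p : Cmd V A} {t t' : ℕ} :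
      Run M mm p s t R → t ≤ t' → (∀ s', R s' → Q s') → Run M mm p s t' Q

theorem Frame.refl (c : Cmd V A) (s : St V A) : Frame c s s := ⟨fun _ _ => rfl, fun _ _ => rfl⟩

/-- What a command does not write stays as it is. -/
theorem Run.frame {M : ℤ} {mm : ℕ → ℕ} {c : Cmd V A} {s : St V A} {t : ℕ} {Q : St V A → Prop}
    (h : Run M mm c s t Q) : Run M mm c s t (fun s' => Q s' ∧ Frame c s s') := by
  induction h with
  | skip h => exact .skip ⟨h, .refl _ _⟩
  | set h h' =>
    refine .set h ⟨h', fun y hy => ?_, fun _ _ => rfl⟩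
    simp [Cmd.wv] at hy
    simp [hy]
  | put h h' =>
    refine .put h ⟨h', fun _ _ => rfl, fun y hy => ?_⟩
    simp [Cmd.wa] at hy
    simp [hy]
  | loadLo h h' =>
    refine .loadLo h ⟨h', fun y hy => ?_, fun _ _ => rfl⟩
    simp [Cmd.wv] at hy
    simp [hy]
  | storeLo h => exact .storeLo ⟨h, fun _ _ => rfl, fun _ _ => rfl⟩
  | call N X Y h1 h2 h3 h4 h5 h6 h7 =>
    exact .call N X Y h1 h2 h3 h4 h5 h6
      (fun lo hlo => ⟨h7 lo hlo, fun _ _ => rfl, fun _ _ => rfl⟩)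
  | seq h1 h2 ih1 ih2 =>
    refine .seq ih1 fun s' hs' => .conseq (ih2 s' hs'.1) le_rfl fun s'' hs'' => ⟨hs''.1, ?_, ?_⟩
    · intro x hx
      simp [Cmd.wv] at hx
      rw [hs''.2.1 x hx.2, hs'.2.1 x hx.1]
    · intro x hx
      simp [Cmd.wa] at hx
      rw [hs''.2.2 x hx.2, hs'.2.2 x hx.1]
  | ite h1 h2 ih1 ih2 =>
    refine .ite (fun h => .conseq (ih1 h) le_rfl fun s' hs' => ⟨hs'.1, ?_, ?_⟩)
      (fun h => .conseq (ih2 h) le_rfl fun s' hs' => ⟨hs'.1, ?_, ?_⟩)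
    · intro x hx
      simp [Cmd.wv] at hx
      exact hs'.2.1 x hx.1
    · intro x hx
      simp [Cmd.wa] at hx
      exact hs'.2.2 x hx.1
    · intro x hx
      simp [Cmd.wv] at hx
      exact hs'.2.1 x hx.2
    · intro x hx
      simp [Cmd.wa] at hx
      exact hs'.2.2 x hx.2
  | @loop s Q x e p t n Inv h1 h2 h3 h4 h5 ih =>
    refine .loop n (fun i s' => Inv i s' ∧ Frame (.loop x e p) s s') h1 h2 ⟨h3, .refl _ _⟩ ?_
      fun s' hs' => ⟨h5 s' hs'.1, hs'.2⟩
    intro i hi s' hs'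
    refine .conseq (ih i hi s' hs'.1) le_rfl fun s'' hs'' => ⟨hs''.1, ?_, ?_⟩
    · intro y hy
      rw [← hs'.2.1 y hy]
      simp [Cmd.wv] at hy
      rw [hs''.2.1 y hy.2, St.setV_v_ne _ hy.1]
    · intro y hy
      rw [← hs'.2.2 y hy]
      simp [Cmd.wa] at hy
      rw [hs''.2.2 y hy, St.setV_m]
  | conseq h1 h2 h3 ih => exact .conseq ih h2 fun s' hs' => ⟨h3 s' hs'.1, hs'.2⟩

/-- The consequence rule with the frame. -/
theorem Run.imp {M : ℤ} {mm : ℕ → ℕ} {c : Cmd V A} {s : St V A} {t t' : ℕ} {R Q : St V A → Prop}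
    (h : Run M mm c s t R) (ht : t ≤ t') (hQ : ∀ s', R s' → Frame c s s' → Q s') :
    Run M mm c s t' Q :=
  .conseq h.frame ht fun s' hs' => hQ s' hs'.1 hs'.2

/-- Sequencing with the frame. -/
theorem Run.seq' {M : ℤ} {mm : ℕ → ℕ} {p q : Cmd V A} {s : St V A} {t1 t2 t : ℕ}
    {R Q : St V A → Prop} (h : Run M mm p s t1 R)
    (h' : ∀ s', R s' → Frame p s s' → Run M mm q s' t2 Q) (ht : t1 + t2 ≤ t) :
    Run M mm (.seq p q) s t Q :=
  .conseq (.seq h.frame fun s' hs' => h' s' hs'.1 hs'.2) ht fun _ h => h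

theorem Run.set_seq {M : ℤ} {mm : ℕ → ℕ} {x : V} {e : Ex V A} {q : Cmd V A} {s : St V A} {t : ℕ}
    {Q : St V A → Prop} (h : |e.eval s| ≤ M) (h' : Run M mm q (s.setV x (e.eval s)) t Q) :
    Run M mm (.seq (.set x e) q) s (t + 1) Q :=
  .conseq (.seq (R := fun s' => s' = s.setV x (e.eval s)) (.set h rfl) fun _ hs => hs ▸ h')
    (by omega) fun _ h => h

theorem Run.put_seq {M : ℤ} {mm : ℕ → ℕ} {a : A} {i e : Ex V A} {q : Cmd V A} {s : St V A} {t : ℕ}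
    {Q : St V A → Prop} (h : |e.eval s| ≤ M)
    (h' : Run M mm q (s.setM a (i.eval s) (e.eval s)) t Q) :
    Run M mm (.seq (.put a i e) q) s (t + 1) Q :=
  .conseq (.seq (R := fun s' => s' = s.setM a (i.eval s) (e.eval s)) (.put h rfl)
    fun _ hs => hs ▸ h') (by omega) fun _ h => h

theorem Run.loadLo_seq {M : ℤ} {mm : ℕ → ℕ} {x : V} {a : Fin 3} {i : Ex V A} {q : Cmd V A}
    {s : St V A} {t : ℕ} {Q : St V A → Prop} (h : |s.lo a (i.eval s)| ≤ M)
    (h' : Run M mm q (s.setV x (s.lo a (i.eval s))) t Q) :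
    Run M mm (.seq (.loadLo x a i) q) s (t + 1) Q :=
  .conseq (.seq (R := fun s' => s' = s.setV x (s.lo a (i.eval s))) (.loadLo h rfl)
    fun _ hs => hs ▸ h') (by omega) fun _ h => h

/-- The loop rule with the frame. -/
theorem Run.loop' {M : ℤ} {mm : ℕ → ℕ} {s : St V A} {Q : St V A → Prop} {x : V} {e : Ex V A}
    {p : Cmd V A} {t t' : ℕ} (n : ℕ) (Inv : ℕ → St V A → Prop) (he : e.eval s = n)
    (hn : (n : ℤ) ≤ M) (h0 : Inv 0 s)
    (hstep : ∀ i < n, ∀ s', Inv i s' → Frame (.loop x e p) s s' →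
      Run M mm p (s'.setV x i) t (Inv (i + 1)))
    (ht : n * (t + 1) + 1 ≤ t')
    (hQ : ∀ s', Inv n s' → Frame (.loop x e p) s s' → Q s') :
    Run M mm (.loop x e p) s t' Q := by
  refine .conseq (.loop (Q := Q) n (fun i s' => Inv i s' ∧ Frame (.loop x e p) s s') he hn
    ⟨h0, .refl _ _⟩ ?_ fun s' hs' => hQ s' hs'.1 hs'.2) ht fun _ h => h
  intro i hi s' hs'
  refine .imp (hstep i hi s' hs'.1 hs'.2) le_rfl fun s'' hs'' hf => ⟨hs'', ?_, ?_⟩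
  · intro y hy
    rw [← hs'.2.1 y hy]
    simp [Cmd.wv] at hy
    rw [hf.1 y hy.2, St.setV_v_ne _ hy.1]
  · intro y hy
    rw [← hs'.2.2 y hy]
    simp [Cmd.wa] at hy
    rw [hf.2 y hy, St.setV_m]

end lang

/-! ### Numbers of bits -/

theorem bits_le {x : ℤ} {b : ℕ} : bits x ≤ b ↔ x.natAbs < 2 ^ b := Nat.size_le

theorem bits_add_le {x y : ℤ} {a b : ℕ} (hx : bits x ≤ a) (hy : bits y ≤ b) (ha : 1 ≤ a)
    (hb : 1 ≤ b) : bits (x + y) ≤ a + b := by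
  rw [bits_le] at *
  have h1 := Int.natAbs_add_le x y
  have : 2 ≤ 2 ^ a := by simpa using Nat.pow_le_pow_right (n := 2) (by norm_num) ha
  have : 2 ≤ 2 ^ b := by simpa using Nat.pow_le_pow_right (n := 2) (by norm_num) hb
  rw [pow_add]
  nlinarith

theorem bits_neg (x : ℤ) : bits (-x) = bits x := by simp [bits]

theorem bits_sub_le {x y : ℤ} {a b : ℕ} (hx : bits x ≤ a) (hy : bits y ≤ b) (ha : 1 ≤ a)
    (hb : 1 ≤ b) : bits (x - y) ≤ a + b := by
  rw [sub_eq_add_neg]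
  exact bits_add_le hx (by rwa [bits_neg]) ha hb

theorem bits_mul_le {x y : ℤ} {a b : ℕ} (hx : bits x ≤ a) (hy : bits y ≤ b) :
    bits (x * y) ≤ a + b := by
  rw [bits_le] at *
  rw [Int.natAbs_mul, pow_add]
  exact Nat.mul_lt_mul'' hx hy

theorem bits_half_le (x : ℤ) : bits (x / 2) ≤ bits x := Nat.size_le_size (by omega)

theorem bits_le_of_abs_le {x M : ℤ} (h : |x| ≤ M) : bits x ≤ bits M :=
  Nat.size_le_size (by zify; exact h.trans (le_abs_self _))

/-! ### Compilation -/

section compile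

variable {V A : Type} (ρ : V → ℕ) (α : A → ℕ) (K : ℕ) (Q0 : Prog)

/-- The register of a variable. -/
def own (x : V) : ℕ := K + 2 * ρ x

/-- Auxiliary registers. -/
def hid (h : ℕ) : ℕ := K + 2 * h + 1

/-- Copy register `x` to register `r ≠ x`. -/
def mov (r x : ℕ) : Prog := .seq (.const r 0) (.add r r x)

/-- The program that puts the value of an expression into the auxiliary register `d`. -/
def Ex.comp : Ex V A → ℕ → Prog
  | .const c, d => .const (hid K d) c
  | .var x, d => mov (hid K d) (own ρ K x)
  | .rd a i, d => .seq (i.comp d) (.load (hid K d) (K + α a) (hid K d))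
  | .add e f, d => .seq (e.comp d) (.seq (f.comp (d + 1)) (.add (hid K d) (hid K d) (hid K (d + 1))))
  | .sub e f, d => .seq (e.comp d) (.seq (f.comp (d + 1)) (.sub (hid K d) (hid K d) (hid K (d + 1))))
  | .mul e f, d => .seq (e.comp d) (.seq (f.comp (d + 1)) (.mul (hid K d) (hid K d) (hid K (d + 1))))
  | .half e, d => .seq (e.comp d) (.half (hid K d) (hid K d))

/-- The program of a command, which uses the auxiliary registers from `d` on. -/
def Cmd.comp : Cmd V A → ℕ → Prog
  | .skip, _ => .skip
  | .set x e, d => .seq (e.comp ρ α K d) (mov (own ρ K x) (hid K d))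
  | .put a i e, d => .seq (i.comp ρ α K d) (.seq (e.comp ρ α K (d + 1))
      (.store (K + α a) (hid K d) (hid K (d + 1))))
  | .loadLo x a i, d => .seq (i.comp ρ α K d) (.seq (.load (hid K d) a (hid K d))
      (mov (own ρ K x) (hid K d)))
  | .storeLo a i e, d => .seq (i.comp ρ α K d) (.seq (e.comp ρ α K (d + 1))
      (.store a (hid K d) (hid K (d + 1))))
  | .call e, d => .seq (e.comp ρ α K d) (.seq (mov 0 (hid K d)) Q0)
  | .seq p q, d => .seq (p.comp d) (q.comp d)
  | .ite e p q, d => .seq (e.comp ρ α K d) (.ifPos (hid K d) (p.comp d) (q.comp d))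
  | .loop x e p, d => .seq (e.comp ρ α K d) (.seq (.const (hid K (d + 1)) 0)
      (.seq (.const (hid K (d + 2)) 1) (.whilePos (hid K d)
        (.seq (mov (own ρ K x) (hid K (d + 1))) (.seq (p.comp (d + 3))
          (.seq (.add (hid K (d + 1)) (hid K (d + 1)) (hid K (d + 2)))
            (.sub (hid K d) (hid K d) (hid K (d + 2)))))))))

/-- The machine state `σ` represents the state `s`. -/
structure Rep (σ : State) (s : St V A) : Prop where
  reg : ∀ x, σ.reg (own ρ K x) = s.v x
  mem : ∀ a, σ.mem (K + α a) = s.m a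
  lo : ∀ a : Fin 3, σ.mem a = s.lo a

/-- The two machine states differ at most in the auxiliary registers from `d` on. -/
def AgreeTo (d : ℕ) (σ σ' : State) : Prop :=
  σ'.mem = σ.mem ∧ ∀ r, (∀ h, d ≤ h → r ≠ hid K h) → σ'.reg r = σ.reg r

variable {ρ α K Q0}

theorem hid_inj {h h' : ℕ} : hid K h = hid K h' ↔ h = h' := by unfold hid; omega

theorem own_ne_hid (x : V) (h : ℕ) : own ρ K x ≠ hid K h := by unfold own hid; omega

theorem AgreeTo.rep {d : ℕ} {σ σ' : State} (h : AgreeTo K d σ σ') {s : St V A}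
    (hs : Rep ρ α K σ s) : Rep ρ α K σ' s :=
  ⟨fun x => by rw [h.2 _ fun _ _ => own_ne_hid _ _, hs.reg], fun a => by rw [h.1, hs.mem],
    fun a => by rw [h.1, hs.lo]⟩

theorem AgreeTo.trans {d d' : ℕ} {σ σ' σ'' : State} (h : AgreeTo K d σ σ')
    (h' : AgreeTo K d' σ' σ'') (hd : d ≤ d') : AgreeTo K d σ σ'' :=
  ⟨h'.1.trans h.1, fun r hr =>
    (h'.2 r fun i hi => hr i (hd.trans hi)).trans (h.2 r hr)⟩

theorem AgreeTo.setReg (d : ℕ) (σ : State) (z : ℤ) : AgreeTo K d σ (σ.setReg (hid K d) z) :=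
  ⟨rfl, fun r hr => by simp [State.setReg, hr d le_rfl]⟩

@[simp] theorem State.setReg_reg_self (σ : State) (r : ℕ) (z : ℤ) : (σ.setReg r z).reg r = z := by
  simp [State.setReg]

@[simp] theorem State.setReg_reg_ne (σ : State) {r r' : ℕ} (h : r' ≠ r) (z : ℤ) :
    (σ.setReg r z).reg r' = σ.reg r' := by
  simp [State.setReg, h]

@[simp] theorem State.setReg_mem (σ : State) (r : ℕ) (z : ℤ) : (σ.setReg r z).mem = σ.mem := rfl

variable {ip im : ℕ → ℕ} {b W : ℕ}

theorem exec_mov (hW : ∀ x ≤ b, ip x ≤ W ∧ im x ≤ W) {r x : ℕ} (hrx : x ≠ r) {σ : State}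
    (hx : bits (σ.reg x) ≤ b) :
    ∃ t, Exec ip im (mov r x) σ t (σ.setReg r (σ.reg x)) ∧ t ≤ 2 * W := by
  have h : (σ.setReg r 0).setReg r ((σ.setReg r 0).reg r + (σ.setReg r 0).reg x) =
      σ.setReg r (σ.reg x) := by
    simp [State.setReg, hrx]
  refine ⟨_, .seq (.const _ _ _) (h ▸ Exec.add _ _ _ _), ?_⟩
  have h1 := (hW (bits 0) (by simp [bits])).1
  have h2 := (hW (max (bits ((σ.setReg r 0).reg r)) (bits ((σ.setReg r 0).reg x)))
    (by simp [hrx, hx]; simp [bits])).1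
  omega

theorem Ex.bd_pos (e : Ex V A) : 1 ≤ e.bd := by
  induction e <;> simp [Ex.bd] <;> omega

theorem Ex.bits_eval {β : ℕ} {s : St V A} (hv : ∀ x, bits (s.v x) ≤ β)
    (hm : ∀ a i, bits (s.m a i) ≤ β) (hβ : 1 ≤ β) (e : Ex V A) : bits (e.eval s) ≤ e.bd * β := by
  have hp : ∀ e : Ex V A, 1 ≤ e.bd * β := fun e => Nat.mul_pos e.bd_pos hβ
  induction e with
  | const c => simp only [Ex.eval, Ex.bd]; nlinarith
  | var x => simpa [Ex.eval, Ex.bd] using hv x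
  | rd a i ih =>
    simp only [Ex.eval, Ex.bd]
    nlinarith [hm a (i.eval s)]
  | add e f ihe ihf | sub e f ihe ihf | mul e f ihe ihf =>
    simp only [Ex.eval, Ex.bd, add_mul]
    first | exact bits_add_le ihe ihf (hp e) (hp f) | exact bits_sub_le ihe ihf (hp e) (hp f) |
      exact bits_mul_le ihe ihf
  | half e ih =>
    simp only [Ex.eval, Ex.bd]
    exact (bits_half_le _).trans ih

theorem Ex.exec (hW : ∀ x ≤ b, ip x ≤ W ∧ im x ≤ W) {β : ℕ} (hβ : 1 ≤ β) {s : St V A}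
    (hv : ∀ x, bits (s.v x) ≤ β) (hm : ∀ a i, bits (s.m a i) ≤ β) (e : Ex V A) :
    ∀ (d : ℕ) (σ : State), Rep ρ α K σ s → e.bd * β ≤ b →
      ∃ t σ', Exec ip im (e.comp ρ α K d) σ t σ' ∧ t ≤ e.len * W ∧ AgreeTo K d σ σ' ∧
        σ'.reg (hid K d) = e.eval s := by
  have hp : ∀ e : Ex V A, 1 ≤ e.bd * β := fun e => Nat.mul_pos e.bd_pos hβ
  have hbits := fun e => Ex.bits_eval hv hm hβ (e := e)
  induction e with
  | const c =>
    intro d σ hs he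
    refine ⟨_, _, .const _ _ _, ?_, .setReg _ _ _, by simp [Ex.eval]⟩
    simp only [Ex.bd] at he
    have := (hW (bits c) (by nlinarith)).1
    simpa [Ex.len]
  | var x =>
    intro d σ hs he
    obtain ⟨t, ht, htW⟩ := exec_mov (r := hid K d) (x := own ρ K x) hW (own_ne_hid _ _) (σ := σ)
      (by rw [hs.reg]; simp [Ex.bd] at he; exact (hv x).trans he)
    exact ⟨t, _, ht, htW, .setReg _ _ _, by simp [Ex.eval, hs.reg]⟩
  | rd a i ih =>
    intro d σ hs he
    simp only [Ex.bd, add_mul] at he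
    obtain ⟨t, σ1, h1, ht, ha, hr⟩ := ih d σ hs (by omega)
    refine ⟨_, _, .seq h1 (.load _ _ _ _), ?_, ha.trans (.setReg _ _ _) le_rfl, ?_⟩
    · have := (hW (max (bits (σ1.reg (hid K d))) (bits (σ1.mem (K + α a) (σ1.reg (hid K d)))))
        (by rw [(ha.rep hs).mem, hr]; have := hbits i; have := hm a (i.eval s)
            exact max_le (by omega) (by omega))).1
      simp only [Ex.len, add_mul]
      omega
    · simp [(ha.rep hs).mem, hr, Ex.eval]
  | half e ih =>
    intro d σ hs he
    simp only [Ex.bd] at he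
    obtain ⟨t, σ1, h1, ht, ha, hr⟩ := ih d σ hs (by omega)
    refine ⟨_, _, .seq h1 (.half _ _ _), ?_, ha.trans (.setReg _ _ _) le_rfl, ?_⟩
    · have := (hW (bits (σ1.reg (hid K d))) (by rw [hr]; exact (hbits e).trans he)).1
      simp only [Ex.len, add_mul]
      omega
    · simp [hr, Ex.eval]
  | add e f ihe ihf | sub e f ihe ihf | mul e f ihe ihf =>
    intro d σ hs he
    simp only [Ex.bd, add_mul] at he
    obtain ⟨t, σ1, h1, ht, ha, hr⟩ := ihe d σ hs (by omega)
    obtain ⟨t', σ2, h2, ht', ha', hr'⟩ := ihf (d + 1) σ1 (ha.rep hs) (by omega)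
    have hr2 : σ2.reg (hid K d) = e.eval s := by
      rw [ha'.2 _ fun h hh => by rw [Ne, hid_inj]; omega, hr]
    refine ⟨_, _, .seq h1 (.seq h2 (by first | exact .add .. | exact .sub .. | exact .mul ..)), ?_,
      (ha.trans ha' (by omega)).trans (.setReg _ _ _) le_rfl, ?_⟩
    · have := hW (max (bits (σ2.reg (hid K d))) (bits (σ2.reg (hid K (d + 1)))))
        (by rw [hr', hr2]; have := hbits e; have := hbits f; exact max_le (by omega) (by omega))
      simp only [Ex.len, add_mul]
      omega
    · simp [hr', hr2, Ex.eval]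

end compile

/-- A strict upper bound of the register and memory names in a program. -/
def Prog.names : Prog → ℕ
  | .skip => 0
  | .const r _ => r + 1
  | .add r x y => r + x + y + 1
  | .sub r x y => r + x + y + 1
  | .mul r x y => r + x + y + 1
  | .half r x => r + x + 1
  | .load r a i => r + a + i + 1
  | .store a i x => a + i + x + 1
  | .seq p q => p.names + q.names
  | .ifPos x p q => x + 1 + p.names + q.names
  | .whilePos x p => x + 1 + p.names

theorem Exec.frame {ip im : ℕ → ℕ} {p : Prog} {s s' : State} {t : ℕ} (h : Exec ip im p s t s')
    {K : ℕ} (hK : p.names ≤ K) :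
    (∀ r, K ≤ r → s'.reg r = s.reg r) ∧ ∀ a, K ≤ a → s'.mem a = s.mem a := by
  induction h with
  | skip | whileFalse => exact ⟨fun _ _ => rfl, fun _ _ => rfl⟩
  | const | add | sub | mul | half | load =>
    refine ⟨fun r hr => ?_, fun _ _ => rfl⟩
    simp only [Prog.names] at hK
    exact State.setReg_reg_ne _ (by omega) _
  | store =>
    refine ⟨fun _ _ => rfl, fun a ha => ?_⟩
    simp only [Prog.names] at hK
    simp only [State.setMem]
    rw [Function.update_of_ne (by omega)]
  | seq _ _ ih ih' =>
    simp only [Prog.names] at hK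
    have h1 := ih (by omega)
    have h2 := ih' (by omega)
    exact ⟨fun r hr => (h2.1 r hr).trans (h1.1 r hr), fun r hr => (h2.2 r hr).trans (h1.2 r hr)⟩
  | ifTrue _ _ ih =>
    simp only [Prog.names] at hK
    exact ih (by omega)
  | ifFalse _ _ ih =>
    simp only [Prog.names] at hK
    exact ih (by omega)
  | whileTrue _ _ _ ih ih' =>
    have h2 := ih' hK
    simp only [Prog.names] at hK
    have h1 := ih (by omega)
    exact ⟨fun r hr => (h2.1 r hr).trans (h1.1 r hr), fun r hr => (h2.2 r hr).trans (h1.2 r hr)⟩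

/-- `Q0` multiplies `N × N` matrices with entries of at most `β` bits in time `mm N * W`. -/
def MulRoutine (ip im : ℕ → ℕ) (Q0 : Prog) (β W : ℕ) (mm : ℕ → ℕ) : Prop :=
  ∀ (N : ℕ) (X Y : Matrix (Fin N) (Fin N) ℤ) (σ : State), 1 ≤ N → N.size ≤ β →
    (∀ i j, bits (X i j) ≤ β ∧ bits (Y i j) ≤ β) → σ.reg 0 = N →
    (∀ i j : Fin N, σ.mem 0 ((N : ℤ) * (i : ℕ) + (j : ℕ)) = X i j) →
    (∀ i j : Fin N, σ.mem 1 ((N : ℤ) * (i : ℕ) + (j : ℕ)) = Y i j) →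
    ∃ t σ', Exec ip im Q0 σ t σ' ∧ t ≤ mm N * W ∧
      ∀ i j : Fin N, σ'.mem 2 ((N : ℤ) * (i : ℕ) + (j : ℕ)) = (X * Y) i j

section sound

variable {V A : Type} [DecidableEq V] [DecidableEq A] {ρ : V → ℕ} {α : A → ℕ} {K : ℕ}
  {Q0 : Prog}

theorem Rep.setV (hρ : Function.Injective ρ) {σ : State} {s : St V A}
    (h : Rep ρ α K σ s) (x : V) (z : ℤ) : Rep ρ α K (σ.setReg (own ρ K x) z) (s.setV x z) := by
  refine ⟨fun y => ?_, h.mem, h.lo⟩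
  rw [St.setV_v]
  split_ifs with hy
  · simp [hy]
  · rw [State.setReg_reg_ne, h.reg]
    unfold own
    have := hρ.ne hy
    omega

theorem Rep.setM (hα : Function.Injective α) (hK : 3 ≤ K) {σ : State} {s : St V A}
    (h : Rep ρ α K σ s) (a : A) (i z : ℤ) :
    Rep ρ α K (σ.setMem (K + α a) i z) (s.setM a i z) := by
  refine ⟨h.reg, fun b => ?_, fun b => ?_⟩
  · by_cases hb : b = a
    · subst hb; simp [State.setMem, St.setM, h.mem]
    · have := hα.ne hb
      simp [State.setMem, hb, h.mem, this]
  · simp only [State.setMem, St.setM, ← h.lo]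
    rw [Function.update_of_ne (by omega)]

theorem Rep.setLo (hK : 3 ≤ K) {σ : State} {s : St V A}
    (h : Rep ρ α K σ s) (a : Fin 3) (i z : ℤ) :
    Rep ρ α K (σ.setMem a i z) (s.setLo a i z) := by
  refine ⟨h.reg, fun b => ?_, fun b => ?_⟩
  · simp only [State.setMem, St.setLo, ← h.mem]
    rw [Function.update_of_ne (by omega)]
  · by_cases hb : b = a
    · subst hb; simp [State.setMem, St.setLo, h.lo]
    · simp only [State.setMem, St.setLo, Function.update_of_ne hb, h.lo]
      rw [Function.update_of_ne (by omega), h.lo]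

theorem Bd.setV {M : ℤ} {s : St V A} (h : Bd M s) (x : V) {z : ℤ} (hz : |z| ≤ M) :
    Bd M (s.setV x z) := by
  refine ⟨fun y => ?_, h.2⟩
  rw [St.setV_v]
  split_ifs
  exacts [hz, h.1 y]

theorem Bd.setM {M : ℤ} {s : St V A} (h : Bd M s) (a : A) (i : ℤ) {z : ℤ} (hz : |z| ≤ M) :
    Bd M (s.setM a i z) := by
  refine ⟨h.1, fun b j => ?_⟩
  by_cases hb : b = a
  · subst hb
    rw [St.setM_m_self]
    split_ifs
    exacts [hz, h.2 _ _]
  · rw [St.setM_m_ne _ hb]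
    exact h.2 _ _

variable {ip im : ℕ → ℕ} {b W β Λ : ℕ} {M : ℤ} {mm : ℕ → ℕ}

set_option maxHeartbeats 1000000 in
/-- Derivable time bounds and postconditions hold for the compiled program. -/
theorem Run.sound (hρ : Function.Injective ρ) (hα : Function.Injective α) (hK : 3 ≤ K)
    (hQ : Q0.names ≤ K) (hW : ∀ x ≤ b, ip x ≤ W ∧ im x ≤ W) (hβ : 1 ≤ β) (hM : bits M ≤ β)
    (hmm : MulRoutine ip im Q0 β W mm) {c : Cmd V A} {s : St V A} {t : ℕ} {P : St V A → Prop}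
    (h : Run M mm c s t P) :
    Bd M s → c.bd * β ≤ b → c.len ≤ Λ → ∀ (d : ℕ) (σ : State), Rep ρ α K σ s →
      ∃ t' σ', Exec ip im (c.comp ρ α K Q0 d) σ t' σ' ∧ t' ≤ t * (Λ * W) ∧
        (∀ h < d, σ'.reg (hid K h) = σ.reg (hid K h)) ∧
        ∃ s', Rep ρ α K σ' s' ∧ Bd M s' ∧ P s' := by
  have hle : ∀ {z}, |z| ≤ M → bits z ≤ β := fun hz => (bits_le_of_abs_le hz).trans hM
  have hEx : ∀ {s : St V A}, Bd M s → ∀ (e : Ex V A) (d : ℕ) (σ : State), Rep ρ α K σ s →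
      e.bd * β ≤ b → bits (e.eval s) ≤ b ∧
      ∃ t σ', Exec ip im (e.comp ρ α K d) σ t σ' ∧ t ≤ e.len * W ∧ AgreeTo K d σ σ' ∧
        σ'.reg (hid K d) = e.eval s :=
    fun hs e d σ hσ he => ⟨(Ex.bits_eval (fun x => hle (hs.1 x)) (fun a i => hle (hs.2 a i)) hβ
      e).trans he, Ex.exec hW hβ (fun x => hle (hs.1 x)) (fun a i => hle (hs.2 a i)) e d σ hσ he⟩
  have hhid : ∀ {d : ℕ} {σ σ' : State}, AgreeTo K d σ σ' →
      ∀ h < d, σ'.reg (hid K h) = σ.reg (hid K h) := by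
    intro d σ σ' hσ h hh
    exact hσ.2 _ fun h' hh' => by rw [Ne, hid_inj]; omega
  induction h with
  | skip h => exact fun hs _ _ d σ hσ => ⟨_, σ, .skip _, by simp, fun _ _ => rfl, _, hσ, hs, h⟩
  | @set s P x e h h' =>
    intro hs hb hl d σ hσ
    simp only [Cmd.bd, Cmd.len] at hb hl
    obtain ⟨hbe, t1, σ1, h1, ht1, ha1, hr1⟩ := hEx hs e d σ hσ hb
    obtain ⟨t2, h2, ht2⟩ := exec_mov (ip := ip) (im := im) (r := own ρ K x) (x := hid K d) hW
      (own_ne_hid _ _).symm (σ := σ1) (by rwa [hr1])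
    refine ⟨_, _, .seq h1 h2, ?_, fun h hh => ?_, _, ?_, hs.setV x h, h'⟩
    · nlinarith [Nat.mul_le_mul_right W hl]
    · rw [State.setReg_reg_ne _ (own_ne_hid _ _).symm, hhid ha1 h hh]
    · rw [hr1]
      exact (ha1.rep hσ).setV hρ _ _
  | @put s P a i e h h' =>
    intro hs hb hl d σ hσ
    simp only [Cmd.bd, Cmd.len, add_mul] at hb hl
    obtain ⟨hbi, t1, σ1, h1, ht1, ha1, hr1⟩ := hEx hs i d σ hσ (by omega)
    obtain ⟨hbe, t2, σ2, h2, ht2, ha2, hr2⟩ := hEx hs e (d + 1) σ1 (ha1.rep hσ) (by omega)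
    have hr : σ2.reg (hid K d) = i.eval s := by rw [hhid ha2 d (by omega), hr1]
    refine ⟨_, _, .seq h1 (.seq h2 (.store _ _ _ _)), ?_, fun h hh => ?_, _, ?_, hs.setM a _ h, h'⟩
    · have := (hW (max (bits (σ2.reg (hid K d))) (bits (σ2.reg (hid K (d + 1)))))
        (by rw [hr, hr2]; exact max_le hbi hbe)).1
      nlinarith [Nat.mul_le_mul_right W hl]
    · change σ2.reg _ = _
      rw [hhid ha2 h (by omega), hhid ha1 h hh]
    · rw [hr, hr2]
      exact (ha2.rep (ha1.rep hσ)).setM hα hK _ _ _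
  | @loadLo s P x a i h h' =>
    intro hs hb hl d σ hσ
    simp only [Cmd.bd, Cmd.len, add_mul] at hb hl
    obtain ⟨hbi, t1, σ1, h1, ht1, ha1, hr1⟩ := hEx hs i d σ hσ (by omega)
    have hσ1 := ha1.rep hσ
    have hbl := hle h
    obtain ⟨t2, h2, ht2⟩ := exec_mov (ip := ip) (im := im) (r := own ρ K x) (x := hid K d) hW
      (own_ne_hid _ _).symm (σ := σ1.setReg (hid K d) (σ1.mem a (σ1.reg (hid K d))))
      (by simp [hr1, hσ1.lo]; omega)
    refine ⟨_, _, .seq h1 (.seq (.load _ _ _ _) h2), ?_, fun h hh => ?_, _, ?_, hs.setV x h, h'⟩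
    · have := (hW (max (bits (σ1.reg (hid K d))) (bits (σ1.mem a (σ1.reg (hid K d)))))
        (by rw [hr1, hσ1.lo]; exact max_le hbi (by omega))).1
      nlinarith [Nat.mul_le_mul_right W hl]
    · rw [State.setReg_reg_ne _ (own_ne_hid _ _).symm, State.setReg_reg_ne _
        (by rw [Ne, hid_inj]; omega), hhid ha1 h hh]
    · rw [State.setReg_reg_self, hr1, hσ1.lo]
      exact ((AgreeTo.setReg _ _ _).rep hσ1).setV hρ _ _
  | @storeLo s P a i e h' =>
    intro hs hb hl d σ hσ
    simp only [Cmd.bd, Cmd.len, add_mul] at hb hl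
    obtain ⟨hbi, t1, σ1, h1, ht1, ha1, hr1⟩ := hEx hs i d σ hσ (by omega)
    obtain ⟨hbe, t2, σ2, h2, ht2, ha2, hr2⟩ := hEx hs e (d + 1) σ1 (ha1.rep hσ) (by omega)
    have hr : σ2.reg (hid K d) = i.eval s := by rw [hhid ha2 d (by omega), hr1]
    refine ⟨_, _, .seq h1 (.seq h2 (.store _ _ _ _)), ?_, fun h hh => ?_, s.setLo a (i.eval s) (e.eval s),
      ?_, hs, h'⟩
    · have := (hW (max (bits (σ2.reg (hid K d))) (bits (σ2.reg (hid K (d + 1)))))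
        (by rw [hr, hr2]; exact max_le hbi hbe)).1
      nlinarith [Nat.mul_le_mul_right W hl]
    · change σ2.reg _ = _
      rw [hhid ha2 h (by omega), hhid ha1 h hh]
    · rw [hr, hr2]
      exact (ha2.rep (ha1.rep hσ)).setLo hK _ _ _
  | @call s P e N X Y hN hN1 hNM hXY hX hY h' =>
    intro hs hb hl d σ hσ
    simp only [Cmd.bd, Cmd.len] at hb hl
    obtain ⟨hbe, t1, σ1, h1, ht1, ha1, hr1⟩ := hEx hs e d σ hσ hb
    obtain ⟨t2, h2, ht2⟩ := exec_mov (ip := ip) (im := im) (r := 0) (x := hid K d) hW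
      (by unfold hid; omega) (σ := σ1) (by rwa [hr1])
    have hσ1 := ha1.rep hσ
    obtain ⟨t3, σ3, h3, ht3, hm3⟩ := hmm N X Y (σ1.setReg 0 (σ1.reg (hid K d))) hN1
      (by have := hle (z := N) (by simpa using hNM); simpa [bits] using this)
      (fun i j => ⟨hle (hXY i j).1, hle (hXY i j).2⟩) (by simp [hr1, hN])
      (by simpa [← hσ1.lo] using hX) (by simpa [← hσ1.lo] using hY)
    have hf := h3.frame hQ
    refine ⟨_, _, .seq h1 (.seq h2 h3), ?_, fun h hh => ?_,
      { s with lo := fun a => σ3.mem a }, ⟨fun x => ?_, fun a => ?_, fun a => rfl⟩, hs, h' _ hm3⟩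
    · have : 1 ≤ Λ := by omega
      nlinarith [Nat.mul_le_mul_right W hl, Nat.mul_le_mul_right (mm N * W) this]
    · rw [hf.1 _ (by unfold hid; omega), State.setReg_reg_ne _ (by unfold hid; omega), hhid ha1 h hh]
    · rw [hf.1 _ (by unfold own; omega), State.setReg_reg_ne _ (by unfold own; omega), hσ1.reg]
    · rw [hf.2 _ (by omega), State.setReg_mem, hσ1.mem]
  | @seq s R P p q t t' h1 h2 ih1 ih2 =>
    intro hs hb hl d σ hσ
    simp only [Cmd.bd, Cmd.len, add_mul] at hb hl
    obtain ⟨t1, σ1, e1, ht1, hh1, s₁, hσ1, hs1, hR⟩ := ih1 hs (by omega) (by omega) d σ hσ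
    obtain ⟨t2, σ2, e2, ht2, hh2, s₂, hσ2, hs2, hP⟩ :=
      ih2 s₁ hR hs1 (by omega) (by omega) d σ1 hσ1
    exact ⟨_, _, .seq e1 e2, by rw [add_mul]; omega, fun h hh => by rw [hh2 h hh, hh1 h hh],
      s₂, hσ2, hs2, hP⟩
  | @ite s P e p q t h1 h2 ih1 ih2 =>
    intro hs hb hl d σ hσ
    simp only [Cmd.bd, Cmd.len, add_mul] at hb hl
    obtain ⟨hbe, t1, σ1, e1, ht1, ha1, hr1⟩ := hEx hs e d σ hσ (by omega)
    have hw := (hW (bits (σ1.reg (hid K d))) (by rwa [hr1])).1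
    have hl' : (e.len + 1) * W ≤ Λ * W := Nat.mul_le_mul_right _ (by omega)
    by_cases hpos : 0 < e.eval s
    · obtain ⟨t2, σ2, e2, ht2, hh2, s₂, hσ2, hs2, hP⟩ :=
        ih1 hpos hs (by omega) (by omega) d σ1 (ha1.rep hσ)
      refine ⟨_, _, .seq e1 (.ifTrue (by rwa [hr1]) e2), ?_,
        fun h hh => by rw [hh2 h hh, hhid ha1 h hh], s₂, hσ2, hs2, hP⟩
      nlinarith
    · obtain ⟨t2, σ2, e2, ht2, hh2, s₂, hσ2, hs2, hP⟩ :=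
        ih2 hpos hs (by omega) (by omega) d σ1 (ha1.rep hσ)
      refine ⟨_, _, .seq e1 (.ifFalse (by rwa [hr1]) e2), ?_,
        fun h hh => by rw [hh2 h hh, hhid ha1 h hh], s₂, hσ2, hs2, hP⟩
      nlinarith
  | @loop s P x e p t n Inv h1 hn h0 hstep hfin ih =>
    intro hs hb hl d σ hσ
    simp only [Cmd.bd, Cmd.len, add_mul] at hb hl
    obtain ⟨hbe, t1, σ1, e1, ht1, ha1, hr1⟩ := hEx hs e d σ hσ (by omega)
    have hbig : β ≤ b := by omega
    have hnat : ∀ j : ℕ, j ≤ n → bits (j : ℤ) ≤ b := fun j hj =>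
      (hle (by rw [abs_of_nonneg (by positivity)]; omega)).trans hbig
    have hone : bits 1 ≤ b := by simp [bits]; omega
    have hwhile : ∀ j ≤ n, ∀ (σ : State) (s' : St V A), Rep ρ α K σ s' → Bd M s' →
        Inv (n - j) s' → σ.reg (hid K d) = j → σ.reg (hid K (d + 1)) = (n - j : ℕ) →
        σ.reg (hid K (d + 2)) = 1 →
        ∃ t' σ', Exec ip im (.whilePos (hid K d) (.seq (mov (own ρ K x) (hid K (d + 1)))
          (.seq (p.comp ρ α K Q0 (d + 3))
          (.seq (.add (hid K (d + 1)) (hid K (d + 1)) (hid K (d + 2)))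
            (.sub (hid K d) (hid K d) (hid K (d + 2))))))) σ t' σ' ∧
          t' ≤ j * ((t + 1) * (Λ * W)) + W ∧
          (∀ h < d, σ'.reg (hid K h) = σ.reg (hid K h)) ∧
          ∃ s'', Rep ρ α K σ' s'' ∧ Bd M s'' ∧ P s'' := by
      intro j
      induction j with
      | zero =>
        intro _ σ s' hσ hs hInv hr _ _
        refine ⟨_, _, .whileFalse (by simp [hr]), ?_, fun _ _ => rfl, s', hσ, hs, hfin _ hInv⟩
        have := (hW (bits (σ.reg (hid K d))) (by rw [hr]; exact hnat _ (by omega))).1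
        omega
      | succ j ihj =>
        intro hj σ s' hσ hs hInv hr hr1 hr2
        obtain ⟨u1, x1, hu1⟩ := exec_mov (ip := ip) (im := im) (r := own ρ K x)
          (x := hid K (d + 1)) hW (own_ne_hid _ _).symm (σ := σ)
          (by rw [hr1]; exact hnat _ (by omega))
        rw [hr1] at x1
        obtain ⟨u2, σ2, x2, hu2, hh2, s₂, hσ2, hs2, hInv2⟩ := ih (n - (j + 1)) (by omega) s' hInv
          (hs.setV x (by rw [abs_of_nonneg (by positivity)]; omega)) (by omega) (by omega)
          (d + 3) _ (hσ.setV hρ x _)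
        have g0 : σ2.reg (hid K d) = (j + 1 : ℕ) := by
          rw [hh2 d (by omega), State.setReg_reg_ne _ (own_ne_hid _ _).symm, hr]
        have g1 : σ2.reg (hid K (d + 1)) = (n - (j + 1) : ℕ) := by
          rw [hh2 _ (by omega), State.setReg_reg_ne _ (own_ne_hid _ _).symm, hr1]
        have g2 : σ2.reg (hid K (d + 2)) = 1 := by
          rw [hh2 _ (by omega), State.setReg_reg_ne _ (own_ne_hid _ _).symm, hr2]
        have n1 : hid K d ≠ hid K (d + 1) := by rw [Ne, hid_inj]; omega
        have n2 : hid K (d + 2) ≠ hid K (d + 1) := by rw [Ne, hid_inj]; omega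
        have n3 : hid K (d + 2) ≠ hid K d := by rw [Ne, hid_inj]; omega
        have x3 := Exec.add (ip := ip) (im := im) σ2 (hid K (d + 1)) (hid K (d + 1)) (hid K (d + 2))
        rw [g1, g2] at x3
        set σ3 := σ2.setReg (hid K (d + 1)) (((n - (j + 1) : ℕ) : ℤ) + 1) with hσ3
        have x4 := Exec.sub (ip := ip) (im := im) σ3 (hid K d) (hid K d) (hid K (d + 2))
        have g3 : σ3.reg (hid K d) = (j + 1 : ℕ) := by rw [hσ3, State.setReg_reg_ne _ n1, g0]
        have g4 : σ3.reg (hid K (d + 2)) = 1 := by rw [hσ3, State.setReg_reg_ne _ n2, g2]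
        rw [g3, g4] at x4
        have hag : AgreeTo K d σ2 (σ3.setReg (hid K d) (((j + 1 : ℕ) : ℤ) - 1)) :=
          AgreeTo.trans (σ' := σ3)
            ⟨rfl, fun r hr => State.setReg_reg_ne _ (hr (d + 1) (by omega)) _⟩
            (AgreeTo.setReg _ _ _) le_rfl
        obtain ⟨u5, σ5, x5, hu5, hh5, hend⟩ := ihj (by omega) (σ3.setReg (hid K d)
          (((j + 1 : ℕ) : ℤ) - 1)) s₂ (hag.rep hσ2) hs2
          (by rwa [show n - j = n - (j + 1) + 1 by omega])
          (by rw [State.setReg_reg_self]; push_cast; ring)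
          (by rw [State.setReg_reg_ne _ n1.symm, hσ3, State.setReg_reg_self]; omega)
          (by rw [State.setReg_reg_ne _ n3, g4])
        refine ⟨_, _, .whileTrue (by rw [hr]; positivity)
          (.seq x1 (.seq x2 (.seq x3 x4))) x5, ?_, fun h hh => ?_, hend⟩
        · have w1 := (hW (bits (σ.reg (hid K d))) (by rw [hr]; exact hnat _ (by omega))).1
          have w2 := (hW (max (bits ((n - (j + 1) : ℕ) : ℤ)) (bits 1))
            (max_le (hnat _ (by omega)) hone)).1
          have w3 := (hW (max (bits ((j + 1 : ℕ) : ℤ)) (bits 1))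
            (max_le (hnat _ (by omega)) hone)).1
          have : 10 * W ≤ Λ * W := Nat.mul_le_mul_right _ (by omega)
          have : (j + 1) * ((t + 1) * (Λ * W)) =
            j * ((t + 1) * (Λ * W)) + t * (Λ * W) + Λ * W := by ring
          omega
        · rw [hh5 h hh, hhid hag h hh, hh2 h (by omega),
            State.setReg_reg_ne _ (own_ne_hid _ _).symm]
    have hag2 : AgreeTo K d σ ((σ1.setReg (hid K (d + 1)) 0).setReg (hid K (d + 2)) 1) :=
      (ha1.trans (AgreeTo.setReg _ _ _) (by omega)).trans (AgreeTo.setReg _ _ _) (by omega)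
    have n1 : hid K d ≠ hid K (d + 1) := by rw [Ne, hid_inj]; omega
    have n2 : hid K (d + 1) ≠ hid K (d + 2) := by rw [Ne, hid_inj]; omega
    have n3 : hid K d ≠ hid K (d + 2) := by rw [Ne, hid_inj]; omega
    obtain ⟨t2, σ2, e2, ht2, hh2, hend⟩ := hwhile n le_rfl _ s (hag2.rep hσ) hs (by simpa using h0)
      (by rw [State.setReg_reg_ne _ n3, State.setReg_reg_ne _ n1, hr1, h1])
      (by rw [State.setReg_reg_ne _ n2]; simp) (by simp)
    refine ⟨_, _, .seq e1 (.seq (.const _ _ _) (.seq (.const _ _ _) e2)), ?_,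
      fun h hh => by rw [hh2 h hh, hhid hag2 h hh], hend⟩
    have w1 := (hW (bits 0) (by simp [bits])).1
    have w2 := (hW (bits 1) hone).1
    have : (e.len + 10) * W ≤ Λ * W := Nat.mul_le_mul_right _ (by omega)
    rw [add_mul] at this ⊢
    rw [mul_assoc, one_mul]
    omega
  | conseq h1 ht hP ih =>
    intro hs hb hl d σ hσ
    obtain ⟨t', σ', e, h2, h3, s', h4, h5, h6⟩ := ih hs hb hl d σ hσ
    exact ⟨t', σ', e, h2.trans (Nat.mul_le_mul_right _ ht), h3, s', h4, h5, hP _ h6⟩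

end sound

end RAM

/-! ### Matchings and partial edge sets -/

namespace MatchCount

open Finset

variable {V : Type*} [Fintype V] [DecidableEq V]

/-- The number of edges of `E` at the vertex `v`. -/
def cnt (E : Finset (Sym2 V)) (v : V) : ℕ := #{e ∈ E | v ∈ e}

/-- The vertices that have edges of `E0` inside and outside of `E`. -/
def bdry (E0 E : Finset (Sym2 V)) : Finset V := {v | 0 < cnt E v ∧ cnt E v < cnt E0 v}

/-- The vertices all whose edges of `E0` belong to `E` (and that have some). -/
def fin (E0 E : Finset (Sym2 V)) : Finset V := {v | 0 < cnt E v ∧ cnt E v = cnt E0 v}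

/-- The number of matchings in `E` that cover `S` and the vertices of `fin E0 E` and no others. -/
def pm (E0 E : Finset (Sym2 V)) (S : Finset V) : ℕ :=
  #{M ∈ E.powerset | ∀ v, cnt M v = if v ∈ fin E0 E ∪ S then 1 else 0}

/-- The number of matchings in `E`. -/
def nM (E : Finset (Sym2 V)) : ℕ := #{M ∈ E.powerset | ∀ v, cnt M v ≤ 1}

theorem cnt_mono {E E' : Finset (Sym2 V)} (h : E ⊆ E') (v : V) : cnt E v ≤ cnt E' v :=
  card_le_card (filter_subset_filter _ h)

theorem cnt_union {E E' : Finset (Sym2 V)} (h : Disjoint E E') (v : V) :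
    cnt (E ∪ E') v = cnt E v + cnt E' v := by
  unfold cnt
  rw [filter_union, card_union_of_disjoint (disjoint_filter_filter h)]

theorem mem_bdry {E0 E : Finset (Sym2 V)} {v : V} :
    v ∈ bdry E0 E ↔ 0 < cnt E v ∧ cnt E v < cnt E0 v := by simp [bdry]

theorem mem_fin {E0 E : Finset (Sym2 V)} {v : V} :
    v ∈ fin E0 E ↔ 0 < cnt E v ∧ cnt E v = cnt E0 v := by simp [fin]

theorem pm_le_nM {E0 E : Finset (Sym2 V)} (h : E ⊆ E0) (S : Finset V) : pm E0 E S ≤ nM E0 := by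
  refine card_le_card fun M hM => ?_
  simp only [mem_filter, mem_powerset] at hM ⊢
  refine ⟨hM.1.trans h, fun v => ?_⟩
  rw [hM.2 v]
  split_ifs <;> simp

/-- The recurrence for the union of two disjoint edge sets. -/
theorem pm_union {E0 E1 E2 : Finset (Sym2 V)} (hE : Disjoint E1 E2) (h₀ : E1 ∪ E2 ⊆ E0)
    {I F L R S : Finset V} (hI : I = bdry E0 E1 ∩ bdry E0 E2 ∩ bdry E0 (E1 ∪ E2))
    (hF : F = (bdry E0 E1 ∩ bdry E0 E2) \ bdry E0 (E1 ∪ E2))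
    (hL : L = bdry E0 E1 \ bdry E0 E2) (hR : R = bdry E0 E2 \ bdry E0 E1)
    (hS : S ⊆ bdry E0 (E1 ∪ E2)) :
    pm E0 (E1 ∪ E2) S = ∑ Y ∈ F.powerset, ∑ A ∈ (S ∩ I).powerset,
      pm E0 E1 (A ∪ (S ∩ L) ∪ Y) * pm E0 E2 (((S ∩ I) \ A) ∪ (S ∩ R) ∪ (F \ Y)) := by
  have hdeg : ∀ v, cnt E1 v + cnt E2 v ≤ cnt E0 v := fun v => cnt_union hE v ▸ cnt_mono h₀ v
  have hIv : ∀ v, v ∈ I ↔ 0 < cnt E1 v ∧ 0 < cnt E2 v ∧ cnt E1 v + cnt E2 v < cnt E0 v := by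
    intro v
    have := hdeg v
    simp only [hI, mem_inter, mem_bdry, cnt_union hE]
    omega
  have hFv : ∀ v, v ∈ F ↔ 0 < cnt E1 v ∧ 0 < cnt E2 v ∧ cnt E1 v + cnt E2 v = cnt E0 v := by
    intro v
    have := hdeg v
    simp only [hF, mem_inter, mem_sdiff, mem_bdry, cnt_union hE]
    omega
  have hLv : ∀ v, v ∈ L ↔ 0 < cnt E1 v ∧ cnt E2 v = 0 ∧ cnt E1 v < cnt E0 v := by
    intro v
    have := hdeg v
    simp only [hL, mem_sdiff, mem_bdry]
    omega
  have hRv : ∀ v, v ∈ R ↔ cnt E1 v = 0 ∧ 0 < cnt E2 v ∧ cnt E2 v < cnt E0 v := by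
    intro v
    have := hdeg v
    simp only [hR, mem_sdiff, mem_bdry]
    omega
  have hSv : ∀ v, v ∈ S → 0 < cnt E1 v + cnt E2 v ∧ cnt E1 v + cnt E2 v < cnt E0 v := by
    intro v hv
    have := hS hv
    rwa [mem_bdry, cnt_union hE] at this
  rw [← sum_product', pm]
  rw [card_eq_sum_card_fiberwise (t := F.powerset ×ˢ (S ∩ I).powerset)
    (f := fun M => ({v ∈ F | cnt (M ∩ E1) v = 1}, {v ∈ I | cnt (M ∩ E1) v = 1}))]
  · refine sum_congr rfl ?_
    rintro ⟨Y, A⟩ hYA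
    simp only [mem_product, mem_powerset] at hYA
    obtain ⟨hY, hA⟩ := hYA
    rw [pm, pm, ← card_product]
    refine card_nbij' (fun M => (M ∩ E1, M ∩ E2)) (fun p => p.1 ∪ p.2) ?_ ?_ ?_ ?_
    · intro M hM
      simp only [coe_filter, mem_filter, mem_powerset, Set.mem_ofPred_eq, Prod.mk.injEq] at hM
      obtain ⟨⟨hME, hMc⟩, hMY, hMA⟩ := hM
      have hd : Disjoint (M ∩ E1) (M ∩ E2) := hE.mono inter_subset_right inter_subset_right
      have hM' : M ∩ E1 ∪ M ∩ E2 = M := by rw [← inter_union_distrib_left, inter_eq_left.2 hME]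
      have hc : ∀ v, cnt M v = cnt (M ∩ E1) v + cnt (M ∩ E2) v := fun v => by
        rw [← cnt_union hd, hM']
      simp only [coe_product, coe_filter, mem_powerset, Set.mem_prod, Set.mem_ofPred_eq,
        inter_subset_right, true_and]
      constructor <;> intro v <;>
      · have h1 := cnt_mono (inter_subset_right : M ∩ E1 ⊆ E1) v
        have h2 := cnt_mono (inter_subset_right : M ∩ E2 ⊆ E2) v
        have h3 := hMc v
        have h4 := hdeg v
        have h5 := hc v
        have h6 := hSv v
        have hYv : v ∈ Y ↔ v ∈ F ∧ cnt (M ∩ E1) v = 1 := by rw [← hMY, mem_filter]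
        have hAv : v ∈ A ↔ v ∈ I ∧ cnt (M ∩ E1) v = 1 := by rw [← hMA, mem_filter]
        simp only [mem_union, mem_inter, mem_sdiff, mem_fin, cnt_union hE, hYv, hAv, hIv, hFv, hLv,
          hRv] at h3 ⊢
        by_cases hvS : v ∈ S <;> simp only [hvS, true_and, false_and, or_false, or_true, false_or,
          if_true] at h3 h6 ⊢ <;> split_ifs at h3 ⊢ <;> omega
    · rintro ⟨M1, M2⟩ hM
      simp only [coe_product, coe_filter, mem_powerset, Set.mem_prod, Set.mem_ofPred_eq] at hM
      obtain ⟨⟨hM₁, hc₁⟩, hM₂, hc₂⟩ := hM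
      have hd : Disjoint M1 M2 := hE.mono hM₁ hM₂
      have e1 : (M1 ∪ M2) ∩ E1 = M1 := by
        rw [union_inter_distrib_right, inter_eq_left.2 hM₁,
          disjoint_iff_inter_eq_empty.1 (hE.symm.mono_left hM₂), union_empty]
      simp only [coe_filter, mem_filter, mem_powerset, Set.mem_ofPred_eq, Prod.mk.injEq, e1]
      have key : ∀ v, (v ∈ Y → v ∈ F) ∧ (v ∈ A → v ∈ S ∧ v ∈ I) := fun v =>
        ⟨fun h => hY h, fun h => mem_inter.1 (hA h)⟩
      refine ⟨⟨union_subset_union hM₁ hM₂, fun v => ?_⟩, ?_, ?_⟩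
      · have h1 := hc₁ v
        have h2 := hc₂ v
        have h4 := hdeg v
        have h6 := hSv v
        have h7 := key v
        rw [cnt_union hd]
        simp only [mem_union, mem_inter, mem_sdiff, mem_fin, cnt_union hE, hIv, hFv, hLv,
          hRv] at h1 h2 h7 ⊢
        by_cases hvS : v ∈ S <;> by_cases hvY : v ∈ Y <;> by_cases hvA : v ∈ A <;>
          simp only [hvS, hvY, hvA, true_and, false_and, or_false, or_true, true_or, false_or, and_true,
            and_false, not_true, not_false_eq_true, forall_true_left, IsEmpty.forall_iff,
            if_true] at h1 h2 h6 h7 ⊢ <;>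
          (try split_ifs at h1) <;> (try split_ifs at h2) <;> (try split_ifs) <;> omega
      all_goals
        ext v
        have h1 := hc₁ v
        have h4 := hdeg v
        have h6 := hSv v
        have h7 := key v
        simp only [mem_filter]
        simp only [mem_union, mem_inter, mem_fin, hIv, hFv, hLv] at h1 h7 ⊢
        by_cases hvS : v ∈ S <;> by_cases hvY : v ∈ Y <;> by_cases hvA : v ∈ A <;>
          simp only [hvS, hvY, hvA, true_and, false_and, or_false, or_true, true_or, false_or, and_true,
            and_false, forall_true_left, IsEmpty.forall_iff, if_true, iff_true, iff_false]
            at h1 h6 h7 ⊢ <;>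
          (try split_ifs at h1) <;> omega
    · intro M hM
      simp only [coe_filter, mem_filter, mem_powerset, Set.mem_ofPred_eq] at hM
      beta_reduce
      rw [← inter_union_distrib_left, inter_eq_left.2 hM.1.1]
    · rintro ⟨M1, M2⟩ hM
      simp only [coe_product, coe_filter, mem_powerset, Set.mem_prod, Set.mem_ofPred_eq] at hM
      obtain ⟨⟨hM₁, _⟩, hM₂, _⟩ := hM
      simp only [Prod.mk.injEq]
      rw [union_inter_distrib_right, union_inter_distrib_right, inter_eq_left.2 hM₁,
        disjoint_iff_inter_eq_empty.1 (hE.symm.mono_left hM₂), union_empty, inter_eq_left.2 hM₂,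
        disjoint_iff_inter_eq_empty.1 (hE.mono_left hM₁), empty_union]
      exact ⟨rfl, rfl⟩
  · intro M hM
    simp only [coe_filter, mem_powerset, Set.mem_ofPred_eq] at hM
    obtain ⟨hME, hMc⟩ := hM
    simp only [coe_product, Set.mem_prod, coe_powerset, Set.mem_preimage, Set.mem_powerset_iff,
      coe_subset]
    refine ⟨filter_subset _ _, fun v hv => ?_⟩
    simp only [mem_filter, hIv] at hv
    have h3 := hMc v
    have h4 := cnt_mono (inter_subset_left : M ∩ E1 ⊆ M) v
    simp only [mem_union, mem_fin, cnt_union hE] at h3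
    rw [mem_inter, hIv]
    refine ⟨?_, hv.1⟩
    by_contra hvS
    rw [if_neg (by simp only [hvS, or_false]; omega)] at h3
    omega

/-- The matchings of a single edge. -/
theorem pm_singleton {E0 : Finset (Sym2 V)} {u v : V} (huv : u ≠ v) (he : s(u, v) ∈ E0)
    {S : Finset V} (hS : S ⊆ bdry E0 {s(u, v)}) :
    pm E0 {s(u, v)} S = (if S = bdry E0 {s(u, v)} then 1 else 0) +
      if S = ∅ ∧ #(bdry E0 {s(u, v)}) = 2 then 1 else 0 := by
  have hc : ∀ x, cnt {s(u, v)} x = if x = u ∨ x = v then 1 else 0 := by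
    intro x
    simp only [cnt, filter_singleton, Sym2.mem_iff]
    split_ifs <;> simp
  have hpos : ∀ x, (x = u ∨ x = v) → 1 ≤ cnt E0 x := by
    intro x hx
    have := cnt_mono (singleton_subset_iff.2 he) x
    rwa [hc, if_pos hx] at this
  have hb : ∀ x, x ∈ bdry E0 {s(u, v)} ↔ (x = u ∨ x = v) ∧ 1 < cnt E0 x := by
    intro x; rw [mem_bdry, hc]; split_ifs with h <;> simp [h]
  have hf : ∀ x, x ∈ fin E0 {s(u, v)} ↔ (x = u ∨ x = v) ∧ 1 = cnt E0 x := by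
    intro x; rw [mem_fin, hc]; split_ifs with h <;> simp [h]
  have h0 : (∀ x, cnt (∅ : Finset (Sym2 V)) x = if x ∈ fin E0 {s(u, v)} ∪ S then 1 else 0) ↔
      S = ∅ ∧ #(bdry E0 {s(u, v)}) = 2 := by
    have : (∀ x, cnt (∅ : Finset (Sym2 V)) x = if x ∈ fin E0 {s(u, v)} ∪ S then 1 else 0) ↔
        fin E0 {s(u, v)} ∪ S = ∅ := by
      simp only [cnt, filter_empty, card_empty, Finset.eq_empty_iff_forall_notMem]
      exact forall_congr' fun x => by split_ifs with h <;> simp [h]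
    rw [this, union_eq_empty, and_comm]
    refine and_congr_right fun hS => ?_
    have hsub : bdry E0 {s(u, v)} ⊆ {u, v} := fun x hx => by simpa using ((hb x).1 hx).1
    rw [← card_pair huv]
    constructor
    · intro h
      congr 1
      refine hsub.antisymm fun x hx => (hb x).2 ?_
      have hx : x = u ∨ x = v := by simpa using hx
      have h1 : ¬ ((x = u ∨ x = v) ∧ 1 = cnt E0 x) := by rw [← hf, h]; simp
      have := hpos x hx
      exact ⟨hx, lt_of_le_of_ne this fun h' => h1 ⟨hx, h'⟩⟩
    · intro h
      have := eq_of_subset_of_card_le hsub h.ge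
      refine eq_empty_of_forall_notMem fun x hx => ?_
      have hx := (hf x).1 hx
      have : x ∈ bdry E0 {s(u, v)} := by rw [this]; simpa using hx.1
      exact ((hb x).1 this).2.ne hx.2
  have h1 : (∀ x, cnt {s(u, v)} x = if x ∈ fin E0 {s(u, v)} ∪ S then 1 else 0) ↔
      S = bdry E0 {s(u, v)} := by
    simp only [hc, mem_union]
    constructor
    · intro h
      refine hS.antisymm fun x hx => ?_
      have hx := (hb x).1 hx
      have h := h x
      rw [if_pos hx.1] at h
      by_contra hxS
      rw [if_neg (by simp only [hxS, or_false, hf]; omega)] at h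
      simp at h
    · rintro rfl x
      simp only [hf, hb]
      have := hpos x
      congr 1
      apply propext
      constructor
      · intro hx
        have := this hx
        by_cases h : 1 = cnt E0 x
        · exact Or.inl ⟨hx, h⟩
        · exact Or.inr ⟨hx, by omega⟩
      · rintro (h | h) <;> exact h.1
  rw [pm, show ({s(u, v)} : Finset (Sym2 V)).powerset = {∅, {s(u, v)}} from rfl, filter_insert,
    filter_singleton]
  simp only [h0, h1]
  split_ifs <;> simp [Finset.card_insert_of_notMem, (Finset.singleton_ne_empty _).symm]

end MatchCount

namespace MatchCount

open Finset

variable {V : Type*} [Fintype V] [DecidableEq V]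

/-- The matchings in a set of `m` edges choose at most one edge at each vertex. -/
theorem nM_le_prod (E : Finset (Sym2 V)) : nM E ≤ ∏ v, (cnt E v + 1) := by
  let t : V → Finset (Finset (Sym2 V)) := fun v => insert ∅ ({e ∈ E | v ∈ e}.image fun e => {e})
  have ht : ∀ v, #(t v) ≤ cnt E v + 1 := fun v =>
    (card_insert_le _ _).trans (Nat.add_le_add_right card_image_le 1)
  refine le_trans ?_ (prod_le_prod' fun v _ => ht v)
  rw [← Fintype.card_piFinset]
  refine card_le_card_of_injOn (fun M v => {e ∈ M | v ∈ e}) ?_ ?_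
  · intro M hM
    simp only [coe_filter, mem_powerset, Set.mem_ofPred_eq] at hM
    simp only [mem_coe, Fintype.mem_piFinset]
    intro v
    obtain h | h := Nat.le_one_iff_eq_zero_or_eq_one.1 (hM.2 v)
    · rw [cnt, card_eq_zero] at h
      simp [t, h]
    · obtain ⟨e, he⟩ := card_eq_one.1 h
      have : e ∈ {e ∈ M | v ∈ e} := by rw [he]; simp
      rw [mem_filter] at this
      simp only [t, he, mem_insert, mem_image, mem_filter]
      exact Or.inr ⟨e, ⟨hM.1 this.1, this.2⟩, rfl⟩
  · intro M _ M' _ h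
    have key : ∀ e, e ∈ M ↔ e ∈ M' := by
      intro e
      obtain ⟨v, hv⟩ : ∃ v, v ∈ e := by
        induction e with
        | _ a b => exact ⟨a, by simp⟩
      have := congrArg (e ∈ ·) (congrFun h v)
      simpa [hv] using this
    exact Finset.ext key

theorem sum_cnt_le (E : Finset (Sym2 V)) : ∑ v, cnt E v ≤ 2 * #E := by
  simp only [cnt, card_filter]
  rw [sum_comm, mul_comm, ← smul_eq_mul]
  refine sum_le_card_nsmul _ _ _ fun e _ => ?_
  rw [← card_filter]
  induction e with
  | _ a b =>
    refine (card_le_card (t := {a, b}) fun x hx => by simpa using hx).trans card_le_two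

theorem nM_le_pow (E : Finset (Sym2 V)) {k : ℕ} (hk : 2 ≤ k)
    (hE : #E ≤ 2 * k * Fintype.card V) :
    nM E ≤ k ^ Fintype.card V * 2 ^ (5 * Fintype.card V) := by
  refine (nM_le_prod E).trans ?_
  have h1 : ∀ v, cnt E v + 1 ≤ k * 2 ^ ((cnt E v + 1) / k) := by
    intro v
    have h2 := Nat.lt_mul_div_succ (cnt E v + 1) (by omega : 0 < k)
    have h3 : (cnt E v + 1) / k + 1 ≤ 2 ^ ((cnt E v + 1) / k) := Nat.lt_two_pow_self
    exact h2.le.trans (Nat.mul_le_mul_left _ h3)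
  refine (prod_le_prod' fun v _ => h1 v).trans ?_
  rw [prod_mul_distrib, prod_const, card_univ, prod_pow_eq_pow_sum]
  refine Nat.mul_le_mul_left _ (Nat.pow_le_pow_right (by norm_num) ?_)
  have h4 : ∑ v, (cnt E v + 1) / k ≤ (∑ v, (cnt E v + 1)) / k := by
    rw [Nat.le_div_iff_mul_le (by omega), sum_mul]
    exact sum_le_sum fun v _ => Nat.div_mul_le_self _ _
  refine h4.trans (Nat.div_le_of_le_mul ?_)
  rw [sum_add_distrib, sum_const, card_univ, smul_eq_mul, mul_one]
  have := sum_cnt_le E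
  nlinarith

/-- The edge sets obtained from single edges by disjoint unions, with small boundaries. -/
inductive Built (E0 : Finset (Sym2 V)) (w : ℕ) : Finset (Sym2 V) → Prop where
  | single {u v : V} : u ≠ v → s(u, v) ∈ E0 → #(bdry E0 {s(u, v)}) ≤ w → Built E0 w {s(u, v)}
  | union {E1 E2 : Finset (Sym2 V)} : Built E0 w E1 → Built E0 w E2 → Disjoint E1 E2 →
      #(bdry E0 (E1 ∪ E2)) ≤ w → Built E0 w (E1 ∪ E2)

theorem Built.subset {E0 E : Finset (Sym2 V)} {w : ℕ} (h : Built E0 w E) : E ⊆ E0 := by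
  induction h with
  | single _ h _ => simpa using h
  | union _ _ _ _ h1 h2 => exact union_subset h1 h2

theorem Built.card_bdry_le {E0 E : Finset (Sym2 V)} {w : ℕ} (h : Built E0 w E) :
    #(bdry E0 E) ≤ w := by
  cases h <;> assumption

theorem card_touching_le {F X : Finset V} (E : Finset (Sym2 V))
    (h : ∀ e ∈ E, ∃ u ∈ F, ∃ v ∈ X, e = s(u, v)) : #E ≤ #F * #X := by
  rw [← card_product]
  refine (card_le_card fun e he => ?_).trans (card_image_le (f := fun p : V × V => s(p.1, p.2)))
  obtain ⟨u, hu, v, hv, rfl⟩ := h e he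
  exact mem_image.2 ⟨(u, v), mem_product.2 ⟨hu, hv⟩, rfl⟩

theorem Built.card_le {E0 E : Finset (Sym2 V)} {w : ℕ} (hw : 1 ≤ w) (h : Built E0 w E) :
    #{e ∈ E | ∃ v ∈ e, v ∉ bdry E0 E} ≤ 2 * w * #(fin E0 E) := by
  induction h with
  | @single u v huv he hb =>
    by_cases hf : fin E0 {s(u, v)} = ∅
    · rw [hf]
      simp only [card_empty, mul_zero, nonpos_iff_eq_zero, card_eq_zero, filter_eq_empty_iff,
        mem_singleton, forall_eq, not_exists, not_and, not_not]
      intro x hx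
      have h1 : x ∉ fin E0 {s(u, v)} := by simp [hf]
      have h2 : 0 < cnt {s(u, v)} x := by
        rw [cnt, card_pos]; exact ⟨_, mem_filter.2 ⟨mem_singleton_self _, hx⟩⟩
      have h3 := cnt_mono (singleton_subset_iff.2 he) x
      rw [mem_fin] at h1
      rw [mem_bdry]
      omega
    · have : 1 ≤ #(fin E0 {s(u, v)}) := card_pos.2 (nonempty_iff_ne_empty.2 hf)
      refine (card_filter_le _ _).trans ?_
      rw [card_singleton]
      nlinarith
  | @union E1 E2 h1 h2 hd hb ih1 ih2 =>
    have h₀ : E1 ∪ E2 ⊆ E0 := union_subset h1.subset h2.subset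
    have hdeg : ∀ v, cnt E1 v + cnt E2 v ≤ cnt E0 v := fun v => cnt_union hd v ▸ cnt_mono h₀ v
    set F := (bdry E0 E1 ∩ bdry E0 E2) \ bdry E0 (E1 ∪ E2) with hF
    have hdisj1 : Disjoint (fin E0 E1) (fin E0 E2) := by
      rw [disjoint_left]
      intro v
      have := hdeg v
      simp only [mem_fin]
      omega
    have hdisj2 : Disjoint (fin E0 E1 ∪ fin E0 E2) F := by
      rw [disjoint_left]
      intro v
      have := hdeg v
      simp only [hF, mem_union, mem_sdiff, mem_inter, mem_bdry, mem_fin, cnt_union hd]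
      omega
    have hsub : fin E0 E1 ∪ fin E0 E2 ∪ F ⊆ fin E0 (E1 ∪ E2) := by
      intro v
      have := hdeg v
      simp only [hF, mem_union, mem_sdiff, mem_inter, mem_bdry, mem_fin, cnt_union hd]
      omega
    have hcard := card_le_card hsub
    rw [card_union_of_disjoint hdisj2, card_union_of_disjoint hdisj1] at hcard
    set A1 := {e ∈ E1 | (∀ v ∈ e, v ∈ bdry E0 E1) ∧ ∃ v ∈ e, v ∈ F} with hA1
    set A2 := {e ∈ E2 | (∀ v ∈ e, v ∈ bdry E0 E2) ∧ ∃ v ∈ e, v ∈ F} with hA2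
    have hcov : {e ∈ E1 ∪ E2 | ∃ v ∈ e, v ∉ bdry E0 (E1 ∪ E2)} ⊆
        ({e ∈ E1 | ∃ v ∈ e, v ∉ bdry E0 E1} ∪ A1) ∪
          ({e ∈ E2 | ∃ v ∈ e, v ∉ bdry E0 E2} ∪ A2) := by
      intro e he
      simp only [hA1, hA2, mem_filter, mem_union] at he ⊢
      obtain ⟨he, v, hv, hvb⟩ := he
      have hv' := hdeg v
      obtain he | he := he
      · left
        by_cases hin : ∃ v ∈ e, v ∉ bdry E0 E1
        · exact Or.inl ⟨he, hin⟩
        · push Not at hin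
          refine Or.inr ⟨he, hin, v, hv, ?_⟩
          have := hin v hv
          simp only [hF, mem_sdiff, mem_inter, mem_bdry, cnt_union hd] at this hvb ⊢
          omega
      · right
        by_cases hin : ∃ v ∈ e, v ∉ bdry E0 E2
        · exact Or.inl ⟨he, hin⟩
        · push Not at hin
          refine Or.inr ⟨he, hin, v, hv, ?_⟩
          have := hin v hv
          simp only [hF, mem_sdiff, mem_inter, mem_bdry, cnt_union hd] at this hvb ⊢
          omega
    have hA : ∀ {E' : Finset (Sym2 V)} {X : Finset V},
        #{e ∈ E' | (∀ v ∈ e, v ∈ X) ∧ ∃ v ∈ e, v ∈ F} ≤ #F * #X := by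
      intro E' X
      refine card_touching_le _ fun e he => ?_
      obtain ⟨_, hX, u, hu, huF⟩ := mem_filter.1 he
      obtain ⟨v, rfl⟩ := Sym2.mem_iff_exists.1 hu
      exact ⟨u, huF, v, hX v (by simp), rfl⟩
    have e1 := (hA : #A1 ≤ _).trans (Nat.mul_le_mul_left _ h1.card_bdry_le)
    have e2 := (hA : #A2 ≤ _).trans (Nat.mul_le_mul_left _ h2.card_bdry_le)
    refine (card_le_card hcov).trans ((card_union_le _ _).trans ?_)
    have e3 := card_union_le {e ∈ E1 | ∃ v ∈ e, v ∉ bdry E0 E1} A1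
    have e4 := card_union_le {e ∈ E2 | ∃ v ∈ e, v ∉ bdry E0 E2} A2
    nlinarith

theorem Built.card_edges_le {E0 : Finset (Sym2 V)} {w : ℕ} (hw : 1 ≤ w) (h : Built E0 w E0) :
    #E0 ≤ 2 * w * Fintype.card V := by
  have h1 := h.card_le hw
  rw [filter_true_of_mem] at h1
  · exact h1.trans (Nat.mul_le_mul_left _ (card_le_univ _))
  · intro e _
    induction e with
    | _ a b => exact ⟨a, by simp, by simp [mem_bdry]⟩

/-! ### Matchings as subgraphs -/

variable {G : SimpleGraph V}

/-- The subgraph of a set of edges. -/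
def toSub (G : SimpleGraph V) (M : Finset (Sym2 V)) : G.Subgraph where
  verts := {v | ∃ w, s(v, w) ∈ M ∧ G.Adj v w}
  Adj v w := s(v, w) ∈ M ∧ G.Adj v w
  adj_sub h := h.2
  edge_vert h := ⟨_, h⟩
  symm := ⟨fun v _ h => ⟨Sym2.eq_swap (a := v) ▸ h.1, h.2.symm⟩⟩

theorem toSub_injOn : Set.InjOn (toSub G) {M | ∀ e ∈ M, e ∈ G.edgeSet} := by
  intro M hM M' hM' h
  ext e
  have key : ∀ v w, (s(v, w) ∈ M ∧ G.Adj v w) ↔ (s(v, w) ∈ M' ∧ G.Adj v w) := fun v w => by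
    change (toSub G M).Adj v w ↔ (toSub G M').Adj v w
    rw [h]
  induction e with
  | _ v w =>
    exact ⟨fun h => ((key v w).1 ⟨h, hM _ h⟩).1, fun h => ((key v w).2 ⟨h, hM' _ h⟩).1⟩

theorem cnt_eq_one {M : Finset (Sym2 V)} (hM : ∀ e ∈ M, e ∈ G.edgeSet) {v : V} :
    cnt M v = 1 ↔ ∃! w, (toSub G M).Adj v w := by
  rw [cnt, card_eq_one]
  constructor
  · rintro ⟨e, he⟩
    have h1 : e ∈ M ∧ v ∈ e := by
      have : e ∈ {e ∈ M | v ∈ e} := by simp [he]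
      simpa using this
    obtain ⟨w, rfl⟩ := Sym2.mem_iff_exists.1 h1.2
    refine ⟨w, ⟨h1.1, hM _ h1.1⟩, fun w' hw' => ?_⟩
    have : s(v, w') ∈ {e ∈ M | v ∈ e} := by simp [hw'.1]
    rw [he, mem_singleton] at this
    exact Sym2.congr_right.1 this
  · rintro ⟨w, hw, hu⟩
    refine ⟨s(v, w), ?_⟩
    ext e
    simp only [mem_filter, mem_singleton]
    constructor
    · rintro ⟨he, hv⟩
      obtain ⟨w', rfl⟩ := Sym2.mem_iff_exists.1 hv
      rw [hu w' ⟨he, hM _ he⟩]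
    · rintro rfl
      exact ⟨hw.1, by simp⟩

theorem nM_le_numMatchings {E0 : Finset (Sym2 V)} (hE : ∀ e, e ∈ E0 ↔ e ∈ G.edgeSet) :
    nM E0 ≤ numMatchings G := by
  rw [nM, numMatchings, ← Set.ncard_coe_finset]
  refine Set.ncard_le_ncard_of_injOn (toSub G) ?_ (toSub_injOn.mono ?_) (Set.toFinite _)
  · intro M hM
    simp only [coe_filter, mem_powerset, Set.mem_ofPred_eq] at hM
    have hM' : ∀ e ∈ M, e ∈ G.edgeSet := fun e he => (hE e).1 (hM.1 he)
    rintro v ⟨w, hw⟩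
    refine (cnt_eq_one hM').1 (le_antisymm (hM.2 v) ?_)
    exact card_pos.2 ⟨s(v, w), by simp [hw.1]⟩
  · intro M hM e he
    simp only [coe_filter, mem_powerset, Set.mem_ofPred_eq] at hM
    exact (hE e).1 (hM.1 he)

theorem numPerfectMatchings_eq {E0 : Finset (Sym2 V)} (hE : ∀ e, e ∈ E0 ↔ e ∈ G.edgeSet) :
    numPerfectMatchings G = #{M ∈ E0.powerset | ∀ v, cnt M v = 1} := by
  classical
  rw [numPerfectMatchings, ← Set.ncard_coe_finset]
  rw [← Set.InjOn.ncard_image (f := toSub G)]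
  · congr 1
    ext H
    simp only [Set.mem_image, coe_filter, mem_powerset, Set.mem_ofPred_eq]
    constructor
    · intro hH
      have hadj : ∀ v w, H.Adj v w ↔
          (s(v, w) ∈ E0.filter (· ∈ H.edgeSet) ∧ G.Adj v w) := by
        intro v w
        simp only [mem_filter, hE, SimpleGraph.mem_edgeSet, SimpleGraph.Subgraph.mem_edgeSet]
        exact ⟨fun h => ⟨⟨h.adj_sub, h⟩, h.adj_sub⟩, fun h => h.1.2⟩
      have hM : ∀ e ∈ E0.filter (· ∈ H.edgeSet), e ∈ G.edgeSet := fun e he =>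
        (hE e).1 (mem_filter.1 he).1
      refine ⟨E0.filter (· ∈ H.edgeSet), ⟨filter_subset _ _, fun v => ?_⟩, ?_⟩
      · rw [cnt_eq_one hM]
        obtain ⟨w, hw, hu⟩ := hH.1 (hH.2 v)
        exact ⟨w, (hadj v w).1 hw, fun w' hw' => hu w' ((hadj v w').2 hw')⟩
      · refine SimpleGraph.Subgraph.ext ?_ ?_
        · ext v
          refine ⟨fun _ => hH.2 v, fun _ => ?_⟩
          obtain ⟨w, hw, -⟩ := hH.1 (hH.2 v)
          exact ⟨w, (hadj v w).1 hw⟩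
        · ext v w
          exact (hadj v w).symm
    · rintro ⟨M, ⟨hM, hc⟩, rfl⟩
      have hM' : ∀ e ∈ M, e ∈ G.edgeSet := fun e he => (hE e).1 (hM he)
      refine ⟨fun v _ => (cnt_eq_one hM').1 (hc v), fun v => ?_⟩
      obtain ⟨w, hw, -⟩ := (cnt_eq_one hM').1 (hc v)
      exact ⟨w, hw⟩
  · refine toSub_injOn.mono ?_
    intro M hM e he
    simp only [coe_filter, mem_powerset, Set.mem_ofPred_eq] at hM
    exact (hE e).1 (hM.1 he)

theorem numPerfectMatchings_eq_pm {E0 : Finset (Sym2 V)} (hE : ∀ e, e ∈ E0 ↔ e ∈ G.edgeSet)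
    (h : ∀ v, 0 < cnt E0 v) : numPerfectMatchings G = pm E0 E0 ∅ := by
  rw [numPerfectMatchings_eq hE, pm]
  congr 1
  ext M
  simp [mem_fin, h]

theorem numPerfectMatchings_eq_zero {E0 : Finset (Sym2 V)} (hE : ∀ e, e ∈ E0 ↔ e ∈ G.edgeSet)
    {v : V} (h : cnt E0 v = 0) : numPerfectMatchings G = 0 := by
  rw [numPerfectMatchings_eq hE, card_eq_zero, filter_eq_empty_iff]
  intro M hM hc
  have := cnt_mono (mem_powerset.1 hM) v
  have := hc v
  omega

end MatchCount

/-! ### Sides of the edges of a tree -/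

namespace SimpleGraph.IsTree

variable {ι : Type*} {H : SimpleGraph ι} (hH : H.IsTree)
include hH

theorem exists_adj_dist_lt {x a : ι} (h : x ≠ a) : ∃ c, H.Adj x c ∧ H.dist c a < H.dist x a := by
  obtain ⟨W, hW⟩ := hH.connected.exists_walk_length_eq_dist x a
  cases W with
  | nil => exact absurd rfl h
  | cons hc W' =>
    refine ⟨_, hc, ?_⟩
    have := dist_le W'
    rw [Walk.length_cons] at hW
    omega

theorem dist_lt_or {x y : ι} (h : H.Adj x y) (a : ι) :
    H.dist y a = H.dist x a + 1 ∨ H.dist x a = H.dist y a + 1 := by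
  have := hH.dist_eq_dist_add_one_of_adj a h
  rw [dist_comm (v := y), dist_comm (v := x)] at this
  exact this.symm

theorem eq_of_adj_dist_lt {x a c c' : ι} (hc : H.Adj x c) (hc' : H.Adj x c')
    (h : H.dist c a < H.dist x a) (h' : H.dist c' a < H.dist x a) : c = c' := by
  obtain ⟨W, hW⟩ := hH.connected.exists_walk_length_eq_dist c a
  obtain ⟨W', hW'⟩ := hH.connected.exists_walk_length_eq_dist c' a
  have h1 := hH.dist_lt_or hc a
  have h2 := hH.dist_lt_or hc' a
  have p1 := (Walk.cons hc W).isPath_of_length_eq_dist (by rw [Walk.length_cons]; omega)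
  have p2 := (Walk.cons hc' W').isPath_of_length_eq_dist (by rw [Walk.length_cons]; omega)
  have := (hH.isAcyclic.subsingleton_path x a).elim ⟨_, p1⟩ ⟨_, p2⟩
  have := congrArg (fun p : H.Path x a => p.1.snd) this
  simpa using this

theorem reachable_deleteEdges {x p a : ι} (h : H.dist x a < H.dist p a) :
    (H.deleteEdges {s(x, p)}).Reachable x a := by
  have key : ∀ (d : ℕ) (y : ι), H.dist y a = d → d < H.dist p a →
      (H.deleteEdges {s(x, p)}).Reachable y a := by
    intro d
    induction d with
    | zero =>
      intro y hy _
      rw [hH.connected.dist_eq_zero_iff] at hy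
      rw [hy]
    | succ d ih =>
      intro y hy hd
      obtain ⟨c, hc, hlt⟩ := hH.exists_adj_dist_lt (x := y) (a := a) (by
        rintro rfl; simp at hy)
      have := hH.dist_lt_or hc a
      have hca : H.dist c a = d := by omega
      refine Reachable.trans (Adj.reachable ?_) (ih c hca (by omega))
      rw [deleteEdges_adj]
      refine ⟨hc, fun he => ?_⟩
      rw [Set.mem_singleton_iff, Sym2.eq_iff] at he
      obtain ⟨rfl, rfl⟩ | ⟨rfl, rfl⟩ := he <;> omega
  exact key _ x rfl h

end SimpleGraph.IsTree

/-! ### The edge sets of a branch decomposition -/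

namespace BranchDecomposition

open Finset MatchCount

variable {V : Type*} [Fintype V] [DecidableEq V] {G : SimpleGraph V} {ι : Type*} [Fintype ι]
  [DecidableEq ι]

open Classical in
/-- The edges of `G` at the leaves on the side of `x` of the tree edge `xp`. -/
noncomputable def below (T : BranchDecomposition G ι) (x p : ι) : Finset (Sym2 V) :=
  (univ.filter fun a : {a // (T.tree.neighborSet a).ncard ≤ 1} =>
    T.tree.dist x a < T.tree.dist p a).image fun a => (T.leafEdge a : Sym2 V)

variable (T : BranchDecomposition G ι)

theorem mem_below {x p : ι} {e : Sym2 V} : e ∈ T.below x p ↔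
    ∃ a : {a // (T.tree.neighborSet a).ncard ≤ 1}, T.tree.dist x a < T.tree.dist p a ∧
      (T.leafEdge a : Sym2 V) = e := by
  classical
  simp [below]

theorem leafEdge_injective {a b : {a // (T.tree.neighborSet a).ncard ≤ 1}}
    (h : (T.leafEdge a : Sym2 V) = T.leafEdge b) : a = b :=
  T.leafEdge.injective (Subtype.ext h)

theorem below_leaf {x p : ι} (hx : (T.tree.neighborSet x).ncard ≤ 1) (hp : T.tree.Adj x p) :
    T.below x p = {(T.leafEdge ⟨x, hx⟩ : Sym2 V)} := by
  ext e
  rw [mem_below, mem_singleton]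
  constructor
  · rintro ⟨⟨a, ha⟩, hlt, rfl⟩
    by_cases hxa : x = a
    · subst hxa; rfl
    · obtain ⟨c, hc, hca⟩ := T.isTree.exists_adj_dist_lt hxa
      have : c = p := by
        rw [Set.ncard_le_one (Set.toFinite _)] at hx
        exact hx c hc p hp
      subst this
      simp only at hlt hca
      omega
  · rintro rfl
    refine ⟨⟨x, hx⟩, ?_, rfl⟩
    have := T.isTree.dist_lt_or hp x
    simp only [SimpleGraph.dist_self] at this ⊢
    omega

theorem below_inner {x p c₁ c₂ : ι} (hN : T.tree.neighborSet x = {p, c₁, c₂})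
    (h1 : c₁ ≠ p) (h2 : c₂ ≠ p) (h3 : c₁ ≠ c₂) (hx : ¬ (T.tree.neighborSet x).ncard ≤ 1) :
    T.below x p = T.below c₁ x ∪ T.below c₂ x ∧ Disjoint (T.below c₁ x) (T.below c₂ x) := by
  have hadj : ∀ y, T.tree.Adj x y ↔ y = p ∨ y = c₁ ∨ y = c₂ := fun y => by
    rw [← SimpleGraph.mem_neighborSet, hN]; simp
  have hp := (hadj p).2 (by simp)
  have hc₁ := (hadj c₁).2 (by simp)
  have hc₂ := (hadj c₂).2 (by simp)
  constructor
  · ext e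
    rw [mem_union, mem_below, mem_below, mem_below, ← exists_or]
    refine exists_congr fun a => ?_
    rw [← or_and_right]
    refine and_congr_left fun _ => ⟨fun h => ?_, fun h => ?_⟩
    · have hxa : x ≠ a := by rintro rfl; exact hx a.2
      obtain ⟨c, hc, hca⟩ := T.isTree.exists_adj_dist_lt hxa
      obtain rfl | rfl | rfl := (hadj c).1 hc
      · omega
      · exact Or.inl hca
      · exact Or.inr hca
    · have := T.isTree.dist_lt_or hp a
      by_contra hlt
      have hpa : T.tree.dist p a < T.tree.dist x a := by omega
      obtain h | h := h
      · exact h1 (T.isTree.eq_of_adj_dist_lt hc₁ hp h hpa)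
      · exact h2 (T.isTree.eq_of_adj_dist_lt hc₂ hp h hpa)
  · rw [Finset.disjoint_left]
    intro e he he'
    rw [mem_below] at he he'
    obtain ⟨a, ha, rfl⟩ := he
    obtain ⟨b, hb, hba⟩ := he'
    obtain rfl := T.leafEdge_injective hba
    exact h3 (T.isTree.eq_of_adj_dist_lt hc₁ hc₂ ha hb)

variable {E0 : Finset (Sym2 V)}

theorem below_subset (hE : ∀ e, e ∈ E0 ↔ e ∈ G.edgeSet) (x p : ι) : T.below x p ⊆ E0 := by
  intro e he
  rw [mem_below] at he
  obtain ⟨a, _, rfl⟩ := he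
  exact (hE _).2 (T.leafEdge a).2

theorem below_union (hE : ∀ e, e ∈ E0 ↔ e ∈ G.edgeSet) {x p : ι} (hp : T.tree.Adj x p) :
    T.below x p ∪ T.below p x = E0 ∧ Disjoint (T.below x p) (T.below p x) := by
  constructor
  · ext e
    rw [mem_union, mem_below, mem_below, ← exists_or, hE]
    constructor
    · rintro ⟨a, ⟨_, rfl⟩ | ⟨_, rfl⟩⟩ <;> exact (T.leafEdge a).2
    · intro he
      obtain ⟨a, ha⟩ := T.leafEdge.surjective ⟨e, he⟩
      have := T.isTree.dist_lt_or hp a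
      refine ⟨a, ?_⟩
      rw [← or_and_right, ha]
      exact ⟨by omega, rfl⟩
  · rw [Finset.disjoint_left]
    intro e he he'
    rw [mem_below] at he he'
    obtain ⟨a, ha, rfl⟩ := he
    obtain ⟨b, hb, hba⟩ := he'
    obtain rfl := T.leafEdge_injective hba
    omega

theorem bdry_below_subset (hE : ∀ e, e ∈ E0 ↔ e ∈ G.edgeSet) {x p : ι} (hp : T.tree.Adj x p) :
    ↑(bdry E0 (T.below x p)) ⊆ T.middleSet x p := by
  intro v hv
  rw [mem_coe, mem_bdry] at hv
  obtain ⟨h1, h2⟩ := hv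
  constructor
  · obtain ⟨e, he⟩ := card_pos.1 h1
    rw [mem_filter, mem_below] at he
    obtain ⟨⟨a, ha, rfl⟩, hve⟩ := he
    exact ⟨a, T.isTree.reachable_deleteEdges ha, hve⟩
  · have h3 := T.below_union hE hp
    rw [← h3.1, cnt_union h3.2] at h2
    obtain ⟨e, he⟩ := card_pos.1 (by omega : 0 < cnt (T.below p x) v)
    rw [mem_filter, mem_below] at he
    obtain ⟨⟨a, ha, rfl⟩, hve⟩ := he
    exact ⟨a, T.isTree.reachable_deleteEdges ha, hve⟩

theorem card_bdry_below_le (hE : ∀ e, e ∈ E0 ↔ e ∈ G.edgeSet) {x p : ι} (hp : T.tree.Adj x p) :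
    #(bdry E0 (T.below x p)) ≤ T.width := by
  have h1 := Set.ncard_le_ncard (T.bdry_below_subset hE hp) (Set.toFinite _)
  rw [Set.ncard_coe_finset] at h1
  refine h1.trans (le_csSup ⟨Fintype.card V, ?_⟩ ⟨x, p, hp, rfl⟩)
  rintro c ⟨x, y, _, rfl⟩
  rw [← Nat.card_eq_fintype_card]
  exact Set.ncard_le_card _

/-- The kinds of nodes of the tree. -/
theorem leaf_or_inner {x p : ι} (hp : T.tree.Adj x p) : (T.tree.neighborSet x).ncard ≤ 1 ∨
    ∃ c₁ c₂, T.tree.neighborSet x = {p, c₁, c₂} ∧ c₁ ≠ p ∧ c₂ ≠ p ∧ c₁ ≠ c₂ ∧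
      ¬ (T.tree.neighborSet x).ncard ≤ 1 := by
  refine (T.degree x).imp id fun h => ?_
  obtain ⟨a, b, c, hab, hac, hbc, hN⟩ := Set.ncard_eq_three.1 h
  have hp' : p ∈ T.tree.neighborSet x := hp
  have h1 : ¬ (T.tree.neighborSet x).ncard ≤ 1 := by omega
  rw [hN] at hp'
  obtain rfl | rfl | rfl := hp'
  · exact ⟨b, c, hN, hab.symm, hac.symm, hbc, h1⟩
  · exact ⟨a, c, by rw [hN, Set.insert_comm], hab, hbc.symm, hac, h1⟩
  · exact ⟨a, b, by rw [hN]; ext; simp; tauto, hac, hbc, hab, h1⟩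

theorem exists_leafEdge_eq (a : {a // (T.tree.neighborSet a).ncard ≤ 1}) :
    ∃ u v, u ≠ v ∧ (T.leafEdge a : Sym2 V) = s(u, v) := by
  obtain ⟨e, he⟩ := T.leafEdge a
  induction e with
  | _ u v => exact ⟨u, v, G.ne_of_adj he, rfl⟩

theorem built_below (hE : ∀ e, e ∈ E0 ↔ e ∈ G.edgeSet) {x p : ι} (hp : T.tree.Adj x p) :
    Built E0 T.width (T.below x p) := by
  classical
  have key : ∀ (d : ℕ) (x p : ι), #{a | T.tree.dist x a < T.tree.dist p a} ≤ d →
      T.tree.Adj x p → Built E0 T.width (T.below x p) := by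
    intro d
    induction d with
    | zero =>
      intro x p hd hp
      have h1 := T.isTree.dist_lt_or hp x
      have : x ∈ ({a | T.tree.dist x a < T.tree.dist p a} : Finset ι) := by
        simp only [mem_filter, mem_univ, true_and, SimpleGraph.dist_self] at h1 ⊢
        omega
      rw [card_eq_zero.1 (Nat.le_zero.1 hd)] at this
      simp at this
    | succ d ih =>
      intro x p hd hp
      have hx : x ∈ ({a | T.tree.dist x a < T.tree.dist p a} : Finset ι) := by
        have h1 := T.isTree.dist_lt_or hp x
        simp only [mem_filter, mem_univ, true_and, SimpleGraph.dist_self] at h1 ⊢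
        omega
      have hb := T.card_bdry_below_le hE hp
      obtain hl | ⟨c₁, c₂, hN, h1, h2, h3, hx1⟩ := T.leaf_or_inner hp
      · rw [T.below_leaf hl hp] at hb ⊢
        obtain ⟨u, v, huv, he⟩ := T.exists_leafEdge_eq ⟨x, hl⟩
        have hmem : (T.leafEdge ⟨x, hl⟩ : Sym2 V) ∈ E0 := (hE _).2 (T.leafEdge _).2
        rw [he] at hb hmem ⊢
        exact .single huv hmem hb
      · have hadj : ∀ c ∈ ({p, c₁, c₂} : Set ι), T.tree.Adj x c := fun c hc => by
          rwa [← hN] at hc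
        have hsub : ∀ c ∈ ({p, c₁, c₂} : Set ι), c ≠ p →
            #{a | T.tree.dist c a < T.tree.dist x a} ≤ d := by
          intro c hc hcp
          have h4 : ({a | T.tree.dist c a < T.tree.dist x a} : Finset ι) ⊆
              ({a | T.tree.dist x a < T.tree.dist p a} : Finset ι).erase x := by
            intro a ha
            simp only [mem_filter, mem_univ, true_and, mem_erase] at ha ⊢
            refine ⟨by rintro rfl; simp at ha, ?_⟩
            have := T.isTree.dist_lt_or hp a
            by_contra hlt
            exact hcp (T.isTree.eq_of_adj_dist_lt (hadj c hc) hp ha (by omega))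
          have h5 := card_le_card h4
          rw [card_erase_of_mem hx] at h5
          omega
        obtain ⟨hu, hdj⟩ := T.below_inner hN h1 h2 h3 hx1
        rw [hu] at hb ⊢
        exact .union (ih c₁ x (hsub c₁ (by simp) h1) (hadj c₁ (by simp)).symm)
          (ih c₂ x (hsub c₂ (by simp) h2) (hadj c₂ (by simp)).symm) hdj hb
  exact key _ x p le_rfl hp

theorem bdry_self (E0 : Finset (Sym2 V)) : bdry E0 E0 = ∅ := by
  ext v; simp [mem_bdry]

theorem eq_singleton_of_no_adj (hE : ∀ e, e ∈ E0 ↔ e ∈ G.edgeSet)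
    (r : {a // (T.tree.neighborSet a).ncard ≤ 1})
    (h : ∀ x : ι, x = r) : E0 = {(T.leafEdge r : Sym2 V)} := by
  ext e
  rw [hE, mem_singleton]
  constructor
  · intro he
    obtain ⟨a, ha⟩ := T.leafEdge.surjective ⟨e, he⟩
    rw [← Subtype.ext (h a) , ha]
  · rintro rfl; exact (T.leafEdge r).2

theorem exists_leaf : ∃ a, (T.tree.neighborSet a).ncard ≤ 1 := by
  classical
  by_contra hcon
  push Not at hcon
  have h3 : ∀ a, 3 ≤ T.tree.degree a := fun a => by
    rw [← SimpleGraph.card_neighborSet_eq_degree, ← Nat.card_eq_fintype_card]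
    exact ((T.degree a).resolve_left (hcon a).not_ge).ge
  have h4 := T.tree.sum_degrees_eq_twice_card_edges
  have h5 := T.isTree.card_edgeFinset
  have h6 : Fintype.card ι * 3 ≤ ∑ a, T.tree.degree a := by
    rw [← smul_eq_mul, ← Finset.card_univ]
    exact Finset.card_nsmul_le_sum _ _ _ fun a _ => h3 a
  omega

/-- The number of nodes is at most three times the number of edges. -/
theorem card_le_three_mul (T : BranchDecomposition G ι) (hE : ∀ e, e ∈ E0 ↔ e ∈ G.edgeSet) : Fintype.card ι ≤ 3 * #E0 := by
  classical
  have hl : #{a | (T.tree.neighborSet a).ncard ≤ 1} = #E0 := by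
    rw [← Fintype.card_subtype, Fintype.card_congr T.leafEdge, ← Set.toFinset_card]
    congr 1
    ext e
    simp [hE]
  have h3 : ∀ a, 3 * (if (T.tree.neighborSet a).ncard ≤ 1 then 0 else 1) ≤ T.tree.degree a := by
    intro a
    split_ifs with h
    · simp
    · rw [← SimpleGraph.card_neighborSet_eq_degree, ← Nat.card_eq_fintype_card]
      exact ((T.degree a).resolve_left h).ge
  have h4 := T.tree.sum_degrees_eq_twice_card_edges
  have h5 := T.isTree.card_edgeFinset
  have h6 := Finset.sum_le_sum fun a (_ : a ∈ (univ : Finset ι)) => h3 a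
  rw [← Finset.mul_sum, h4] at h6
  have h7 : ∑ a : ι, (if (T.tree.neighborSet a).ncard ≤ 1 then 0 else 1) + #E0 =
      Fintype.card ι := by
    rw [← hl, Finset.card_filter, ← Finset.sum_add_distrib, ← Finset.card_univ,
      Finset.card_eq_sum_ones]
    exact Finset.sum_congr rfl fun a _ => by split_ifs <;> rfl
  omega

theorem built_univ (hE : ∀ e, e ∈ E0 ↔ e ∈ G.edgeSet) : Built E0 T.width E0 := by
  obtain ⟨r, hr⟩ := T.exists_leaf
  by_cases h : ∃ c, T.tree.Adj r c
  · obtain ⟨c, hc⟩ := h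
    have h1 := T.built_below hE hc
    have h2 := T.built_below hE hc.symm
    have h3 := T.below_union hE hc
    have := Built.union h1 h2 h3.2 (by rw [h3.1, bdry_self]; simp)
    rwa [h3.1] at this
  · have hone : ∀ x, x = r := by
      intro x
      by_contra hx
      obtain ⟨c, hc, _⟩ := T.isTree.exists_adj_dist_lt (Ne.symm hx)
      exact h ⟨c, hc⟩
    have h1 := T.eq_singleton_of_no_adj hE ⟨r, hr⟩ hone
    obtain ⟨u, v, huv, he⟩ := T.exists_leafEdge_eq ⟨r, hr⟩
    rw [he] at h1
    have := Built.single (E0 := E0) (w := T.width) huv (by rw [h1]; simp)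
      (by rw [← h1, bdry_self]; simp)
    rwa [← h1] at this

end BranchDecomposition

/-! ### Binary encodings of subsets -/

namespace MatchCount

open Finset

variable {V : Type*} [DecidableEq V]

/-- The set of those entries of `l` whose position is a one bit of `q`. -/
def sub (l : List V) (q : ℕ) : Finset V := {v ∈ l.toFinset | q.testBit (l.idxOf v)}

/-- The sum of those entries of `ws` whose position is a one bit of `q`. -/
def lsum : List ℤ → ℕ → ℤ
  | [], _ => 0
  | w :: ws, q => (if q.testBit 0 then w else 0) + lsum ws (q / 2)

theorem lsum_append_lt (w : ℤ) : ∀ (ws : List ℤ) (q : ℕ), q < 2 ^ ws.length →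
    lsum (ws ++ [w]) q = lsum ws q
  | [], q, h => by
    have : q = 0 := by simpa using h
    simp [lsum, this]
  | w' :: ws, q, h => by
    rw [List.cons_append, lsum, lsum, lsum_append_lt w ws]
    rw [List.length_cons, pow_succ] at h
    omega

theorem lsum_append_add (w : ℤ) : ∀ (ws : List ℤ) (q : ℕ), q < 2 ^ ws.length →
    lsum (ws ++ [w]) (2 ^ ws.length + q) = lsum ws q + w
  | [], q, h => by
    have : q = 0 := by simpa using h
    simp [lsum, this]
  | w' :: ws, q, h => by
    rw [List.length_cons, pow_succ] at h
    have h1 : (2 ^ (w' :: ws).length + q) / 2 = 2 ^ ws.length + q / 2 := by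
      rw [List.length_cons, pow_succ]; omega
    have h2 : (2 ^ (w' :: ws).length + q).testBit 0 = q.testBit 0 := by
      rw [List.length_cons, pow_succ, Nat.testBit_zero, Nat.testBit_zero]
      congr 2
      omega
    rw [List.cons_append, lsum, lsum, h1, h2, lsum_append_add w ws _ (by omega)]
    ring

theorem sub_subset (l : List V) (q : ℕ) : sub l q ⊆ l.toFinset := filter_subset _ _

theorem mem_sub {l : List V} {q : ℕ} {v : V} : v ∈ sub l q ↔ v ∈ l ∧ q.testBit (l.idxOf v) := by
  simp [sub]

@[simp] theorem sub_nil (q : ℕ) : sub ([] : List V) q = ∅ := by simp [sub]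

theorem sub_cons {v : V} {l : List V} (h : v ∉ l) (q : ℕ) :
    sub (v :: l) q = (if q.testBit 0 then {v} else ∅) ∪ sub l (q / 2) := by
  ext u
  rw [mem_union, mem_sub, mem_sub]
  by_cases hu : u = v
  · subst hu
    simp only [List.mem_cons, List.idxOf_cons_self, true_and, h, false_and, or_false]
    split_ifs with h1 <;> simp [h1]
  · rw [List.idxOf_cons_ne _ (Ne.symm hu), ← Nat.testBit_div_two]
    have : u ∉ (if q.testBit 0 then {v} else ∅ : Finset V) := by split_ifs <;> simp [hu]
    simp only [List.mem_cons, hu, false_or, this]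

theorem lsum_map {l : List V} (hl : l.Nodup) (f : V → ℤ) :
    ∀ q, lsum (l.map f) q = ∑ v ∈ sub l q, f v := by
  induction l with
  | nil => simp [lsum]
  | cons v l ih =>
    intro q
    rw [List.nodup_cons] at hl
    rw [List.map_cons, lsum, ih hl.2, sub_cons hl.1, sum_union]
    · congr 1
      split_ifs <;> simp
    · split_ifs
      · rw [disjoint_singleton_left, mem_sub]
        exact fun h => hl.1 h.1
      · simp

theorem sum_pow_sub {l : List V} (hl : l.Nodup) :
    ∀ q < 2 ^ l.length, ∑ v ∈ sub l q, (2 : ℤ) ^ l.idxOf v = q := by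
  induction l with
  | nil => intro q hq; simp at hq; simp [hq]
  | cons v l ih =>
    intro q hq
    rw [List.nodup_cons] at hl
    rw [List.length_cons, pow_succ] at hq
    rw [sub_cons hl.1, sum_union]
    · have h1 : ∑ x ∈ sub l (q / 2), (2 : ℤ) ^ (v :: l).idxOf x =
          2 * ∑ x ∈ sub l (q / 2), (2 : ℤ) ^ l.idxOf x := by
        rw [mul_sum]
        refine sum_congr rfl fun x hx => ?_
        rw [List.idxOf_cons_ne _ (by rintro rfl; exact hl.1 (mem_sub.1 hx).1), pow_succ, mul_comm]
      rw [h1, ih hl.2 _ (by omega), Nat.testBit_zero]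
      split_ifs with h <;> simp at h ⊢ <;> omega
    · split_ifs
      · rw [disjoint_singleton_left, mem_sub]
        exact fun h => hl.1 h.1
      · simp

theorem exists_sub_eq {l : List V} (hl : l.Nodup) :
    ∀ S ⊆ l.toFinset, ∃ q < 2 ^ l.length, sub l q = S := by
  induction l with
  | nil => intro S hS; exact ⟨0, by simp, by simpa using (subset_empty.1 hS).symm⟩
  | cons v l ih =>
    intro S hS
    rw [List.nodup_cons] at hl
    obtain ⟨q, hq, h⟩ := ih hl.2 (S.erase v) (by
      rw [List.toFinset_cons] at hS
      exact subset_insert_iff.1 hS)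
    rw [List.length_cons, pow_succ]
    by_cases hv : v ∈ S
    · refine ⟨2 * q + 1, by omega, ?_⟩
      rw [sub_cons hl.1, show (2 * q + 1) / 2 = q by omega, h]
      simp [insert_erase hv]
    · refine ⟨2 * q, by omega, ?_⟩
      rw [sub_cons hl.1, show (2 * q) / 2 = q by omega, h]
      simp [erase_eq_of_notMem hv]

theorem sub_injOn {l : List V} (hl : l.Nodup) : Set.InjOn (sub l) {q | q < 2 ^ l.length} := by
  intro q hq q' hq' h
  have := sum_pow_sub hl q hq
  rw [h, sum_pow_sub hl q' hq'] at this
  exact_mod_cast this.symm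

/-- Sums over binary codes are sums over subsets. -/
theorem sum_range_sub {l : List V} (hl : l.Nodup) (f : Finset V → ℤ) :
    ∑ q ∈ range (2 ^ l.length), f (sub l q) = ∑ S ∈ l.toFinset.powerset, f S := by
  refine sum_nbij (sub l) (fun q _ => mem_powerset.2 (sub_subset l q))
    ((sub_injOn hl).mono fun q hq => by simpa using hq) ?_ fun _ _ => rfl
  intro S hS
  obtain ⟨q, hq, h⟩ := exists_sub_eq hl S (mem_powerset.1 (mem_coe.1 hS))
  exact ⟨q, by simpa using hq, h⟩

theorem sub_append {l1 l2 : List V} (hl : (l1 ++ l2).Nodup) {x y : ℕ} (hy : y < 2 ^ l1.length) :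
    sub (l1 ++ l2) (2 ^ l1.length * x + y) = sub l1 y ∪ sub l2 x := by
  ext v
  rw [mem_union, mem_sub, mem_sub, mem_sub, Nat.testBit_two_pow_mul_add _ hy, List.idxOf_append,
    List.mem_append]
  by_cases h1 : v ∈ l1
  · have h2 : v ∉ l2 := fun h2 => (List.disjoint_of_nodup_append hl) h1 h2
    simp [h1, h2, List.idxOf_lt_length_of_mem h1]
  · simp [h1]

theorem getElem_mem_sub {l : List V} (hl : l.Nodup) {b : ℕ} (hb : b < l.length) (q : ℕ) :
    l[b] ∈ sub l q ↔ q.testBit b := by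
  rw [mem_sub, hl.idxOf_getElem b hb]
  simp

theorem sub_clear {l : List V} (hl : l.Nodup) {b h r : ℕ} (hb : b < l.length)
    (hr : r < 2 ^ b) :
    l[b] ∈ sub l (2 ^ b * (2 * h + 1) + r) ∧ l[b] ∉ sub l (2 ^ b * (2 * h) + r) ∧
      sub l (2 ^ b * (2 * h) + r) = (sub l (2 ^ b * (2 * h + 1) + r)).erase l[b] := by
  have h1 : l[b] ∈ sub l (2 ^ b * (2 * h + 1) + r) := by
    rw [getElem_mem_sub hl hb, Nat.testBit_two_pow_mul_add _ hr]; simp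
  have h2 : l[b] ∉ sub l (2 ^ b * (2 * h) + r) := by
    rw [getElem_mem_sub hl hb, Nat.testBit_two_pow_mul_add _ hr]; simp
  refine ⟨h1, h2, ?_⟩
  ext v
  rw [mem_erase]
  by_cases hv : v = l[b]
  · simp [hv, h2]
  · simp only [ne_eq, hv, not_false_eq_true, true_and]
    rw [mem_sub, mem_sub, Nat.testBit_two_pow_mul_add _ hr, Nat.testBit_two_pow_mul_add _ hr]
    refine and_congr_right fun hvl => ?_
    split_ifs with hlt
    · rfl
    · have : l.idxOf v ≠ b := fun h => hv (by subst h; exact (List.getElem_idxOf _).symm)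
      obtain ⟨j, hj⟩ : ∃ j, l.idxOf v - b = j + 1 := ⟨l.idxOf v - b - 1, by omega⟩
      rw [hj, Nat.testBit_succ, Nat.testBit_succ, show (2 * h + 1) / 2 = 2 * h / 2 by omega]

/-! ### Subset convolution -/

/-- The (possibly signed) zeta transform in the elements of `P`. -/
def zp (σ : ℤ) (P : Finset V) (g : Finset V → ℤ) (A : Finset V) : ℤ :=
  ∑ U ∈ (A ∩ P).powerset, σ ^ #U * g (A \ U)

theorem zp_empty (σ : ℤ) (g : Finset V → ℤ) (A : Finset V) : zp σ ∅ g A = g A := by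
  simp [zp]

theorem zp_insert (σ : ℤ) {P : Finset V} {v : V} (hv : v ∉ P) (g : Finset V → ℤ) (A : Finset V) :
    zp σ (insert v P) g A = zp σ P g A + if v ∈ A then σ * zp σ P g (A.erase v) else 0 := by
  unfold zp
  split_ifs with h
  · rw [inter_insert_of_mem h, sum_powerset_insert (by simp [hv])]
    congr 1
    rw [mul_sum]
    have : A.erase v ∩ P = A ∩ P := by
      ext u; simp only [mem_inter, mem_erase]
      constructor
      · tauto
      · rintro ⟨h1, h2⟩; exact ⟨⟨by rintro rfl; exact hv h2, h1⟩, h2⟩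
    rw [this]
    refine sum_congr rfl fun U hU => ?_
    have hvU : v ∉ U := fun h' => hv (mem_inter.1 (mem_powerset.1 hU h')).2
    rw [card_insert_of_notMem hvU, pow_succ, sdiff_insert, ← erase_sdiff_comm]
    ring
  · rw [inter_insert_of_notMem h, add_zero]

theorem abs_zp_le {σ : ℤ} (hσ : |σ| ≤ 1) (P : Finset V) {g : Finset V → ℤ} {β : ℤ}
    (hg : ∀ B, |g B| ≤ β) (A : Finset V) : |zp σ P g A| ≤ 2 ^ #P * β := by
  have hβ : 0 ≤ β := (abs_nonneg _).trans (hg A)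
  refine (abs_sum_le_sum_abs _ _).trans ?_
  refine (sum_le_card_nsmul _ _ β fun U _ => ?_).trans ?_
  · rw [abs_mul, abs_pow]
    calc |σ| ^ #U * |g (A \ U)| ≤ 1 * β :=
          mul_le_mul (pow_le_one₀ (abs_nonneg _) hσ) (hg _) (abs_nonneg _) zero_le_one
      _ = β := one_mul _
  · rw [card_powerset, nsmul_eq_mul]
    push_cast
    have : (2 : ℤ) ^ #(A ∩ P) ≤ 2 ^ #P :=
      pow_le_pow_right₀ (by norm_num) (card_le_card inter_subset_right)
    nlinarith

theorem zp_one {P A : Finset V} (h : A ⊆ P) (g : Finset V → ℤ) :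
    zp 1 P g A = ∑ B ∈ A.powerset, g B := by
  unfold zp
  rw [inter_eq_left.2 h]
  refine sum_nbij' (fun U => A \ U) (fun U => A \ U) ?_ ?_ ?_ ?_ ?_
  · intro U _; simp
  · intro U _; simp
  · intro U hU; exact Finset.sdiff_sdiff_eq_self (mem_powerset.1 hU)
  · intro U hU; exact Finset.sdiff_sdiff_eq_self (mem_powerset.1 hU)
  · intro U _; simp

/-- Ranked subset convolution. -/
theorem ranked_conv {P a : Finset V} (ha : a ⊆ P) (f g : Finset V → ℤ) :
    zp (-1) P (fun B => ∑ i ∈ range (#a + 1), zp 1 P (fun A => if #A = i then f A else 0) B *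
        zp 1 P (fun A => if #A = #a - i then g A else 0) B) a =
      ∑ A ∈ a.powerset, f A * g (a \ A) := by
  have h1 : ∀ U ∈ a.powerset, (∑ i ∈ range (#a + 1),
      zp 1 P (fun A => if #A = i then f A else 0) (a \ U) *
        zp 1 P (fun A => if #A = #a - i then g A else 0) (a \ U)) =
      ∑ A ∈ a.powerset, ∑ B ∈ a.powerset,
        if Disjoint U (A ∪ B) ∧ #A + #B = #a then f A * g B else 0 := by
    intro U hU
    have hUa : a \ U ⊆ a := sdiff_subset
    have h2 : ∀ h : Finset V → ℤ, ∑ A ∈ (a \ U).powerset, h A =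
        ∑ A ∈ a.powerset, if Disjoint U A then h A else 0 := by
      intro h
      rw [← sum_filter]
      refine sum_congr ?_ fun _ _ => rfl
      ext A
      simp only [mem_powerset, mem_filter, subset_sdiff]
      rw [disjoint_comm]
    simp only [zp_one (hUa.trans ha), h2, sum_mul_sum]
    rw [sum_comm]
    refine sum_congr rfl fun A hA => ?_
    rw [sum_comm]
    refine sum_congr rfl fun B hB => ?_
    have hAa := card_le_card (mem_powerset.1 hA)
    rw [sum_eq_single (#A)]
    · simp only [if_true, disjoint_union_right]
      by_cases c1 : Disjoint U A <;> by_cases c2 : Disjoint U B <;> simp only [c1, c2, if_true,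
        if_false, true_and, false_and, and_false, zero_mul, mul_zero]
      by_cases c3 : #A + #B = #a
      · rw [if_pos c3, if_pos (by omega)]
      · rw [if_neg c3, if_neg (by omega), mul_zero]
    · intro i _ hi
      simp [hi.symm]
    · intro h; simp at h; omega
  rw [zp, inter_eq_left.2 ha, sum_congr rfl fun U hU => by rw [h1 U hU, mul_sum]]
  simp only [mul_sum]
  rw [sum_comm]
  refine sum_congr rfl fun A hA => ?_
  rw [mem_powerset] at hA
  rw [sum_comm, sum_eq_single (a \ A)]
  · rw [union_sdiff_of_subset hA, sum_eq_single ∅]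
    · have := card_sdiff_add_card_eq_card hA
      simp; intro h; omega
    · intro U hU hne
      rw [if_neg, mul_zero]
      rintro ⟨h, _⟩
      exact hne (disjoint_self_iff_empty U |>.1 (h.mono_right (mem_powerset.1 hU)))
    · simp
  · intro B hB hne
    rw [mem_powerset] at hB
    by_cases hc : #A + #B = #a
    · have h3 : a \ (A ∪ B) ≠ ∅ := by
        intro h
        rw [sdiff_eq_empty_iff_subset] at h
        have h4 : A ∪ B = a := (union_subset hA hB).antisymm h
        have h5 : Disjoint A B := by
          rw [← card_union_eq_card_add_card, h4, hc]
        refine hne ?_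
        rw [← h4, union_sdiff_cancel_left h5]
      have h6 := sum_powerset_neg_one_pow_card (α := V) (x := a \ (A ∪ B))
      rw [if_neg h3] at h6
      simp only [hc, and_true, mul_ite, mul_zero]
      rw [← sum_filter, ← sum_mul]
      have h7 : {U ∈ a.powerset | Disjoint U (A ∪ B)} = (a \ (A ∪ B)).powerset := by
        ext U
        simp only [mem_filter, mem_powerset, subset_sdiff]
      rw [h7, h6, zero_mul]
    · simp [hc]
  · simp

end MatchCount

/-! ### The program: tables -/

namespace RAM

open Finset MatchCount

/-- The variables of the program. -/
inductive Var where
  | n | N | x | d | u | v | root | touched | idx | cnt | p | y | j | i | k | b | sz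
  | ja | jb | jc | la | lb | pa | pb | ta | tb | pw | w | c | ni | nl | nf | nr | tot
  | si | sl | sf | sr | sa | sb | so | top | ltop | st | hc | h | l
  | bf | bg | bh | mn | pp | nx | ny | nz | bu | bv | bw | t | res
  deriving DecidableEq

/-- The arrays of the program. -/
inductive Arr where
  | deg | nb | eu | ev | vd | ord | par | fk | LV | LC | LN | LB | TB | TAB | POS | PCN
  | WIA | WIB | VI | CI | ONE | ZERO | WFA | WFB | WLA | VL | CL | WRB | VR | CR
  | OA | RA | OB | RB | RO | FH | GH | HH
  deriving DecidableEq

/-- The states of the program. -/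
abbrev Store := St Var Arr

/-- The commands of the program. -/
abbrev Code := Cmd Var Arr

/-- The expressions of the program. -/
abbrev Term := Ex Var Arr

infixr:60 " ;; " => Cmd.seq

open Ex (half)

/-- The value of a variable. -/
abbrev vr (x : Var) : Term := .var x

/-- An array element. -/
abbrev rd (a : Arr) (i : Term) : Term := Ex.rd a i

/-- Extend a table of subset sums by `len` further summands. -/
def extend (O W : Arr) (len : Var) : Code :=
  .loop .b (vr len)
    (.loop .j (vr .sz)
      (.put O (vr .sz + vr .j) (rd O (vr .j) + rd W (vr .b))) ;;
    .set .sz (vr .sz + vr .sz))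

/-- The table of the subset sums of three lists of summands. -/
def build (O : Arr) (e : Term) (W1 : Arr) (l1 : Var) (W2 : Arr) (l2 : Var) (W3 : Arr)
    (l3 : Var) : Code :=
  .put O 0 e ;; .set .sz 1 ;; extend O W1 l1 ;; extend O W2 l2 ;; extend O W3 l3

/-- Set `x` to `2 ^ e`. -/
def pow2 (x : Var) (e : Term) : Code :=
  .set x 1 ;; .loop .b e (.set x (vr x + vr x))

/-- Set the first `e` entries of an array to `0`. -/
def zero (H : Arr) (e : Term) : Code := .loop .i e (.put H (vr .i) 0)

/-- Distribute the table at `t` over the ranks. -/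
def fill (H O R : Arr) (sv t : Var) : Code :=
  zero H ((vr .ni + 1) * vr sv) ;;
  .loop .i (vr sv) (.put H (rd R (vr .i) * vr sv + vr .i) (rd .TAB (vr t + rd O (vr .i))))

/-- One pass of a zeta or Möbius transform. -/
def pass (H : Arr) (σ : ℤ) : Code :=
  .loop .h (vr .hc)
    (.loop .l (vr .st)
      (.put H ((2 * vr .h + 1) * vr .st + vr .l)
        (rd H ((2 * vr .h + 1) * vr .st + vr .l) + .const σ * rd H (2 * vr .h * vr .st + vr .l))))

/-- The zeta transform (`σ = 1`) or the Möbius transform (`σ = -1`) of all ranks and for all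
positions in blocks of size `e`. -/
def zeta (H : Arr) (σ : ℤ) (e : Term) : Code :=
  .set .st e ;; .set .hc ((vr .ni + 1) * vr .si) ;;
  .loop .b (vr .ni)
    (.set .hc (half (vr .hc)) ;; pass H σ ;; .set .st (vr .st + vr .st))

variable {M : ℤ} {mm : ℕ → ℕ} {s : Store}

theorem _root_.MatchCount.lsum_append_left (ws ws' : List ℤ) (q : ℕ) (hq : q < 2 ^ ws.length) :
    lsum (ws ++ ws') q = lsum ws q := by
  induction ws' using List.reverseRecOn with
  | nil => simp
  | append_singleton l w ih =>
    rw [← List.append_assoc, lsum_append_lt, ih]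
    refine hq.trans_le (Nat.pow_le_pow_right (by norm_num) ?_)
    simp

theorem run_extend {O W : Arr} {len : Var} (hWO : W ≠ O) {base : ℤ}
    {ws ws' : List ℤ} (hsz : s.v .sz = (2 ^ ws.length : ℕ)) (hl : s.v len = ws'.length)
    (hO : ∀ q : ℕ, q < 2 ^ ws.length → s.m O q = base + lsum ws q)
    (hW : ∀ (b : ℕ) (h : b < ws'.length), s.m W b = ws'[b])
    (hM : ((2 ^ (ws ++ ws').length : ℕ) : ℤ) ≤ M)
    (hb : ∀ q : ℕ, q < 2 ^ (ws ++ ws').length → |base + lsum (ws ++ ws') q| ≤ M) :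
    Run M mm (extend O W len) s (ws'.length * (2 * 2 ^ (ws ++ ws').length + 3) + 1) fun s' =>
      s'.v .sz = (2 ^ (ws ++ ws').length : ℕ) ∧
        ∀ q : ℕ, q < 2 ^ (ws ++ ws').length → s'.m O q = base + lsum (ws ++ ws') q := by
  have hlen : ∀ b ≤ ws'.length, (ws ++ ws'.take b).length = ws.length + b := fun b hb => by
    simp [hb]
  have hpow : ∀ b ≤ ws'.length, (2 : ℕ) ^ (ws ++ ws'.take b).length ≤ 2 ^ (ws ++ ws').length :=
    fun b hb => Nat.pow_le_pow_right (by norm_num) (by rw [hlen b hb, List.length_append]; omega)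
  refine Run.loop' ws'.length (fun b s' => s'.v .sz = (2 ^ (ws ++ ws'.take b).length : ℕ) ∧
    ∀ q : ℕ, q < 2 ^ (ws ++ ws'.take b).length → s'.m O q = base + lsum (ws ++ ws'.take b) q)
    hl ?_ (by simpa using ⟨hsz, hO⟩) ?_ le_rfl (fun s' h _ => by simpa using h)
  · have : ws'.length < 2 ^ (ws ++ ws').length := by
      refine Nat.lt_two_pow_self.trans_le (Nat.pow_le_pow_right (by norm_num) (by simp))
    omega
  intro b hb' s₁ ⟨hsz1, hO1⟩ hf
  obtain ⟨S, hS⟩ : ∃ S : ℕ, 2 ^ (ws ++ ws'.take b).length = S := ⟨_, rfl⟩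
  rw [hS] at hsz1 hO1
  have htake : ws ++ ws'.take (b + 1) = (ws ++ ws'.take b) ++ [ws'[b]] := by
    rw [List.append_assoc, List.take_append_getElem]
  have hS2 : 2 ^ (ws ++ ws'.take (b + 1)).length = S + S := by
    rw [htake, List.length_append (bs := [_]), List.length_singleton, pow_succ, hS]; omega
  have hSle := hpow (b + 1) hb'
  rw [hS2] at hSle
  have hlo : ∀ q < S, lsum (ws ++ ws'.take (b + 1)) q = lsum (ws ++ ws'.take b) q := fun q hq => by
    rw [htake, lsum_append_lt _ _ _ (hS.symm ▸ hq)]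
  have hhi : ∀ q < S, lsum (ws ++ ws'.take (b + 1)) (S + q) =
      lsum (ws ++ ws'.take b) q + ws'[b] := fun q hq => by
    rw [htake, ← hS, lsum_append_add _ _ _ (hS.symm ▸ hq)]
  have hbd : ∀ q < S, |base + lsum (ws ++ ws'.take b) q + ws'[b]| ≤ M := by
    intro q hq
    have h1 := hb (S + q) (by omega)
    have h2 : lsum (ws ++ ws') (S + q) = lsum (ws ++ ws'.take (b + 1)) (S + q) := by
      conv_lhs => rw [← List.take_append_drop (b + 1) ws', ← List.append_assoc]
      rw [lsum_append_left]
      omega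
    rwa [h2, hhi q hq, ← add_assoc] at h1
  have hWb : s₁.m W b = ws'[b] := by
    rw [hf.2 W (by simpa [Cmd.wa] using hWO), hW b hb']
  refine Run.seq' (t1 := S * 2 + 1) (t2 := 1)
    (R := fun s' => (∀ q : ℕ, q < S → s'.m O q = base + lsum (ws ++ ws'.take b) q) ∧
      ∀ q : ℕ, q < S → s'.m O ((S + q : ℕ) : ℤ) = base + lsum (ws ++ ws'.take b) q + ws'[b])
    ?_ ?_ (by omega)
  · refine Run.loop' S (fun j s' => (∀ q : ℕ, q < S → s'.m O q = base + lsum (ws ++ ws'.take b) q) ∧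
      ∀ q : ℕ, q < j → s'.m O ((S + q : ℕ) : ℤ) = base + lsum (ws ++ ws'.take b) q + ws'[b])
      (t := 1) (by simpa using hsz1) (by omega) ⟨by simpa using hO1, by simp⟩ ?_ le_rfl
      (fun s' h _ => h)
    intro j hj s₂ ⟨h1, h2⟩ hf2
    have hb₂ : s₂.v .b = b := by rw [hf2.1 _ (by simp [Cmd.wv])]; simp
    have hsz2 : s₂.v .sz = S := by rw [hf2.1 _ (by simp [Cmd.wv])]; simpa using hsz1
    have hW2 : s₂.m W = s₁.m W := by rw [hf2.2 _ (by simpa [Cmd.wa] using hWO)]; simp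
    have he : (rd O (vr .j) + rd W (vr .b)).eval (s₂.setV .j j) =
        base + lsum (ws ++ ws'.take b) j + ws'[b] := by
      simp [hb₂, hW2, hWb, h1 j hj]
    have hi : (vr .sz + vr .j : Term).eval (s₂.setV .j j) = ((S + j : ℕ) : ℤ) := by
      simp [hsz2]
    refine Run.put (by rw [he]; exact hbd j hj) ?_
    rw [he, hi]
    constructor
    · intro q hq
      rw [St.setM_m_self, if_neg (by omega)]
      exact h1 q hq
    · intro q hq
      rw [St.setM_m_self]
      split_ifs with h
      · have : q = j := by omega
        rw [this]
      · exact h2 q (by omega)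
  · intro s₂ ⟨h1, h2⟩ hf2
    have hsz2 : s₂.v .sz = S := by rw [hf2.1 _ (by simp [Cmd.wv])]; simpa using hsz1
    have he : (vr .sz + vr .sz : Term).eval s₂ = ((S + S : ℕ) : ℤ) := by simp [hsz2]
    refine Run.set (by rw [he, abs_of_nonneg (by positivity)]; omega) ?_
    rw [he, hS2]
    refine ⟨by simp, fun q hq => ?_⟩
    rw [St.setV_m]
    by_cases hqS : q < S
    · rw [h1 q hqS, hlo q hqS]
    · obtain ⟨r, rfl⟩ := Nat.exists_eq_add_of_le (not_lt.1 hqS)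
      rw [h2 r (by omega), hhi r (by omega), add_assoc]

theorem run_build {O W1 W2 W3 : Arr} {l1 l2 l3 : Var} {e : Term}
    {w₁ w₂ w₃ : List ℤ} (hO : O ∉ [W1, W2, W3]) (hv : ∀ l ∈ [l1, l2, l3], l ∉ [Var.b, .j, .sz])
    (h₁ : s.v l1 = w₁.length) (h₂ : s.v l2 = w₂.length) (h₃ : s.v l3 = w₃.length)
    (hW1 : ∀ (b : ℕ) (h : b < w₁.length), s.m W1 b = w₁[b])
    (hW2 : ∀ (b : ℕ) (h : b < w₂.length), s.m W2 b = w₂[b])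
    (hW3 : ∀ (b : ℕ) (h : b < w₃.length), s.m W3 b = w₃[b])
    (hM : ((2 ^ (w₁ ++ w₂ ++ w₃).length : ℕ) : ℤ) ≤ M)
    (hb : ∀ q : ℕ, q < 2 ^ (w₁ ++ w₂ ++ w₃).length → |e.eval s + lsum (w₁ ++ w₂ ++ w₃) q| ≤ M) :
    Run M mm (build O e W1 l1 W2 l2 W3 l3) s
      ((w₁ ++ w₂ ++ w₃).length * (2 * 2 ^ (w₁ ++ w₂ ++ w₃).length + 3) + 5) fun s' =>
      s'.v .sz = (2 ^ (w₁ ++ w₂ ++ w₃).length : ℕ) ∧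
        ∀ q : ℕ, q < 2 ^ (w₁ ++ w₂ ++ w₃).length →
          s'.m O q = e.eval s + lsum (w₁ ++ w₂ ++ w₃) q := by
  simp [not_or, forall_eq_or_imp, forall_eq] at hO hv
  obtain ⟨⟨b1, j1, z1⟩, ⟨b2, j2, z2⟩, ⟨b3, j3, z3⟩⟩ := hv
  set L := (w₁ ++ w₂ ++ w₃).length with hL
  have hp1 : (2 : ℕ) ^ w₁.length ≤ 2 ^ L := Nat.pow_le_pow_right (by norm_num) (by simp [hL])
  have hp2 : (2 : ℕ) ^ (w₁ ++ w₂).length ≤ 2 ^ L :=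
    Nat.pow_le_pow_right (by norm_num) (by simp [hL])
  have hp0 : 0 < 2 ^ L := by positivity
  have hb0 := hb 0 hp0
  have hb1 : ∀ q : ℕ, q < 2 ^ w₁.length → |e.eval s + lsum w₁ q| ≤ M := fun q hq => by
    have := hb q (by omega)
    rwa [List.append_assoc, lsum_append_left _ _ _ hq] at this
  have hb2 : ∀ q : ℕ, q < 2 ^ (w₁ ++ w₂).length → |e.eval s + lsum (w₁ ++ w₂) q| ≤ M :=
    fun q hq => by
    have := hb q (by omega)
    rwa [lsum_append_left _ _ _ hq] at this
  have h0 : ∀ ws : List ℤ, lsum ws 0 = 0 := fun ws => by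
    induction ws with
    | nil => rfl
    | cons w ws ih => simp [lsum, ih]
  have hc : L * (2 * 2 ^ L + 3) + 5 = ((w₁.length * (2 * 2 ^ L + 3) + 1) +
      ((w₂.length * (2 * 2 ^ L + 3) + 1) + (w₃.length * (2 * 2 ^ L + 3) + 1)) + 1) + 1 := by
    rw [hL, List.length_append, List.length_append]; ring
  rw [hc]
  refine Run.put_seq (by simpa [h0] using hb0) (Run.set_seq (by simp; omega) ?_)
  set s0 := (s.setM O (Ex.eval s 0) (e.eval s)).setV .sz (Ex.eval (s.setM O (Ex.eval s 0) (e.eval s)) 1)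
    with hs₀
  refine Run.seq' (Run.imp (run_extend (O := O) (W := W1) (len := l1) (ws := []) (ws' := w₁)
    (base := e.eval s) (Ne.symm hO.1) ?_ ?_ ?_ ?_ ?_ ?_) ?_ fun s' h _ => h) ?_ le_rfl
  · simp [hs₀]
  · simp [hs₀, z1, h₁]
  · intro q hq
    have : q = 0 := by simpa using hq
    subst this
    simp [hs₀, lsum, St.setM_m_self]
  · intro b h
    simp [hs₀, Ne.symm hO.1, hW1 b h]
  · refine le_trans ?_ hM
    exact_mod_cast hp1
  · simpa using hb1
  · simp only [List.nil_append]
    gcongr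
  intro s₁ hs1 hf1
  simp only [List.nil_append] at hs1
  refine Run.seq' (Run.imp (run_extend (O := O) (W := W2) (len := l2) (ws := w₁) (ws' := w₂)
    (base := e.eval s) (Ne.symm hO.2.1) hs1.1 ?_ hs1.2 ?_ ?_ hb2) ?_ fun s' h _ => h) ?_ le_rfl
  · rw [hf1.1 _ (by simp [extend, Cmd.wv, b2, j2, z2])]
    simp [hs₀, z2, h₂]
  · intro b h
    rw [hf1.2 _ (by simp [extend, Cmd.wa, Ne.symm hO.2.1])]
    simp [hs₀, Ne.symm hO.2.1, hW2 b h]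
  · refine le_trans ?_ hM
    exact_mod_cast hp2
  · gcongr
  intro s₂ hs2 hf2
  refine Run.imp (run_extend (O := O) (W := W3) (len := l3) (ws := w₁ ++ w₂) (ws' := w₃)
    (base := e.eval s) (Ne.symm hO.2.2) hs2.1 ?_ hs2.2 ?_ hM hb) le_rfl fun s' h _ => h
  · rw [hf2.1 _ (by simp [extend, Cmd.wv, b3, j3, z3]),
      hf1.1 _ (by simp [extend, Cmd.wv, b3, j3, z3])]
    simp [hs₀, z3, h₃]
  · intro b h
    rw [hf2.2 _ (by simp [extend, Cmd.wa, Ne.symm hO.2.2]),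
      hf1.2 _ (by simp [extend, Cmd.wa, Ne.symm hO.2.2])]
    simp [hs₀, Ne.symm hO.2.2, hW3 b h]

theorem run_pow2 {x : Var} {e : Term} {k : ℕ} (hx : x ≠ .b)
    (he : ∀ z, e.eval (s.setV x z) = k) (hM : ((2 ^ k : ℕ) : ℤ) ≤ M) :
    Run M mm (pow2 x e) s (2 * k + 2) fun s' => s'.v x = (2 ^ k : ℕ) := by
  have hk : k < 2 ^ k := Nat.lt_two_pow_self
  refine Run.set_seq (t := 2 * k + 1) (by simp; omega) ?_
  refine Run.loop' k (fun b s' => s'.v x = (2 ^ b : ℕ)) (t := 1) (he _) (by omega) (by simp) ?_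
    (by omega) fun _ h _ => h
  intro b hb s' h _
  have h2 : (2 : ℕ) ^ (b + 1) ≤ 2 ^ k := Nat.pow_le_pow_right (by norm_num) hb
  have he : (vr x + vr x : Term).eval (s'.setV .b b) = (2 ^ (b + 1) : ℕ) := by
    simp only [Ex.eval_add, Ex.eval_var, St.setV_v_ne _ hx, h]; push_cast; ring
  refine Run.set ?_ (by simp [he])
  rw [he, abs_of_nonneg (by positivity)]
  omega

theorem run_zero {H : Arr} {e : Term} {k : ℕ}
    (he : e.eval s = k) (hM : (k : ℤ) ≤ M) :
    Run M mm (zero H e) s (2 * k + 1) fun s' => ∀ a : ℕ, a < k → s'.m H a = 0 := by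
  refine Run.loop' k (fun i s' => ∀ a : ℕ, a < i → s'.m H a = 0) (t := 1) he hM (by simp) ?_
    (by omega) fun _ h _ => h
  intro i hi s' h _
  refine Run.put (by simp; omega) fun a ha => ?_
  simp only [Ex.eval_var, St.setV_v_self, Ex.eval_zero, St.setM_m_self]
  split_ifs with hai
  · rfl
  · exact h a (by omega)

theorem _root_.Nat.mul_add_eq_mul_add_iff {S r r' q q' : ℕ} (hq : q < S) (hq' : q' < S) :
    r * S + q = r' * S + q' ↔ r = r' ∧ q = q' := by
  constructor
  · intro h
    have h1 : (r * S + q) / S = (r' * S + q') / S := by rw [h]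
    have hS : 0 < S := by omega
    rw [mul_comm r, mul_comm r', Nat.mul_add_div hS, Nat.mul_add_div hS, Nat.div_eq_of_lt hq,
      Nat.div_eq_of_lt hq', add_zero, add_zero] at h1
    subst h1
    exact ⟨rfl, by omega⟩
  · rintro ⟨rfl, rfl⟩; rfl

theorem run_fill {H O R : Arr} {sv t : Var} {S ni : ℕ} {ρ : ℕ → ℕ}
    (hH : H ∉ [O, R, .TAB]) (hsv : sv ≠ .i) (ht : t ≠ .i)
    (hS : s.v sv = S) (hni : s.v .ni = ni) (hSM : (((ni + 1) * S : ℕ) : ℤ) ≤ M)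
    (hR : ∀ q : ℕ, q < S → s.m R q = ρ q)
    (hT : ∀ a, |s.m .TAB a| ≤ M) :
    Run M mm (fill H O R sv t) s (4 * ((ni + 1) * S) + 2) fun s' =>
      ∀ r ≤ ni, ∀ q < S, s'.m H ((r * S + q : ℕ) : ℤ) =
        if ρ q = r then s.m .TAB (s.v t + s.m O q) else 0 := by
  simp [not_or] at hH
  have hSle : S ≤ (ni + 1) * S := Nat.le_mul_of_pos_left S (by omega)
  refine Run.seq' (t1 := 2 * ((ni + 1) * S) + 1) (t2 := 2 * S + 1)
    (run_zero (k := (ni + 1) * S) (by simp [hS, hni]) hSM) ?_ (by omega)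
  intro s₁ h₁ hf1
  have ev : ∀ x, x ≠ .i → s₁.v x = s.v x := fun x hx => hf1.1 _ (by simp [zero, Cmd.wv, hx])
  have em : ∀ a, a ≠ H → s₁.m a = s.m a := fun a ha => hf1.2 _ (by simp [zero, Cmd.wa, ha])
  refine Run.loop' S (fun i s' => ∀ r ≤ ni, ∀ q < S, s'.m H ((r * S + q : ℕ) : ℤ) =
        if q < i ∧ ρ q = r then s.m .TAB (s.v t + s.m O q) else 0) (t := 1)
    (by simp [ev _ hsv, hS]) (by omega) ?_ ?_ (by omega) ?_
  · intro r hr q hq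
    rw [h₁]
    · simp
    · calc r * S + q < r * S + S := by omega
        _ = (r + 1) * S := by ring
        _ ≤ (ni + 1) * S := Nat.mul_le_mul_right _ (by omega)
  · intro i hi s₂ h₂ hf2
    have ev2 : ∀ x, x ≠ .i → s₂.v x = s.v x := fun x hx => by
      rw [hf2.1 _ (by simp [Cmd.wv, hx]), ev x hx]
    have em2 : ∀ a, a ≠ H → s₂.m a = s.m a := fun a ha => by
      rw [hf2.2 _ (by simp [Cmd.wa, ha]), em a ha]
    have e1 : (rd R (vr .i) * vr sv + vr .i : Term).eval (s₂.setV .i i) =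
        ((ρ i * S + i : ℕ) : ℤ) := by
      simp [em2 _ (Ne.symm hH.2.1), hR i hi, hsv, ev2 _ hsv, hS]
    have e2 : (rd .TAB (vr t + rd O (vr .i)) : Term).eval (s₂.setV .i i) =
        s.m .TAB (s.v t + s.m O i) := by
      simp [em2 _ (Ne.symm hH.2.2), em2 _ (Ne.symm hH.1), ht, ev2 _ ht]
    refine Run.put (by rw [e2]; exact hT _) fun r hr q hq => ?_
    simp only [e1, e2, St.setM_m_self, Nat.cast_inj, Nat.mul_add_eq_mul_add_iff hq hi, St.setV_m,
      h₂ r hr q hq]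
    by_cases hqi : q = i
    · subst hqi
      simp only [and_true, lt_irrefl, false_and, if_false, Nat.lt_succ_self, true_and]
      split_ifs with h1 h2 h2 <;> first | rfl | omega
    · have : q < i + 1 ↔ q < i := by omega
      simp [hqi, this]
  · intro s' h _ r hr q hq
    rw [h r hr q hq]
    simp [hq]

theorem run_pass {H : Arr} {σ : ℤ} {HC ST : ℕ} {B : ℤ} (hσ : |σ| ≤ 1)
    (hhc : s.v .hc = HC) (hst : s.v .st = ST) (hM₁ : (HC : ℤ) ≤ M) (hM₂ : (ST : ℤ) ≤ M)
    (hB : ∀ c : ℕ, c < 2 * HC * ST → |s.m H c| ≤ B) (hBM : 2 * B ≤ M) :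
    Run M mm (pass H σ) s (HC * (2 * ST + 2) + 1) fun s' => ∀ h < HC, ∀ l < ST,
      s'.m H ((2 * h * ST + l : ℕ) : ℤ) = s.m H ((2 * h * ST + l : ℕ) : ℤ) ∧
      s'.m H (((2 * h + 1) * ST + l : ℕ) : ℤ) = s.m H (((2 * h + 1) * ST + l : ℕ) : ℤ) +
        σ * s.m H ((2 * h * ST + l : ℕ) : ℤ) := by
  have hlt : ∀ h < HC, ∀ l < ST, ∀ d ≤ 1, (2 * h + d) * ST + l < 2 * HC * ST := by
    intro h hh l hl d hd
    calc (2 * h + d) * ST + l < (2 * h + d) * ST + ST := by omega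
      _ = (2 * h + d + 1) * ST := by ring
      _ ≤ _ := Nat.mul_le_mul_right _ (by omega)
  refine Run.loop' HC (fun h' s' => ∀ h < HC, ∀ l < ST,
      s'.m H ((2 * h * ST + l : ℕ) : ℤ) = s.m H ((2 * h * ST + l : ℕ) : ℤ) ∧
      s'.m H (((2 * h + 1) * ST + l : ℕ) : ℤ) = s.m H (((2 * h + 1) * ST + l : ℕ) : ℤ) +
        if h < h' then σ * s.m H ((2 * h * ST + l : ℕ) : ℤ) else 0)
    (t := 2 * ST + 1) (by simpa using hhc) hM₁ (by simp) ?_ (by rw [add_assoc]) ?_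
  · intro h' hh' s₁ h₁ hf1
    have hst1 : s₁.v .st = ST := by rw [hf1.1 _ (by simp [Cmd.wv]), hst]
    refine Run.loop' ST (fun l' s' => ∀ h < HC, ∀ l < ST,
      s'.m H ((2 * h * ST + l : ℕ) : ℤ) = s.m H ((2 * h * ST + l : ℕ) : ℤ) ∧
      s'.m H (((2 * h + 1) * ST + l : ℕ) : ℤ) = s.m H (((2 * h + 1) * ST + l : ℕ) : ℤ) +
        if h < h' ∨ h = h' ∧ l < l' then σ * s.m H ((2 * h * ST + l : ℕ) : ℤ) else 0)
      (t := 1) (by simpa using hst1) hM₂ (by simpa using h₁) ?_ (by omega) ?_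
    · intro l' hl' s₂ h₂ hf2
      have hst2 : s₂.v .st = ST := by rw [hf2.1 _ (by simp [Cmd.wv])]; simpa using hst1
      have hh₂ : s₂.v .h = h' := by rw [hf2.1 _ (by simp [Cmd.wv])]; simp
      obtain ⟨g1, g2⟩ := h₂ h' hh' l' hl'
      have e1 : ((2 * vr .h + 1) * vr .st + vr .l : Term).eval (s₂.setV .l l') =
          (((2 * h' + 1) * ST + l' : ℕ) : ℤ) := by simp [hst2, hh₂]
      have e2 : (2 * vr .h * vr .st + vr .l : Term).eval (s₂.setV .l l') =
          ((2 * h' * ST + l' : ℕ) : ℤ) := by simp [hst2, hh₂]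
      have e3 : (rd H ((2 * vr .h + 1) * vr .st + vr .l) +
          .const σ * rd H (2 * vr .h * vr .st + vr .l) : Term).eval (s₂.setV .l l') =
          s.m H (((2 * h' + 1) * ST + l' : ℕ) : ℤ) + σ * s.m H ((2 * h' * ST + l' : ℕ) : ℤ) := by
        rw [Ex.eval_add, Ex.eval_mul, Ex.eval_rd, Ex.eval_rd, e1, e2, Ex.eval_const, St.setV_m, g1,
          g2]
        simp
      refine Run.put ?_ fun h hh l hl => ?_
      · rw [e3]
        have b1 := hB _ (hlt h' hh' l' hl' 1 le_rfl)
        have b2 := hB _ (hlt h' hh' l' hl' 0 (by norm_num))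
        rw [add_zero] at b2
        have b3 : |σ * s.m H ((2 * h' * ST + l' : ℕ) : ℤ)| ≤ B := by
          rw [abs_mul]
          calc _ ≤ 1 * |s.m H ((2 * h' * ST + l' : ℕ) : ℤ)| :=
                mul_le_mul_of_nonneg_right hσ (abs_nonneg _)
            _ ≤ B := by rwa [one_mul]
        refine (abs_add_le _ _).trans ?_
        omega
      · simp only [e1, e3, St.setM_m_self, Nat.cast_inj, Nat.mul_add_eq_mul_add_iff hl hl',
          St.setV_m]
        obtain ⟨f1, f2⟩ := h₂ h hh l hl
        refine ⟨by rw [if_neg (by omega), f1], ?_⟩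
        by_cases hc : h = h' ∧ l = l'
        · obtain ⟨rfl, rfl⟩ := hc
          simp
        · rw [if_neg (by omega), f2]
          congr 1
          refine if_congr ?_ rfl rfl
          omega
    · intro s₂ h₂ _ h hh l hl
      refine ⟨(h₂ h hh l hl).1, ?_⟩
      rw [(h₂ h hh l hl).2]
      congr 1
      refine if_congr ?_ rfl rfl
      omega
  · intro s' h₁ _ h hh l hl
    simpa [hh] using h₁ h hh l hl

variable {V : Type*} [DecidableEq V]

theorem run_zeta {H : Arr} {σ : ℤ} {e : Term} {l : List V} {Bk : ℕ}
    {β : ℤ} {g : ℕ → ℕ → Finset V → ℤ} (hσ : |σ| ≤ 1) (hl : l.Nodup) (he : e.eval s = Bk)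
    (hBk : 1 ≤ Bk) (hni : s.v .ni = l.length) (hsi : s.v .si = (2 ^ l.length : ℕ))
    (hM : (((l.length + 1) * 2 ^ l.length * Bk : ℕ) : ℤ) ≤ M) (hβ : 2 ^ l.length * β ≤ M)
    (hβ0 : 0 ≤ β)
    (hb : ∀ c : ℕ, c < (l.length + 1) * 2 ^ l.length * Bk → |s.m H c| ≤ β)
    (hg : ∀ r ≤ l.length, ∀ a < 2 ^ l.length, ∀ x < Bk,
      s.m H (((r * 2 ^ l.length + a) * Bk + x : ℕ) : ℤ) = g r x (sub l a)) :
    Run M mm (zeta H σ e) s (l.length * (2 * ((l.length + 1) * 2 ^ l.length * Bk) + 4) + 3)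
      fun s' => (∀ c : ℕ, c < (l.length + 1) * 2 ^ l.length * Bk →
        |s'.m H c| ≤ 2 ^ l.length * β) ∧
        ∀ r ≤ l.length, ∀ a < 2 ^ l.length, ∀ x < Bk,
          s'.m H (((r * 2 ^ l.length + a) * Bk + x : ℕ) : ℤ) =
            zp σ l.toFinset (g r x) (sub l a) := by
  set m := l.length with hm
  have hle : ∀ i ≤ (m + 1) * 2 ^ m * Bk, (i : ℤ) ≤ M := fun i hi => by
    refine le_trans ?_ hM
    exact_mod_cast hi
  have hle1 : (m + 1) * 2 ^ m ≤ (m + 1) * 2 ^ m * Bk := Nat.le_mul_of_pos_right _ hBk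
  have hle2 : m ≤ (m + 1) * 2 ^ m := by
    have : 1 ≤ 2 ^ m := Nat.one_le_two_pow
    nlinarith
  have hle3 : Bk ≤ (m + 1) * 2 ^ m * Bk := Nat.le_mul_of_pos_left _ (by positivity)
  have ec : ((vr .ni + 1) * vr .si : Term).eval (s.setV .st (e.eval s)) =
      (((m + 1) * 2 ^ m : ℕ) : ℤ) := by simp [hni, hsi, hm]
  refine Run.set_seq (t := m * (2 * ((m + 1) * 2 ^ m * Bk) + 4) + 2) ?_
    (Run.set_seq (t := m * (2 * ((m + 1) * 2 ^ m * Bk) + 4) + 1) ?_ ?_)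
  · rw [he, Nat.abs_cast]; exact hle _ hle3
  · rw [ec, Nat.abs_cast]; exact hle _ hle1
  rw [ec, he]
  refine Run.loop' m (fun b s' => s'.v .hc = (((m + 1) * 2 ^ (m - b) : ℕ) : ℤ) ∧
      s'.v .st = ((Bk * 2 ^ b : ℕ) : ℤ) ∧
      (∀ c : ℕ, c < (m + 1) * 2 ^ m * Bk → |s'.m H c| ≤ 2 ^ b * β) ∧
        ∀ r ≤ m, ∀ a < 2 ^ m, ∀ x < Bk,
          s'.m H (((r * 2 ^ m + a) * Bk + x : ℕ) : ℤ) =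
            zp σ (l.take b).toFinset (g r x) (sub l a))
    (t := 2 * ((m + 1) * 2 ^ m * Bk) + 3) (by simp [hni, hm]) (hle _ (by omega)) ?_ ?_ le_rfl ?_
  · refine ⟨by simp, by simp, by simpa using hb, fun r hr a ha x hx => ?_⟩
    simpa [zp_empty] using hg r hr a ha x hx
  · intro b hbm s₁ ⟨hhc, hst, hb₁, hg1⟩ hf1
    obtain ⟨d, hd⟩ : ∃ d, m = b + 1 + d := ⟨m - b - 1, by omega⟩
    have hmb : m - b = d + 1 := by omega
    have hT : (m + 1) * 2 ^ m * Bk = 2 * ((m + 1) * 2 ^ d) * (Bk * 2 ^ b) := by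
      have : (2 : ℕ) ^ m = 2 ^ b * 2 * 2 ^ d := by rw [hd, pow_add, pow_add, pow_one]
      rw [this]; ring
    have hBb : 1 ≤ Bk * 2 ^ b := Nat.mul_pos hBk (by positivity)
    have hHCT : 2 * ((m + 1) * 2 ^ d) ≤ (m + 1) * 2 ^ m * Bk := by
      rw [hT]; exact Nat.le_mul_of_pos_right _ hBb
    have hSTT : 2 * (Bk * 2 ^ b) ≤ (m + 1) * 2 ^ m * Bk := by
      rw [hT]
      have : 1 ≤ (m + 1) * 2 ^ d := Nat.mul_pos (by omega) (by positivity)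
      nlinarith
    have eh : (Ex.half (vr .hc) : Term).eval (s₁.setV .b b) =
        (((m + 1) * 2 ^ d : ℕ) : ℤ) := by
      have : (((m + 1) * 2 ^ (d + 1) : ℕ) : ℤ) = (((m + 1) * 2 ^ d : ℕ) : ℤ) * 2 := by
        push_cast; ring
      simp only [Ex.eval_half, Ex.eval_var, ne_eq, reduceCtorEq, not_false_eq_true, St.setV_v_ne,
        hhc, hmb, this]
      rw [Int.mul_ediv_cancel _ (by norm_num)]
    have hpb : (2 : ℤ) ^ (b + 1) * β ≤ 2 ^ m * β :=
      mul_le_mul_of_nonneg_right (pow_le_pow_right₀ (by norm_num) hbm) hβ0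
    have hB2 : (2 : ℤ) * (2 ^ b * β) = 2 ^ (b + 1) * β := by ring
    refine Run.set_seq (t := (m + 1) * 2 ^ d * (2 * (Bk * 2 ^ b) + 2) + 1 + 1) ?_ ?_ |>.imp ?_
      fun _ h _ => h
    · rw [eh, Nat.abs_cast]; exact hle _ (by omega)
    rotate_left
    · have h1 : (m + 1) * 2 ^ d * (2 * (Bk * 2 ^ b) + 2) =
        2 * ((m + 1) * 2 ^ d) * (Bk * 2 ^ b) + 2 * ((m + 1) * 2 ^ d) := by ring
      rw [h1, ← hT]
      omega
    rw [eh]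
    refine Run.seq' (run_pass (HC := (m + 1) * 2 ^ d) (ST := Bk * 2 ^ b) (B := 2 ^ b * β) hσ
      (by simp) (by simp [hst]) (hle _ (by omega)) (hle _ (by omega)) ?_ (by omega)) ?_ le_rfl
    · rw [← hT]; simpa using hb₁
    intro s₂ hs2 hf2
    have hst2 : s₂.v .st = ((Bk * 2 ^ b : ℕ) : ℤ) := by
      rw [hf2.1 _ (by simp [pass, Cmd.wv])]; simp [hst]
    have hhc2 : s₂.v .hc = (((m + 1) * 2 ^ d : ℕ) : ℤ) := by
      rw [hf2.1 _ (by simp [pass, Cmd.wv])]; simp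
    have es : (vr .st + vr .st : Term).eval s₂ = ((Bk * 2 ^ (b + 1) : ℕ) : ℤ) := by
      simp [hst2]; ring
    refine Run.set ?_ ⟨?_, ?_, ?_, ?_⟩
    · rw [es, Nat.abs_cast]; exact hle _ (by rw [pow_succ, ← mul_assoc, mul_comm]; exact hSTT)
    · rw [St.setV_v_ne _ (by simp), hhc2, show m - (b + 1) = d by omega]
    · rw [es]; simp
    · intro c hc
      rw [St.setV_m]
      rw [hT] at hc
      have hq : c / (Bk * 2 ^ b) < 2 * ((m + 1) * 2 ^ d) := (Nat.div_lt_iff_lt_mul hBb).2 hc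
      have hr : c % (Bk * 2 ^ b) < Bk * 2 ^ b := Nat.mod_lt _ hBb
      have hcd := Nat.div_add_mod c (Bk * 2 ^ b)
      have hb0 : 0 ≤ 2 ^ b * β := by positivity
      have hlt : ∀ h < (m + 1) * 2 ^ d, ∀ l < Bk * 2 ^ b, ∀ e ≤ 1,
          (2 * h + e) * (Bk * 2 ^ b) + l < (m + 1) * 2 ^ m * Bk := by
        intro h hh l hl e he
        rw [hT]
        calc (2 * h + e) * (Bk * 2 ^ b) + l < (2 * h + e) * (Bk * 2 ^ b) + Bk * 2 ^ b := by omega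
          _ = (2 * h + e + 1) * (Bk * 2 ^ b) := by ring
          _ ≤ _ := Nat.mul_le_mul_right _ (by omega)
      obtain ⟨h', hh'⟩ := Nat.even_or_odd' (c / (Bk * 2 ^ b))
      have hh'' : h' < (m + 1) * 2 ^ d := by omega
      have key := hs2 h' hh'' _ hr
      have k1 := hb₁ _ (hlt h' hh'' _ hr 0 (by norm_num))
      have k2 := hb₁ _ (hlt h' hh'' _ hr 1 le_rfl)
      rw [add_zero] at k1
      rw [← hB2]
      rcases hh' with hh' | hh'
      · have : c = 2 * h' * (Bk * 2 ^ b) + c % (Bk * 2 ^ b) := by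
          rw [← hh', mul_comm]; omega
        rw [this, key.1, St.setV_m, St.setV_m]
        omega
      · have : c = (2 * h' + 1) * (Bk * 2 ^ b) + c % (Bk * 2 ^ b) := by
          rw [← hh', mul_comm]; omega
        rw [this, key.2]
        simp only [St.setV_m]
        have b3 : |σ * s₁.m H ((2 * h' * (Bk * 2 ^ b) + c % (Bk * 2 ^ b) : ℕ) : ℤ)| ≤
            2 ^ b * β := by
          rw [abs_mul]
          calc _ ≤ 1 * |s₁.m H ((2 * h' * (Bk * 2 ^ b) + c % (Bk * 2 ^ b) : ℕ) : ℤ)| :=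
                mul_le_mul_of_nonneg_right hσ (abs_nonneg _)
            _ ≤ _ := by rwa [one_mul]
        refine (abs_add_le _ _).trans ?_
        linarith
    · intro r hr a ha x hx
      rw [St.setV_m]
      have hda := Nat.div_add_mod a (2 ^ b)
      have hra : a % 2 ^ b < 2 ^ b := Nat.mod_lt _ (by positivity)
      have hqa : a / 2 ^ b < 2 * 2 ^ d := by
        rw [Nat.div_lt_iff_lt_mul (by positivity)]
        calc a < 2 ^ m := ha
          _ = _ := by rw [hd, pow_add, pow_add]; ring
      obtain ⟨h₀, hh0⟩ := Nat.even_or_odd' (a / 2 ^ b)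
      have hh1 : h₀ < 2 ^ d := by omega
      set r0 := a % 2 ^ b with hr₀
      have hH : r * 2 ^ d + h₀ < (m + 1) * 2 ^ d := by
        calc _ < r * 2 ^ d + 2 ^ d := by omega
          _ = (r + 1) * 2 ^ d := by ring
          _ ≤ _ := Nat.mul_le_mul_right _ (by omega)
      have hL : r0 * Bk + x < Bk * 2 ^ b := by
        calc _ < r0 * Bk + Bk := by omega
          _ = Bk * (r0 + 1) := by ring
          _ ≤ _ := Nat.mul_le_mul_left _ (by omega)
      have key := hs2 _ hH _ hL
      have hpm : (2 : ℕ) ^ m = 2 ^ b * 2 * 2 ^ d := by rw [hd, pow_add, pow_add, pow_one]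
      have haddr : ∀ e, (r * 2 ^ m + (2 ^ b * (2 * h₀ + e) + r0)) * Bk + x =
          (2 * (r * 2 ^ d + h₀) + e) * (Bk * 2 ^ b) + (r0 * Bk + x) := fun e => by
        rw [hpm]; ring
      have hlt : ∀ e ≤ 1, 2 ^ b * (2 * h₀ + e) + r0 < 2 ^ m := fun e he => by
        rw [hpm]
        calc _ < 2 ^ b * (2 * h₀ + e) + 2 ^ b := by omega
          _ = 2 ^ b * (2 * h₀ + e + 1) := by ring
          _ ≤ 2 ^ b * (2 * 2 ^ d) := Nat.mul_le_mul_left _ (by omega)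
          _ = _ := by ring
      have g0 := hg1 r hr _ (hlt 0 (by norm_num)) x hx
      have g1 := hg1 r hr _ (hlt 1 le_rfl) x hx
      rw [haddr, add_zero] at g0
      rw [haddr] at g1
      rw [St.setV_m, St.setV_m] at key
      rw [add_zero] at g0
      obtain ⟨c1, c2, c3⟩ := sub_clear hl (b := b) (h := h₀) (r := r0) hbm hra
      have htake : (l.take (b + 1)).toFinset = insert l[b] (l.take b).toFinset := by
        rw [← List.take_append_getElem (h := hbm), List.toFinset_append]
        ext; simp [or_comm]
      have hnot : l[b] ∉ (l.take b).toFinset := by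
        rw [List.mem_toFinset]
        intro h
        rw [List.mem_take_iff_getElem] at h
        obtain ⟨i, hi, h⟩ := h
        have := (List.Nodup.getElem_inj_iff hl).1 h
        omega
      rw [htake, zp_insert _ hnot]
      rcases hh0 with hh0 | hh0
      · have ha' : a = 2 ^ b * (2 * h₀ + 0) + r0 := by rw [add_zero, ← hh0]; omega
        rw [ha', haddr, add_zero, add_zero, key.1, g0, if_neg c2, add_zero]
      · have ha' : a = 2 ^ b * (2 * h₀ + 1) + r0 := by rw [← hh0]; omega
        rw [ha', haddr, key.2, g0, g1, if_pos c1, c3]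
  · intro s' ⟨_, _, h1, h2⟩ _
    refine ⟨h1, ?_⟩
    simpa [hm] using h2

/-! ### The program: products of matrices of all ranks -/

/-- Copy a `pp × pp` matrix into a shared memory. -/
def copyLo (a : Fin 3) (e : Term) : Code :=
  .loop .x (vr .pp) (.loop .y (vr .pp) (.storeLo a (vr .pp * vr .x + vr .y) e))

/-- Add the product held by the last shared memory. -/
def addLo (H : Arr) (i : Term) : Code :=
  .loop .x (vr .pp) (.loop .y (vr .pp)
    (.loadLo .t 2 (vr .pp * vr .x + vr .y) ;; .put H i (rd H i + vr .t)))

/-- Multiply two blocks and add the product to a third one. -/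
def block : Code :=
  copyLo 0 (rd .FH (vr .bf + (vr .bu * vr .pp + vr .x) * vr .sf + (vr .bw * vr .pp + vr .y))) ;;
  copyLo 1 (rd .GH (vr .bg + (vr .bw * vr .pp + vr .x) * vr .sr + (vr .bv * vr .pp + vr .y))) ;;
  .call (vr .pp) ;;
  addLo .HH (vr .bh + (vr .bu * vr .pp + vr .x) * vr .sr + (vr .bv * vr .pp + vr .y))

/-- Multiply two matrices block by block. -/
def product : Code :=
  .loop .bu (vr .nx) (.loop .bv (vr .nz) (.loop .bw (vr .ny) block))

/-- Multiply the matrices of all pairs of ranks. -/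
def products : Code :=
  .loop .i (vr .ni + 1) (.loop .j (vr .ni + 1 - vr .i) (.loop .k (vr .si)
    (.set .bf ((vr .i * vr .si + vr .k) * (vr .sl * vr .sf)) ;;
    .set .bg ((vr .j * vr .si + vr .k) * (vr .sf * vr .sr)) ;;
    .set .bh (((vr .i + vr .j) * vr .si + vr .k) * (vr .sl * vr .sr)) ;;
    product)))

theorem run_copyLo {a : Fin 3} {e : Term} {P : ℕ} {X : ℕ → ℕ → ℤ}
    (hP : s.v .pp = P) (hM : (P : ℤ) ≤ M)
    (he : ∀ s' : Store, (∀ v, v ≠ .x → v ≠ .y → s'.v v = s.v v) → s'.m = s.m →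
      ∀ x < P, ∀ y < P, s'.v .x = (x : ℕ) → s'.v .y = (y : ℕ) → e.eval s' = X x y) :
    Run M mm (copyLo a e) s (P * (2 * P + 2) + 1) fun s' =>
      (∀ x < P, ∀ y < P, s'.lo a ((P : ℤ) * x + y) = X x y) ∧ ∀ b, b ≠ a → s'.lo b = s.lo b := by
  refine Run.loop' P (fun x' s' => (∀ x < P, ∀ y < P, x < x' →
      s'.lo a ((P : ℤ) * x + y) = X x y) ∧ ∀ b, b ≠ a → s'.lo b = s.lo b) (t := 2 * P + 1)
    hP hM ⟨by simp, fun _ _ => rfl⟩ ?_ (by rw [add_assoc]) ?_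
  · intro x' hx' s₁ ⟨h₁, h₁'⟩ hf1
    refine Run.loop' P (fun y' s' => (∀ x < P, ∀ y < P, x < x' ∨ x = x' ∧ y < y' →
      s'.lo a ((P : ℤ) * x + y) = X x y) ∧ ∀ b, b ≠ a → s'.lo b = s.lo b) (t := 1)
      ?_ hM ⟨by simpa using h₁, by simpa using h₁'⟩ ?_ (by omega) ?_
    · simp
      rw [hf1.1 _ (by simp [Cmd.wv]), hP]
    · intro y' hy' s₂ ⟨h₂, h₂'⟩ hf2
      have hv : ∀ v, v ≠ .x → v ≠ .y → (s₂.setV .y y').v v = s.v v := fun v h1 h2 => by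
        rw [St.setV_v_ne _ h2, hf2.1 _ (by simp [Cmd.wv, h2]), St.setV_v_ne _ h1,
          hf1.1 _ (by simp [Cmd.wv, h1, h2])]
      have hm : (s₂.setV .y y').m = s.m := by
        rw [St.setV_m]; funext b
        rw [hf2.2 _ (by simp [Cmd.wa]), St.setV_m, hf1.2 _ (by simp [Cmd.wa])]
      have hx : (s₂.setV .y y').v .x = x' := by
        rw [St.setV_v_ne _ (by simp), hf2.1 _ (by simp [Cmd.wv]), St.setV_v_self]
      have e1 := he _ hv hm x' hx' y' hy' hx (by simp)
      have e2 : (vr .pp * vr .x + vr .y : Term).eval (s₂.setV .y y') =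
          (P : ℤ) * x' + y' := by
        simp only [Ex.eval_add, Ex.eval_mul, Ex.eval_var, hx, hv .pp (by simp) (by simp), hP,
          St.setV_v_self]
      refine Run.storeLo ⟨fun x hx y hy hxy => ?_, fun b hb => ?_⟩
      · have key : ((P : ℤ) * x + y = (P : ℤ) * x' + y') ↔ x = x' ∧ y = y' := by
          rw [← Nat.mul_add_eq_mul_add_iff hy hy', mul_comm x, mul_comm x']
          norm_cast
        simp only [e1, e2, St.setLo_lo_self, key, St.setV_lo]
        split_ifs with h
        · rw [h.1, h.2]
        · exact h₂ x hx y hy (by omega)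
      · rw [St.setLo_lo_ne _ hb, St.setV_lo, h₂' b hb]
    · intro s' ⟨h, h'⟩ _
      exact ⟨fun x hx y hy hxy => h x hx y hy (by omega), h'⟩
  · intro s' ⟨h, h'⟩ _
    exact ⟨fun x hx y hy => h x hx y hy hx, h'⟩

/-- A loop that adds to the cells of an array. -/
theorem Run.accum {x : Var} {e : Term} {p : Code} {t : ℕ} {H : Arr}
    (n : ℕ) (S : Set ℤ) (c : ℕ → ℤ → ℤ) (δ B : ℤ) (J : Store → Prop)
    (he : e.eval s = n) (hn : (n : ℤ) ≤ M) (hJ : J s) (hB : ∀ a ∈ S, |s.m H a| ≤ B)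
    (hc : ∀ i < n, ∀ a, |c i a| ≤ δ)
    (hstep : ∀ i < n, ∀ s', J s' → Frame (.loop x e p) s s' →
      (∀ a ∈ S, |s'.m H a| ≤ B + i * δ) → Run M mm p (s'.setV x i) t
        (fun s'' => (∀ a, s''.m H a = s'.m H a + c i a) ∧ J s'')) :
    Run M mm (.loop x e p) s (n * (t + 1) + 1)
      fun s' => (∀ a, s'.m H a = s.m H a + ∑ i ∈ range n, c i a) ∧ J s' := by
  refine Run.loop' n (fun i s' => (∀ a, s'.m H a = s.m H a + ∑ i ∈ range i, c i a) ∧ J s')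
    he hn ⟨by simp, hJ⟩ ?_ le_rfl fun _ h _ => h
  intro i hi s' ⟨h, hJ'⟩ hf
  refine (hstep i hi s' hJ' hf fun a ha => ?_).imp le_rfl fun s'' hs'' _ => ⟨fun a => ?_, hs''.2⟩
  · rw [h a]
    refine (abs_add_le _ _).trans (add_le_add (hB a ha) ?_)
    refine (abs_sum_le_sum_abs _ _).trans ?_
    refine (sum_le_card_nsmul _ _ δ fun j hj => hc j ?_ a).trans (by simp)
    have := mem_range.1 hj
    omega
  · rw [hs''.1 a, h a, sum_range_succ, add_assoc]

theorem _root_.Finset.abs_sum_range_le {c : ℕ → ℤ} {n : ℕ} {δ : ℤ} (hc : ∀ i < n, |c i| ≤ δ) :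
    |∑ i ∈ range n, c i| ≤ n * δ :=
  (abs_sum_le_sum_abs _ _).trans
    ((sum_le_card_nsmul _ _ δ fun j hj => hc j (mem_range.1 hj)).trans (by simp))

theorem run_addLo {H : Arr} {e : Term} {P : ℕ} {X : ℕ → ℕ → ℤ}
    {ad : ℕ → ℕ → ℤ} {B δ : ℤ} (S : Set ℤ) (hS : ∀ x < P, ∀ y < P, ad x y ∈ S)
    (hP : s.v .pp = P) (hM : (P : ℤ) ≤ M)
    (hX : ∀ x < P, ∀ y < P, s.lo 2 ((P : ℤ) * x + y) = X x y)
    (hδ : ∀ x < P, ∀ y < P, |X x y| ≤ δ) (hδM : δ ≤ M) (hδ0 : 0 ≤ δ)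
    (hB : ∀ a ∈ S, |s.m H a| ≤ B) (hBM : B + P * (P * δ) ≤ M)
    (he : ∀ s' : Store, (∀ v, v ∉ [Var.x, .y, .t] → s'.v v = s.v v) →
      (∀ a, a ≠ H → s'.m a = s.m a) →
      ∀ x < P, ∀ y < P, s'.v .x = (x : ℕ) → s'.v .y = (y : ℕ) → e.eval s' = ad x y) :
    Run M mm (addLo H e) s (P * (3 * P + 2) + 1) fun s' => ∀ a, s'.m H a = s.m H a +
      ∑ x ∈ range P, ∑ y ∈ range P, if a = ad x y then X x y else 0 := by
  have hc0 : ∀ x < P, ∀ y < P, ∀ a, |if a = ad x y then X x y else 0| ≤ δ := by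
    intro x hx y hy a
    split_ifs
    · exact hδ x hx y hy
    · simpa using hδ0
  refine (Run.accum (t := 3 * P + 1) P S (fun x a => ∑ y ∈ range P, if a = ad x y then X x y else 0)
    (P * δ) B (fun s' => s'.lo = s.lo) (by exact hP) hM rfl hB
    (fun x hx a => abs_sum_range_le fun y hy => hc0 x hx y hy a) ?_).imp le_rfl fun _ h _ => h.1
  intro x' hx' s₁ hlo1 hf1 hb₁
  refine (Run.accum (t := 2) P S (fun y a => if a = ad x' y then X x' y else 0)
    δ (B + x' * (P * δ)) (fun s' => s'.lo = s.lo) ?_ hM (by simpa using hlo1) (by simpa using hb₁)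
    (fun y hy a => hc0 x' hx' y hy a) ?_).imp (by omega) fun _ h _ => by simpa using h
  · simp only [Ex.eval_var, ne_eq, reduceCtorEq, not_false_eq_true, St.setV_v_ne]
    rw [hf1.1 _ (by simp [Cmd.wv]), hP]
  intro y' hy' s₂ hlo2 hf2 hb₂
  have hv : ∀ v, v ∉ [Var.x, .y, .t] → ∀ z, ((s₂.setV .y y').setV .t z).v v = s.v v :=
    fun v h z => by
    simp only [List.mem_cons, List.not_mem_nil, or_false, not_or] at h
    rw [St.setV_v_ne _ h.2.2, St.setV_v_ne _ h.2.1, hf2.1 _ (by simp [Cmd.wv, h]),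
      St.setV_v_ne _ h.1, hf1.1 _ (by simp [Cmd.wv, h])]
  have hm : ∀ a, a ≠ H → ∀ z, ((s₂.setV .y y').setV .t z).m a = s.m a := by
    intro a ha z
    rw [St.setV_m, St.setV_m, hf2.2 _ (by simp [Cmd.wa, ha]), St.setV_m,
      hf1.2 _ (by simp [Cmd.wa, ha])]
  have hx : ∀ z, ((s₂.setV .y y').setV .t z).v .x = x' := fun z => by
    rw [St.setV_v_ne _ (by simp), St.setV_v_ne _ (by simp), hf2.1 _ (by simp [Cmd.wv]),
      St.setV_v_self]
  have e2 : (vr .pp * vr .x + vr .y : Term).eval (s₂.setV .y y') =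
      (P : ℤ) * x' + y' := by
    have h1 := hx 0
    have h2 := hv .pp (by simp) 0
    rw [St.setV_v_ne _ (by simp)] at h1 h2
    simp only [Ex.eval_add, Ex.eval_mul, Ex.eval_var, h1, h2, hP, St.setV_v_self]
  have e3 : (s₂.setV .y y').lo 2 ((vr .pp * vr .x + vr .y : Term).eval (s₂.setV .y y')) =
      X x' y' := by
    rw [e2, St.setV_lo, hlo2, hX x' hx' y' hy']
  refine Run.loadLo_seq (t := 1) ?_ ?_
  · rw [e3]; exact (hδ x' hx' y' hy').trans hδM
  rw [e3]
  have e1 := he _ (fun v h => hv v h (X x' y')) (fun a h => hm a h (X x' y')) x' hx' y' hy'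
    (hx _) (by simp)
  have e4 : (rd H e + vr .t : Term).eval ((s₂.setV .y y').setV .t (X x' y')) =
      s₂.m H (ad x' y') + X x' y' := by
    rw [Ex.eval_add, Ex.eval_rd, e1]; simp
  refine Run.put ?_ ⟨fun a => ?_, by simpa using hlo2⟩
  · rw [e4]
    refine (abs_add_le _ _).trans ((add_le_add (hb₂ _ (hS x' hx' y' hy')) (hδ x' hx' y' hy')).trans (le_trans ?_ hBM))
    have h1 : ((y' : ℤ) + 1) * δ ≤ P * δ := mul_le_mul_of_nonneg_right (by omega) hδ0
    have h2 : ((x' : ℤ) + 1) * (P * δ) ≤ P * (P * δ) :=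
      mul_le_mul_of_nonneg_right (by omega) (by positivity)
    linarith
  · rw [e1, e4, St.setM_m_self]
    split_ifs with h
    · rw [h]
    · simp

/-- The number of steps for the product of two `p × p` blocks. -/
def blockCost (mm : ℕ → ℕ) (p : ℕ) : ℕ := mm p + 14 * (p * p) + 4

theorem run_block {P bu bv bw : ℕ} {sf sr bf bg bh B β : ℤ} (S : Set ℤ)
    (hS : ∀ x < P, ∀ y < P, bh + (bu * P + x) * sr + (bv * P + y) ∈ S)
    (hP1 : 1 ≤ P) (hPP : s.v .pp = P) (hbu : s.v .bu = bu) (hbv : s.v .bv = bv)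
    (hbw : s.v .bw = bw) (hsf : s.v .sf = sf) (hsr : s.v .sr = sr) (hbf : s.v .bf = bf)
    (hbg : s.v .bg = bg) (hbh : s.v .bh = bh) (hM : (P : ℤ) ≤ M)
    (hF : ∀ x < P, ∀ z < P, |s.m .FH (bf + (bu * P + x) * sf + (bw * P + z))| ≤ β)
    (hG : ∀ z < P, ∀ y < P, |s.m .GH (bg + (bw * P + z) * sr + (bv * P + y))| ≤ β)
    (hβ : 1 ≤ β) (hB : ∀ a ∈ S, |s.m .HH a| ≤ B) (hBM : B + P * (P * (P * β ^ 2)) ≤ M) :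
    Run M mm block s (blockCost mm P) fun s' => ∀ a, s'.m .HH a = s.m .HH a +
      ∑ x ∈ range P, ∑ y ∈ range P, if a = bh + (bu * P + x) * sr + (bv * P + y) then
        ∑ z ∈ range P, s.m .FH (bf + (bu * P + x) * sf + (bw * P + z)) *
          s.m .GH (bg + (bw * P + z) * sr + (bv * P + y)) else 0 := by
  have hB0 : 0 ≤ B := (abs_nonneg _).trans (hB _ (hS 0 hP1 0 hP1))
  have hP0 : (1 : ℤ) ≤ P := by exact_mod_cast hP1
  have hδ0 : 0 ≤ P * β ^ 2 := by positivity
  have hδM : P * β ^ 2 ≤ M := by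
    have h1 : P * β ^ 2 ≤ P * (P * β ^ 2) := le_mul_of_one_le_left hδ0 hP0
    have h2 : P * (P * β ^ 2) ≤ P * (P * (P * β ^ 2)) :=
      le_mul_of_one_le_left (by positivity) hP0
    linarith
  have hβM : β ≤ M := by nlinarith
  set F : ℕ → ℕ → ℤ := fun x z => s.m .FH (bf + (bu * P + x) * sf + (bw * P + z)) with hFdef
  set G : ℕ → ℕ → ℤ := fun z y => s.m .GH (bg + (bw * P + z) * sr + (bv * P + y)) with hGdef
  refine Run.seq' (t1 := P * (2 * P + 2) + 1) (t2 := (P * (2 * P + 2) + 1) +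
    ((mm P + 1) + (P * (3 * P + 2) + 1)))
    (run_copyLo (X := F) hPP hM fun s' hv hm x hx y hy ex ey => ?_) ?_ ?_
  · simp [hm, ex, ey, hv, hbf, hbu, hbw, hPP, hsf, hFdef]
  rotate_left
  · unfold blockCost
    nlinarith
  intro s₁ ⟨hA1, _⟩ hf1
  have ev1 : ∀ v, v ≠ .x → v ≠ .y → s₁.v v = s.v v := fun v h h' =>
    hf1.1 _ (by simp [copyLo, Cmd.wv, h, h'])
  have em1 : s₁.m = s.m := funext fun a => hf1.2 _ (by simp [copyLo, Cmd.wa])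
  refine Run.seq' (run_copyLo (X := G) (by rw [ev1 _ (by simp) (by simp), hPP]) hM
    fun s' hv hm x hx y hy ex ey => ?_) ?_ le_rfl
  · simp [hm, ex, ey, hv, ev1, em1, hbg, hbv, hbw, hPP, hsr, hGdef]
  intro s₂ ⟨hA2, hlo2⟩ hf2
  have ev2 : ∀ v, v ≠ .x → v ≠ .y → s₂.v v = s.v v := fun v h h' => by
    rw [hf2.1 _ (by simp [copyLo, Cmd.wv, h, h']), ev1 v h h']
  have em2 : s₂.m = s.m := by
    rw [← em1]; exact funext fun a => hf2.2 _ (by simp [copyLo, Cmd.wa])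
  refine Run.seq' (R := fun s' => ∀ x < P, ∀ y < P, s'.lo 2 ((P : ℤ) * x + y) =
    ∑ z ∈ range P, F x z * G z y)
    (Run.call P (.of fun i j => F i j) (.of fun i j => G i j) ?_ hP1 hM ?_ ?_ ?_ ?_) ?_ le_rfl
  · simp [ev2, hPP]
  · exact fun i j => ⟨(hF i i.2 j j.2).trans hβM, (hG i i.2 j j.2).trans hβM⟩
  · intro i j
    rw [hlo2 0 (by decide), hA1 i i.2 j j.2]; rfl
  · intro i j
    rw [hA2 i i.2 j j.2]; rfl
  · intro lo hlo x hx y hy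
    have := hlo ⟨x, hx⟩ ⟨y, hy⟩
    rw [Matrix.mul_apply] at this
    rw [sum_range]
    exact this
  intro s₃ h₃ hf3
  have ev3 : ∀ v, v ≠ .x → v ≠ .y → s₃.v v = s.v v := fun v h h' => by
    rw [hf3.1 _ (by simp [Cmd.wv]), ev2 v h h']
  have em3 : s₃.m = s.m := by
    rw [← em2]; exact funext fun a => hf3.2 _ (by simp [Cmd.wa])
  refine (run_addLo (X := fun x y => ∑ z ∈ range P, F x z * G z y)
    (ad := fun x y => bh + (bu * P + x) * sr + (bv * P + y)) (B := B) (δ := P * β ^ 2) S hS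
    (by rw [ev3 _ (by simp) (by simp), hPP]) hM h₃ ?_ hδM hδ0 (by rw [em3]; exact hB) hBM
    fun s' hv hm x hx y hy ex ey => ?_).imp le_rfl fun s' h _ => by rw [em3] at h; exact h
  · intro x hx y hy
    refine abs_sum_range_le fun z hz => ?_
    rw [abs_mul, pow_two]
    exact mul_le_mul (hF x hx z hz) (hG z hz y hy) (abs_nonneg _) (by omega)
  · simp [ex, ey, hv, ev3, hbu, hbv, hPP, hsr, hbh]

theorem _root_.Finset.sum_range_mul_add (f : ℕ → ℤ) (n p : ℕ) :
    ∑ u ∈ range n, ∑ x ∈ range p, f (u * p + x) = ∑ i ∈ range (n * p), f i := by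
  induction n with
  | zero => simp
  | succ n ih => rw [sum_range_succ, ih, add_mul, one_mul, sum_range_add]

/-- The number of steps for a product of matrices divided into blocks. -/
def productCost (mm : ℕ → ℕ) (p nx ny nz : ℕ) : ℕ :=
  nx * (nz * (ny * (blockCost mm p + 1) + 2) + 2) + 1

theorem run_product {P nx ny nz : ℕ} {bf bg bh B β : ℤ} (S : Set ℤ)
    (hS : ∀ l < nx * P, ∀ r < nz * P, bh + l * (nz * P : ℕ) + r ∈ S)
    (hP1 : 1 ≤ P) (hPP : s.v .pp = P) (hnx : s.v .nx = nx) (hny : s.v .ny = ny)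
    (hnz : s.v .nz = nz) (hsf : s.v .sf = (ny * P : ℕ)) (hsr : s.v .sr = (nz * P : ℕ))
    (hbf : s.v .bf = bf) (hbg : s.v .bg = bg) (hbh : s.v .bh = bh) (hM : (P : ℤ) ≤ M)
    (hMx : (nx : ℤ) ≤ M) (hMy : (ny : ℤ) ≤ M) (hMz : (nz : ℤ) ≤ M)
    (hF : ∀ l < nx * P, ∀ f < ny * P, |s.m .FH (bf + l * (ny * P : ℕ) + f)| ≤ β)
    (hG : ∀ f < ny * P, ∀ r < nz * P, |s.m .GH (bg + f * (nz * P : ℕ) + r)| ≤ β)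
    (hβ : 1 ≤ β) (hB : ∀ a ∈ S, |s.m .HH a| ≤ B)
    (hBM : B + nx * (nz * (ny * (P * (P * (P * β ^ 2))))) ≤ M) :
    Run M mm product s (productCost mm P nx ny nz) fun s' => ∀ a, s'.m .HH a = s.m .HH a +
      ∑ l ∈ range (nx * P), ∑ r ∈ range (nz * P), if a = bh + l * (nz * P : ℕ) + r then
        ∑ f ∈ range (ny * P), s.m .FH (bf + l * (ny * P : ℕ) + f) *
          s.m .GH (bg + f * (nz * P : ℕ) + r) else 0 := by
  obtain ⟨T, hT⟩ : ∃ T : ℕ → ℕ → ℕ → ℤ → ℤ, T = fun (u v w : ℕ) a =>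
      ∑ x ∈ range P, ∑ y ∈ range P,
        if a = bh + (u * P + x) * (nz * P : ℕ) + (v * P + y) then
        ∑ z ∈ range P, s.m .FH (bf + (u * P + x) * (ny * P : ℕ) + (w * P + z)) *
          s.m .GH (bg + (w * P + z) * (nz * P : ℕ) + (v * P + y)) else 0 := ⟨_, rfl⟩
  have hlt : ∀ {n u x : ℕ}, u < n → x < P → u * P + x < n * P := fun {n u x} hu hx => by
    calc u * P + x < u * P + P := by omega
      _ = (u + 1) * P := by ring
      _ ≤ _ := Nat.mul_le_mul_right _ hu
  have hF' : ∀ u < nx, ∀ w < ny, ∀ x < P, ∀ z < P,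
      |s.m .FH (bf + (u * P + x) * (ny * P : ℕ) + (w * P + z))| ≤ β := fun u hu w hw x hx z hz => by
    have := hF _ (hlt hu hx) _ (hlt hw hz)
    push_cast at this ⊢
    exact this
  have hG' : ∀ v < nz, ∀ w < ny, ∀ z < P, ∀ y < P,
      |s.m .GH (bg + (w * P + z) * (nz * P : ℕ) + (v * P + y))| ≤ β := fun v hv w hw z hz y hy => by
    have := hG _ (hlt hw hz) _ (hlt hv hy)
    push_cast at this ⊢
    exact this
  have hTδ : ∀ u < nx, ∀ v < nz, ∀ w < ny, ∀ a, |T u v w a| ≤ P * (P * (P * β ^ 2)) := by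
    intro u hu v hv w hw a
    rw [hT]
    refine abs_sum_range_le fun x hx => abs_sum_range_le fun y hy => ?_
    split_ifs
    · refine abs_sum_range_le fun z hz => ?_
      rw [abs_mul, pow_two]
      exact mul_le_mul (hF' u hu w hw x hx z hz) (hG' v hv w hw z hz y hy) (abs_nonneg _) (by omega)
    · simp only [abs_zero]; positivity
  obtain ⟨δ, hδ⟩ : ∃ δ, δ = P * (P * (P * β ^ 2)) := ⟨_, rfl⟩
  have hδ0 : 0 ≤ δ := by rw [hδ]; positivity
  rw [← hδ] at hBM hTδ
  have hTs : ∀ a, ∑ u ∈ range nx, ∑ v ∈ range nz, ∑ w ∈ range ny, T u v w a =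
      ∑ l ∈ range (nx * P), ∑ r ∈ range (nz * P), if a = bh + l * (nz * P : ℕ) + r then
        ∑ f ∈ range (ny * P), s.m .FH (bf + l * (ny * P : ℕ) + f) *
          s.m .GH (bg + f * (nz * P : ℕ) + r) else 0 := by
    intro a
    rw [← sum_range_mul_add]
    refine sum_congr rfl fun u _ => ?_
    have h1 : ∀ v, ∑ w ∈ range ny, T u v w a = ∑ x ∈ range P, ∑ y ∈ range P,
        if a = bh + (u * P + x : ℕ) * (nz * P : ℕ) + (v * P + y : ℕ) then
          ∑ f ∈ range (ny * P), s.m .FH (bf + (u * P + x : ℕ) * (ny * P : ℕ) + f) *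
          s.m .GH (bg + f * (nz * P : ℕ) + (v * P + y : ℕ)) else 0 := by
      intro v
      rw [hT, sum_comm]
      refine sum_congr rfl fun x _ => ?_
      rw [sum_comm]
      refine sum_congr rfl fun y _ => ?_
      simp only [Nat.cast_add, Nat.cast_mul]
      split_ifs
      · have := sum_range_mul_add (fun f => s.m .FH (bf + (u * P + x : ℕ) * (ny * P : ℕ) + f) *
          s.m .GH (bg + f * (nz * P : ℕ) + (v * P + y : ℕ))) ny P
        simp only [Nat.cast_add, Nat.cast_mul] at this
        exact this
      · simp
    rw [sum_congr rfl fun v _ => h1 v, sum_comm]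
    refine sum_congr rfl fun x _ => ?_
    exact sum_range_mul_add (fun r => if a = bh + (u * P + x : ℕ) * (nz * P : ℕ) + r then
        ∑ f ∈ range (ny * P), s.m .FH (bf + (u * P + x : ℕ) * (ny * P : ℕ) + f) *
          s.m .GH (bg + f * (nz * P : ℕ) + r) else 0) nz P
  refine (Run.accum (t := nz * (ny * (blockCost mm P + 1) + 2) + 1) nx S
    (fun u a => ∑ v ∈ range nz, ∑ w ∈ range ny, T u v w a) (nz * (ny * δ)) B (fun _ => True)
    (by simpa using hnx) hMx trivial hB
    (fun u hu a => abs_sum_range_le fun v hv => abs_sum_range_le fun w hw => hTδ u hu v hv w hw a)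
    ?_).imp le_rfl fun s' h _ a => by rw [h.1 a, hTs]
  intro u hu s₁ _ hf1 hb₁
  refine (Run.accum (t := ny * (blockCost mm P + 1) + 1) nz S
    (fun v a => ∑ w ∈ range ny, T u v w a) (ny * δ) (B + u * (nz * (ny * δ))) (fun _ => True)
    ?_ hMz trivial (by simpa using hb₁)
    (fun v hv a => abs_sum_range_le fun w hw => hTδ u hu v hv w hw a) ?_).imp le_rfl
    fun s' h _ => by simpa using h
  · rw [Ex.eval_var, St.setV_v_ne _ (by simp), hf1.v _, hnz]
  intro v hv s₂ _ hf2 hb₂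
  refine (Run.accum (t := blockCost mm P) ny S
    (fun w a => T u v w a) δ (B + u * (nz * (ny * δ)) + v * (ny * δ)) (fun _ => True)
    ?_ hMy trivial (by simpa using hb₂) (fun w hw a => hTδ u hu v hv w hw a) ?_).imp le_rfl
    fun s' h _ => by simpa using h
  · rw [Ex.eval_var, St.setV_v_ne _ (by simp), hf2.v _, St.setV_v_ne _ (by simp),
      hf1.v _, hny]
  intro w hw s₃ _ hf3 hb₃
  have ev : ∀ x, x ∉ [Var.x, .y, .t, .bu, .bv, .bw] → (s₃.setV .bw w).v x = s.v x := by
    intro x hx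
    simp only [List.mem_cons, List.not_mem_nil, or_false, not_or] at hx
    rw [St.setV_v_ne _ (by tauto), hf3.1 _ (by simp [Cmd.wv, block, copyLo, addLo, hx]),
      St.setV_v_ne _ (by tauto), hf2.1 _ (by simp [Cmd.wv, block, copyLo, addLo, hx]),
      St.setV_v_ne _ (by tauto), hf1.1 _ (by simp [Cmd.wv, block, copyLo, addLo, hx])]
  have em : ∀ a, a ≠ .HH → (s₃.setV .bw w).m a = s.m a := by
    intro a ha
    rw [St.setV_m, hf3.2 _ (by simp [Cmd.wa, block, copyLo, addLo, ha]),
      St.setV_m, hf2.2 _ (by simp [Cmd.wa, block, copyLo, addLo, ha]),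
      St.setV_m, hf1.2 _ (by simp [Cmd.wa, block, copyLo, addLo, ha])]
  refine (run_block (P := P) (bu := u) (bv := v) (bw := w) (sf := (ny * P : ℕ))
    (sr := (nz * P : ℕ)) (bf := bf) (bg := bg) (bh := bh)
    (B := B + u * (nz * (ny * δ)) + v * (ny * δ) + w * δ) (β := β) S ?_ hP1
    (by rw [ev _ (by decide), hPP]) ?_ ?_ (by simp) (by rw [ev _ (by decide), hsf])
    (by rw [ev _ (by decide), hsr]) (by rw [ev _ (by decide), hbf]) (by rw [ev _ (by decide), hbg])
    (by rw [ev _ (by decide), hbh]) hM (by rw [em _ (by decide)]; exact hF' u hu w hw)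
    (by rw [em _ (by decide)]; exact hG' v hv w hw) hβ (by simpa using hb₃) ?_).imp le_rfl ?_
  · intro x hx y hy
    have := hS _ (hlt hu hx) _ (hlt hv hy)
    push_cast at this ⊢
    exact this
  · rw [St.setV_v_ne _ (by simp), hf3.v _, St.setV_v_ne _ (by simp),
      hf2.v _, St.setV_v_self]
  · rw [St.setV_v_ne _ (by simp), hf3.v _, St.setV_v_self]
  · rw [← hδ]
    have h1 : ((u : ℤ) + 1) * (nz * (ny * δ)) ≤ nx * (nz * (ny * δ)) :=
      mul_le_mul_of_nonneg_right (by omega) (by positivity)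
    have h2 : ((v : ℤ) + 1) * (ny * δ) ≤ nz * (ny * δ) :=
      mul_le_mul_of_nonneg_right (by omega) (by positivity)
    have h3 : ((w : ℤ) + 1) * δ ≤ ny * δ := mul_le_mul_of_nonneg_right (by omega) hδ0
    linarith
  · intro s' h _
    refine ⟨fun a => ?_, trivial⟩
    rw [h a, hT, em .FH (by decide), em .GH (by decide)]
    rfl

/-- The number of steps for the products of all ranks. -/
def productsCost (mm : ℕ → ℕ) (m p nx ny nz : ℕ) : ℕ :=
  (m + 1) * ((m + 1) * (2 ^ m * (productCost mm p nx ny nz + 4) + 2) + 2) + 1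

theorem run_products {m P nx ny nz : ℕ} {β : ℤ}
    {F G : ℕ → ℕ → ℕ → ℕ → ℤ} {SL SF SR : ℕ} (eL : SL = nx * P) (eF : SF = ny * P)
    (eR : SR = nz * P)
    (hP1 : 1 ≤ P) (hni : s.v .ni = m) (hsi : s.v .si = (2 ^ m : ℕ))
    (hPP : s.v .pp = P) (hnx : s.v .nx = nx) (hny : s.v .ny = ny)
    (hnz : s.v .nz = nz) (hsl : s.v .sl = SL) (hsf : s.v .sf = SF) (hsr : s.v .sr = SR)
    (hny1 : 1 ≤ ny) (hnz1 : 1 ≤ nz) (hnx1 : 1 ≤ nx)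
    (hMF : (((m + 1) * 2 ^ m * (SL * SF) : ℕ) : ℤ) ≤ M)
    (hMG : (((m + 1) * 2 ^ m * (SF * SR) : ℕ) : ℤ) ≤ M)
    (hMH : (((m + 1) * 2 ^ m * (SL * SR) : ℕ) : ℤ) ≤ M)
    (hF : ∀ i ≤ m, ∀ k < 2 ^ m, ∀ l < SL, ∀ f < SF,
      s.m .FH (((i * 2 ^ m + k) * (SL * SF) + (l * SF + f) : ℕ) : ℤ) = F i k l f)
    (hG : ∀ j ≤ m, ∀ k < 2 ^ m, ∀ f < SF, ∀ r < SR,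
      s.m .GH (((j * 2 ^ m + k) * (SF * SR) + (f * SR + r) : ℕ) : ℤ) = G j k f r)
    (hFβ : ∀ i ≤ m, ∀ k < 2 ^ m, ∀ l < SL, ∀ f < SF, |F i k l f| ≤ β)
    (hGβ : ∀ j ≤ m, ∀ k < 2 ^ m, ∀ f < SF, ∀ r < SR, |G j k f r| ≤ β)
    (hβ : 1 ≤ β)
    (hH : ∀ c : ℕ, c < (m + 1) * 2 ^ m * (SL * SR) → s.m .HH c = 0)
    (hBM : ((m + 1 : ℕ) : ℤ) * ((m + 1 : ℕ) * ((2 ^ m : ℕ) * (nx * (nz * (ny * (P * (P * (P *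
      β ^ 2)))))))) ≤ M) :
    Run M mm products s (productsCost mm m P nx ny nz) fun s' =>
      (∀ c : ℕ, c < (m + 1) * 2 ^ m * (SL * SR) → |s'.m .HH c| ≤
        ((m + 1 : ℕ) : ℤ) * ((m + 1 : ℕ) * ((2 ^ m : ℕ) * (nx * (nz * (ny * (P * (P * (P *
          β ^ 2))))))))) ∧
      ∀ h ≤ m, ∀ k < 2 ^ m, ∀ l < SL, ∀ r < SR,
        s'.m .HH (((h * 2 ^ m + k) * (SL * SR) + (l * SR + r) : ℕ) : ℤ) =
          ∑ i ∈ range (h + 1), ∑ f ∈ range SF, F i k l f * G (h - i) k f r := by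
  obtain ⟨δ, hδ⟩ : ∃ δ : ℤ, δ = nx * (nz * (ny * (P * (P * (P * β ^ 2))))) := ⟨_, rfl⟩
  have hδ0 : 0 ≤ δ := by rw [hδ]; positivity
  rw [← hδ] at hBM ⊢
  have h2m : 1 ≤ 2 ^ m := Nat.one_le_two_pow
  have hL1 : 1 ≤ SL := eL ▸ Nat.mul_pos hnx1 hP1
  have hF1 : 1 ≤ SF := eF ▸ Nat.mul_pos hny1 hP1
  have hR1 : 1 ≤ SR := eR ▸ Nat.mul_pos hnz1 hP1
  have hle : ∀ i ≤ (m + 1) * 2 ^ m * (SL * SR), (i : ℤ) ≤ M := fun i hi => by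
    refine le_trans ?_ hMH
    exact_mod_cast hi
  have hleF : ∀ i ≤ (m + 1) * 2 ^ m * (SL * SF), (i : ℤ) ≤ M := fun i hi => by
    refine le_trans ?_ hMF
    exact_mod_cast hi
  have hleG : ∀ i ≤ (m + 1) * 2 ^ m * (SF * SR), (i : ℤ) ≤ M := fun i hi => by
    refine le_trans ?_ hMG
    exact_mod_cast hi
  have hLR : 1 ≤ SL * SR := Nat.mul_pos hL1 hR1
  have hb1 : (m + 1) * 2 ^ m ≤ (m + 1) * 2 ^ m * (SL * SR) := Nat.le_mul_of_pos_right _ hLR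
  have hb2 : m + 1 ≤ (m + 1) * 2 ^ m := Nat.le_mul_of_pos_right _ h2m
  have hb3 : 2 ^ m ≤ (m + 1) * 2 ^ m := Nat.le_mul_of_pos_left _ (by omega)
  have hb4 : SL * SR ≤ (m + 1) * 2 ^ m * (SL * SR) := Nat.le_mul_of_pos_left _ (by positivity)
  have hb5 : SF ≤ (m + 1) * 2 ^ m * (SL * SF) := by
    calc SF ≤ SL * SF := Nat.le_mul_of_pos_left _ hL1
      _ ≤ _ := Nat.le_mul_of_pos_left _ (by positivity)
  have hsub : ∀ {A B C D : ℕ}, A < B → C < D → A * D + C < B * D := fun {A B C D} h h' => by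
    calc A * D + C < A * D + D := by omega
      _ = (A + 1) * D := by ring
      _ ≤ _ := Nat.mul_le_mul_right _ h
  obtain ⟨T, hT⟩ : ∃ T : ℕ → ℕ → ℕ → ℤ → ℤ, T = fun (i j k : ℕ) a =>
      ∑ l ∈ range SL, ∑ r ∈ range SR,
        if a = ((((i + j) * 2 ^ m + k) * (SL * SR) + (l * SR + r) : ℕ) : ℤ) then
          ∑ f ∈ range SF, F i k l f * G j k f r else 0 := ⟨_, rfl⟩
  have hTδ : ∀ i < m + 1, ∀ j < m + 1 - i, ∀ k < 2 ^ m, ∀ a, |T i j k a| ≤ δ := by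
    intro i hi j hj k hk a
    have : |T i j k a| ≤ SL * (SR * (SF * β ^ 2)) := by
      rw [hT]
      refine abs_sum_range_le fun l hl => abs_sum_range_le fun r hr => ?_
      split_ifs
      · refine abs_sum_range_le fun f hf => ?_
        rw [abs_mul, pow_two]
        exact mul_le_mul (hFβ i (by omega) k hk l hl f hf) (hGβ j (by omega) k hk f hf r hr)
          (abs_nonneg _) (by omega)
      · simp only [abs_zero]; positivity
    refine this.trans (le_of_eq ?_)
    rw [hδ, eL, eF, eR]
    push_cast
    ring
  set S : Set ℤ := {a | ∃ c : ℕ, a = c ∧ c < (m + 1) * 2 ^ m * (SL * SR)} with hS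
  have hH0 : ∀ a ∈ S, s.m .HH a = 0 := by
    rintro a ⟨c, rfl, hc⟩
    exact hH c hc
  refine (Run.accum (H := .HH) (t := (m + 1) * (2 ^ m * (productCost mm P nx ny nz + 4) + 2) + 1) (m + 1) S
    (fun i a => ∑ j ∈ range (m + 1 - i), ∑ k ∈ range (2 ^ m), T i j k a)
    ((m + 1 : ℕ) * ((2 ^ m : ℕ) * δ)) 0 (fun _ => True) (by simp [hni]) (hle _ (by omega)) trivial
    (fun a ha => by simp [hH0 a ha]) (fun i hi a => ?_) ?_).imp le_rfl ?_
  · have h1 : |∑ j ∈ range (m + 1 - i), ∑ k ∈ range (2 ^ m), T i j k a| ≤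
        (m + 1 - i : ℕ) * ((2 ^ m : ℕ) * δ) :=
      abs_sum_range_le fun j hj => abs_sum_range_le fun k hk => hTδ i hi j hj k hk a
    exact h1.trans (mul_le_mul_of_nonneg_right (by exact_mod_cast (by omega)) (by positivity))
  · intro i hi s₁ _ hf1 hb₁
    refine (Run.accum (t := 2 ^ m * (productCost mm P nx ny nz + 4) + 1) (m + 1 - i) S
      (fun j a => ∑ k ∈ range (2 ^ m), T i j k a) ((2 ^ m : ℕ) * δ)
      (0 + i * ((m + 1 : ℕ) * ((2 ^ m : ℕ) * δ))) (fun _ => True) ?_ (hle _ (by omega)) trivial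
      (by simpa using hb₁)
      (fun j hj a => abs_sum_range_le fun k hk => hTδ i hi j hj k hk a) ?_).imp ?_
      fun s' h _ => by simpa using h
    · have : s₁.v .ni = m := by rw [hf1.v _, hni]
      simp only [Ex.eval_sub, Ex.eval_add, Ex.eval_var, ne_eq, reduceCtorEq, not_false_eq_true,
        St.setV_v_ne, this, Ex.eval_one, St.setV_v_self]
      push_cast [Nat.sub_add_comm, hi.le]
      ring
    rotate_left
    · exact Nat.add_le_add_right (Nat.mul_le_mul_right _ (by omega)) _
    intro j hj s₂ _ hf2 hb₂
    refine (Run.accum (t := productCost mm P nx ny nz + 3) (2 ^ m) S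
      (fun k a => T i j k a) δ (0 + i * ((m + 1 : ℕ) * ((2 ^ m : ℕ) * δ)) + j * ((2 ^ m : ℕ) * δ))
      (fun _ => True) ?_ (hle _ (by omega)) trivial
      (by simpa using hb₂)
      (fun k hk a => hTδ i hi j hj k hk a) ?_).imp le_rfl fun s' h _ => by simpa using h
    · rw [Ex.eval_var, St.setV_v_ne _ (by simp), hf2.v _, St.setV_v_ne _ (by simp),
        hf1.v _, hsi]
    intro k hk s₃ _ hf3 hb₃
    have ev : ∀ x ∈ [Var.si, .sl, .sf, .sr, .pp, .nx, .ny, .nz], s₃.v x = s.v x := by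
      intro x hx
      have h3 : x ∉ (Cmd.loop Var.i (vr .ni + 1) (.loop .j (vr .ni + 1 - vr .i) (.loop .k (vr .si)
        (.set .bf ((vr .i * vr .si + vr .k) * (vr .sl * vr .sf)) ;;
        .set .bg ((vr .j * vr .si + vr .k) * (vr .sf * vr .sr)) ;;
        .set .bh (((vr .i + vr .j) * vr .si + vr .k) * (vr .sl * vr .sr)) ;;
        product)))).wv := by
        revert x; decide
      have h4 : x ≠ .i ∧ x ≠ .j := by revert x; decide
      rw [hf3.1 x (fun h => h3 (List.mem_cons_of_mem _ (List.mem_cons_of_mem _ h))),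
        St.setV_v_ne _ h4.2, hf2.1 x (fun h => h3 (List.mem_cons_of_mem _ h)),
        St.setV_v_ne _ h4.1, hf1.1 x h3]
    have em : ∀ a, a ≠ .HH → s₃.m a = s.m a := by
      intro a ha
      rw [hf3.2 _ (by simp [Cmd.wa, product, block, copyLo, addLo, ha]),
        St.setV_m, hf2.2 _ (by simp [Cmd.wa, product, block, copyLo, addLo, ha]),
        St.setV_m, hf1.2 _ (by simp [Cmd.wa, product, block, copyLo, addLo, ha])]
    have ei : s₃.v .i = i := by
      rw [hf3.v _, St.setV_v_ne _ (by simp), hf2.v _, St.setV_v_self]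
    have ej : s₃.v .j = j := by rw [hf3.v _, St.setV_v_self]
    have e1 : s₃.v .si = (2 ^ m : ℕ) := by rw [ev _ (by decide), hsi]
    have e2 : s₃.v .sl = SL := by rw [ev _ (by decide), hsl]
    have e3 : s₃.v .sf = SF := by rw [ev _ (by decide), hsf]
    have e4 : s₃.v .sr = SR := by rw [ev _ (by decide), hsr]
    have ik : ∀ {i}, i ≤ m → i * 2 ^ m + k < (m + 1) * 2 ^ m := fun {i} h => hsub (by omega) hk
    set s₄ := (s₃.setV .k k).setV .bf (((i * 2 ^ m + k) * (SL * SF) : ℕ) : ℤ) with hs4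
    set s₅ := s₄.setV .bg (((j * 2 ^ m + k) * (SF * SR) : ℕ) : ℤ) with hs5
    set s₆ := s₅.setV .bh ((((i + j) * 2 ^ m + k) * (SL * SR) : ℕ) : ℤ) with hs6
    have w1 : ((vr .i * vr .si + vr .k) * (vr .sl * vr .sf) : Term).eval (s₃.setV .k k) =
        (((i * 2 ^ m + k) * (SL * SF) : ℕ) : ℤ) := by
      simp [ei, e1, e2, e3]
    have w2 : ((vr .j * vr .si + vr .k) * (vr .sf * vr .sr) : Term).eval s₄ =
        (((j * 2 ^ m + k) * (SF * SR) : ℕ) : ℤ) := by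
      simp [hs4, ej, e1, e4, e3]
    have w3 : (((vr .i + vr .j) * vr .si + vr .k) * (vr .sl * vr .sr) : Term).eval s₅ =
        ((((i + j) * 2 ^ m + k) * (SL * SR) : ℕ) : ℤ) := by
      simp [hs5, hs4, ei, ej, e1, e4, e2]
    refine Run.set_seq (t := productCost mm P nx ny nz + 2) ?_ ?_
    · rw [w1, Nat.abs_cast]
      exact hleF _ (Nat.mul_le_mul_right _ (ik (by omega)).le)
    rw [w1, ← hs4]
    refine Run.set_seq (t := productCost mm P nx ny nz + 1) ?_ ?_
    · rw [w2, Nat.abs_cast]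
      exact hleG _ (Nat.mul_le_mul_right _ (ik (by omega)).le)
    rw [w2, ← hs5]
    refine Run.set_seq (t := productCost mm P nx ny nz) ?_ ?_
    · rw [w3, Nat.abs_cast]
      exact hle _ (Nat.mul_le_mul_right _ (ik (by omega)).le)
    rw [w3, ← hs6]
    have hF' : ∀ l < SL, ∀ f < SF, s₆.m .FH ((((i * 2 ^ m + k) * (SL * SF) : ℕ) : ℤ) +
        l * (SF : ℕ) + f) = F i k l f := by
      intro l hl f hf
      rw [← hF i (by omega) k hk l hl f hf, hs6, hs5, hs4]
      simp only [St.setV_m, em .FH (by decide)]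
      congr 1
      push_cast
      ring
    have hG' : ∀ f < SF, ∀ r < SR, s₆.m .GH ((((j * 2 ^ m + k) * (SF * SR) : ℕ) : ℤ) +
        f * (SR : ℕ) + r) = G j k f r := by
      intro f hf r hr
      rw [← hG j (by omega) k hk f hf r hr, hs6, hs5, hs4]
      simp only [St.setV_m, em .GH (by decide)]
      congr 1
      push_cast
      ring
    refine (run_product (P := P) (nx := nx) (ny := ny) (nz := nz) (β := β)
      (bf := (((i * 2 ^ m + k) * (SL * SF) : ℕ) : ℤ))
      (bg := (((j * 2 ^ m + k) * (SF * SR) : ℕ) : ℤ))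
      (bh := ((((i + j) * 2 ^ m + k) * (SL * SR) : ℕ) : ℤ))
      (B := 0 + i * ((m + 1 : ℕ) * ((2 ^ m : ℕ) * δ)) + j * ((2 ^ m : ℕ) * δ) + k * δ) S ?_ hP1
      ?_ ?_ ?_ ?_ ?_ ?_ ?_ ?_ ?_ ?_ ?_ ?_ ?_ ?_ ?_ hβ ?_ ?_).imp le_rfl ?_
    · intro l hl r hr
      refine ⟨((i + j) * 2 ^ m + k) * (SL * SR) + (l * SR + r), ?_, ?_⟩
      · rw [eR]; push_cast; ring
      · rw [← eL] at hl
        rw [← eR] at hr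
        exact hsub (ik (by omega)) (hsub hl hr)
    · simp [hs6, hs5, hs4, ev, hPP]
    · simp [hs6, hs5, hs4, ev, hnx]
    · simp [hs6, hs5, hs4, ev, hny]
    · simp [hs6, hs5, hs4, ev, hnz]
    · simp [hs6, hs5, hs4, ev, hsf, eF]
    · simp [hs6, hs5, hs4, ev, hsr, eR]
    · simp [hs6, hs5, hs4]
    · simp [hs6, hs5]
    · simp [hs6]
    · exact hleF _ (((Nat.le_mul_of_pos_left _ hny1).trans eF.ge).trans hb5)
    · refine hle _ (((Nat.le_mul_of_pos_right _ hP1).trans eL.ge).trans ?_)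
      exact (Nat.le_mul_of_pos_right _ hR1).trans hb4
    · exact hleF _ (((Nat.le_mul_of_pos_right _ hP1).trans eF.ge).trans hb5)
    · refine hle _ (((Nat.le_mul_of_pos_right _ hP1).trans eR.ge).trans ?_)
      exact (Nat.le_mul_of_pos_left _ hL1).trans hb4
    · intro l hl f hf
      rw [← eL] at hl
      rw [← eF] at hf ⊢
      rw [hF' l hl f hf]
      exact hFβ i (by omega) k hk l hl f hf
    · intro f hf r hr
      rw [← eF] at hf
      rw [← eR] at hr ⊢
      rw [hG' f hf r hr]
      exact hGβ j (by omega) k hk f hf r hr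
    · simpa [hs6, hs5, hs4] using hb₃
    · rw [← hδ]
      have h1 : ((i : ℤ) + 1) * ((m + 1 : ℕ) * ((2 ^ m : ℕ) * δ)) ≤
          (m + 1 : ℕ) * ((m + 1 : ℕ) * ((2 ^ m : ℕ) * δ)) :=
        mul_le_mul_of_nonneg_right (by exact_mod_cast hi) (by positivity)
      have h2 : ((j : ℤ) + 1) * ((2 ^ m : ℕ) * δ) ≤ (m + 1 : ℕ) * ((2 ^ m : ℕ) * δ) :=
        mul_le_mul_of_nonneg_right (by exact_mod_cast (by omega)) (by positivity)
      have h3 : ((k : ℤ) + 1) * δ ≤ (2 ^ m : ℕ) * δ :=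
        mul_le_mul_of_nonneg_right (by exact_mod_cast hk) hδ0
      linarith
    · intro s' h _
      refine ⟨fun a => ?_, trivial⟩
      rw [h a, hT, ← eL, ← eR, ← eF]
      have : s₆.m .HH a = (s₃.setV .k k).m .HH a := by simp [hs6, hs5, hs4]
      rw [this, St.setV_m]
      congr 1
      refine sum_congr rfl fun l hl => sum_congr rfl fun r hr => ?_
      have hadr : ((((i + j) * 2 ^ m + k) * (SL * SR) : ℕ) : ℤ) + l * (SR : ℕ) + r =
          ((((i + j) * 2 ^ m + k) * (SL * SR) + (l * SR + r) : ℕ) : ℤ) := by push_cast; ring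
      rw [hadr]
      refine if_congr Iff.rfl (sum_congr rfl fun f hf => ?_) rfl
      rw [hF' l (mem_range.1 hl) f (mem_range.1 hf), hG' f (mem_range.1 hf) r (mem_range.1 hr)]
  · intro s' ⟨h, _⟩ _
    constructor
    · intro c hc
      rw [h, hH c hc, zero_add]
      refine abs_sum_range_le fun i hi => ?_
      have h1 : |∑ j ∈ range (m + 1 - i), ∑ k ∈ range (2 ^ m), T i j k c| ≤
          (m + 1 - i : ℕ) * ((2 ^ m : ℕ) * δ) :=
        abs_sum_range_le fun j hj => abs_sum_range_le fun k hk => hTδ i hi j hj k hk c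
      exact h1.trans (mul_le_mul_of_nonneg_right (by exact_mod_cast (by omega)) (by positivity))
    · intro h₀ hh0 k0 hk₀ l0 hl0 r0 hr₀
      rw [h, hH _ (hsub (hsub (by omega) hk₀) (hsub hl0 hr₀)), zero_add]
      have key : ∀ i < m + 1, ∀ j < m + 1 - i, ∀ k < 2 ^ m,
          T i j k (((h₀ * 2 ^ m + k0) * (SL * SR) + (l0 * SR + r0) : ℕ) : ℤ) =
          if k = k0 then (if i + j = h₀ then ∑ f ∈ range SF, F i k0 l0 f * G j k0 f r0 else 0)
            else 0 := by
        intro i hi j hj k hk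
        rw [hT]
        have hcond : ∀ l < SL, ∀ r < SR,
            ((((h₀ * 2 ^ m + k0) * (SL * SR) + (l0 * SR + r0) : ℕ) : ℤ) =
            ((((i + j) * 2 ^ m + k) * (SL * SR) + (l * SR + r) : ℕ) : ℤ)) ↔
            ((k = k0 ∧ i + j = h₀) ∧ l = l0) ∧ r = r0 := by
          intro l hl r hr
          rw [Nat.cast_inj, Nat.mul_add_eq_mul_add_iff (hsub hl0 hr₀) (hsub hl hr),
            Nat.mul_add_eq_mul_add_iff hk₀ hk, Nat.mul_add_eq_mul_add_iff hr₀ hr]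
          tauto
        by_cases hc : k = k0 ∧ i + j = h₀
        · rw [if_pos hc.1, if_pos hc.2]
          simp only
          rw [sum_eq_single l0, sum_eq_single r0]
          · rw [if_pos ((hcond _ hl0 _ hr₀).2 ⟨⟨hc, rfl⟩, rfl⟩), hc.1]
          · intro r hr hne
            rw [if_neg (fun h => hne ((hcond _ hl0 _ (mem_range.1 hr)).1 h).2)]
          · intro h; exact absurd (mem_range.2 hr₀) h
          · intro l hl hne
            refine sum_eq_zero fun r hr => ?_
            rw [if_neg (fun h => hne ((hcond _ (mem_range.1 hl) _ (mem_range.1 hr)).1 h).1.2)]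
          · intro h; exact absurd (mem_range.2 hl0) h
        · have : (if k = k0 then (if i + j = h₀ then ∑ f ∈ range SF, F i k0 l0 f * G j k0 f r0
            else 0) else 0) = 0 := by
            split_ifs with h1 h2
            · exact absurd ⟨h1, h2⟩ hc
            · rfl
            · rfl
          rw [this]
          refine sum_eq_zero fun l hl => sum_eq_zero fun r hr => ?_
          rw [if_neg (fun h => hc ((hcond _ (mem_range.1 hl) _ (mem_range.1 hr)).1 h).1.1)]
      have step : ∀ i ∈ range (m + 1), ∑ j ∈ range (m + 1 - i), ∑ k ∈ range (2 ^ m),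
          T i j k (((h₀ * 2 ^ m + k0) * (SL * SR) + (l0 * SR + r0) : ℕ) : ℤ) =
          if i < h₀ + 1 then ∑ f ∈ range SF, F i k0 l0 f * G (h₀ - i) k0 f r0 else 0 := by
        intro i hi
        have hi' := mem_range.1 hi
        have : ∀ j ∈ range (m + 1 - i), ∑ k ∈ range (2 ^ m),
            T i j k (((h₀ * 2 ^ m + k0) * (SL * SR) + (l0 * SR + r0) : ℕ) : ℤ) =
            if i + j = h₀ then ∑ f ∈ range SF, F i k0 l0 f * G j k0 f r0 else 0 := by
          intro j hj
          rw [sum_congr rfl fun k hk => key i hi' j (mem_range.1 hj) k (mem_range.1 hk),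
            sum_ite_eq' , if_pos (mem_range.2 hk₀)]
        rw [sum_congr rfl this]
        split_ifs with hih
        · rw [sum_eq_single (h₀ - i)]
          · rw [if_pos (by omega)]
          · intro j _ hj
            rw [if_neg (by omega)]
          · intro h
            exact absurd (mem_range.2 (by omega)) h
        · exact sum_eq_zero fun j _ => if_neg (by omega)
      rw [sum_congr rfl step, ← sum_filter]
      congr 1
      ext i
      simp only [mem_filter, mem_range]
      omega

/-! ### The program: the convolution of two tables -/

/-- Table sizes and block sizes. -/
def sizes : Code :=
  pow2 .si (vr .ni) ;; pow2 .sl (vr .nl) ;; pow2 .sf (vr .nf) ;; pow2 .sr (vr .nr) ;;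
  .set .sa (vr .si * (vr .sl * vr .sf)) ;;
  .set .sb (vr .si * (vr .sf * vr .sr)) ;;
  .set .so (vr .si * (vr .sl * vr .sr)) ;;
  .set .mn (vr .nl) ;;
  .ite (vr .mn - vr .nf) (.set .mn (vr .nf)) .skip ;;
  .ite (vr .mn - vr .nr) (.set .mn (vr .nr)) .skip ;;
  pow2 .pp (vr .mn) ;; pow2 .nx (vr .nl - vr .mn) ;; pow2 .ny (vr .nf - vr .mn) ;;
  pow2 .nz (vr .nr - vr .mn)

/-- The offsets and the ranks of the table entries. -/
def offsets : Code :=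
  build .OA 0 .WFA .nf .WLA .nl .WIA .ni ;;
  build .RA 0 .ZERO .nf .ZERO .nl .ONE .ni ;;
  build .OB (vr .tot) .WRB .nr .WFB .nf .WIB .ni ;;
  build .RB 0 .ZERO .nr .ZERO .nf .ONE .ni ;;
  build .RO 0 .ZERO .nr .ZERO .nl .ONE .ni

/-- The zeta transform of the ranked form of the table at `t`. -/
def transform (H O R : Arr) (sv t : Var) (e : Term) : Code :=
  fill H O R sv t ;; zeta H 1 e

/-- The product of the transforms and its inverse transform. -/
def combine : Code :=
  zero .HH ((vr .ni + 1) * vr .so) ;; products ;; zeta .HH (-1) (vr .sl * vr .sr)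

/-- The convolution of two tables. -/
def convolve : Code :=
  sizes ;; offsets ;; transform .FH .OA .RA .sa .ta (vr .sl * vr .sf) ;;
  transform .GH .OB .RB .sb .tb (vr .sf * vr .sr) ;; combine

/-- Sequencing, where the second command has the remaining time. -/
theorem Run.andThen {p q : Code} {t1 t : ℕ} {R Q : Store → Prop}
    (h : Run M mm p s t1 R) (h' : ∀ s', R s' → Frame p s s' → Run M mm q s' (t - t1) Q)
    (ht : t1 ≤ t := by omega) : Run M mm (p ;; q) s t Q :=
  h.seq' h' (by omega)

theorem Run.setThen {x : Var} {e : Term} {q : Code} {t : ℕ}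
    {Q : Store → Prop} (h : |e.eval s| ≤ M)
    (h' : Run M mm q (s.setV x (e.eval s)) (t - 1) Q) (ht : 1 ≤ t := by omega) : Run M mm (.set x e ;; q) s t Q :=
  (Run.set_seq h h').imp (by omega) fun _ h _ => h

theorem Run.putThen {a : Arr} {i e : Term} {q : Code} {t : ℕ}
    {Q : Store → Prop} (h : |e.eval s| ≤ M)
    (h' : Run M mm q (s.setM a (i.eval s) (e.eval s)) (t - 1) Q) (ht : 1 ≤ t := by omega) :
    Run M mm (.put a i e ;; q) s t Q :=
  (Run.put_seq h h').imp (by omega) fun _ h _ => h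

/-- The results of the program `sizes`. -/
structure Sizes (s : Store) (m nl nf nr : ℕ) : Prop where
  si : s.v .si = (2 ^ m : ℕ)
  sl : s.v .sl = (2 ^ nl : ℕ)
  sf : s.v .sf = (2 ^ nf : ℕ)
  sr : s.v .sr = (2 ^ nr : ℕ)
  sa : s.v .sa = (2 ^ m * (2 ^ nl * 2 ^ nf) : ℕ)
  sb : s.v .sb = (2 ^ m * (2 ^ nf * 2 ^ nr) : ℕ)
  so : s.v .so = (2 ^ m * (2 ^ nl * 2 ^ nr) : ℕ)
  pp : s.v .pp = (2 ^ min (min nl nf) nr : ℕ)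
  nx : s.v .nx = (2 ^ (nl - min (min nl nf) nr) : ℕ)
  ny : s.v .ny = (2 ^ (nf - min (min nl nf) nr) : ℕ)
  nz : s.v .nz = (2 ^ (nr - min (min nl nf) nr) : ℕ)

theorem Sizes.of_eq {s s' : Store} {m nl nf nr : ℕ} (h : Sizes s m nl nf nr)
    (hv : ∀ x ∈ [Var.si, .sl, .sf, .sr, .sa, .sb, .so, .pp, .nx, .ny, .nz], s'.v x = s.v x) :
    Sizes s' m nl nf nr := by
  simp [forall_eq_or_imp, forall_eq] at hv
  obtain ⟨h1, h2, h3, h4, h5, h6, h7, h8, h9, h10, h11⟩ := hv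
  exact ⟨h1 ▸ h.si, h2 ▸ h.sl, h3 ▸ h.sf, h4 ▸ h.sr, h5 ▸ h.sa, h6 ▸ h.sb, h7 ▸ h.so, h8 ▸ h.pp,
    h9 ▸ h.nx, h10 ▸ h.ny, h11 ▸ h.nz⟩

theorem run_sizes {m nl nf nr w : ℕ} (hni : s.v .ni = m) (hnl : s.v .nl = nl)
    (hnf : s.v .nf = nf) (hnr : s.v .nr = nr) (h₁ : nf + nl + m ≤ w) (h₂ : nr + nf + m ≤ w)
    (h₃ : nr + nl + m ≤ w) (hp : ∀ i ≤ w, ((2 ^ i : ℕ) : ℤ) ≤ M) :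
    Run M mm sizes s (20 * w + 40) (Sizes · m nl nf nr) := by
  have hw : (w : ℤ) ≤ M := le_trans (by exact_mod_cast Nat.lt_two_pow_self.le) (hp w le_rfl)
  refine Run.andThen (run_pow2 (k := m) (by decide) (by simp [hni]) (hp _ (by omega))) ?_
  intro s₁ h₁' hf1
  refine Run.andThen (run_pow2 (k := nl) (by decide)
    (by intro z; simp [hf1.v .nl, hnl]) (hp _ (by omega))) ?_
  intro s₂ h₂' hf2
  refine Run.andThen (run_pow2 (k := nf) (by decide)
    (by intro z; simp [hf2.v .nf, hf1.v .nf, hnf])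
    (hp _ (by omega))) ?_
  intro s₃ h3' hf3
  refine Run.andThen (run_pow2 (k := nr) (by decide)
    (by intro z; simp [hf3.v .nr, hf2.v .nr, hf1.v .nr, hnr])
    (hp _ (by omega))) ?_
  intro s₄ h4' hf4
  have e1 : s₄.v .si = (2 ^ m : ℕ) := by
    rw [hf4.v _, hf3.v _, hf2.v _, h₁']
  have e2 : s₄.v .sl = (2 ^ nl : ℕ) := by
    rw [hf4.v _, hf3.v _, h₂']
  have e3 : s₄.v .sf = (2 ^ nf : ℕ) := by rw [hf4.v _, h3']
  have e4 := h4'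
  have en : ∀ x ∈ [Var.nl, .nf, .nr], s₄.v x = s.v x := by
    intro x hx
    rw [hf4.vs (by decide) _ hx, hf3.vs (by decide) _ hx,
      hf2.vs (by decide) _ hx, hf1.vs (by decide) _ hx]
  have w1 : (vr .si * (vr .sl * vr .sf) : Term).eval s₄ =
      (2 ^ m * (2 ^ nl * 2 ^ nf) : ℕ) := by simp [e1, e2, e3]
  have w2 : ∀ z, (vr .si * (vr .sf * vr .sr) : Term).eval (s₄.setV .sa z) =
      (2 ^ m * (2 ^ nf * 2 ^ nr) : ℕ) := fun z => by simp [e1, e3, e4]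
  have w3 : ∀ z z', (vr .si * (vr .sl * vr .sr) : Term).eval
      ((s₄.setV .sa z).setV .sb z') = (2 ^ m * (2 ^ nl * 2 ^ nr) : ℕ) := fun z z' => by
    simp [e1, e2, e4]
  refine Run.setThen ?_ (Run.setThen ?_ (Run.setThen ?_
    (Run.setThen ?_ ?_)))
  · rw [w1, Nat.abs_cast, ← pow_add, ← pow_add]; exact hp _ (by omega)
  · rw [w2, Nat.abs_cast, ← pow_add, ← pow_add]; exact hp _ (by omega)
  · rw [w3, Nat.abs_cast, ← pow_add, ← pow_add]; exact hp _ (by omega)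
  · simp only [Ex.eval_var, ne_eq, reduceCtorEq, not_false_eq_true, St.setV_v_ne,
      en .nl (by decide), hnl, Nat.abs_cast]
    omega
  rw [w1, w2, w3]
  set s₅ := ((((s₄.setV .sa (2 ^ m * (2 ^ nl * 2 ^ nf) : ℕ)).setV .sb
    (2 ^ m * (2 ^ nf * 2 ^ nr) : ℕ)).setV .so (2 ^ m * (2 ^ nl * 2 ^ nr) : ℕ)).setV .mn
    ((vr .nl).eval (((s₄.setV .sa (2 ^ m * (2 ^ nl * 2 ^ nf) : ℕ)).setV .sb
    (2 ^ m * (2 ^ nf * 2 ^ nr) : ℕ)).setV .so (2 ^ m * (2 ^ nl * 2 ^ nr) : ℕ)))) with hs5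
  have m1 : s₅.v .mn = nl := by simp [hs5, en .nl (by decide), hnl]
  have m2 : s₅.v .nf = nf := by simp [hs5, en .nf (by decide), hnf]
  have m3 : s₅.v .nr = nr := by simp [hs5, en .nr (by decide), hnr]
  have m4 : s₅.v .nl = nl := by simp [hs5, en .nl (by decide), hnl]
  refine Run.andThen (R := fun s' => s'.v .mn = (min nl nf : ℕ))
    (Run.ite (t := 1) (fun h => Run.set ?_ ?_) (fun h => Run.imp (Run.skip (Q := fun s' =>
      s'.v .mn = (min nl nf : ℕ)) ?_) (by norm_num) fun _ h _ => h)) ?_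
  · simp only [Ex.eval_var, m2, Nat.abs_cast]; omega
  · simp only [Ex.eval_sub, Ex.eval_var, m1, m2] at h
    simp only [Ex.eval_var, m2, St.setV_v_self]
    omega
  · simp only [Ex.eval_sub, Ex.eval_var, m1, m2] at h
    rw [m1]; omega
  intro s₆ h₆ hf6
  have m3' : s₆.v .nr = nr := by rw [hf6.v _, m3]
  refine Run.andThen (R := fun s' => s'.v .mn = (min (min nl nf) nr : ℕ))
    (Run.ite (t := 1) (fun h => Run.set ?_ ?_) (fun h => Run.imp (Run.skip (Q := fun s' =>
      s'.v .mn = (min (min nl nf) nr : ℕ)) ?_) (by norm_num) fun _ h _ => h)) ?_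
  · simp only [Ex.eval_var, m3', Nat.abs_cast]; omega
  · simp only [Ex.eval_sub, Ex.eval_var, h₆, m3'] at h
    simp only [Ex.eval_var, m3', St.setV_v_self]
    omega
  · simp only [Ex.eval_sub, Ex.eval_var, h₆, m3'] at h
    rw [h₆]; omega
  intro s7 h₇ hf7
  refine Run.andThen (run_pow2 (k := min (min nl nf) nr) (by decide) (by simp [h₇])
    (hp _ (by omega))) ?_
  intro s8 h₈ hf8
  have k1 : s8.v .mn = (min (min nl nf) nr : ℕ) := by rw [hf8.v _, h₇]
  have k2 : s8.v .nl = nl := by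
    rw [hf8.v _, hf7.v _, hf6.v _, m4]
  have k3 : s8.v .nf = nf := by
    rw [hf8.v _, hf7.v _, hf6.v _, m2]
  have k4 : s8.v .nr = nr := by
    rw [hf8.v _, hf7.v _, hf6.v _, m3]
  refine Run.andThen (run_pow2 (k := nl - min (min nl nf) nr) (by decide) (fun z => by
    simp only [Ex.eval_sub, Ex.eval_var, ne_eq, reduceCtorEq, not_false_eq_true, St.setV_v_ne, k1,
      k2]; omega) (hp _ (by omega))) ?_
  intro s9 h₉ hf9
  refine Run.andThen (run_pow2 (k := nf - min (min nl nf) nr) (by decide) (fun z => by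
    simp only [Ex.eval_sub, Ex.eval_var, ne_eq, reduceCtorEq, not_false_eq_true, St.setV_v_ne,
      hf9.v .mn, hf9.v .nf, k1, k3]; omega) (hp _ (by omega))) ?_
  intro s10 h₁₀ hf10
  refine Run.imp (run_pow2 (k := nr - min (min nl nf) nr) (by decide) (fun z => by
    simp only [Ex.eval_sub, Ex.eval_var, ne_eq, reduceCtorEq, not_false_eq_true, St.setV_v_ne,
      hf10.v .mn, hf10.v .nr, hf9.v .mn,
      hf9.v .nr, k1, k4]; omega) (hp _ (by omega))) (by omega) ?_
  intro s11 h₁₁ hf11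
  have fin : ∀ x ∈ [Var.si, .sl, .sf, .sr, .sa, .sb, .so], s11.v x = s₅.v x := by
    intro x hx
    rw [hf11.vs (by decide) _ hx, hf10.vs (by decide) _ hx,
      hf9.vs (by decide) _ hx, hf8.vs (by decide) _ hx,
      hf7.vs (by decide) _ hx, hf6.vs (by decide) _ hx]
  constructor
  · rw [fin _ (by decide)]; simp [hs5, e1]
  · rw [fin _ (by decide)]; simp [hs5, e2]
  · rw [fin _ (by decide)]; simp [hs5, e3]
  · rw [fin _ (by decide)]; simp [hs5, e4]
  · rw [fin _ (by decide)]; simp [hs5]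
  · rw [fin _ (by decide)]; simp [hs5]
  · rw [fin _ (by decide)]; simp [hs5]
  · rw [hf11.v _, hf10.v _, hf9.v _, h₈]
  · rw [hf11.v _, hf10.v _, h₉]
  · rw [hf11.v _, h₁₀]
  · rw [h₁₁]

variable {V : Type*} [DecidableEq V]

/-- The input of a convolution: the vertices of the two tables are divided into the lists `lF` and
`lL`, `lI`, `lR`; a set of vertices has the position in a table that is given by the sum of the
weights of its elements. -/
structure ConvIn (s : Store) (lF lL lI lR : List V) (wA wB : V → ℤ) (fA gB : Finset V → ℤ) :
    Prop where
  nf : s.v .nf = lF.length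
  nl : s.v .nl = lL.length
  ni : s.v .ni = lI.length
  nr : s.v .nr = lR.length
  tot : s.v .tot = ∑ v ∈ lF.toFinset, wB v
  WFA : ∀ (b : ℕ) (h : b < lF.length), s.m .WFA b = wA lF[b]
  WLA : ∀ (b : ℕ) (h : b < lL.length), s.m .WLA b = wA lL[b]
  WIA : ∀ (b : ℕ) (h : b < lI.length), s.m .WIA b = wA lI[b]
  WFB : ∀ (b : ℕ) (h : b < lF.length), s.m .WFB b = -wB lF[b]
  WRB : ∀ (b : ℕ) (h : b < lR.length), s.m .WRB b = wB lR[b]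
  WIB : ∀ (b : ℕ) (h : b < lI.length), s.m .WIB b = wB lI[b]
  ONE : ∀ b : ℕ, b < lI.length → s.m .ONE b = 1
  ZERO : ∀ b : ℕ, s.m .ZERO b = 0
  tabA : ∀ S ⊆ lF.toFinset ∪ lL.toFinset ∪ lI.toFinset,
    s.m .TAB (s.v .ta + ∑ v ∈ S, wA v) = fA S
  tabB : ∀ S ⊆ lR.toFinset ∪ lF.toFinset ∪ lI.toFinset,
    s.m .TAB (s.v .tb + ∑ v ∈ S, wB v) = gB S

theorem ConvIn.of_eq {s s' : Store} {lF lL lI lR : List V} {wA wB : V → ℤ}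
    {fA gB : Finset V → ℤ} (h : ConvIn s lF lL lI lR wA wB fA gB)
    (hv : ∀ x ∈ [Var.nf, .nl, .ni, .nr, .tot, .ta, .tb], s'.v x = s.v x)
    (hm : ∀ a ∈ [Arr.WFA, .WLA, .WIA, .WFB, .WRB, .WIB, .ONE, .ZERO, .TAB], s'.m a = s.m a) :
    ConvIn s' lF lL lI lR wA wB fA gB := by
  simp only [List.mem_cons, List.not_mem_nil, or_false, forall_eq_or_imp, forall_eq] at hv hm
  obtain ⟨h1, h2, h3, h4, h5, h6, h7⟩ := hv
  obtain ⟨g1, g2, g3, g4, g5, g6, g7, g8, g9⟩ := hm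
  exact ⟨h1 ▸ h.nf, h2 ▸ h.nl, h3 ▸ h.ni, h4 ▸ h.nr, h5 ▸ h.tot, g1 ▸ h.WFA, g2 ▸ h.WLA,
    g3 ▸ h.WIA, g4 ▸ h.WFB, g5 ▸ h.WRB, g6 ▸ h.WIB, g7 ▸ h.ONE, g8 ▸ h.ZERO,
    by rw [g9, h6]; exact h.tabA, by rw [g9, h7]; exact h.tabB⟩

/-- The results of the program `offsets`. -/
structure Offsets (s : Store) (lF lL lI lR : List V) (wA wB : V → ℤ) : Prop where
  OA : ∀ q : ℕ, q < 2 ^ (lF ++ lL ++ lI).length →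
    s.m .OA q = ∑ v ∈ sub (lF ++ lL ++ lI) q, wA v
  RA : ∀ q : ℕ, q < 2 ^ (lF ++ lL ++ lI).length →
    s.m .RA q = (#(sub (lF ++ lL ++ lI) q ∩ lI.toFinset) : ℕ)
  OB : ∀ q : ℕ, q < 2 ^ (lR ++ lF ++ lI).length →
    s.m .OB q = ∑ v ∈ lF.toFinset, wB v + ∑ v ∈ sub (lR ++ lF ++ lI) q,
      if v ∈ lF then -wB v else wB v
  RB : ∀ q : ℕ, q < 2 ^ (lR ++ lF ++ lI).length →
    s.m .RB q = (#(sub (lR ++ lF ++ lI) q ∩ lI.toFinset) : ℕ)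
  RO : ∀ q : ℕ, q < 2 ^ (lR ++ lL ++ lI).length →
    s.m .RO q = (#(sub (lR ++ lL ++ lI) q ∩ lI.toFinset) : ℕ)

theorem Offsets.of_eq {s s' : Store} {lF lL lI lR : List V} {wA wB : V → ℤ}
    (h : Offsets s lF lL lI lR wA wB)
    (hm : ∀ a ∈ [Arr.OA, .RA, .OB, .RB, .RO], s'.m a = s.m a) :
    Offsets s' lF lL lI lR wA wB := by
  simp only [List.mem_cons, List.not_mem_nil, or_false, forall_eq_or_imp, forall_eq] at hm
  obtain ⟨h1, h2, h3, h4, h5⟩ := hm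
  exact ⟨h1 ▸ h.OA, h2 ▸ h.RA, h3 ▸ h.OB, h4 ▸ h.RB, h5 ▸ h.RO⟩

theorem run_build_sub {O W1 W2 W3 : Arr} {x₁ x₂ x₃ : Var} {e : Term}
    {l1 l2 l3 : List V} {f : V → ℤ} {w : ℕ}
    (hl : (l1 ++ l2 ++ l3).Nodup) (hw : (l1 ++ l2 ++ l3).length ≤ w)
    (hO : O ∉ [W1, W2, W3]) (hv : ∀ l ∈ [x₁, x₂, x₃], l ∉ [Var.b, .j, .sz])
    (h₁ : s.v x₁ = l1.length) (h₂ : s.v x₂ = l2.length) (h₃ : s.v x₃ = l3.length)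
    (hW1 : ∀ (b : ℕ) (h : b < l1.length), s.m W1 b = f l1[b])
    (hW2 : ∀ (b : ℕ) (h : b < l2.length), s.m W2 b = f l2[b])
    (hW3 : ∀ (b : ℕ) (h : b < l3.length), s.m W3 b = f l3[b])
    (hM : ((2 ^ w : ℕ) : ℤ) ≤ M)
    (hb : ∀ S ⊆ (l1 ++ l2 ++ l3).toFinset, |e.eval s + ∑ v ∈ S, f v| ≤ M) :
    Run M mm (build O e W1 x₁ W2 x₂ W3 x₃) s (w * (2 * 2 ^ w + 3) + 5) fun s' =>
      ∀ q : ℕ, q < 2 ^ (l1 ++ l2 ++ l3).length →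
        s'.m O q = e.eval s + ∑ v ∈ sub (l1 ++ l2 ++ l3) q, f v := by
  have hlen : (l1.map f ++ l2.map f ++ l3.map f).length = (l1 ++ l2 ++ l3).length := by simp
  have hmap : l1.map f ++ l2.map f ++ l3.map f = (l1 ++ l2 ++ l3).map f := by simp
  have hpw : (2 : ℕ) ^ (l1 ++ l2 ++ l3).length ≤ 2 ^ w := Nat.pow_le_pow_right (by norm_num) hw
  refine (run_build (w₁ := l1.map f) (w₂ := l2.map f) (w₃ := l3.map f) hO hv (by simpa using h₁)
    (by simpa using h₂) (by simpa using h₃) (fun b h => ?_) (fun b h => ?_) (fun b h => ?_)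
    (le_trans ?_ hM) ?_).imp ?_ ?_
  · simpa using hW1 b (by simpa using h)
  · simpa using hW2 b (by simpa using h)
  · simpa using hW3 b (by simpa using h)
  · rw [hlen]; exact_mod_cast hpw
  · intro q _
    rw [hmap, lsum_map hl]
    exact hb _ (sub_subset _ _)
  · rw [hlen]
    gcongr
  · intro s' h _ q hq
    rw [h.2 q (by rwa [hlen]), hmap, lsum_map hl]

theorem run_offsets {lF lL lI lR : List V} {wA wB : V → ℤ}
    {fA gB : Finset V → ℤ} {w : ℕ} (h : ConvIn s lF lL lI lR wA wB fA gB)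
    (hA : (lF ++ lL ++ lI).Nodup) (hB : (lR ++ lF ++ lI).Nodup) (hO : (lR ++ lL ++ lI).Nodup)
    (hAw : (lF ++ lL ++ lI).length ≤ w) (hBw : (lR ++ lF ++ lI).length ≤ w)
    (hOw : (lR ++ lL ++ lI).length ≤ w) (hM : ((2 ^ w : ℕ) : ℤ) ≤ M)
    (hwA : ∀ S ⊆ (lF ++ lL ++ lI).toFinset, |∑ v ∈ S, wA v| ≤ M)
    (hwB : ∀ S ⊆ (lR ++ lF ++ lI).toFinset, |∑ v ∈ S, wB v| ≤ M) :
    Run M mm offsets s (5 * (w * (2 * 2 ^ w + 3) + 5)) fun s' =>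
      Offsets s' lF lL lI lR wA wB := by
  have hrank : ∀ (l : List V), l.length ≤ w → ∀ S ⊆ l.toFinset,
      |(0 : ℤ) + ∑ v ∈ S, if v ∈ lI then 1 else 0| ≤ M := by
    intro l hl S hS
    rw [zero_add, ← sum_filter, sum_const, nsmul_one, Nat.abs_cast]
    refine le_trans ?_ hM
    have := (card_filter_le S (· ∈ lI)).trans ((card_le_card hS).trans (List.toFinset_card_le l))
    have := Nat.lt_two_pow_self (n := w)
    exact_mod_cast (by omega : #{v ∈ S | v ∈ lI} ≤ 2 ^ w)
  have hcard : ∀ S : Finset V, (∑ v ∈ S, if v ∈ lI then (1 : ℤ) else 0) =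
      (#(S ∩ lI.toFinset) : ℕ) := by
    intro S
    rw [← sum_filter, sum_const, nsmul_one, ← filter_mem_eq_inter]
    simp
  have dFI : ∀ (b : ℕ) (h : b < lF.length), lF[b] ∉ lI := fun b h h' =>
    List.disjoint_of_nodup_append hA (List.mem_append_left _ (List.getElem_mem h)) h'
  have dLI : ∀ (b : ℕ) (h : b < lL.length), lL[b] ∉ lI := fun b h h' =>
    List.disjoint_of_nodup_append hA (List.mem_append_right _ (List.getElem_mem h)) h'
  have dRI : ∀ (b : ℕ) (h : b < lR.length), lR[b] ∉ lI := fun b h h' =>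
    List.disjoint_of_nodup_append hB (List.mem_append_left _ (List.getElem_mem h)) h'
  have dRF : ∀ (b : ℕ) (h : b < lR.length), lR[b] ∉ lF := fun b h h' =>
    List.disjoint_of_nodup_append (List.nodup_append.1 hB).1 (List.getElem_mem h) h'
  have dIF : ∀ (b : ℕ) (h : b < lI.length), lI[b] ∉ lF := fun b h h' =>
    List.disjoint_of_nodup_append hA (List.mem_append_left _ h') (List.getElem_mem h)
  have hc : 5 * (w * (2 * 2 ^ w + 3) + 5) = (w * (2 * 2 ^ w + 3) + 5) +
      ((w * (2 * 2 ^ w + 3) + 5) + ((w * (2 * 2 ^ w + 3) + 5) +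
      ((w * (2 * 2 ^ w + 3) + 5) + (w * (2 * 2 ^ w + 3) + 5)))) := by ring
  rw [hc]
  refine Run.seq' (run_build_sub (f := wA) hA hAw (by decide) (by decide) h.nf h.nl h.ni
    h.WFA h.WLA h.WIA hM (fun S hS => by simpa using hwA S hS)) ?_ le_rfl
  intro s₁ h₁ hf1
  have c₁ := h.of_eq (hf1.vs)
    (hf1.ms)
  refine Run.seq' (run_build_sub (f := fun v => if v ∈ lI then 1 else 0) hA hAw (by decide)
    (by decide) c₁.nf c₁.nl c₁.ni (fun b hb => by simp [c₁.ZERO, dFI b hb])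
    (fun b hb => by simp [c₁.ZERO, dLI b hb]) (fun b hb => by simp [c₁.ONE b hb]) hM
    (hrank _ hAw)) ?_ le_rfl
  intro s₂ h₂ hf2
  have c₂ := c₁.of_eq (hf2.vs)
    (hf2.ms)
  refine Run.seq' (run_build_sub (f := fun v => if v ∈ lF then -wB v else wB v) hB hBw (by decide)
    (by decide) c₂.nr c₂.nf c₂.ni (fun b hb => by simp [c₂.WRB b hb, dRF b hb])
    (fun b hb => by simp [c₂.WFB b hb]) (fun b hb => by simp [c₂.WIB b hb, dIF b hb]) hM ?_)
    ?_ le_rfl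
  · intro S hS
    have : (vr .tot).eval s₂ + (∑ v ∈ S, if v ∈ lF then -wB v else wB v) =
        ∑ v ∈ (lF.toFinset \ S) ∪ (S \ lF.toFinset), wB v := by
      rw [Ex.eval_var, c₂.tot, sum_union (disjoint_sdiff_sdiff)]
      have e1 : ∑ v ∈ lF.toFinset, wB v = ∑ v ∈ lF.toFinset \ S, wB v +
          ∑ v ∈ S ∩ lF.toFinset, wB v := by
        rw [inter_comm, add_comm, sum_inter_add_sum_sdiff]
      have e2 : (∑ v ∈ S, if v ∈ lF then -wB v else wB v) = ∑ v ∈ S \ lF.toFinset, wB v -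
          ∑ v ∈ S ∩ lF.toFinset, wB v := by
        rw [← sum_inter_add_sum_sdiff S lF.toFinset, add_comm, sub_eq_add_neg, ← sum_neg_distrib]
        congr 1
        · refine sum_congr rfl fun v hv => ?_
          rw [if_neg (by simpa using (mem_sdiff.1 hv).2)]
        · refine sum_congr rfl fun v hv => ?_
          rw [if_pos (by simpa using (mem_inter.1 hv).2)]
      rw [e1, e2]; ring
    rw [this]
    refine hwB _ (union_subset (sdiff_subset.trans ?_) (sdiff_subset.trans hS))
    intro v hv
    simp only [List.toFinset_append, mem_union]
    exact Or.inl (Or.inr hv)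
  intro s₃ h₃ hf3
  have c₃ := c₂.of_eq (hf3.vs)
    (hf3.ms)
  refine Run.seq' (run_build_sub (f := fun v => if v ∈ lI then 1 else 0) hB hBw (by decide)
    (by decide) c₃.nr c₃.nf c₃.ni (fun b hb => by simp [c₃.ZERO, dRI b hb])
    (fun b hb => by simp [c₃.ZERO, dFI b hb]) (fun b hb => by simp [c₃.ONE b hb]) hM
    (hrank _ hBw)) ?_ le_rfl
  intro s₄ h₄ hf4
  have c4 := c₃.of_eq (hf4.vs)
    (hf4.ms)
  refine Run.imp (run_build_sub (f := fun v => if v ∈ lI then 1 else 0) hO hOw (by decide)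
    (by decide) c4.nr c4.nl c4.ni (fun b hb => by simp [c4.ZERO, dRI b hb])
    (fun b hb => by simp [c4.ZERO, dLI b hb]) (fun b hb => by simp [c4.ONE b hb]) hM
    (hrank _ hOw)) le_rfl ?_
  intro s₅ h₅ hf5
  refine ⟨fun q hq => ?_, fun q hq => ?_, fun q hq => ?_, fun q hq => ?_, fun q hq => ?_⟩
  · rw [hf5.m _, hf4.m _, hf3.m _, hf2.m _, h₁ q hq]
    simp
  · rw [hf5.m _, hf4.m _, hf3.m _, h₂ q hq, hcard]
    simp
  · rw [hf5.m _, hf4.m _, h₃ q hq, Ex.eval_var, c₂.tot]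
  · rw [hf5.m _, h₄ q hq, hcard]
    simp
  · rw [h₅ q hq, hcard]
    simp

end RAM

namespace MatchCount

open Finset

variable {V : Type*} [DecidableEq V]

theorem zp_sum {ι : Type*} (s : Finset ι) (σ : ℤ) (P : Finset V) (g : ι → Finset V → ℤ)
    (A : Finset V) : zp σ P (fun B => ∑ i ∈ s, g i B) A = ∑ i ∈ s, zp σ P (g i) A := by
  simp only [zp, mul_sum]
  exact sum_comm

theorem sub_append₃ {l1 l2 l3 : List V} (hl : (l1 ++ l2 ++ l3).Nodup) {x y z : ℕ}
    (hx : x < 2 ^ l1.length) (hy : y < 2 ^ l2.length) :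
    sub (l1 ++ l2 ++ l3) (z * (2 ^ l2.length * 2 ^ l1.length) + (y * 2 ^ l1.length + x)) =
      sub l1 x ∪ sub l2 y ∪ sub l3 z := by
  have h1 : z * (2 ^ l2.length * 2 ^ l1.length) + (y * 2 ^ l1.length + x) =
      2 ^ (l1 ++ l2).length * z + (2 ^ l1.length * y + x) := by
    rw [List.length_append, pow_add]; ring
  have h2 : 2 ^ l1.length * y + x < 2 ^ (l1 ++ l2).length := by
    rw [List.length_append, pow_add]
    calc _ < 2 ^ l1.length * y + 2 ^ l1.length := by omega
      _ = 2 ^ l1.length * (y + 1) := by ring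
      _ ≤ _ := Nat.mul_le_mul_left _ hy
  rw [h1, sub_append hl h2, sub_append (List.nodup_append.1 hl).1 hx]

theorem two_pow_length₃ (l1 l2 l3 : List V) :
    2 ^ (l1 ++ l2 ++ l3).length = 2 ^ l3.length * (2 ^ l2.length * 2 ^ l1.length) := by
  rw [List.length_append, List.length_append, pow_add, pow_add]; ring

end MatchCount

namespace RAM

open Finset MatchCount

variable {M : ℤ} {mm : ℕ → ℕ} {V : Type*} [DecidableEq V] {s : Store}

theorem run_transform {H O R : Arr} {sv t : Var} {e : Term}
    {l1 l2 l3 : List V} {F : Finset V → ℤ} {μ : ℤ} {w : ℕ}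
    (hl : (l1 ++ l2 ++ l3).Nodup) (hH : H ∉ [O, R, .TAB]) (hsv : sv ≠ .i) (ht : t ≠ .i)
    (hS : s.v sv = (2 ^ l3.length * (2 ^ l2.length * 2 ^ l1.length) : ℕ))
    (he : ∀ s' : Store, (∀ x, x ≠ .i → s'.v x = s.v x) →
      e.eval s' = (2 ^ l2.length * 2 ^ l1.length : ℕ))
    (hni : s.v .ni = l3.length) (hsi : s.v .si = (2 ^ l3.length : ℕ))
    (hT : ∀ q : ℕ, q < 2 ^ (l1 ++ l2 ++ l3).length →
      s.m .TAB (s.v t + s.m O q) = F (sub (l1 ++ l2 ++ l3) q))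
    (hR : ∀ q : ℕ, q < 2 ^ (l1 ++ l2 ++ l3).length →
      s.m R q = (#(sub (l1 ++ l2 ++ l3) q ∩ l3.toFinset) : ℕ))
    (hF : ∀ S, |F S| ≤ μ) (hTM : ∀ a, |s.m .TAB a| ≤ M)
    (hlw : (l1 ++ l2 ++ l3).length ≤ w) (hM₁ : (2 ^ (2 * w) : ℤ) ≤ M) (hM₂ : 2 ^ w * μ ≤ M) :
    Run M mm (transform H O R sv t e) s (15 * (w + 1) ^ 2 * 2 ^ w) fun s' =>
      ∀ i ≤ l3.length, ∀ k < 2 ^ l3.length, ∀ y < 2 ^ l2.length, ∀ x < 2 ^ l1.length,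
        s'.m H (((i * 2 ^ l3.length + k) * (2 ^ l2.length * 2 ^ l1.length) +
          (y * 2 ^ l1.length + x) : ℕ) : ℤ) = zp 1 l3.toFinset
            (fun B => if #B = i then F (sub l1 x ∪ sub l2 y ∪ B) else 0) (sub l3 k) := by
  have hμ : 0 ≤ μ := (abs_nonneg _).trans (hF ∅)
  have hp3 := two_pow_length₃ l1 l2 l3
  have hpw : 2 ^ (l1 ++ l2 ++ l3).length ≤ 2 ^ w := Nat.pow_le_pow_right (by norm_num) hlw
  obtain ⟨m, hm⟩ : ∃ m, m = l3.length := ⟨_, rfl⟩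
  obtain ⟨Y, hY⟩ : ∃ Y, Y = 2 ^ l2.length := ⟨_, rfl⟩
  obtain ⟨X, hX⟩ : ∃ X, X = 2 ^ l1.length := ⟨_, rfl⟩
  have hm3 : m ≤ w := by
    rw [hm]; refine le_trans ?_ hlw; simp only [List.length_append]; omega
  have hmd : ∀ q < 2 ^ m * (Y * X), ∃ z < 2 ^ m, ∃ y < Y, ∃ x < X, q = z * (Y * X) + (y * X + x) := by
    intro q hq
    have hX0 : 0 < X := by rw [hX]; positivity
    have hY0 : 0 < Y := by rw [hY]; positivity
    refine ⟨q / (Y * X), (Nat.div_lt_iff_lt_mul (by positivity)).2 hq, q % (Y * X) / X,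
      (Nat.div_lt_iff_lt_mul hX0).2 (Nat.mod_lt _ (by positivity)), q % (Y * X) % X,
      Nat.mod_lt _ hX0, ?_⟩
    have h1 := Nat.div_add_mod q (Y * X)
    have h2 := Nat.div_add_mod (q % (Y * X)) X
    rw [mul_comm (q % (Y * X) / X), h2, mul_comm (q / (Y * X)), h1]
  have hlt : ∀ {A B C D : ℕ}, A < B → C < D → A * D + C < B * D := fun {A B C D} h h' => by
    calc A * D + C < A * D + D := by omega
      _ = (A + 1) * D := by ring
      _ ≤ _ := Nat.mul_le_mul_right _ h
  have hsub : ∀ z < 2 ^ m, ∀ y < Y, ∀ x < X, sub (l1 ++ l2 ++ l3) (z * (Y * X) + (y * X + x)) =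
      sub l1 x ∪ sub l2 y ∪ sub l3 z := by
    intro z _ y hy x hx
    rw [hY, hX]
    exact sub_append₃ hl (hX ▸ hx) (hY ▸ hy)
  have hint : ∀ z x y, (sub l1 x ∪ sub l2 y ∪ sub l3 z) ∩ l3.toFinset = sub l3 z := by
    intro z x y
    have hd := List.disjoint_of_nodup_append hl
    rw [union_inter_distrib_right, inter_eq_left.2 (sub_subset l3 z)]
    refine union_eq_right.2 fun v hv => ?_
    rw [mem_inter, mem_union, MatchCount.mem_sub, MatchCount.mem_sub, List.mem_toFinset] at hv
    exact absurd hv.2 (hd (List.mem_append.2 (hv.1.imp And.left And.left)))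
  rw [← hm] at hS hni hsi hp3 ⊢
  rw [← hY, ← hX] at hS hp3 ⊢
  rw [← hY, ← hX] at he
  rw [hp3] at hT hR hpw
  have hm1w : (m + 1) * (2 ^ m * (Y * X)) ≤ (w + 1) * 2 ^ w := Nat.mul_le_mul (by omega) hpw
  have hwM : (((m + 1) * (2 ^ m * (Y * X)) : ℕ) : ℤ) ≤ M := by
    refine le_trans ?_ hM₁
    have : (w + 1) * 2 ^ w ≤ 2 ^ (2 * w) := by
      rw [two_mul, pow_add]
      exact Nat.mul_le_mul_right _ Nat.lt_two_pow_self
    exact_mod_cast hm1w.trans this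
  have hYX : 1 ≤ Y * X := by rw [hY, hX]; exact Nat.mul_pos (by positivity) (by positivity)
  refine Run.seq' (run_fill (S := 2 ^ m * (Y * X)) (ni := m)
    (ρ := fun q => #(sub (l1 ++ l2 ++ l3) q ∩ l3.toFinset)) hH hsv ht hS hni hwM hR hTM) ?_
    (t2 := m * (2 * ((m + 1) * (2 ^ m * (Y * X))) + 4) + 3) ?_
  rotate_left
  · have h2w : 1 ≤ 2 ^ w := Nat.one_le_two_pow
    have h1 : (w + 1) * 2 ^ w ≤ (w + 1) ^ 2 * 2 ^ w :=
      Nat.mul_le_mul_right _ (by nlinarith)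
    have h2 : m * (2 * ((m + 1) * (2 ^ m * (Y * X))) + 4) ≤ w * (2 * ((w + 1) * 2 ^ w) + 4) :=
      Nat.mul_le_mul hm3 (by omega)
    have h3 : w * (2 * ((w + 1) * 2 ^ w)) ≤ 2 * ((w + 1) ^ 2 * 2 ^ w) := by nlinarith
    have h4 : w + 1 ≤ (w + 1) * 2 ^ w := Nat.le_mul_of_pos_right _ h2w
    rw [mul_assoc]
    have h5 : w * (2 * ((w + 1) * 2 ^ w) + 4) = w * (2 * ((w + 1) * 2 ^ w)) + 4 * w := by ring
    omega
  intro s₁ h₁ hf1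
  have ev : ∀ x, x ≠ .i → s₁.v x = s.v x := fun x hx =>
    hf1.1 x (by simp [fill, zero, Cmd.wv, hx])
  refine (run_zeta (l := l3) (Bk := Y * X) (β := μ) (g := fun i x B => if #B = i then
      F (sub l1 (x % X) ∪ sub l2 (x / X) ∪ B) else 0) (by norm_num)
    (List.nodup_append.1 hl).2.1 (he s₁ ev) hYX (by rw [ev _ (by decide), hni, hm])
    (by rw [ev _ (by decide), hsi, hm]) ?_ ?_ hμ ?_ ?_).imp ?_ ?_
  · rw [← hm, mul_assoc]; exact hwM
  · rw [← hm]
    refine le_trans (mul_le_mul_of_nonneg_right ?_ hμ) hM₂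
    exact pow_le_pow_right₀ (by norm_num) hm3
  · intro c hc
    rw [← hm, mul_assoc] at hc
    have hpos : 0 < 2 ^ m * (Y * X) := by positivity
    have hr : c / (2 ^ m * (Y * X)) < m + 1 := (Nat.div_lt_iff_lt_mul hpos).2 hc
    have hq := Nat.mod_lt c hpos
    have := h₁ _ (by omega : c / (2 ^ m * (Y * X)) ≤ m) _ hq
    rw [mul_comm (c / _), Nat.div_add_mod] at this
    rw [this]
    split_ifs
    · rw [hT _ hq]; exact hF _
    · simpa using hμ
  · intro r hr a ha x hx
    rw [← hm] at hr ha ⊢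
    have hX0 : 0 < X := by rw [hX]; positivity
    have hxd := Nat.div_add_mod x X
    have hx1 : x / X < Y := (Nat.div_lt_iff_lt_mul hX0).2 hx
    have hx2 := Nat.mod_lt x hX0
    have haddr : (r * 2 ^ m + a) * (Y * X) + x = r * (2 ^ m * (Y * X)) +
        (a * (Y * X) + (x / X * X + x % X)) := by
      rw [mul_comm (x / X), hxd]; ring
    have hq : a * (Y * X) + (x / X * X + x % X) < 2 ^ m * (Y * X) := hlt ha (hlt hx1 hx2)
    rw [haddr, h₁ r hr _ hq, hT _ hq, hsub _ ha _ hx1 _ hx2, hint]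
  · rw [← hm, mul_assoc (m + 1)]
  · intro s' h _ i hi k hk y hy x hx
    rw [hm] at hi hk
    have := h.2 i hi k hk (y * X + x) (hlt hy hx)
    have h1 : (y * X + x) % X = x := by
      rw [mul_comm, Nat.mul_add_mod, Nat.mod_eq_of_lt hx]
    have h2 : (y * X + x) / X = y := by
      rw [mul_comm, Nat.mul_add_div (by omega), Nat.div_eq_of_lt hx, add_zero]
    rw [h1, h2, ← hm] at this
    exact this

/-- The number of steps for the products in a convolution. -/
def convCost (mm : ℕ → ℕ) (m nl nf nr : ℕ) : ℕ :=
  productsCost mm m (2 ^ min (min nl nf) nr) (2 ^ (nl - min (min nl nf) nr))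
    (2 ^ (nf - min (min nl nf) nr)) (2 ^ (nr - min (min nl nf) nr))

theorem run_combine {lI : List V} {m nl nf nr w : ℕ} {μ : ℤ}
    {gF gG : ℕ → ℕ → ℕ → Finset V → ℤ} (hnd : lI.Nodup) (hm : m = lI.length)
    (hs : Sizes s m nl nf nr) (hni : s.v .ni = m)
    (hAw : nf + nl + m ≤ w) (hBw : nr + nf + m ≤ w)
    (hOw : nr + nl + m ≤ w) (hμ : 1 ≤ μ) (hM : 2 ^ (10 * w) * μ ^ 2 ≤ M)
    (hF : ∀ i ≤ m, ∀ k < 2 ^ m, ∀ l < 2 ^ nl, ∀ f < 2 ^ nf,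
      s.m .FH (((i * 2 ^ m + k) * (2 ^ nl * 2 ^ nf) +
        (l * 2 ^ nf + f) : ℕ) : ℤ) = zp 1 lI.toFinset (gF i l f) (sub lI k))
    (hG : ∀ i ≤ m, ∀ k < 2 ^ m, ∀ f < 2 ^ nf, ∀ r < 2 ^ nr,
      s.m .GH (((i * 2 ^ m + k) * (2 ^ nf * 2 ^ nr) +
        (f * 2 ^ nr + r) : ℕ) : ℤ) = zp 1 lI.toFinset (gG i f r) (sub lI k))
    (hFμ : ∀ i l f B, |gF i l f B| ≤ μ) (hGμ : ∀ i f r B, |gG i f r B| ≤ μ) :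
    Run M mm combine s (convCost mm m nl nf nr +
        11 * (w + 1) ^ 2 * 2 ^ w) fun s' =>
      ∀ h ≤ m, ∀ k < 2 ^ m, ∀ l < 2 ^ nl, ∀ r < 2 ^ nr,
        s'.m .HH (((h * 2 ^ m + k) * (2 ^ nl * 2 ^ nr) +
          (l * 2 ^ nr + r) : ℕ) : ℤ) = zp (-1) lI.toFinset (fun B =>
            ∑ i ∈ range (h + 1), ∑ f ∈ range (2 ^ nf),
              zp 1 lI.toFinset (gF i l f) B * zp 1 lI.toFinset (gG (h - i) f r) B) (sub lI k) := by
  obtain ⟨p, hp⟩ : ∃ p, p = min (min nl nf) nr := ⟨_, rfl⟩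
  have hw2 : ∀ {a b : ℕ}, a ≤ b → (2 : ℕ) ^ a ≤ 2 ^ b := fun {a b} h =>
    Nat.pow_le_pow_right (by norm_num) h
  have hm1 : m + 1 ≤ 2 ^ w := (by omega : m + 1 ≤ w + 1).trans Nat.lt_two_pow_self
  have hpL : 2 ^ m * (2 ^ nl * 2 ^ nf) ≤ 2 ^ w := by
    rw [← pow_add, ← pow_add]; exact hw2 (by omega)
  have hpR : 2 ^ m * (2 ^ nf * 2 ^ nr) ≤ 2 ^ w := by
    rw [← pow_add, ← pow_add]; exact hw2 (by omega)
  have hpO : 2 ^ m * (2 ^ nl * 2 ^ nr) ≤ 2 ^ w := by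
    rw [← pow_add, ← pow_add]; exact hw2 (by omega)
  have hle : ∀ {x : ℕ}, x ≤ 2 ^ w → (((m + 1) * x : ℕ) : ℤ) ≤ M := by
    intro x hx
    have h1 : (m + 1) * x ≤ 2 ^ (10 * w) :=
      (Nat.mul_le_mul hm1 hx).trans (by rw [← pow_add]; exact hw2 (by omega))
    have h2 : (2 : ℤ) ^ (10 * w) ≤ 2 ^ (10 * w) * μ ^ 2 :=
      le_mul_of_one_le_right (by positivity) (one_le_pow₀ hμ)
    have h3 : (((m + 1) * x : ℕ) : ℤ) ≤ 2 ^ (10 * w) := by exact_mod_cast h1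
    exact h3.trans (h2.trans hM)
  have hbound : ((m + 1 : ℕ) : ℤ) * ((m + 1 : ℕ) * ((2 ^ m : ℕ) * ((2 ^ (nl - p) : ℕ) *
      ((2 ^ (nr - p) : ℕ) * ((2 ^ (nf - p) : ℕ) * ((2 ^ p : ℕ) * ((2 ^ p : ℕ) * ((2 ^ p : ℕ) *
        (2 ^ m * μ) ^ 2)))))))) ≤ 2 ^ (8 * w) * μ ^ 2 := by
    have e1 : ((m + 1 : ℕ) : ℤ) * ((m + 1 : ℕ) * ((2 ^ m : ℕ) * ((2 ^ (nl - p) : ℕ) *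
      ((2 ^ (nr - p) : ℕ) * ((2 ^ (nf - p) : ℕ) * ((2 ^ p : ℕ) * ((2 ^ p : ℕ) * ((2 ^ p : ℕ) *
        (2 ^ m * μ) ^ 2)))))))) = (((m + 1) * (m + 1) * 2 ^ (m + (nl - p) + (nr - p) + (nf - p) +
          p + p + p + m + m) : ℕ) : ℤ) * μ ^ 2 := by
      simp only [pow_add]; push_cast; ring
    rw [e1]
    refine mul_le_mul_of_nonneg_right ?_ (by positivity)
    have h1 : (m + 1) * (m + 1) * 2 ^ (m + (nl - p) + (nr - p) + (nf - p) +
          p + p + p + m + m) ≤ 2 ^ w * 2 ^ w * 2 ^ (6 * w) :=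
      Nat.mul_le_mul (Nat.mul_le_mul hm1 hm1) (hw2 (by omega))
    rw [← pow_add, ← pow_add] at h1
    have h2 : w + w + 6 * w = 8 * w := by ring
    rw [h2] at h1
    exact_mod_cast h1
  have h8 : (2 : ℤ) ^ (8 * w) * μ ^ 2 ≤ 2 ^ (10 * w) * μ ^ 2 :=
    mul_le_mul_of_nonneg_right (pow_le_pow_right₀ (by norm_num) (by omega)) (by positivity)
  have h2w : 1 ≤ 2 ^ w := Nat.one_le_two_pow
  have hmw : m ≤ w := by omega
  have hc1 : (m + 1) * (2 ^ m * (2 ^ nl * 2 ^ nr)) ≤ (w + 1) * 2 ^ w :=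
    Nat.mul_le_mul (by omega) hpO
  have hc2 : (w + 1) * 2 ^ w ≤ (w + 1) ^ 2 * 2 ^ w := Nat.mul_le_mul_right _ (by nlinarith)
  have hc3 : m * (2 * ((m + 1) * (2 ^ m * (2 ^ nl * 2 ^ nr))) + 4) ≤
      w * (2 * ((w + 1) * 2 ^ w) + 4) := Nat.mul_le_mul hmw (by omega)
  have hc4 : w * (2 * ((w + 1) * 2 ^ w)) ≤ 2 * ((w + 1) ^ 2 * 2 ^ w) := by nlinarith
  have hc5 : w + 1 ≤ (w + 1) * 2 ^ w := Nat.le_mul_of_pos_right _ h2w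
  have hc6 : w * (2 * ((w + 1) * 2 ^ w) + 4) = w * (2 * ((w + 1) * 2 ^ w)) + 4 * w := by ring
  rw [mul_assoc 11]
  refine Run.andThen (run_zero (k := (m + 1) * (2 ^ m * (2 ^ nl * 2 ^ nr))) ?_ (hle hpO)) ?_
  · simp [hni, hs.so]
  intro s₁ h₁ hf1
  have s1' : Sizes s₁ m nl nf nr := hs.of_eq hf1.vs
  have hni1 : s₁.v .ni = m := by rw [hf1.v _, hni]
  have hzF : ∀ i k l f, |zp 1 lI.toFinset (gF i l f) (sub lI k)| ≤ 2 ^ m * μ := by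
    intro i k l f
    have := abs_zp_le (σ := 1) (by norm_num) lI.toFinset (hFμ i l f) (sub lI k)
    rwa [List.toFinset_card_of_nodup hnd, ← hm] at this
  have hzG : ∀ i k f r, |zp 1 lI.toFinset (gG i f r) (sub lI k)| ≤ 2 ^ m * μ := by
    intro i k f r
    have := abs_zp_le (σ := 1) (by norm_num) lI.toFinset (hGμ i f r) (sub lI k)
    rwa [List.toFinset_card_of_nodup hnd, ← hm] at this
  have hsplit : ∀ {a}, p ≤ a → 2 ^ a = 2 ^ (a - p) * 2 ^ p := fun {a} h => by
    rw [← pow_add]; congr 1; omega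
  refine Run.andThen (run_products (β := 2 ^ m * μ) (P := 2 ^ p) (nx := 2 ^ (nl - p))
    (ny := 2 ^ (nf - p)) (nz := 2 ^ (nr - p)) (SL := 2 ^ nl) (SF := 2 ^ nf) (SR := 2 ^ nr)
    (F := fun i k l f => zp 1 lI.toFinset (gF i l f) (sub lI k))
    (G := fun i k f r => zp 1 lI.toFinset (gG i f r) (sub lI k))
    (hsplit (by omega)) (hsplit (by omega)) (hsplit (by omega)) Nat.one_le_two_pow hni1 s1'.si
    (by rw [s1'.pp, hp]) (by rw [s1'.nx, hp]) (by rw [s1'.ny, hp]) (by rw [s1'.nz, hp]) s1'.sl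
    s1'.sf s1'.sr Nat.one_le_two_pow Nat.one_le_two_pow Nat.one_le_two_pow
    (by rw [mul_assoc]; exact hle hpL) (by rw [mul_assoc]; exact hle hpR)
    (by rw [mul_assoc]; exact hle hpO)
    (by rw [hf1.m .FH]; exact hF) (by rw [hf1.m .GH]; exact hG)
    (fun i _ k _ l _ f _ => hzF i k l f) (fun i _ k _ f _ r _ => hzG i k f r)
    (by
      have h1 : (1 : ℤ) ≤ 2 ^ m := one_le_pow₀ (by norm_num)
      nlinarith)
    (by rw [mul_assoc]; exact h₁) (hbound.trans (h8.trans hM)))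
    ?_ (by rw [convCost, ← hp]; omega)
  intro s₂ ⟨h2b, h₂⟩ hf2
  have s2' : Sizes s₂ m nl nf nr := s1'.of_eq hf2.vs
  have hni2 : s₂.v .ni = m := by rw [hf2.v _, hni1]
  refine (run_zeta (l := lI) (Bk := 2 ^ nl * 2 ^ nr) (β := 2 ^ (8 * w) * μ ^ 2)
    (g := fun h x B => ∑ i ∈ range (h + 1), ∑ f ∈ range (2 ^ nf),
      zp 1 lI.toFinset (gF i (x / 2 ^ nr) f) B *
        zp 1 lI.toFinset (gG (h - i) f (x % 2 ^ nr)) B)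
    (by norm_num) hnd (by simp [s2'.sl, s2'.sr]) (Nat.mul_pos (by positivity) (by positivity))
    (by rw [← hm, hni2]) (by rw [← hm, s2'.si]) (by rw [← hm, mul_assoc]; exact hle hpO) ?_
    (by positivity) ?_ ?_).imp ?_ ?_
  · rw [← hm]
    calc (2 : ℤ) ^ m * (2 ^ (8 * w) * μ ^ 2) = 2 ^ (m + 8 * w) * μ ^ 2 := by rw [pow_add]; ring
      _ ≤ 2 ^ (10 * w) * μ ^ 2 := mul_le_mul_of_nonneg_right
          (pow_le_pow_right₀ (by norm_num) (by omega)) (by positivity)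
      _ ≤ M := hM
  · intro c hc
    rw [← hm] at hc
    exact (h2b c hc).trans hbound
  · intro h hh k hk x hx
    rw [← hm] at hh hk ⊢
    have hxd := Nat.div_add_mod x (2 ^ nr)
    have := h₂ h hh k hk (x / 2 ^ nr) ((Nat.div_lt_iff_lt_mul (by positivity)).2 hx)
      (x % 2 ^ nr) (Nat.mod_lt _ (by positivity))
    rw [mul_comm (x / 2 ^ nr), hxd] at this
    exact this
  · rw [← hm, mul_assoc (m + 1), convCost, ← hp]
    omega
  · intro s' h _ i hi k hk y hy x hx
    rw [hm] at hi hk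
    have hlt : y * 2 ^ nr + x < 2 ^ nl * 2 ^ nr := by
      calc _ < y * 2 ^ nr + 2 ^ nr := by omega
        _ = (y + 1) * 2 ^ nr := by ring
        _ ≤ _ := Nat.mul_le_mul_right _ hy
    have := h.2 i hi k hk (y * 2 ^ nr + x) hlt
    have h1 : (y * 2 ^ nr + x) % 2 ^ nr = x := by
      rw [mul_comm, Nat.mul_add_mod, Nat.mod_eq_of_lt hx]
    have h2 : (y * 2 ^ nr + x) / 2 ^ nr = y := by
      rw [mul_comm, Nat.mul_add_div (by positivity), Nat.div_eq_of_lt hx, add_zero]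
    rw [h1, h2, ← hm] at this
    exact this

section convolve

variable {V : Type*} [DecidableEq V]

theorem run_convolve {lF lL lI lR : List V} {wA wB : V → ℤ}
    {fA gB : Finset V → ℤ} {w : ℕ} {μ : ℤ} (h : ConvIn s lF lL lI lR wA wB fA gB)
    (hA : (lF ++ lL ++ lI).Nodup) (hB : (lR ++ lF ++ lI).Nodup) (hO : (lR ++ lL ++ lI).Nodup)
    (hAw : (lF ++ lL ++ lI).length ≤ w) (hBw : (lR ++ lF ++ lI).length ≤ w)
    (hOw : (lR ++ lL ++ lI).length ≤ w) (hμ : 1 ≤ μ) (hM : 2 ^ (10 * w) * μ ^ 2 ≤ M)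
    (hwA : ∀ S ⊆ (lF ++ lL ++ lI).toFinset, |∑ v ∈ S, wA v| ≤ M)
    (hwB : ∀ S ⊆ (lR ++ lF ++ lI).toFinset, |∑ v ∈ S, wB v| ≤ M)
    (hfA : ∀ S, |fA S| ≤ μ) (hgB : ∀ S, |gB S| ≤ μ) (hT : ∀ a, |s.m .TAB a| ≤ M) :
    Run M mm convolve s (convCost mm lI.length lL.length lF.length lR.length +
        130 * (w + 1) ^ 2 * 2 ^ w) fun s' =>
      s'.v .so = (2 ^ (lR ++ lL ++ lI).length : ℕ) ∧
      ∀ q : ℕ, q < 2 ^ (lR ++ lL ++ lI).length →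
        s'.m .RO q = (#(sub (lR ++ lL ++ lI) q ∩ lI.toFinset) : ℕ) ∧
        s'.m .HH (s'.m .RO q * (2 ^ (lR ++ lL ++ lI).length : ℕ) + q) =
          ∑ Y ∈ lF.toFinset.powerset,
            ∑ A ∈ (sub (lR ++ lL ++ lI) q ∩ lI.toFinset).powerset,
              fA (A ∪ (sub (lR ++ lL ++ lI) q ∩ lL.toFinset) ∪ Y) *
                gB ((sub (lR ++ lL ++ lI) q ∩ lI.toFinset) \ A ∪
                  (sub (lR ++ lL ++ lI) q ∩ lR.toFinset) ∪ (lF.toFinset \ Y)) := by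
  have hpow : ∀ {i : ℕ} {x : ℕ}, x ≤ 2 ^ i → i ≤ 10 * w → (x : ℤ) ≤ M := by
    intro i x hx hi
    have h2 : (2 : ℤ) ^ (10 * w) ≤ 2 ^ (10 * w) * μ ^ 2 :=
      le_mul_of_one_le_right (by positivity) (one_le_pow₀ hμ)
    have h1 : x ≤ 2 ^ (10 * w) := hx.trans (Nat.pow_le_pow_right (by norm_num) hi)
    have h3 : (x : ℤ) ≤ 2 ^ (10 * w) := by exact_mod_cast h1
    exact h3.trans (h2.trans hM)
  have hAw' : lF.length + lL.length + lI.length ≤ w := by simpa [add_assoc] using hAw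
  have hBw' : lR.length + lF.length + lI.length ≤ w := by simpa [add_assoc] using hBw
  have hOw' : lR.length + lL.length + lI.length ≤ w := by simpa [add_assoc] using hOw
  have hM₁ : (2 ^ (2 * w) : ℤ) ≤ M := by
    have := hpow (le_refl (2 ^ (2 * w))) (by omega)
    exact_mod_cast this
  have hM₂ : 2 ^ w * μ ≤ M := by
    refine le_trans ?_ hM
    exact mul_le_mul (pow_le_pow_right₀ (by norm_num) (by omega)) (by nlinarith) (by omega)
      (by positivity)
  have hM3 : ((2 ^ w : ℕ) : ℤ) ≤ M := hpow le_rfl (by omega)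
  have h2w : 1 ≤ 2 ^ w := Nat.one_le_two_pow
  have c1 : (w + 1) * 2 ^ w ≤ (w + 1) ^ 2 * 2 ^ w := Nat.mul_le_mul_right _ (by nlinarith)
  have c2 : w + 1 ≤ (w + 1) * 2 ^ w := Nat.le_mul_of_pos_right _ h2w
  have c3 : 5 * (w * (2 * 2 ^ w + 3) + 5) ≤ 25 * ((w + 1) * 2 ^ w) := by nlinarith
  have e130 : 130 * (w + 1) ^ 2 * 2 ^ w = 130 * ((w + 1) ^ 2 * 2 ^ w) := mul_assoc _ _ _
  have e15 : 15 * (w + 1) ^ 2 * 2 ^ w = 15 * ((w + 1) ^ 2 * 2 ^ w) := mul_assoc _ _ _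
  have e11 : 11 * (w + 1) ^ 2 * 2 ^ w = 11 * ((w + 1) ^ 2 * 2 ^ w) := mul_assoc _ _ _
  refine Run.andThen (run_sizes (w := w) h.ni h.nl h.nf h.nr hAw' hBw' hOw'
    fun i hi => hpow le_rfl (by omega)) ?_
  intro s₁ z₁ hf1
  have k₁ := h.of_eq (hf1.vs)
    (hf1.ms)
  refine Run.andThen (run_offsets k₁ hA hB hO hAw hBw hOw hM3 hwA hwB) ?_
  intro s₂ o2 hf2
  have k₂ := k₁.of_eq (hf2.vs)
    (hf2.ms)
  have z₂ := z₁.of_eq (hf2.vs)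
  have t2 : s₂.m .TAB = s.m .TAB := by rw [hf2.m _, hf1.m _]
  refine Run.andThen (run_transform (l1 := lF) (l2 := lL) (l3 := lI) (F := fA) (μ := μ) (w := w)
    hA (by decide) (by decide) (by decide) (by rw [z₂.sa]) (fun s' hs' => by
      simp [hs' .sl (by decide), hs' .sf (by decide), z₂.sl, z₂.sf]) k₂.ni z₂.si ?_ o2.RA hfA
    (by rw [t2]; exact hT) hAw hM₁ hM₂) ?_
  · intro q hq
    rw [o2.OA q hq, k₂.tabA]
    refine (sub_subset _ _).trans ?_
    simp
  intro s₃ F3 hf3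
  have k₃ := k₂.of_eq (hf3.vs)
    (hf3.ms)
  have z₃ := z₂.of_eq (hf3.vs)
  have o3 := o2.of_eq (hf3.ms)
  have t3 : s₃.m .TAB = s.m .TAB := by rw [hf3.m _, t2]
  refine Run.andThen (run_transform (l1 := lR) (l2 := lF) (l3 := lI)
    (F := fun S => gB (S \ lF.toFinset ∪ lF.toFinset \ S)) (μ := μ) (w := w)
    hB (by decide) (by decide) (by decide) (by rw [z₃.sb]) (fun s' hs' => by
      simp [hs' .sr (by decide), hs' .sf (by decide), z₃.sr, z₃.sf]) k₃.ni z₃.si ?_ o3.RB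
    (fun S => hgB _) (by rw [t3]; exact hT) hBw hM₁ hM₂) ?_
  · intro q hq
    rw [o3.OB q hq]
    have : ∑ v ∈ lF.toFinset, wB v + (∑ v ∈ sub (lR ++ lF ++ lI) q,
        if v ∈ lF then -wB v else wB v) = ∑ v ∈ sub (lR ++ lF ++ lI) q \ lF.toFinset ∪
          lF.toFinset \ sub (lR ++ lF ++ lI) q, wB v := by
      obtain ⟨S, hS⟩ : ∃ S, S = sub (lR ++ lF ++ lI) q := ⟨_, rfl⟩
      rw [← hS, sum_union disjoint_sdiff_sdiff, ← sum_inter_add_sum_sdiff lF.toFinset S,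
        ← sum_inter_add_sum_sdiff S lF.toFinset (fun v => if v ∈ lF then -wB v else wB v),
        inter_comm S]
      have e1 : (∑ v ∈ lF.toFinset ∩ S, if v ∈ lF then -wB v else wB v) =
          -∑ v ∈ lF.toFinset ∩ S, wB v := by
        rw [← sum_neg_distrib]
        exact sum_congr rfl fun v hv => if_pos (by simpa using (mem_inter.1 hv).1)
      have e2 : (∑ v ∈ S \ lF.toFinset, if v ∈ lF then -wB v else wB v) =
          ∑ v ∈ S \ lF.toFinset, wB v :=
        sum_congr rfl fun v hv => if_neg (by simpa using (mem_sdiff.1 hv).2)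
      rw [e1, e2]; ring
    rw [this, k₃.tabB]
    refine union_subset (sdiff_subset.trans ((sub_subset _ _).trans ?_)) (sdiff_subset.trans ?_)
    · simp
    · exact fun v hv => by simp [List.mem_toFinset.1 hv]
  intro s₄ G4 hf4
  have k₄ := k₃.of_eq (hf4.vs)
    (hf4.ms)
  have z4 := z₃.of_eq (hf4.vs)
  have o4 := o3.of_eq (hf4.ms)
  have hle : ∀ (p : Prop) [Decidable p] (x : ℤ), |x| ≤ μ → |if p then x else 0| ≤ μ := by
    intro p _ x hx
    split_ifs
    · exact hx
    · simp; omega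
  refine (run_combine (lI := lI) (w := w) (μ := μ)
    (gF := fun i l f B => if #B = i then fA (sub lF f ∪ sub lL l ∪ B) else 0)
    (gG := fun i f r B => if #B = i then gB ((sub lR r ∪ sub lF f ∪ B) \ lF.toFinset ∪
      lF.toFinset \ (sub lR r ∪ sub lF f ∪ B)) else 0)
    (List.nodup_append.1 hA).2.1 rfl z4 k₄.ni hAw' hBw' hOw' hμ hM
    (by rw [hf4.m .FH]; exact F3) G4 (fun _ _ _ _ => hle _ _ (hfA _))
    (fun _ _ _ _ => hle _ _ (hgB _))).imp (by omega) ?_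
  intro s₅ H5 hf5
  have z5 := z4.of_eq (hf5.vs)
  have o5 := o4.of_eq (hf5.ms)
  have hp3 := two_pow_length₃ lR lL lI
  refine ⟨by rw [z5.so, hp3], fun q hq => ⟨o5.RO q hq, ?_⟩⟩
  rw [o5.RO q hq]
  have hX0 : 0 < 2 ^ lR.length := by positivity
  have hYX0 : 0 < 2 ^ lL.length * 2 ^ lR.length := by positivity
  obtain ⟨k, hk⟩ : ∃ k, k = q / (2 ^ lL.length * 2 ^ lR.length) := ⟨_, rfl⟩
  obtain ⟨l, hl⟩ : ∃ l, l = q % (2 ^ lL.length * 2 ^ lR.length) / 2 ^ lR.length := ⟨_, rfl⟩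
  obtain ⟨r, hr⟩ : ∃ r, r = q % (2 ^ lL.length * 2 ^ lR.length) % 2 ^ lR.length := ⟨_, rfl⟩
  have hk' : k < 2 ^ lI.length := by
    rw [hp3] at hq
    rw [hk]; exact (Nat.div_lt_iff_lt_mul hYX0).2 hq
  have hl' : l < 2 ^ lL.length := by
    rw [hl]; exact (Nat.div_lt_iff_lt_mul hX0).2 (Nat.mod_lt _ hYX0)
  have hr' : r < 2 ^ lR.length := by rw [hr]; exact Nat.mod_lt _ hX0
  have hqe : q = k * (2 ^ lL.length * 2 ^ lR.length) + (l * 2 ^ lR.length + r) := by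
    have h1 := Nat.div_add_mod q (2 ^ lL.length * 2 ^ lR.length)
    have h2 := Nat.div_add_mod (q % (2 ^ lL.length * 2 ^ lR.length)) (2 ^ lR.length)
    rw [← hl, ← hr] at h2
    rw [← hk, ← h2] at h1
    rw [mul_comm k, mul_comm l, h1]
  have hsub : sub (lR ++ lL ++ lI) q = sub lR r ∪ sub lL l ∪ sub lI k := by
    rw [hqe]; exact sub_append₃ hO hr' hl'
  have dRL : Disjoint lR.toFinset lL.toFinset := by
    rw [List.disjoint_toFinset_iff_disjoint]
    exact List.disjoint_of_nodup_append (List.nodup_append.1 hO).1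
  have dRF : Disjoint lR.toFinset lF.toFinset := by
    rw [List.disjoint_toFinset_iff_disjoint]
    exact List.disjoint_of_nodup_append (List.nodup_append.1 hB).1
  have dRI : Disjoint lR.toFinset lI.toFinset := by
    rw [List.disjoint_toFinset_iff_disjoint]
    exact fun v hv hv' => List.disjoint_of_nodup_append hO (List.mem_append_left _ hv) hv'
  have dLI : Disjoint lL.toFinset lI.toFinset := by
    rw [List.disjoint_toFinset_iff_disjoint]
    exact fun v hv hv' => List.disjoint_of_nodup_append hO (List.mem_append_right _ hv) hv'
  have dFI : Disjoint lF.toFinset lI.toFinset := by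
    rw [List.disjoint_toFinset_iff_disjoint]
    exact fun v hv hv' => List.disjoint_of_nodup_append hB (List.mem_append_right _ hv) hv'
  have sR := sub_subset lR r
  have sL := sub_subset lL l
  have sI := sub_subset lI k
  have iI : sub (lR ++ lL ++ lI) q ∩ lI.toFinset = sub lI k := by
    rw [hsub, union_inter_distrib_right, union_inter_distrib_right, inter_eq_left.2 sI,
      disjoint_iff_inter_eq_empty.1 (dRI.mono_left sR),
      disjoint_iff_inter_eq_empty.1 (dLI.mono_left sL), empty_union, empty_union]
  have iL : sub (lR ++ lL ++ lI) q ∩ lL.toFinset = sub lL l := by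
    rw [hsub, union_inter_distrib_right, union_inter_distrib_right, inter_eq_left.2 sL,
      disjoint_iff_inter_eq_empty.1 (dRL.mono_left sR),
      disjoint_iff_inter_eq_empty.1 (dLI.symm.mono_left sI), empty_union, union_empty]
  have iR : sub (lR ++ lL ++ lI) q ∩ lR.toFinset = sub lR r := by
    rw [hsub, union_inter_distrib_right, union_inter_distrib_right, inter_eq_left.2 sR,
      disjoint_iff_inter_eq_empty.1 (dRL.symm.mono_left sL),
      disjoint_iff_inter_eq_empty.1 (dRI.symm.mono_left sI), union_empty, union_empty]
  rw [iI, iL, iR]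
  have hcard : #(sub lI k) ≤ lI.length := (card_le_card sI).trans (List.toFinset_card_le lI)
  have key := H5 _ hcard k hk' l hl' r hr'
  have haddr : ((#(sub lI k) : ℕ) : ℤ) * (2 ^ (lR ++ lL ++ lI).length : ℕ) + (q : ℕ) =
      (((#(sub lI k) * 2 ^ lI.length + k) * (2 ^ lL.length * 2 ^ lR.length) +
        (l * 2 ^ lR.length + r) : ℕ) : ℤ) := by
    rw [hp3]
    conv_lhs => rw [hqe]
    push_cast; ring
  rw [haddr, key]
  have hcomm : (fun B => ∑ i ∈ range (#(sub lI k) + 1), ∑ f ∈ range (2 ^ lF.length),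
      zp 1 lI.toFinset (fun B => if #B = i then fA (sub lF f ∪ sub lL l ∪ B) else 0) B *
      zp 1 lI.toFinset (fun B => if #B = #(sub lI k) - i then
        gB ((sub lR r ∪ sub lF f ∪ B) \ lF.toFinset ∪ lF.toFinset \ (sub lR r ∪ sub lF f ∪ B))
        else 0) B) = fun B => ∑ f ∈ range (2 ^ lF.length), ∑ i ∈ range (#(sub lI k) + 1),
      zp 1 lI.toFinset (fun B => if #B = i then fA (sub lF f ∪ sub lL l ∪ B) else 0) B *
      zp 1 lI.toFinset (fun B => if #B = #(sub lI k) - i then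
        gB ((sub lR r ∪ sub lF f ∪ B) \ lF.toFinset ∪ lF.toFinset \ (sub lR r ∪ sub lF f ∪ B))
        else 0) B := funext fun B => sum_comm
  rw [hcomm, zp_sum, ← sum_range_sub (List.nodup_append.1 (List.nodup_append.1 hA).1).1
    (fun Y => ∑ A ∈ (sub lI k).powerset, fA (A ∪ sub lL l ∪ Y) *
      gB (sub lI k \ A ∪ sub lR r ∪ lF.toFinset \ Y))]
  refine sum_congr rfl fun f _ => ?_
  rw [ranked_conv sI (fun B => fA (sub lF f ∪ sub lL l ∪ B)) (fun B =>
    gB ((sub lR r ∪ sub lF f ∪ B) \ lF.toFinset ∪ lF.toFinset \ (sub lR r ∪ sub lF f ∪ B)))]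
  refine sum_congr rfl fun A hA' => ?_
  have hAI : A ⊆ lI.toFinset := (mem_powerset.1 hA').trans sI
  congr 2
  · rw [union_comm, union_comm (sub lF f), union_assoc]
  · have sF := sub_subset lF f
    have hBI : sub lI k \ A ⊆ lI.toFinset := sdiff_subset.trans sI
    have e1 : (sub lR r ∪ sub lF f ∪ sub lI k \ A) \ lF.toFinset = sub lR r ∪ sub lI k \ A := by
      rw [union_sdiff_distrib, union_sdiff_distrib, sdiff_eq_empty_iff_subset.2 sF, union_empty,
        sdiff_eq_self_of_disjoint (dRF.mono_left sR),
        sdiff_eq_self_of_disjoint (dFI.symm.mono_left hBI)]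
    have e2 : lF.toFinset \ (sub lR r ∪ sub lF f ∪ sub lI k \ A) = lF.toFinset \ sub lF f := by
      rw [sdiff_union_distrib, sdiff_union_distrib,
        sdiff_eq_self_of_disjoint (dRF.symm.mono_right sR),
        sdiff_eq_self_of_disjoint (dFI.mono_right hBI)]
      rw [inter_eq_right.2 sdiff_subset, inter_eq_left.2 sdiff_subset]
    rw [e1, e2, union_comm (sub lR r)]

end convolve

/-! ### The program: comparison of two vertex lists -/

/-- Record the positions and the degrees of the vertices of the second list. -/
def scan : Code :=
  .set .pw 1 ;;
  .loop .j (vr .lb)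
    (.set .v (rd .LV (vr .pb + vr .j)) ;;
    .put .POS (vr .v) (vr .pw) ;;
    .put .PCN (vr .v) (rd .LC (vr .pb + vr .j)) ;;
    .set .pw (vr .pw + vr .pw))

/-- Assign a vertex of the first list to its class. -/
def assign : Code :=
  .ite (vr .w)
    (.put .POS (vr .v) 0 ;; .set .c (vr .c + rd .PCN (vr .v)) ;;
    .ite (rd .vd (vr .v) - vr .c)
      (.put .WIA (vr .ni) (vr .pw) ;; .put .WIB (vr .ni) (vr .w) ;; .put .VI (vr .ni) (vr .v) ;;
      .put .CI (vr .ni) (vr .c) ;; .put .ONE (vr .ni) 1 ;; .set .ni (vr .ni + 1))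
      (.put .WFA (vr .nf) (vr .pw) ;; .put .WFB (vr .nf) (0 - vr .w) ;;
      .set .tot (vr .tot + vr .w) ;; .set .nf (vr .nf + 1)))
    (.put .WLA (vr .nl) (vr .pw) ;; .put .VL (vr .nl) (vr .v) ;; .put .CL (vr .nl) (vr .c) ;;
    .set .nl (vr .nl + 1))

/-- Divide the vertices of the two lists into classes. -/
def classify : Code :=
  .set .ni 0 ;; .set .nl 0 ;; .set .nf 0 ;; .set .nr 0 ;; .set .tot 0 ;; scan ;; .set .pw 1 ;;
  .loop .j (vr .la)
    (.set .v (rd .LV (vr .pa + vr .j)) ;; .set .w (rd .POS (vr .v)) ;;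
    .set .c (rd .LC (vr .pa + vr .j)) ;; assign ;; .set .pw (vr .pw + vr .pw)) ;;
  .loop .j (vr .lb)
    (.set .v (rd .LV (vr .pb + vr .j)) ;; .set .w (rd .POS (vr .v)) ;;
    .ite (vr .w)
      (.put .WRB (vr .nr) (vr .w) ;; .put .VR (vr .nr) (vr .v) ;;
      .put .CR (vr .nr) (rd .PCN (vr .v)) ;; .put .POS (vr .v) 0 ;; .set .nr (vr .nr + 1)) .skip)

theorem Run.setEnd {x : Var} {e : Term} {t : ℕ} {Q : Store → Prop}
    (h : |e.eval s| ≤ M) (h' : Q (s.setV x (e.eval s))) (ht : 1 ≤ t := by omega) :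
    Run M mm (.set x e) s t Q :=
  (Run.set h h').imp ht fun _ h _ => h

theorem Run.putEnd {a : Arr} {i e : Term} {t : ℕ} {Q : Store → Prop}
    (h : |e.eval s| ≤ M) (h' : Q (s.setM a (i.eval s) (e.eval s))) (ht : 1 ≤ t := by omega) :
    Run M mm (.put a i e) s t Q :=
  (Run.put h h').imp ht fun _ h _ => h

theorem Run.skipEnd {t : ℕ} {Q : Store → Prop} (h : Q s) :
    Run M mm .skip s t Q :=
  (Run.skip h).imp (by omega) fun _ h _ => h

theorem Run.iteEnd {e : Term} {p q : Code} {t : ℕ}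
    {Q : Store → Prop} (h : 0 < e.eval s → Run M mm p s (t - 1) Q)
    (h' : ¬ 0 < e.eval s → Run M mm q s (t - 1) Q) (ht : 1 ≤ t := by omega) : Run M mm (.ite e p q) s t Q :=
  (Run.ite h h').imp (by omega) fun _ h _ => h

/-- The array `f` starts with the list `l`. -/
def ArrIs (f : ℤ → ℤ) (l : List ℤ) : Prop := ∀ (b : ℕ) (h : b < l.length), f b = l[b]

theorem ArrIs.append {a : Arr} {l : List ℤ} {i z : ℤ} (h : ArrIs (s.m a) l)
    (hi : i = l.length) : ArrIs ((s.setM a i z).m a) (l ++ [z]) := by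
  intro b hb
  rw [St.setM_m_self]
  rw [List.length_append, List.length_singleton] at hb
  by_cases hbl : b < l.length
  · rw [if_neg (by omega), List.getElem_append_left hbl, h b hbl]
  · have : b = l.length := by omega
    subst this
    rw [if_pos hi.symm]
    simp

variable {n : ℕ}

/-- The lists of the classes of vertices, as written so far. -/
structure Classes (s : Store) (wA wB : Fin n → ℤ) (c₁ c₂ : Fin n → ℕ)
    (LI LF LL LR : List (Fin n)) : Prop where
  ni : s.v .ni = LI.length
  nf : s.v .nf = LF.length
  nl : s.v .nl = LL.length
  nr : s.v .nr = LR.length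
  tot : s.v .tot = (LF.map wB).sum
  WIA : ArrIs (s.m .WIA) (LI.map wA)
  WIB : ArrIs (s.m .WIB) (LI.map wB)
  VI : ArrIs (s.m .VI) (LI.map fun v : Fin n => ((v : ℕ) : ℤ))
  CI : ArrIs (s.m .CI) (LI.map fun v => ((c₁ v + c₂ v : ℕ) : ℤ))
  ONE : ArrIs (s.m .ONE) (LI.map fun _ => 1)
  WFA : ArrIs (s.m .WFA) (LF.map wA)
  WFB : ArrIs (s.m .WFB) (LF.map fun v => -wB v)
  WLA : ArrIs (s.m .WLA) (LL.map wA)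
  VL : ArrIs (s.m .VL) (LL.map fun v : Fin n => ((v : ℕ) : ℤ))
  CL : ArrIs (s.m .CL) (LL.map fun v => ((c₁ v : ℕ) : ℤ))
  WRB : ArrIs (s.m .WRB) (LR.map wB)
  VR : ArrIs (s.m .VR) (LR.map fun v : Fin n => ((v : ℕ) : ℤ))
  CR : ArrIs (s.m .CR) (LR.map fun v => ((c₂ v : ℕ) : ℤ))

theorem Classes.of_eq {s s' : Store} {wA wB : Fin n → ℤ} {c₁ c₂ : Fin n → ℕ}
    {LI LF LL LR : List (Fin n)} (h : Classes s wA wB c₁ c₂ LI LF LL LR)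
    (hv : ∀ x ∈ [Var.ni, .nf, .nl, .nr, .tot], s'.v x = s.v x)
    (hm : ∀ a ∈ [Arr.WIA, .WIB, .VI, .CI, .ONE, .WFA, .WFB, .WLA, .VL, .CL, .WRB, .VR, .CR],
      s'.m a = s.m a) : Classes s' wA wB c₁ c₂ LI LF LL LR := by
  simp only [List.mem_cons, List.not_mem_nil, or_false, forall_eq_or_imp, forall_eq] at hv hm
  obtain ⟨h1, h2, h3, h4, h5⟩ := hv
  obtain ⟨g1, g2, g3, g4, g5, g6, g7, g8, g9, g10, g11, g12, g13⟩ := hm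
  exact ⟨h1 ▸ h.ni, h2 ▸ h.nf, h3 ▸ h.nl, h4 ▸ h.nr, h5 ▸ h.tot, g1 ▸ h.WIA, g2 ▸ h.WIB,
    g3 ▸ h.VI, g4 ▸ h.CI, g5 ▸ h.ONE, g6 ▸ h.WFA, g7 ▸ h.WFB, g8 ▸ h.WLA, g9 ▸ h.VL, g10 ▸ h.CL,
    g11 ▸ h.WRB, g12 ▸ h.VR, g13 ▸ h.CR⟩

theorem sum_two_pow_idxOf_le {l : List (Fin n)} (hl : l.Nodup) {S : Finset (Fin n)}
    (hS : S ⊆ l.toFinset) : 0 ≤ ∑ v ∈ S, (2 : ℤ) ^ l.idxOf v ∧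
      ∑ v ∈ S, (2 : ℤ) ^ l.idxOf v ≤ 2 ^ l.length := by
  obtain ⟨q, hq, rfl⟩ := exists_sub_eq hl S hS
  rw [sum_pow_sub hl q hq]
  exact ⟨by positivity, by exact_mod_cast hq.le⟩

theorem run_scan {l : List (Fin n)} {c : Fin n → ℕ} {w : ℕ} (hl : l.Nodup)
    (hlb : s.v .lb = l.length)
    (hLV : ∀ (i : ℕ) (h : i < l.length), s.m .LV (s.v .pb + i) = (l[i] : ℕ))
    (hLC : ∀ (i : ℕ) (h : i < l.length), s.m .LC (s.v .pb + i) = (c l[i] : ℕ))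
    (hPOS : ∀ v : Fin n, s.m .POS (v : ℕ) = 0) (hw : l.length ≤ w)
    (hM : ((2 ^ w : ℕ) : ℤ) ≤ M) (hn : (n : ℤ) ≤ M) (hc : ∀ v, (c v : ℤ) ≤ M) :
    Run M mm scan s (5 * w + 2) fun s' =>
      (∀ v : Fin n, s'.m .POS (v : ℕ) = if v ∈ l then 2 ^ l.idxOf v else 0) ∧
        ∀ v ∈ l, s'.m .PCN (v : ℕ) = c v := by
  have hpw : ∀ {i}, i ≤ l.length → ((2 ^ i : ℕ) : ℤ) ≤ M := fun {i} hi =>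
    le_trans (by exact_mod_cast Nat.pow_le_pow_right (by norm_num) (hi.trans hw)) hM
  have hwM : (w : ℤ) ≤ M := le_trans (by exact_mod_cast Nat.lt_two_pow_self.le) hM
  refine Run.setThen ?_ ?_
  · simpa using hpw (Nat.zero_le _)
  refine Run.loop' l.length (fun j s' => s'.v .pw = (2 ^ j : ℕ) ∧
    (∀ v : Fin n, s'.m .POS (v : ℕ) = if v ∈ l.take j then 2 ^ l.idxOf v else 0) ∧
      ∀ v ∈ l.take j, s'.m .PCN (v : ℕ) = c v) (t := 4) (by simpa using hlb) (by omega)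
    (by simpa using hPOS) ?_ (by omega) (fun s' h _ => by simpa using h.2)
  intro j hj s₁ ⟨h1, h2, h3⟩ hf1
  have e1 : s₁.v .pb = s.v .pb := by rw [hf1.v _]; simp
  have e2 : s₁.m .LV = s.m .LV := by rw [hf1.m _]; simp
  have e3 : s₁.m .LC = s.m .LC := by rw [hf1.m _]; simp
  have htake : l.take (j + 1) = l.take j ++ [l[j]] := (List.take_append_getElem hj).symm
  have hnew : l[j] ∉ l.take j := fun h => by
    rw [List.mem_take_iff_getElem] at h
    obtain ⟨i, hi, h⟩ := h
    have := (List.Nodup.getElem_inj_iff hl).1 h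
    omega
  have hv : (rd .LV (vr .pb + vr .j)).eval (s₁.setV .j j) = ((l[j] : ℕ) : ℤ) := by
    simp [e1, e2, hLV j hj]
  refine Run.setThen ?_ ?_
  · rw [hv, Nat.abs_cast]
    exact le_trans (by exact_mod_cast l[j].2.le) hn
  rw [hv]
  refine Run.putThen ?_ (Run.putThen ?_ (Run.setEnd ?_ ?_))
  · simp [h1]
    exact hpw hj.le
  · simp [e1, e3, hLC j hj, hc]
  · simp only [Ex.eval_add, Ex.eval_var, ne_eq, reduceCtorEq, not_false_eq_true, St.setV_v_ne,
      St.setM_v, h1]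
    have := hpw hj
    rw [pow_succ] at this
    rw [← Nat.cast_add, Nat.abs_cast]
    omega
  · refine ⟨?_, fun v => ?_, fun v hv => ?_⟩
    · simp [h1]; ring
    · simp only [Ex.eval_var, ne_eq, reduceCtorEq, not_false_eq_true, St.setV_v_ne, St.setV_v_self,
        h1, St.setV_m, St.setM_m_ne, St.setM_m_self, St.setM_v, Nat.cast_inj, htake,
        List.mem_append, List.mem_singleton, h2, Fin.val_inj]
      by_cases hvj : v = l[j]
      · subst hvj
        simp [hl.idxOf_getElem j hj]
      · simp [hvj]
    · simp only [Ex.eval_var, ne_eq, reduceCtorEq, not_false_eq_true, St.setV_v_ne, St.setV_v_self,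
        St.setV_m, St.setM_m_ne, St.setM_m_self, St.setM_v, Ex.eval_rd, Ex.eval_add, e1, e3,
        hLC j hj]
      rw [htake, List.mem_append, List.mem_singleton] at hv
      by_cases hvj : v = l[j]
      · rw [hvj, if_pos rfl]
      · rw [if_neg (by rw [Nat.cast_inj, Fin.val_inj]; exact hvj),
          h3 v (hv.resolve_right hvj)]

theorem run_assign {wA wB : Fin n → ℤ} {c₁ c₂ d : Fin n → ℕ}
    {LI LF LL : List (Fin n)} (h : Classes s wA wB c₁ c₂ LI LF LL []) {v : Fin n}
    (hv : s.v .v = (v : ℕ)) (hpw : s.v .pw = wA v) {P : Prop} [Decidable P]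
    (hw : s.v .w = if P then wB v else 0) (hwB : 0 < wB v) (hc : s.v .c = (c₁ v : ℕ))
    (hd : s.m .vd (v : ℕ) = (d v : ℕ)) (hPCN : P → s.m .PCN (v : ℕ) = (c₂ v : ℕ))
    (hn : (n : ℤ) ≤ M) (hcM : ∀ v, ((c₁ v + c₂ v : ℕ) : ℤ) ≤ M) (hwAM : |wA v| ≤ M)
    (hwBM : wB v ≤ M) (htM : |(LF.map wB).sum + wB v| ≤ M) (hLI : (LI.length : ℤ) + 1 ≤ M)
    (hLF : (LF.length : ℤ) + 1 ≤ M) (hLL : (LL.length : ℤ) + 1 ≤ M) :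
    Run M mm assign s 10 fun s' =>
      Classes s' wA wB c₁ c₂ (LI ++ if P ∧ c₁ v + c₂ v < d v then [v] else [])
        (LF ++ if P ∧ ¬ c₁ v + c₂ v < d v then [v] else []) (LL ++ if P then [] else [v]) [] ∧
      ∀ u : Fin n, s'.m .POS (u : ℕ) = if P ∧ u = v then 0 else s.m .POS (u : ℕ) := by
  have hvn : (((v : ℕ) : ℕ) : ℤ) ≤ M := le_trans (by exact_mod_cast v.2.le) hn
  have hM1 : (1 : ℤ) ≤ M := by omega
  have hc1 := hcM v
  refine Run.iteEnd (fun hp => ?_) fun hp => ?_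
  · have hP : P := by
      by_contra hP
      simp [hw, hP] at hp
    have hw' : s.v .w = wB v := by rw [hw, if_pos hP]
    have hce : (vr .c + rd .PCN (vr .v)).eval (s.setM .POS ((vr .v).eval s) (Ex.eval s 0)) =
        ((c₁ v + c₂ v : ℕ) : ℤ) := by
      simp [hc, hv, hPCN hP]
    refine Run.putThen (by simp; omega) (Run.setThen ?_ ?_)
    · rw [hce, Nat.abs_cast]; exact hc1
    rw [hce]
    have hpos : ∀ u : Fin n, (s.setM .POS ((vr .v).eval s) (Ex.eval s 0)).m .POS (u : ℕ) =
        if u = v then 0 else s.m .POS (u : ℕ) := by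
      intro u
      simp only [Ex.eval_var, hv, St.setM_m_self, Ex.eval_zero, Nat.cast_inj, Fin.val_inj]
    rw [← St.setV_m (x := .c) (z := ((c₁ v + c₂ v : ℕ) : ℤ))] at hpos
    obtain ⟨s₁, hs1⟩ : ∃ s₁, s₁ = (s.setM .POS ((vr .v).eval s) (Ex.eval s 0)).setV .c
      ((c₁ v + c₂ v : ℕ) : ℤ) := ⟨_, rfl⟩
    have k := h.of_eq (s' := s₁) (fun x hx => by
      rw [hs1, St.setV_v_ne _ (by revert x; decide), St.setM_v]) fun a ha => by
      rw [hs1, St.setV_m, St.setM_m_ne _ (by revert a; decide)]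
    have hv1 : s₁.v .v = (v : ℕ) := by simp [hs1, hv]
    have hw1 : s₁.v .w = wB v := by simp [hs1, hw']
    have hpw1 : s₁.v .pw = wA v := by simp [hs1, hpw]
    have hd1 : s₁.m .vd (v : ℕ) = (d v : ℕ) := by simp [hs1, hd]
    have hc₁ : s₁.v .c = (c₁ v + c₂ v : ℕ) := by simp [hs1]
    rw [← hs1] at hpos ⊢
    refine Run.iteEnd (fun hq => ?_) fun hq => ?_
    · have hlt : c₁ v + c₂ v < d v := by
        simp only [Ex.eval_sub, Ex.eval_rd, Ex.eval_var, hv1, hd1, hc₁] at hq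
        omega
      refine Run.putThen ?_ (Run.putThen ?_ (Run.putThen ?_
        (Run.putThen ?_ (Run.putThen ?_
        (Run.setEnd ?_ ⟨?_, ?_⟩)))))
      · simpa [hpw1] using hwAM
      · simpa [hw1, abs_of_pos hwB] using hwBM
      · simpa [hv1] using hvn
      · simp only [Ex.eval_var, St.setM_v, hc₁, Nat.abs_cast]; exact hc1
      · simpa using hM1
      · simp only [Ex.eval_add, Ex.eval_var, St.setM_v, k.ni, Ex.eval_one]
        rw [abs_of_nonneg (by positivity)]; exact hLI
      · rw [if_pos ⟨hP, hlt⟩, if_neg (by tauto), if_pos hP, List.append_nil, List.append_nil]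
        constructor <;> simp only [Ex.eval_var, Ex.eval_add, Ex.eval_one, St.setM_v, St.setV_v_self,
          ne_eq, reduceCtorEq, not_false_eq_true, St.setV_v_ne, St.setV_m, St.setM_m_ne,
          List.map_append, List.map_cons, List.map_nil, List.length_append, hv1, hw1, hpw1, hc₁]
        case ni => simp [k.ni]
        case WIA => exact k.WIA.append (by simp [k.ni])
        case WIB => exact ArrIs.append (by simpa using k.WIB) (by simp [k.ni])
        case VI => exact k.VI.append (by simp [k.ni])
        case CI => exact k.CI.append (by simp [k.ni])
        case ONE => exact ArrIs.append (by simpa using k.ONE) (by simp [k.ni])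
        all_goals cases k; assumption
      · intro u
        simp [hP, hpos]
    · have hlt : ¬ c₁ v + c₂ v < d v := by
        simp only [Ex.eval_sub, Ex.eval_rd, Ex.eval_var, hv1, hd1, hc₁] at hq
        omega
      refine Run.putThen ?_ (Run.putThen ?_ (Run.setThen ?_
        (Run.setEnd ?_ ⟨?_, ?_⟩)))
      · simpa [hpw1] using hwAM
      · simpa [hw1, abs_of_pos hwB] using hwBM
      · simpa [hw1, k.tot] using htM
      · simp only [Ex.eval_add, Ex.eval_var, St.setM_v, ne_eq, reduceCtorEq, not_false_eq_true,
          St.setV_v_ne, k.nf, Ex.eval_one]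
        rw [abs_of_nonneg (by positivity)]; exact hLF
      · rw [if_neg (by tauto), if_pos ⟨hP, hlt⟩, if_pos hP, List.append_nil, List.append_nil]
        constructor <;> simp only [Ex.eval_var, Ex.eval_add, Ex.eval_sub, Ex.eval_zero, zero_sub,
          Ex.eval_one, St.setM_v, St.setV_v_self,
          ne_eq, reduceCtorEq, not_false_eq_true, St.setV_v_ne, St.setV_m, St.setM_m_ne,
          List.map_append, List.map_cons, List.map_nil, List.length_append, hw1, hpw1]
        case nf => simp [k.nf]
        case tot => simp [k.tot]
        case WFA => exact k.WFA.append (by simp [k.nf])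
        case WFB => exact ArrIs.append (by simpa using k.WFB) (by simp [k.nf])
        all_goals cases k; assumption
      · intro u
        simp [hP, hpos]
  · have hP : ¬ P := by
      intro hP
      simp [hw, hP] at hp
      omega
    refine Run.putThen ?_ (Run.putThen ?_ (Run.putThen ?_
        (Run.setEnd ?_ ⟨?_, ?_⟩)))
    · simpa [hpw] using hwAM
    · simpa [hv] using hvn
    · simp only [Ex.eval_var, St.setM_v, hc, Nat.abs_cast]; omega
    · simp only [Ex.eval_add, Ex.eval_var, St.setM_v, h.nl, Ex.eval_one]
      rw [abs_of_nonneg (by positivity)]; exact hLL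
    · rw [if_neg (by tauto), if_neg (by tauto), if_neg hP, List.append_nil, List.append_nil]
      constructor <;> simp only [Ex.eval_var, Ex.eval_add,
          Ex.eval_one, St.setM_v, St.setV_v_self,
          ne_eq, reduceCtorEq, not_false_eq_true, St.setV_v_ne, St.setV_m, St.setM_m_ne,
          List.map_append, List.map_cons, List.map_nil, List.length_append, hv, hpw, hc]
      case nl => simp [h.nl]
      case WLA => exact h.WLA.append (by simp [h.nl])
      case VL => exact h.VL.append (by simp [h.nl])
      case CL => exact h.CL.append (by simp [h.nl])
      all_goals cases h; assumption
    · intro u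
      simp [hP]

theorem run_classify {l1 l2 : List (Fin n)} {c₁ c₂ d : Fin n → ℕ} {w : ℕ}
    (hl1 : l1.Nodup) (hl₂ : l2.Nodup) (hw1 : l1.length ≤ w) (hw₂ : l2.length ≤ w)
    (hla : s.v .la = l1.length) (hlb : s.v .lb = l2.length)
    (hLV1 : ∀ (i : ℕ) (h : i < l1.length), s.m .LV (s.v .pa + i) = (l1[i] : ℕ))
    (hLC1 : ∀ (i : ℕ) (h : i < l1.length), s.m .LC (s.v .pa + i) = (c₁ l1[i] : ℕ))
    (hLV2 : ∀ (i : ℕ) (h : i < l2.length), s.m .LV (s.v .pb + i) = (l2[i] : ℕ))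
    (hLC2 : ∀ (i : ℕ) (h : i < l2.length), s.m .LC (s.v .pb + i) = (c₂ l2[i] : ℕ))
    (hd : ∀ v : Fin n, s.m .vd (v : ℕ) = (d v : ℕ))
    (hPOS : ∀ v : Fin n, s.m .POS (v : ℕ) = 0)
    (hM : ((2 ^ (w + 1) : ℕ) : ℤ) ≤ M) (hn : (n : ℤ) ≤ M)
    (hc : ∀ v, ((c₁ v + c₂ v : ℕ) : ℤ) ≤ M) :
    Run M mm classify s (30 * w + 15) fun s' =>
      Classes s' (fun v => 2 ^ l1.idxOf v) (fun v => 2 ^ l2.idxOf v) c₁ c₂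
        (l1.filter fun v => v ∈ l2 ∧ c₁ v + c₂ v < d v)
        (l1.filter fun v => v ∈ l2 ∧ ¬ c₁ v + c₂ v < d v) (l1.filter fun v => v ∉ l2)
        (l2.filter fun v => v ∉ l1) ∧
      ∀ v : Fin n, s'.m .POS (v : ℕ) = 0 := by
  have hMw : ((2 ^ w : ℕ) : ℤ) ≤ M :=
    le_trans (by exact_mod_cast Nat.pow_le_pow_right (by norm_num) (by omega)) hM
  have hpw : ∀ {i}, i ≤ w → ((2 ^ i : ℕ) : ℤ) ≤ M := fun {i} hi =>
    le_trans (by exact_mod_cast Nat.pow_le_pow_right (by norm_num) hi) hMw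
  have hwM : (w : ℤ) + 1 ≤ M := le_trans (by exact_mod_cast Nat.lt_two_pow_self) hMw
  have h0M : |(0 : ℤ)| ≤ M := by rw [abs_zero]; omega
  refine Run.setThen h0M (Run.setThen h0M (Run.setThen h0M
    (Run.setThen h0M (Run.setThen h0M ?_))))
  simp only [Ex.eval_zero]
  have hs0 : Classes (((((s.setV .ni 0).setV .nl 0).setV .nf 0).setV .nr 0).setV .tot 0)
      (fun v => 2 ^ l1.idxOf v) (fun v => 2 ^ l2.idxOf v) c₁ c₂ ([] : List (Fin n)) [] [] [] := by
    constructor <;> first | simp; done | (intro b hb; simp at hb)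
  have hv0 : ∀ x ∉ [Var.ni, .nl, .nf, .nr, .tot],
      (((((s.setV .ni 0).setV .nl 0).setV .nf 0).setV .nr 0).setV .tot 0).v x = s.v x := by
    intro x hx
    simp only [List.mem_cons, List.not_mem_nil, or_false, not_or] at hx
    simp [hx]
  have hm0 : (((((s.setV .ni 0).setV .nl 0).setV .nf 0).setV .nr 0).setV .tot 0).m = s.m := by simp
  generalize (((((s.setV .ni 0).setV .nl 0).setV .nf 0).setV .nr 0).setV .tot 0) = s0 at *
  refine Run.andThen (run_scan (w := w) hl₂ (by rw [hv0 _ (by decide), hlb])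
    (by rw [hm0, hv0 _ (by decide)]; exact hLV2) (by rw [hm0, hv0 _ (by decide)]; exact hLC2)
    (by rw [hm0]; exact hPOS) hw₂ hMw hn fun v => le_trans (by push_cast; omega) (hc v)) ?_
  intro s₁ ⟨hP₁, hC1⟩ hf1
  have k₁ := hs0.of_eq (hf1.vs)
    (hf1.ms)
  have v1 : ∀ x ∈ [Var.la, .lb, .pa, .pb], s₁.v x = s.v x := fun x hx => by
    rw [hf1.vs (by decide) _ hx, hv0 x (by revert x; decide)]
  have m₁ : ∀ x ∈ [Arr.LV, .LC, .vd], s₁.m x = s.m x := fun x hx => by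
    rw [hf1.ms (by decide) _ hx, hm0]
  refine Run.setThen (by simpa using hpw (Nat.zero_le _)) ?_
  simp only [Ex.eval_one]
  set pI : Fin n → Bool := fun v => v ∈ l2 ∧ c₁ v + c₂ v < d v with hpI
  set pF : Fin n → Bool := fun v => v ∈ l2 ∧ ¬ c₁ v + c₂ v < d v with hpF
  set pL : Fin n → Bool := fun v => v ∉ l2 with hpL
  set pR : Fin n → Bool := fun v => v ∉ l1 with hpR
  have hnewt : ∀ {l : List (Fin n)}, l.Nodup → ∀ (j : ℕ) (hj : j < l.length), l[j] ∉ l.take j := by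
    intro l hl j hj h
    rw [List.mem_take_iff_getElem] at h
    obtain ⟨i, hi, h⟩ := h
    have := (List.Nodup.getElem_inj_iff hl).1 h
    omega
  refine Run.andThen (t1 := 15 * w + 1) (R := fun s' => Classes s' (fun v => 2 ^ l1.idxOf v)
      (fun v => 2 ^ l2.idxOf v) c₁ c₂ (l1.filter pI) (l1.filter pF) (l1.filter pL) [] ∧
      (∀ v : Fin n, s'.m .POS (v : ℕ) = if v ∈ l2 ∧ v ∉ l1 then 2 ^ l2.idxOf v else 0))
    (Run.loop' l1.length (fun j s' => Classes s' (fun v => 2 ^ l1.idxOf v)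
      (fun v => 2 ^ l2.idxOf v) c₁ c₂ ((l1.take j).filter pI) ((l1.take j).filter pF)
      ((l1.take j).filter pL) [] ∧ s'.v .pw = (2 ^ j : ℕ) ∧
      (∀ v : Fin n, s'.m .POS (v : ℕ) =
        if v ∈ l2 ∧ v ∉ l1.take j then 2 ^ l2.idxOf v else 0)) (t := 14)
      (by simpa [v1] using hla) (by omega) ?_ ?_ (by omega) ?_) ?_
  · refine ⟨k₁.of_eq (fun x hx => St.setV_v_ne _ (by revert x; decide) _) (fun _ _ => rfl),
      by simp, by simpa using hP₁⟩
  · intro j hj s₂ ⟨k₂, hpw2, hP₂⟩ hf2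
    have v2 : ∀ x ∈ [Var.la, .lb, .pa, .pb], s₂.v x = s.v x := fun x hx => by
      rw [hf2.vs (by decide) _ hx, St.setV_v_ne _ (by revert x; decide), v1 x hx]
    have m₂ : ∀ x ∈ [Arr.LV, .LC, .vd], s₂.m x = s.m x := fun x hx => by
      rw [hf2.ms (by decide) _ hx, St.setV_m, m₁ x hx]
    have hC2 : s₂.m .PCN = s₁.m .PCN := by rw [hf2.m _, St.setV_m]
    have e1 : (rd .LV (vr .pa + vr .j)).eval (s₂.setV .j j) = ((l1[j] : ℕ) : ℤ) := by
      simp [v2, m₂, hLV1 j hj]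
    have e2 : (rd .POS (vr .v)).eval ((s₂.setV .j j).setV .v (l1[j] : ℕ)) =
        if l1[j] ∈ l2 then 2 ^ l2.idxOf l1[j] else 0 := by
      simp [hP₂, hnewt hl1 j hj]
    have e3 : ∀ z, (rd .LC (vr .pa + vr .j)).eval (((s₂.setV .j j).setV .v (l1[j] : ℕ)).setV .w z) =
        ((c₁ l1[j] : ℕ) : ℤ) := fun z => by
      simp [v2, m₂, hLC1 j hj]
    have hidx : ∀ v : Fin n, v ∈ l2 → (2 : ℤ) ^ l2.idxOf v ≤ M := fun v hv => by
      have := hpw ((List.idxOf_lt_length_of_mem hv).le.trans hw₂)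
      exact_mod_cast this
    have hidxs : ∀ v : Fin n, (2 : ℤ) ^ l2.idxOf v ≤ M := fun v => by
      have := hpw ((List.idxOf_le_length (a := v) (l := l2)).trans hw₂)
      exact_mod_cast this
    have hin : ((l1[j] : ℕ) : ℤ) ≤ M := le_trans (by exact_mod_cast l1[j].2.le) hn
    refine Run.setThen (by rw [e1, Nat.abs_cast]; exact hin) ?_
    rw [e1]
    refine Run.setThen ?_ ?_
    · rw [e2]
      split_ifs with h
      · rw [abs_of_nonneg (by positivity)]; exact hidx _ h
      · exact h0M
    rw [e2]
    refine Run.setThen ?_ ?_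
    · rw [e3, Nat.abs_cast]; exact le_trans (by push_cast; omega) (hc l1[j])
    rw [e3]
    set s₃ := (((s₂.setV .j j).setV .v (l1[j] : ℕ)).setV .w
      (if l1[j] ∈ l2 then 2 ^ l2.idxOf l1[j] else 0)).setV .c ((c₁ l1[j] : ℕ) : ℤ) with hs3
    have k₃ := k₂.of_eq (s' := s₃) (fun x hx => by
      rw [hs3, St.setV_v_ne _ (by revert x; decide), St.setV_v_ne _ (by revert x; decide),
        St.setV_v_ne _ (by revert x; decide), St.setV_v_ne _ (by revert x; decide)])
      (fun _ _ => rfl)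
    have hlen : ∀ p, ((((l1.take j).filter p).length : ℕ) : ℤ) + 1 ≤ M := by
      intro p
      have := List.length_filter_le p (l1.take j)
      have := List.length_take_le j l1
      omega
    have hsum : ((((l1.take j).filter pF).map fun v => (2 : ℤ) ^ l2.idxOf v).sum + 2 ^ l2.idxOf l1[j]) ≤ M ∧
        0 ≤ (((l1.take j).filter pF).map fun v => (2 : ℤ) ^ l2.idxOf v).sum := by
      have hnd : ((l1.take j).filter pF).Nodup := (hl1.sublist (List.take_sublist _ _)).filter _
      rw [← List.sum_toFinset _ hnd]
      have h1 := sum_two_pow_idxOf_le hl₂ (S := ((l1.take j).filter pF).toFinset) (fun v hv => by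
        rw [List.mem_toFinset, List.mem_filter] at hv
        rw [List.mem_toFinset]
        have := hv.2
        simp [hpF] at this
        exact this.1)
      refine ⟨?_, h1.1⟩
      have h2 : (2 : ℤ) ^ l2.length ≤ 2 ^ w := pow_le_pow_right₀ (by norm_num) hw₂
      have h3 : (2 : ℤ) ^ l2.idxOf l1[j] ≤ 2 ^ w := pow_le_pow_right₀ (by norm_num)
        (List.idxOf_le_length.trans hw₂)
      have h4 : (2 : ℤ) ^ w + 2 ^ w ≤ M := by
        have : ((2 ^ (w + 1) : ℕ) : ℤ) = 2 ^ w + 2 ^ w := by push_cast; ring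
        omega
      linarith [h1.2]
    refine Run.andThen (run_assign k₃ (v := l1[j]) (d := d) (P := l1[j] ∈ l2) (by simp [hs3])
      (by simp [hs3, hpw2, hl1.idxOf_getElem j hj]) (by simp [hs3]) (by positivity) (by simp [hs3])
      (by simp [hs3, m₂, hd]) (fun h => by simp [hs3, hC2, hC1 _ h]) hn hc ?_ (hidxs _) ?_
      (hlen _) (hlen _) (hlen _)) ?_
    · rw [hl1.idxOf_getElem j hj, abs_of_nonneg (by positivity)]
      exact_mod_cast hpw (hj.le.trans hw1)
    · rw [abs_of_nonneg (add_nonneg hsum.2 (by positivity))]; exact hsum.1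
    intro s₄ ⟨k₄, hP4⟩ hf4
    have hpw4 : s₄.v .pw = (2 ^ j : ℕ) := by rw [hf4.v _]; simp [hs3, hpw2]
    have e4 : (vr .pw + vr .pw : Term).eval s₄ = (2 ^ (j + 1) : ℕ) := by
      simp [hpw4]; ring
    refine Run.setEnd ?_ ⟨?_, ?_, ?_⟩
    · rw [e4, Nat.abs_cast]
      exact hpw (by omega)
    · have htake : l1.take (j + 1) = l1.take j ++ [l1[j]] := (List.take_append_getElem hj).symm
      have k5 := k₄.of_eq (s' := s₄.setV .pw ((vr .pw + vr .pw : Term).eval s₄))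
        (fun x hx => St.setV_v_ne _ (by revert x; decide) _) (fun _ _ => rfl)
      have f1 : ∀ p : Fin n → Bool, (l1.take (j + 1)).filter p = (l1.take j).filter p ++
          if p l1[j] then [l1[j]] else [] := fun p => by
        rw [htake, List.filter_append]
        congr 1
        simp [List.filter_cons]
      rw [f1, f1, f1]
      convert k5 using 2
      · simp [hpI]
      · simp [hpF]
      · simp only [hpL]
        by_cases h : l1[j] ∈ l2 <;> simp [h]
    · rw [e4, St.setV_v_self]
    · intro v
      rw [St.setV_m, hP4 v]
      have hP3 : s₃.m .POS = s₂.m .POS := rfl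
      have htake : l1.take (j + 1) = l1.take j ++ [l1[j]] := (List.take_append_getElem hj).symm
      rw [hP3, hP₂ v]
      simp only [htake, List.mem_append, List.mem_singleton]
      by_cases hv : v = l1[j]
      · by_cases h2 : l1[j] ∈ l2
        · rw [if_pos ⟨h2, hv⟩, if_neg (by tauto)]
        · rw [if_neg (by tauto), if_neg (by rw [hv]; tauto), if_neg (by rw [hv]; tauto)]
      · rw [if_neg (by tauto)]
        refine if_congr ?_ rfl rfl
        tauto
  · intro s' h _
    rw [List.take_length] at h
    exact ⟨h.1, h.2.2⟩
  intro s₂ ⟨k₂, hP₂⟩ hf2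
  have v2 : ∀ x ∈ [Var.lb, .pb], s₂.v x = s.v x := fun x hx => by
    rw [hf2.vs (by decide) _ hx, St.setV_v_ne _ (by revert x; decide),
      v1 x (by revert x; decide)]
  have m₂ : s₂.m .LV = s.m .LV := by rw [hf2.m _, St.setV_m, m₁ _ (by decide)]
  have hC2 : s₂.m .PCN = s₁.m .PCN := by rw [hf2.m _, St.setV_m]
  refine Run.loop' l2.length (fun j s' => Classes s' (fun v => 2 ^ l1.idxOf v)
      (fun v => 2 ^ l2.idxOf v) c₁ c₂ (l1.filter pI) (l1.filter pF)
      (l1.filter pL) ((l2.take j).filter pR) ∧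
      (∀ v : Fin n, s'.m .POS (v : ℕ) =
        if v ∈ l2 ∧ v ∉ l1 ∧ v ∉ l2.take j then 2 ^ l2.idxOf v else 0)) (t := 8)
      (by simpa [v2] using hlb) (by omega) ?_ ?_ (by omega) ?_
  · exact ⟨by simpa using k₂, by simpa using hP₂⟩
  · intro j hj s₃ ⟨k₃, hP3⟩ hf3
    have e1 : (rd .LV (vr .pb + vr .j)).eval (s₃.setV .j j) = ((l2[j] : ℕ) : ℤ) := by
      simp [hf3.v .pb, v2, hf3.m .LV, m₂, hLV2 j hj]
    have e2 : (rd .POS (vr .v)).eval ((s₃.setV .j j).setV .v (l2[j] : ℕ)) =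
        if l2[j] ∉ l1 then 2 ^ l2.idxOf l2[j] else 0 := by
      simp [hP3, hnewt hl₂ j hj]
    have hC3 : s₃.m .PCN (l2[j] : ℕ) = c₂ l2[j] := by
      rw [hf3.m _, hC2, hC1 _ (List.getElem_mem hj)]
    have hin : ((l2[j] : ℕ) : ℤ) ≤ M := le_trans (by exact_mod_cast l2[j].2.le) hn
    have hidx : (2 : ℤ) ^ l2.idxOf l2[j] ≤ M := by
      have := hpw (List.idxOf_le_length.trans hw₂ : l2.idxOf l2[j] ≤ w)
      exact_mod_cast this
    have htake : l2.take (j + 1) = l2.take j ++ [l2[j]] := (List.take_append_getElem hj).symm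
    have f1 : (l2.take (j + 1)).filter pR = (l2.take j).filter pR ++
        if l2[j] ∉ l1 then [l2[j]] else [] := by
      rw [htake, List.filter_append]
      congr 1
      simp [List.filter_cons, hpR]
    refine Run.setThen (by rw [e1, Nat.abs_cast]; exact hin) ?_
    rw [e1]
    refine Run.setThen ?_ ?_
    · rw [e2]
      split_ifs with h
      · exact h0M
      · rw [abs_of_nonneg (by positivity)]; exact hidx
    rw [e2]
    set s₄ := ((s₃.setV .j j).setV .v (l2[j] : ℕ)).setV .w
      (if l2[j] ∉ l1 then 2 ^ l2.idxOf l2[j] else 0) with hs4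
    have k₄ := k₃.of_eq (s' := s₄) (fun x hx => by
      rw [hs4, St.setV_v_ne _ (by revert x; decide), St.setV_v_ne _ (by revert x; decide),
        St.setV_v_ne _ (by revert x; decide)])
      (fun _ _ => rfl)
    have hP4 : s₄.m .POS = s₃.m .POS := rfl
    have hv4 : s₄.v .v = (l2[j] : ℕ) := by simp [hs4]
    refine Run.iteEnd (fun hp => ?_) fun hp => ?_
    · have hnot : l2[j] ∉ l1 := by
        by_contra hcon
        simp [hs4, hcon] at hp
      have hw4 : s₄.v .w = 2 ^ l2.idxOf l2[j] := by simp [hs4, hnot]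
      rw [← hP4] at hP3
      have hC4 : s₄.m .PCN (l2[j] : ℕ) = c₂ l2[j] := hC3
      clear_value s₄
      refine Run.putThen ?_ (Run.putThen ?_ (Run.putThen ?_
        (Run.putThen ?_ (Run.setEnd ?_ ⟨?_, ?_⟩))))
      · simp only [Ex.eval_var, hw4]; rw [abs_of_nonneg (by positivity)]; exact hidx
      · simpa [hv4] using hin
      · simp only [Ex.eval_rd, Ex.eval_var, St.setM_v, ne_eq, reduceCtorEq, not_false_eq_true,
          St.setM_m_ne, hv4, hC4, Nat.abs_cast]
        exact le_trans (by push_cast; omega) (hc l2[j])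
      · exact h0M
      · simp only [Ex.eval_add, Ex.eval_var, St.setM_v, k₄.nr, Ex.eval_one]
        rw [abs_of_nonneg (by positivity)]
        have := List.length_filter_le pR (l2.take j)
        have := List.length_take_le j l2
        omega
      · rw [f1, if_pos hnot]
        constructor <;> simp only [Ex.eval_var, Ex.eval_add,
          Ex.eval_one, St.setM_v, St.setV_v_self, Ex.eval_rd,
          ne_eq, reduceCtorEq, not_false_eq_true, St.setV_v_ne, St.setV_m, St.setM_m_ne,
          List.map_append, List.map_cons, List.map_nil, List.length_append, hv4, hw4, hC4]
        case nr => simp [k₄.nr]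
        case WRB => exact k₄.WRB.append (by simp [k₄.nr])
        case VR => exact ArrIs.append (by simpa using k₄.VR) (by simp [k₄.nr])
        case CR => exact ArrIs.append (by simpa using k₄.CR) (by simp [k₄.nr])
        all_goals cases k₄; assumption
      · intro v
        simp only [Ex.eval_var, St.setM_v, St.setV_m, St.setM_m_self, hv4, Ex.eval_zero,
          Nat.cast_inj, Fin.val_inj, ne_eq, reduceCtorEq, not_false_eq_true, St.setM_m_ne, hP3, htake,
          List.mem_append, List.mem_singleton]
        by_cases hv : v = l2[j]
        · rw [if_pos hv, if_neg (by tauto)]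
        · rw [if_neg hv]
          refine if_congr ?_ rfl rfl
          tauto
    · have hin' : l2[j] ∈ l1 := by
        by_contra hcon
        simp [hs4, hcon] at hp
      refine Run.skipEnd ⟨?_, fun v => ?_⟩
      · rw [f1, if_neg (not_not.2 hin'), List.append_nil]
        exact k₄
      · rw [hP4, hP3]
        simp only [htake, List.mem_append, List.mem_singleton]
        refine if_congr ?_ rfl rfl
        constructor
        · rintro ⟨h1, h2, h3⟩
          exact ⟨h1, h2, fun h => h.elim h3 fun h => h2 (h ▸ hin')⟩
        · rintro ⟨h1, h2, h3⟩
          exact ⟨h1, h2, fun h => h3 (Or.inl h)⟩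
  · intro s' ⟨h1, h2⟩ _
    rw [List.take_length] at h1 h2
    refine ⟨h1, fun v => ?_⟩
    rw [h2 v, if_neg (by tauto)]

/-! ### The program: combination of two slots -/

/-- Append a class of vertices to the list being written. -/
def emit (VA CA : Arr) (len : Var) : Code :=
  .loop .i (vr len)
    (.put .LV (vr .ltop) (rd VA (vr .i)) ;; .put .LC (vr .ltop) (rd CA (vr .i)) ;;
    .set .ltop (vr .ltop + 1))

/-- Write the table and the vertex list of the union. -/
def output : Code :=
  .put .LN (vr .jc) (vr .nr + vr .nl + vr .ni) ;; .put .LB (vr .jc) (vr .ltop) ;;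
  .put .TB (vr .jc) (vr .top) ;;
  .loop .i (vr .so)
    (.put .TAB (vr .top + vr .i) (rd .HH (rd .RO (vr .i) * vr .so + vr .i))) ;;
  .set .top (vr .top + vr .so) ;; emit .VR .CR .nr ;; emit .VL .CL .nl ;; emit .VI .CI .ni

/-- Combine the slots `ja` and `jb` to the slot `jc`. -/
def join : Code :=
  .set .la (rd .LN (vr .ja)) ;; .set .lb (rd .LN (vr .jb)) ;;
  .set .pa (rd .LB (vr .ja)) ;; .set .pb (rd .LB (vr .jb)) ;;
  .set .ta (rd .TB (vr .ja)) ;; .set .tb (rd .TB (vr .jb)) ;; classify ;; convolve ;; output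

variable {M : ℤ} {mm : ℕ → ℕ} {n : ℕ} {s : Store}

/-- The array `f` holds the list `l` from the address `a` on. -/
def ArrFrom (f : ℤ → ℤ) (a : ℤ) (l : List ℤ) : Prop :=
  ∀ (b : ℕ) (h : b < l.length), f (a + b) = l[b]

theorem ArrFrom.append {f : ℤ → ℤ} {a : ℤ} {l l' : List ℤ} (h : ArrFrom f a l)
    (h' : ArrFrom f (a + l.length) l') : ArrFrom f a (l ++ l') := by
  intro b hb
  by_cases hbl : b < l.length
  · rw [List.getElem_append_left hbl, h b hbl]
  · rw [List.length_append] at hb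
    rw [List.getElem_append_right (by omega), ← h' (b - l.length) (by omega)]
    congr 1
    omega

theorem ArrFrom.of_eq {f g : ℤ → ℤ} {a z : ℤ} {l : List ℤ} (h : ArrFrom f a l)
    (hz : a + l.length ≤ z) (hg : ∀ i < z, g i = f i) : ArrFrom g a l := fun b hb => by
  rw [hg _ (by omega), h b hb]

theorem run_emit {VA CA : Arr} {len : Var} (hVA : VA ∉ [Arr.LV, .LC]) (hCA : CA ∉ [Arr.LV, .LC])
    {vs cs : List ℤ} (h : s.v len = vs.length)
    (hc : cs.length = vs.length) (hv : ArrIs (s.m VA) vs) (hcs : ArrIs (s.m CA) cs)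
    (hM : |s.v .ltop| + vs.length ≤ M) (hvM : ∀ z ∈ vs, |z| ≤ M) (hcM : ∀ z ∈ cs, |z| ≤ M) :
    Run M mm (emit VA CA len) s (4 * vs.length + 1) fun s' =>
      s'.v .ltop = s.v .ltop + vs.length ∧ ArrFrom (s'.m .LV) (s.v .ltop) vs ∧
      ArrFrom (s'.m .LC) (s.v .ltop) cs ∧
      ∀ z < s.v .ltop, s'.m .LV z = s.m .LV z ∧ s'.m .LC z = s.m .LC z := by
  simp only [List.mem_cons, List.not_mem_nil, or_false, not_or] at hVA hCA
  have h0 := abs_nonneg (s.v .ltop)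
  refine Run.loop' vs.length (fun i s' => s'.v .ltop = s.v .ltop + i ∧
    (∀ (b : ℕ) (h : b < vs.length), b < i → s'.m .LV (s.v .ltop + b) = vs[b]) ∧
    (∀ (b : ℕ) (h : b < cs.length), b < i → s'.m .LC (s.v .ltop + b) = cs[b]) ∧
    ∀ z < s.v .ltop, s'.m .LV z = s.m .LV z ∧ s'.m .LC z = s.m .LC z) (t := 3) h (by omega)
    ⟨by simp, by simp, by simp, fun _ _ => ⟨rfl, rfl⟩⟩ ?_ (by omega) ?_
  · intro i hi s₁ ⟨h1, h2, h3, h4⟩ hf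
    have eV : (rd VA (vr .i)).eval (s₁.setV .i i) = vs[i] := by
      rw [Ex.eval_rd, Ex.eval_var, St.setV_v_self, St.setV_m, hf.2 VA (by simp [Cmd.wa, hVA]),
        hv i hi]
    have eC : cs[i]'(hc ▸ hi) = s₁.m CA i := by
      rw [hf.2 CA (by simp [Cmd.wa, hCA]), hcs i (hc ▸ hi)]
    refine Run.putThen (by rw [eV]; exact hvM _ (by simp)) (Run.putThen ?_ (Run.setEnd ?_ ⟨?_, fun b hb hbi => ?_, fun b hb hbi => ?_,
        fun z hz => ?_⟩))
    · simp [St.setM_m_ne _ hCA.1, ← eC]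
      exact hcM _ (by simp)
    · simp only [Ex.eval_add, Ex.eval_var, St.setM_v, ne_eq, reduceCtorEq, not_false_eq_true,
        St.setV_v_ne, h1, Ex.eval_one]
      have := abs_le.1 (le_refl |s.v .ltop|)
      exact abs_le.2 ⟨by omega, by omega⟩
    · simp [h1]; ring
    · simp [St.setM_m_self, h1, eV, add_right_inj]
      by_cases hbi' : b = i
      · subst hbi'; simp
      · rw [if_neg hbi', h2 b hb (by omega)]
    · simp [St.setM_m_self, h1, add_right_inj, St.setM_m_ne _ hCA.1, ← eC]
      by_cases hbi' : b = i
      · subst hbi'; simp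
      · rw [if_neg hbi', h3 b hb (by omega)]
    · simp [St.setM_m_self, h1]
      rw [if_neg (by omega), if_neg (by omega)]
      exact h4 z hz
  · intro s' ⟨h1, h2, h3, h4⟩ _
    exact ⟨h1, fun b hb => h2 b hb hb, fun b hb => h3 b hb (hc ▸ hb), h4⟩

/-- Slot `k` of the state `s` describes the set of edges `E`: `l` lists its boundary, and there
are its list of vertices and of their degrees at `lb` and its table at `tb`. -/
structure Slot (E0 : Finset (Sym2 (Fin n))) (s : Store) (E : Finset (Sym2 (Fin n))) (k : ℕ)
    (l : List (Fin n)) (lb tb : ℕ) : Prop where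
  nodup : l.Nodup
  toFinset : l.toFinset = bdry E0 E
  LN : s.m .LN k = l.length
  LB : s.m .LB k = lb
  TB : s.m .TB k = tb
  LV : ArrFrom (s.m .LV) lb (l.map fun v : Fin n => ((v : ℕ) : ℤ))
  LC : ArrFrom (s.m .LC) lb (l.map fun v => ((cnt E v : ℕ) : ℤ))
  TAB : ∀ q : ℕ, q < 2 ^ l.length → s.m .TAB ((tb : ℤ) + q) = (pm E0 E (sub l q) : ℕ)

/-- Slot `k` of the state `s` describes `E` by data below the current ends. -/
def HasSlot (E0 : Finset (Sym2 (Fin n))) (s : Store) (E : Finset (Sym2 (Fin n))) (k : ℕ) :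
    Prop :=
  ∃ l lb tb, Slot E0 s E k l lb tb ∧ (lb : ℤ) + l.length ≤ s.v .ltop ∧
    (tb : ℤ) + (2 ^ l.length : ℕ) ≤ s.v .top

/-- The slots other than `k` persist, and what is stored grows. -/
structure Grows (k : ℕ) (s s' : Store) : Prop where
  ltop : s.v .ltop ≤ s'.v .ltop
  top : s.v .top ≤ s'.v .top
  dir : ∀ a ∈ [Arr.LN, .LB, .TB], ∀ i : ℕ, i ≠ k → s'.m a i = s.m a i
  lists : ∀ a ∈ [Arr.LV, .LC], ∀ i < s.v .ltop, s'.m a i = s.m a i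
  TAB : ∀ i < s.v .top, s'.m .TAB i = s.m .TAB i

theorem HasSlot.of_grows {E0 E : Finset (Sym2 (Fin n))} {s s' : Store} {j k : ℕ}
    (h : HasSlot E0 s E j) (hg : Grows k s s') (hk : j ≠ k) : HasSlot E0 s' E j := by
  obtain ⟨l, lb, tb, h, hl, ht⟩ := h
  refine ⟨l, lb, tb, ⟨h.nodup, h.toFinset, ?_, ?_, ?_, ?_, ?_, fun q hq => ?_⟩,
    hl.trans hg.ltop, ht.trans hg.top⟩
  · rw [hg.dir _ (by simp) j hk, h.LN]
  · rw [hg.dir _ (by simp) j hk, h.LB]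
  · rw [hg.dir _ (by simp) j hk, h.TB]
  · exact h.LV.of_eq (by simpa using hl) (hg.lists _ (by simp))
  · exact h.LC.of_eq (by simpa using hl) (hg.lists _ (by simp))
  · rw [hg.TAB _ (lt_of_lt_of_le (by rw [add_lt_add_iff_left]; exact_mod_cast hq) ht), h.TAB q hq]

theorem Slot.tab_sum {E0 E : Finset (Sym2 (Fin n))} {k lb tb : ℕ}
    {l : List (Fin n)} (h : Slot E0 s E k l lb tb) {S : Finset (Fin n)} (hS : S ⊆ l.toFinset) :
    s.m .TAB ((tb : ℤ) + ∑ v ∈ S, 2 ^ l.idxOf v) = (pm E0 E S : ℕ) := by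
  obtain ⟨q, hq, rfl⟩ := exists_sub_eq h.nodup S hS
  rw [sum_pow_sub h.nodup q hq, h.TAB q hq]

theorem Slot.sum_le {E0 E : Finset (Sym2 (Fin n))} {k lb tb : ℕ}
    {l : List (Fin n)} (h : Slot E0 s E k l lb tb) {S : Finset (Fin n)} (hS : S ⊆ l.toFinset) :
    |∑ v ∈ S, (2 : ℤ) ^ l.idxOf v| ≤ (2 ^ l.length : ℕ) := by
  obtain ⟨q, hq, rfl⟩ := exists_sub_eq h.nodup S hS
  rw [sum_pow_sub h.nodup q hq, Nat.abs_cast]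
  exact_mod_cast hq.le

theorem run_output {wA wB : Fin n → ℤ} {c₁ c₂ : Fin n → ℕ}
    {LI LF LL LR : List (Fin n)} (hC : Classes s wA wB c₁ c₂ LI LF LL LR) {k w lt tp : ℕ}
    {g : ℕ → ℤ} (hk : s.v .jc = k) (hlt : s.v .ltop = lt) (htp : s.v .top = tp)
    (hso : s.v .so = (2 ^ (LR ++ LL ++ LI).length : ℕ)) (hw : (LR ++ LL ++ LI).length ≤ w)
    (hg : ∀ q : ℕ, q < 2 ^ (LR ++ LL ++ LI).length →
      s.m .HH (s.m .RO q * (2 ^ (LR ++ LL ++ LI).length : ℕ) + q) = g q ∧ |g q| ≤ M)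
    (hn : (n : ℤ) ≤ M) (hc : ∀ v, ((c₁ v + c₂ v : ℕ) : ℤ) ≤ M)
    (hltM : ((lt + w : ℕ) : ℤ) ≤ M) (htpM : ((tp + 2 ^ w : ℕ) : ℤ) ≤ M) :
    Run M mm output s (2 * 2 ^ w + 4 * w + 8) fun s' =>
      s'.m .LN k = (LR ++ LL ++ LI).length ∧ s'.m .LB k = lt ∧ s'.m .TB k = tp ∧
      s'.v .ltop = lt + (LR ++ LL ++ LI).length ∧
      s'.v .top = tp + (2 ^ (LR ++ LL ++ LI).length : ℕ) ∧ Grows k s s' ∧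
      ArrFrom (s'.m .LV) lt ((LR ++ LL ++ LI).map fun v : Fin n => ((v : ℕ) : ℤ)) ∧
      ArrFrom (s'.m .LC) lt ((LR.map fun v => ((c₂ v : ℕ) : ℤ)) ++
        (LL.map fun v => ((c₁ v : ℕ) : ℤ)) ++ LI.map fun v => ((c₁ v + c₂ v : ℕ) : ℤ)) ∧
      ∀ q : ℕ, q < 2 ^ (LR ++ LL ++ LI).length → s'.m .TAB ((tp : ℤ) + q) = g q := by
  set so := 2 ^ (LR ++ LL ++ LI).length with hsodef
  have hsow : so ≤ 2 ^ w := Nat.pow_le_pow_right (by norm_num) hw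
  have hlen : (LR ++ LL ++ LI).length = LR.length + LL.length + LI.length := by
    simp [add_assoc]
  rw [hlen] at hw ⊢
  clear_value so
  have h2w : (0 : ℤ) ≤ 2 ^ w := by positivity
  have hvM : ∀ {l : List (Fin n)}, ∀ z ∈ l.map fun v : Fin n => ((v : ℕ) : ℤ), |z| ≤ M := by
    intro l z hz
    obtain ⟨v, _, rfl⟩ := List.mem_map.1 hz
    rw [Nat.abs_cast]
    have := v.2
    omega
  have hcM : ∀ {l : List (Fin n)} {c : Fin n → ℕ}, (∀ v, c v ≤ c₁ v + c₂ v) →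
      ∀ z ∈ l.map fun v : Fin n => ((c v : ℕ) : ℤ), |z| ≤ M := by
    intro l c hcc z hz
    obtain ⟨v, _, rfl⟩ := List.mem_map.1 hz
    rw [Nat.abs_cast]
    exact le_trans (by exact_mod_cast hcc v) (hc v)
  refine Run.putThen ?_ (Run.putThen ?_ (Run.putThen ?_ ?_))
  · simp only [Ex.eval_add, Ex.eval_var, hC.nr, hC.nl, hC.ni]
    rw [abs_of_nonneg (by positivity)]
    omega
  · simp only [Ex.eval_var, St.setM_v, hlt, Nat.abs_cast]
    omega
  · simp only [Ex.eval_var, St.setM_v, htp, Nat.abs_cast]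
    omega
  simp only [Ex.eval_add, Ex.eval_var, St.setM_v, hC.nr, hC.nl, hC.ni, hk, hlt, htp]
  set s₁ := ((s.setM .LN k _).setM .LB k _).setM .TB k _ with hs1
  have hm₁ : ∀ a ∉ [Arr.LN, .LB, .TB], s₁.m a = s.m a := by
    intro a ha
    simp only [List.mem_cons, List.not_mem_nil, or_false, not_or] at ha
    rw [hs1, St.setM_m_ne _ ha.2.2, St.setM_m_ne _ ha.2.1, St.setM_m_ne _ ha.1]
  refine Run.andThen (t1 := so * 2 + 1) (R := fun s' =>
    (∀ q : ℕ, q < so → s'.m .TAB ((tp : ℤ) + q) = g q) ∧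
    ∀ i < (tp : ℤ), s'.m .TAB i = s.m .TAB i) ?_ ?_
  · refine Run.loop' so (fun i s' => (∀ q : ℕ, q < so → q < i → s'.m .TAB ((tp : ℤ) + q) = g q) ∧
      ∀ i < (tp : ℤ), s'.m .TAB i = s.m .TAB i) (t := 1) hso (by omega)
      ⟨by simp, fun z _ => by rw [hm₁ _ (by decide)]⟩ ?_ le_rfl fun s' ⟨h1, h2⟩ _ =>
        ⟨fun q hq => h1 q hq hq, h2⟩
    intro i hi s₂ ⟨h1, h2⟩ hf
    have e : (rd .HH (rd .RO (vr .i) * vr .so + vr .i)).eval (s₂.setV .i i) = g i := by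
      simp
      rw [hf.m .HH, hf.m .RO, hf.v .so, hm₁ _ (by decide),
        hm₁ _ (by decide), hs1, St.setM_v, St.setM_v, St.setM_v, hso]
      exact (hg i hi).1
    have e' : (vr .top + vr .i : Term).eval (s₂.setV .i i) = (tp : ℤ) + i := by
      simp only [Ex.eval_add, Ex.eval_var, St.setV_v_self, ne_eq,
        reduceCtorEq, not_false_eq_true, St.setV_v_ne]
      rw [hf.v .top, hs1, St.setM_v, St.setM_v, St.setM_v, htp]
    refine Run.putEnd (by rw [e]; exact (hg i hi).2) ⟨fun q hq hqi => ?_, fun z hz => ?_⟩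
    · rw [e, e', St.setM_m_self, St.setV_m]
      simp only [add_right_inj, Nat.cast_inj]
      by_cases h : q = i
      · rw [if_pos h, h]
      · rw [if_neg h, h1 q hq (by omega)]
    · rw [e, e', St.setM_m_self, if_neg (by omega), St.setV_m, h2 z hz]
  intro s₂ ⟨hT, hT'⟩ hf2
  have hv2 : ∀ x, x ≠ .i → s₂.v x = s.v x := fun x hx => by
    rw [hf2.1 x (by simpa [Cmd.wv] using hx)]; rfl
  have htop : (vr .top + vr .so : Term).eval s₂ = (tp : ℤ) + so := by
    simp only [Ex.eval_add, Ex.eval_var, hv2 .top (by decide), hv2 .so (by decide), htp, hso]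
  refine Run.setThen (by rw [htop, abs_of_nonneg (by positivity)]; omega) ?_
  rw [htop]
  set s₃ := s₂.setV .top ((tp : ℤ) + so) with hs3
  have hv3 : ∀ x, x ≠ .i → x ≠ .top → s₃.v x = s.v x := fun x h h' => by
    rw [hs3, St.setV_v_ne _ h', hv2 x h]
  have hm₃ : ∀ a, a ≠ .TAB → s₃.m a = s₁.m a := fun a ha => by
    rw [hs3, St.setV_m, hf2.2 a (by simpa [Cmd.wa] using ha)]
  have h3lt : s₃.v .ltop = lt := by rw [hv3 _ (by decide) (by decide), hlt]
  refine Run.andThen (run_emit (vs := LR.map fun v : Fin n => ((v : ℕ) : ℤ))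
    (cs := LR.map fun v => ((c₂ v : ℕ) : ℤ)) (by decide) (by decide) ?_ (by simp) ?_ ?_ ?_ hvM
    (hcM fun v => by omega)) ?_
    (by simp only [List.length_map]; omega)
  · rw [hv3 _ (by decide) (by decide), hC.nr, List.length_map]
  · rw [hm₃ _ (by decide), hm₁ _ (by decide)]; exact hC.VR
  · rw [hm₃ _ (by decide), hm₁ _ (by decide)]; exact hC.CR
  · rw [h3lt, Nat.abs_cast, List.length_map]; omega
  rw [h3lt, List.length_map]
  intro s₄ ⟨hl4, hV4, hC4, hlo4⟩ hf4
  refine Run.andThen (run_emit (vs := LL.map fun v : Fin n => ((v : ℕ) : ℤ))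
    (cs := LL.map fun v => ((c₁ v : ℕ) : ℤ)) (by decide) (by decide) ?_ (by simp) ?_ ?_ ?_ hvM
    (hcM fun v => by omega)) ?_
    (by simp only [List.length_map]; omega)
  · rw [hf4.v _, hv3 _ (by decide) (by decide), hC.nl, List.length_map]
  · rw [hf4.m _, hm₃ _ (by decide), hm₁ _ (by decide)]; exact hC.VL
  · rw [hf4.m _, hm₃ _ (by decide), hm₁ _ (by decide)]; exact hC.CL
  · rw [hl4, List.length_map, abs_of_nonneg (by positivity)]; omega
  rw [hl4, List.length_map]
  intro s₅ ⟨hl5, hV5, hC5, hlo5⟩ hf5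
  refine (run_emit (vs := LI.map fun v : Fin n => ((v : ℕ) : ℤ))
    (cs := LI.map fun v => ((c₁ v + c₂ v : ℕ) : ℤ)) (by decide) (by decide) ?_ (by simp) ?_ ?_ ?_
    hvM (hcM fun v => by omega)).imp (by simp only [List.length_map]; omega) ?_
  · rw [hf5.v _, hf4.v _, hv3 _ (by decide) (by decide), hC.ni,
      List.length_map]
  · rw [hf5.m _, hf4.m _, hm₃ _ (by decide), hm₁ _ (by decide)]
    exact hC.VI
  · rw [hf5.m _, hf4.m _, hm₃ _ (by decide), hm₁ _ (by decide)]
    exact hC.CI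
  · rw [hl5, List.length_map, abs_of_nonneg (by positivity)]; omega
  rw [hl5, List.length_map]
  intro s₆ ⟨hl6, hV6, hC6, hlo6⟩ hf6
  have hm6 : ∀ a ∉ [Arr.LV, .LC], s₆.m a = s₂.m a := fun a ha => by
    rw [hf6.2 a (by simpa [Cmd.wa, emit] using ha), hf5.2 a (by simpa [Cmd.wa, emit] using ha),
      hf4.2 a (by simpa [Cmd.wa, emit] using ha), hs3, St.setV_m]
  have hm6' : ∀ a ∉ [Arr.LV, .LC, .TAB], s₆.m a = s₁.m a := fun a ha => by
    simp [not_or] at ha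
    rw [hm6 a (by simp [ha]), hf2.2 a (by simpa [Cmd.wa] using ha.2.2)]
  have htop6 : s₆.v .top = (tp : ℤ) + so := by
    rw [hf6.v _, hf5.v _, hf4.v _, hs3, St.setV_v_self]
  refine ⟨?_, ?_, ?_, ?_, htop6, ⟨?_, ?_, ?_, ?_, ?_⟩, ?_, ?_, ?_⟩
  · rw [hm6' _ (by decide), hs1]
    simp [St.setM_m_self]
  · rw [hm6' _ (by decide), hs1]
    simp [St.setM_m_self]
  · rw [hm6' _ (by decide), hs1]
    simp [St.setM_m_self]
  · rw [hl6]; push_cast; ring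
  · rw [hl6, hlt]; omega
  · rw [htop6, htp]; omega
  · intro a ha i hi
    have hi' : (i : ℤ) ≠ k := by exact_mod_cast hi
    simp only [List.mem_cons, List.not_mem_nil, or_false] at ha
    rcases ha with rfl | rfl | rfl <;> rw [hm6' _ (by decide), hs1] <;>
      simp [St.setM_m_self, hi']
  · intro a ha i hi
    rw [hlt] at hi
    have key : ∀ a ∈ [Arr.LV, .LC], s₃.m a = s.m a := fun a ha => by
      rw [hm₃ a (by rintro rfl; simp at ha), hm₁ a (by revert a; decide)]
    have h4 := hlo4 i hi
    have h5 := hlo5 i (by omega)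
    have h6 := hlo6 i (by omega)
    rw [← key a ha]
    simp only [List.mem_cons, List.not_mem_nil, or_false] at ha
    rcases ha with rfl | rfl
    · rw [h6.1, h5.1, h4.1]
    · rw [h6.2, h5.2, h4.2]
  · intro i hi
    rw [hm6 _ (by decide), hT' i (htp ▸ hi)]
  · rw [List.map_append, List.map_append]
    refine ArrFrom.append (ArrFrom.append ?_ ?_) ?_
    · refine (hV4.of_eq (z := lt + LR.length) (by simp) fun z hz => ?_).of_eq
        (z := lt + LR.length) (by simp) fun z hz => (hlo6 z (by omega)).1
      exact (hlo5 z hz).1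
    · rw [List.length_map]
      exact hV5.of_eq (z := lt + LR.length + LL.length) (by simp) fun z hz => (hlo6 z hz).1
    · simpa [add_assoc] using hV6
  · refine ArrFrom.append (ArrFrom.append ?_ ?_) ?_
    · refine (hC4.of_eq (z := lt + LR.length) (by simp) fun z hz => ?_).of_eq
        (z := lt + LR.length) (by simp) fun z hz => (hlo6 z (by omega)).2
      exact (hlo5 z hz).2
    · rw [List.length_map]
      exact hC5.of_eq (z := lt + LR.length + LL.length) (by simp) fun z hz => (hlo6 z hz).2
    · simpa [add_assoc] using hC6
  · intro q hq
    rw [hm6 _ (by decide), hT q hq]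

variable {M : ℤ} {mm : ℕ → ℕ} {n : ℕ} {s : Store}

theorem Classes.convIn {E0 E1 E2 : Finset (Sym2 (Fin n))} {ja jb ta tb pa pb : ℕ}
    {l1 l2 LI LF LL LR : List (Fin n)} {c₁ c₂ : Fin n → ℕ}
    (h : Classes s (fun v => 2 ^ l1.idxOf v) (fun v => 2 ^ l2.idxOf v) c₁ c₂ LI LF LL LR)
    (h₁ : Slot E0 s E1 ja l1 pa ta) (h₂ : Slot E0 s E2 jb l2 pb tb)
    (hta : s.v .ta = ta) (htb : s.v .tb = tb) (hZ : ∀ b : ℕ, s.m .ZERO b = 0) (hF : LF.Nodup)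
    (hA : LF.toFinset ∪ LL.toFinset ∪ LI.toFinset ⊆ l1.toFinset)
    (hB : LR.toFinset ∪ LF.toFinset ∪ LI.toFinset ⊆ l2.toFinset) :
    ConvIn s LF LL LI LR (fun v => 2 ^ l1.idxOf v) (fun v => 2 ^ l2.idxOf v)
      (fun S => (pm E0 E1 S : ℕ)) (fun S => (pm E0 E2 S : ℕ)) where
  nf := h.nf
  nl := h.nl
  ni := h.ni
  nr := h.nr
  tot := by rw [h.tot, List.sum_toFinset _ hF]
  WFA b hb := by rw [h.WFA b (by simpa using hb), List.getElem_map]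
  WLA b hb := by rw [h.WLA b (by simpa using hb), List.getElem_map]
  WIA b hb := by rw [h.WIA b (by simpa using hb), List.getElem_map]
  WFB b hb := by rw [h.WFB b (by simpa using hb), List.getElem_map]
  WRB b hb := by rw [h.WRB b (by simpa using hb), List.getElem_map]
  WIB b hb := by rw [h.WIB b (by simpa using hb), List.getElem_map]
  ONE b hb := by rw [h.ONE b (by simpa using hb), List.getElem_map]
  ZERO := hZ
  tabA S hS := by rw [hta]; exact h₁.tab_sum (hS.trans hA)
  tabB S hS := by rw [htb]; exact h₂.tab_sum (hS.trans hB)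

theorem Slot.of_eq {E0 E : Finset (Sym2 (Fin n))} {s s' : Store} {k lb tb : ℕ}
    {l : List (Fin n)} (h : Slot E0 s E k l lb tb)
    (hm : ∀ a ∈ [Arr.LN, .LB, .TB, .LV, .LC, .TAB], s'.m a = s.m a) : Slot E0 s' E k l lb tb := by
  simp [forall_eq_or_imp, forall_eq] at hm
  obtain ⟨g1, g2, g3, g4, g5, g6⟩ := hm
  exact ⟨h.nodup, h.toFinset, g1 ▸ h.LN, g2 ▸ h.LB, g3 ▸ h.TB, g4 ▸ h.LV, g5 ▸ h.LC, g6 ▸ h.TAB⟩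

set_option maxHeartbeats 1000000 in
theorem run_join {E0 E1 E2 : Finset (Sym2 (Fin n))} {a b c w lt tp T : ℕ} {μ : ℤ}
    (ha : s.v .ja = a) (hb : s.v .jb = b) (hc : s.v .jc = c) (hlt : s.v .ltop = lt)
    (htp : s.v .top = tp) (h₁ : HasSlot E0 s E1 a) (h₂ : HasSlot E0 s E2 b)
    (hE : Disjoint E1 E2) (h₀ : E1 ∪ E2 ⊆ E0) (hw1 : #(bdry E0 E1) ≤ w)
    (hw₂ : #(bdry E0 E2) ≤ w) (hw : #(bdry E0 (E1 ∪ E2)) ≤ w)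
    (hvd : ∀ v : Fin n, s.m .vd (v : ℕ) = (cnt E0 v : ℕ)) (hP : ∀ v : Fin n, s.m .POS (v : ℕ) = 0)
    (hZ : ∀ b : ℕ, s.m .ZERO b = 0) (hμ : 1 ≤ μ) (hnM : (nM E0 : ℤ) ≤ μ)
    (hM : 2 ^ (10 * w) * μ ^ 2 ≤ M) (hwM : ((2 ^ (w + 1) : ℕ) : ℤ) ≤ M) (hn : (n : ℤ) ≤ M)
    (hdM : ∀ v, ((cnt E0 v : ℕ) : ℤ) ≤ M) (hltM : ((lt + w : ℕ) : ℤ) ≤ M)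
    (htpM : ((tp + 2 ^ w : ℕ) : ℤ) ≤ M) (hT : ∀ i, |s.m .TAB i| ≤ M)
    (hcost : ∀ i l f r, i + l + f ≤ w → i + r + f ≤ w → i + r + l ≤ w → convCost mm i l f r ≤ T) :
    Run M mm join s (T + 200 * (w + 1) ^ 2 * 2 ^ w) fun s' =>
      HasSlot E0 s' (E1 ∪ E2) c ∧ Grows c s s' ∧ s'.v .ltop ≤ lt + w ∧
      s'.v .top ≤ tp + (2 ^ w : ℕ) ∧ ∀ v : Fin n, s'.m .POS (v : ℕ) = 0 := by
  obtain ⟨l1, pa, ta, k₁, hl1, ht₁⟩ := h₁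
  obtain ⟨l2, pb, tb, k₂, hl₂, ht₂⟩ := h₂
  have hlen1 : l1.length ≤ w := by
    rw [← List.toFinset_card_of_nodup k₁.nodup, k₁.toFinset]; exact hw1
  have hlen2 : l2.length ≤ w := by
    rw [← List.toFinset_card_of_nodup k₂.nodup, k₂.toFinset]; exact hw₂
  have hcU : ∀ v, cnt (E1 ∪ E2) v = cnt E1 v + cnt E2 v := cnt_union hE
  have hc0 : ∀ v, cnt E1 v + cnt E2 v ≤ cnt E0 v := fun v => hcU v ▸ cnt_mono h₀ v
  have hm₁ : ∀ v, v ∈ l1 ↔ 0 < cnt E1 v ∧ cnt E1 v < cnt E0 v := fun v => by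
    rw [← mem_bdry, ← k₁.toFinset, List.mem_toFinset]
  have hm2 : ∀ v, v ∈ l2 ↔ 0 < cnt E2 v ∧ cnt E2 v < cnt E0 v := fun v => by
    rw [← mem_bdry, ← k₂.toFinset, List.mem_toFinset]
  obtain ⟨LI, hLI⟩ : ∃ l, l = l1.filter fun v => v ∈ l2 ∧ cnt E1 v + cnt E2 v < cnt E0 v := ⟨_, rfl⟩
  obtain ⟨LF, hLF⟩ : ∃ l, l = l1.filter fun v => v ∈ l2 ∧ ¬ cnt E1 v + cnt E2 v < cnt E0 v :=
    ⟨_, rfl⟩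
  obtain ⟨LL, hLL⟩ : ∃ l, l = l1.filter fun v => v ∉ l2 := ⟨_, rfl⟩
  obtain ⟨LR, hLR⟩ : ∃ l, l = l2.filter fun v => v ∉ l1 := ⟨_, rfl⟩
  have mI : ∀ v, v ∈ LI ↔ v ∈ l1 ∧ v ∈ l2 ∧ cnt E1 v + cnt E2 v < cnt E0 v := by simp [hLI]
  have mF : ∀ v, v ∈ LF ↔ v ∈ l1 ∧ v ∈ l2 ∧ ¬ cnt E1 v + cnt E2 v < cnt E0 v := by simp [hLF]
  have mL : ∀ v, v ∈ LL ↔ v ∈ l1 ∧ v ∉ l2 := by simp [hLL]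
  have mR : ∀ v, v ∈ LR ↔ v ∈ l2 ∧ v ∉ l1 := by simp [hLR]
  have nI : LI.Nodup := hLI ▸ k₁.nodup.filter _
  have nF : LF.Nodup := hLF ▸ k₁.nodup.filter _
  have nL : LL.Nodup := hLL ▸ k₁.nodup.filter _
  have nR : LR.Nodup := hLR ▸ k₂.nodup.filter _
  have hA : (LF ++ LL ++ LI).Nodup := by
    refine List.nodup_append'.2 ⟨List.nodup_append'.2 ⟨nF, nL, ?_⟩, nI, ?_⟩ <;> intro v hv hv' <;>
      simp only [List.mem_append, mI, mF, mL] at hv hv' <;> tauto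
  have hB : (LR ++ LF ++ LI).Nodup := by
    refine List.nodup_append'.2 ⟨List.nodup_append'.2 ⟨nR, nF, ?_⟩, nI, ?_⟩ <;> intro v hv hv' <;>
      simp only [List.mem_append, mI, mF, mR] at hv hv' <;> tauto
  have hO : (LR ++ LL ++ LI).Nodup := by
    refine List.nodup_append'.2 ⟨List.nodup_append'.2 ⟨nR, nL, ?_⟩, nI, ?_⟩ <;> intro v hv hv' <;>
      simp only [List.mem_append, mI, mL, mR] at hv hv' <;> tauto
  have sA : (LF ++ LL ++ LI).toFinset ⊆ l1.toFinset := fun v hv => by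
    simp only [List.mem_toFinset, List.mem_append, mI, mF, mL] at hv ⊢; tauto
  have sB : (LR ++ LF ++ LI).toFinset ⊆ l2.toFinset := fun v hv => by
    simp only [List.mem_toFinset, List.mem_append, mI, mF, mR] at hv ⊢; tauto
  have sO : (LR ++ LL ++ LI).toFinset = bdry E0 (E1 ∪ E2) := by
    ext v
    have := hc0 v
    simp only [List.mem_toFinset, List.mem_append, mI, mL, mR, mem_bdry, hcU, hm₁, hm2]
    omega
  have lA : (LF ++ LL ++ LI).length ≤ w := by
    rw [← List.toFinset_card_of_nodup hA]
    exact (card_le_card sA).trans (by rwa [k₁.toFinset])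
  have lB : (LR ++ LF ++ LI).length ≤ w := by
    rw [← List.toFinset_card_of_nodup hB]
    exact (card_le_card sB).trans (by rwa [k₂.toFinset])
  have lO : (LR ++ LL ++ LI).length ≤ w := by
    rw [← List.toFinset_card_of_nodup hO, sO]; exact hw
  have hpM : ∀ {i}, i ≤ w → ((2 ^ i : ℕ) : ℤ) ≤ M := fun {i} hi =>
    le_trans (by exact_mod_cast Nat.pow_le_pow_right (by norm_num) (by omega)) hwM
  have hwsm : w + 1 ≤ (w + 1) ^ 2 * 2 ^ w := by
    have h1 : 1 ≤ 2 ^ w := Nat.one_le_two_pow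
    nlinarith [Nat.zero_le w]
  have hpsm : 2 ^ w ≤ (w + 1) ^ 2 * 2 ^ w := Nat.le_mul_of_pos_left _ (by positivity)
  have hassoc : ∀ c, c * (w + 1) ^ 2 * 2 ^ w = c * ((w + 1) ^ 2 * 2 ^ w) := fun c => mul_assoc _ _ _
  rw [hassoc]
  set Z := (w + 1) ^ 2 * 2 ^ w with hZdef
  clear_value Z
  have e1 : (rd .LN (vr .ja)).eval s = l1.length := by
    rw [Ex.eval_rd, Ex.eval_var, ha, k₁.LN]
  have hwM' : (w : ℤ) ≤ M := le_trans (by exact_mod_cast Nat.lt_two_pow_self.le) (hpM le_rfl)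
  have htaM : (ta : ℤ) ≤ tp := by have : (0:ℤ) ≤ (2 ^ l1.length : ℕ) := by positivity
                                  omega
  have htbM : (tb : ℤ) ≤ tp := by have : (0:ℤ) ≤ (2 ^ l2.length : ℕ) := by positivity
                                  omega
  have h2w : (0 : ℤ) ≤ 2 ^ w := by positivity
  push_cast at htpM hltM
  refine Run.setThen ?_ (Run.setThen ?_ (Run.setThen ?_
    (Run.setThen ?_ (Run.setThen ?_ (Run.setThen ?_ ?_)))))
  · simp [ha, k₁.LN]; omega
  · simp only [Ex.eval_rd, Ex.eval_var, ne_eq, reduceCtorEq, not_false_eq_true, St.setV_v_ne,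
      St.setV_m, hb, k₂.LN, Nat.abs_cast]; omega
  · simp only [Ex.eval_rd, Ex.eval_var, ne_eq, reduceCtorEq, not_false_eq_true, St.setV_v_ne,
      St.setV_m, ha, k₁.LB, Nat.abs_cast]; omega
  · simp only [Ex.eval_rd, Ex.eval_var, ne_eq, reduceCtorEq, not_false_eq_true, St.setV_v_ne,
      St.setV_m, hb, k₂.LB, Nat.abs_cast]; omega
  · simp only [Ex.eval_rd, Ex.eval_var, ne_eq, reduceCtorEq, not_false_eq_true, St.setV_v_ne,
      St.setV_m, ha, k₁.TB, Nat.abs_cast]; omega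
  · simp only [Ex.eval_rd, Ex.eval_var, ne_eq, reduceCtorEq, not_false_eq_true, St.setV_v_ne,
      St.setV_m, hb, k₂.TB, Nat.abs_cast]; omega
  simp only [Ex.eval_rd, Ex.eval_var, ne_eq, reduceCtorEq, not_false_eq_true, St.setV_v_ne,
      St.setV_m, ha, hb, k₁.LN, k₂.LN, k₁.LB, k₂.LB, k₁.TB, k₂.TB]
  set s₁ := (((((s.setV .la l1.length).setV .lb l2.length).setV .pa pa).setV .pb pb).setV .ta
    ta).setV .tb tb with hs1
  have hv1 : ∀ x ∉ [Var.la, .lb, .pa, .pb, .ta, .tb], s₁.v x = s.v x := fun x hx => by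
    simp only [List.mem_cons, List.not_mem_nil, or_false, not_or] at hx
    simp [hs1, hx]
  refine Run.andThen (run_classify (w := w) (l1 := l1) (l2 := l2) (c₁ := cnt E1) (c₂ := cnt E2)
    (d := cnt E0) k₁.nodup k₂.nodup hlen1 hlen2 (by simp [hs1]) (by simp [hs1]) ?_ ?_ ?_ ?_ hvd hP
    hwM hn fun v => ?_) ?_
  · intro i hi
    have := k₁.LV i (by simpa using hi)
    rw [List.getElem_map] at this
    simpa [hs1] using this
  · intro i hi
    have := k₁.LC i (by simpa using hi)
    rw [List.getElem_map] at this
    simpa [hs1] using this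
  · intro i hi
    have := k₂.LV i (by simpa using hi)
    rw [List.getElem_map] at this
    simpa [hs1] using this
  · intro i hi
    have := k₂.LC i (by simpa using hi)
    rw [List.getElem_map] at this
    simpa [hs1] using this
  · exact le_trans (by exact_mod_cast hc0 v) (hdM v)
  rw [← hLI, ← hLF, ← hLL, ← hLR]
  intro s₂ ⟨hC, hP₂⟩ hf2
  have hv2 : ∀ x, x ∉ classify.wv → x ∉ [Var.la, .lb, .pa, .pb, .ta, .tb] → s₂.v x = s.v x :=
    fun x hx hx' => by rw [hf2.1 x hx, hv1 x hx']
  have hq2 : ∀ a, a ∉ classify.wa → s₂.m a = s.m a := fun a ha => by rw [hf2.2 a ha]; rfl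
  have k1' := k₁.of_eq (s' := s₂) fun a ha => hq2 a (by revert a; decide)
  have k2' := k₂.of_eq (s' := s₂) fun a ha => hq2 a (by revert a; decide)
  have hin := hC.convIn k1' k2' (by rw [hf2.v _]; simp [hs1])
    (by rw [hf2.v _]; simp [hs1]) (by rw [hq2 _ (by decide)]; exact hZ) nF
    (by simpa only [List.toFinset_append] using sA) (by simpa only [List.toFinset_append] using sB)
  have hpmM : ∀ E ⊆ E0, ∀ S, |((pm E0 E S : ℕ) : ℤ)| ≤ μ := fun E hE S => by
    rw [Nat.abs_cast]
    exact le_trans (by exact_mod_cast pm_le_nM hE S) hnM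
  have hcost' := hcost LI.length LL.length LF.length LR.length
    (by simp only [List.length_append] at lA; omega) (by simp only [List.length_append] at lB; omega)
    (by simp only [List.length_append] at lO; omega)
  refine Run.andThen (run_convolve (w := w) hin hA hB hO lA lB lO hμ hM ?_ ?_
    (hpmM E1 (subset_union_left.trans h₀)) (hpmM E2 (subset_union_right.trans h₀)) ?_)
    ?_ (by rw [hassoc]; omega)
  · exact fun S hS => (k₁.sum_le (hS.trans sA)).trans (hpM hlen1)
  · exact fun S hS => (k₂.sum_le (hS.trans sB)).trans (hpM hlen2)
  · rw [hq2 _ (by decide)]; exact hT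
  intro s₃ ⟨hso, hq⟩ hf3
  have hv3 : ∀ x, x ∉ convolve.wv → x ∉ classify.wv → x ∉ [Var.la, .lb, .pa, .pb, .ta, .tb] →
      s₃.v x = s.v x := fun x hx hx' hx'' => by rw [hf3.1 x hx, hv2 x hx' hx'']
  have hm₃ : ∀ a, a ∉ convolve.wa → a ∉ classify.wa → s₃.m a = s.m a := fun a ha ha' => by
    rw [hf3.2 a ha, hq2 a ha']
  have hC3 := hC.of_eq (s' := s₃) (hf3.vs)
    hf3.ms
  have hg0 : s₃.v .ltop = lt := by rw [hv3 _ (by decide) (by decide) (by decide), hlt]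
  have hg1 : s₃.v .top = tp := by rw [hv3 _ (by decide) (by decide) (by decide), htp]
  refine (run_output (w := w) (k := c) (lt := lt) (tp := tp)
    (g := fun q => (pm E0 (E1 ∪ E2) (sub (LR ++ LL ++ LI) q) : ℕ)) hC3
    (by rw [hv3 _ (by decide) (by decide) (by decide), hc]) hg0 hg1 hso lO
    (fun q hql => ⟨?_, ?_⟩) hn (fun v => le_trans (by exact_mod_cast hc0 v) (hdM v))
    (by push_cast; exact hltM) (by push_cast; exact htpM)).imp (by rw [hassoc]; omega) ?_
  · have hS : sub (LR ++ LL ++ LI) q ⊆ bdry E0 (E1 ∪ E2) := sO ▸ sub_subset _ _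
    rw [(hq q hql).2, pm_union hE h₀ (I := LI.toFinset) (F := LF.toFinset) (L := LL.toFinset)
      (R := LR.toFinset) ?_ ?_ ?_ ?_ hS]
    · push_cast; rfl
    all_goals
      ext v
      have := hc0 v
      simp only [List.mem_toFinset, mem_inter, mem_sdiff, mem_bdry, hcU, mI, mF, mL, mR, hm₁, hm2]
      try omega
  · refine (hpmM _ h₀ _).trans (le_trans ?_ hM)
    have h3 : (1 : ℤ) ≤ 2 ^ (10 * w) := one_le_pow₀ (by norm_num)
    nlinarith
  intro s₄ ⟨hLN, hLB, hTB, hlt4, htp4, hG, hLV, hLC, hTAB⟩ hf4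
  refine ⟨⟨LR ++ LL ++ LI, lt, tp, ⟨hO, sO, hLN, hLB, hTB, hLV, ?_, hTAB⟩, hlt4.ge, htp4.ge⟩,
    ⟨?_, ?_, ?_, ?_, ?_⟩, ?_, ?_, ?_⟩
  · convert hLC using 1
    rw [List.map_append, List.map_append]
    congr 2
    · refine List.map_congr_left fun v hv => ?_
      have := hc0 v
      rw [mR, hm₁, hm2] at hv
      rw [hcU]
      congr 1
      omega
    · refine List.map_congr_left fun v hv => ?_
      have := hc0 v
      rw [mL, hm₁, hm2] at hv
      rw [hcU]
      congr 1
      omega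
    · exact funext fun v => by rw [hcU]
  · rw [hlt, ← hg0]; exact hG.ltop
  · rw [htp, ← hg1]; exact hG.top
  · intro a ha i hi
    rw [hG.dir a ha i hi, hm₃ a (by revert a; decide) (by revert a; decide)]
  · intro a ha i hi
    rw [hG.lists a ha i (by rw [hg0, ← hlt]; exact hi), hm₃ a (by revert a; decide) (by revert a; decide)]
  · intro i hi
    rw [hG.TAB i (by rw [hg1, ← htp]; exact hi), hm₃ _ (by decide) (by decide)]
  · rw [hlt4]; omega
  · rw [htp4]
    have : 2 ^ (LR ++ LL ++ LI).length ≤ 2 ^ w := Nat.pow_le_pow_right (by norm_num) lO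
    have : ((2 ^ (LR ++ LL ++ LI).length : ℕ) : ℤ) ≤ (2 ^ w : ℕ) := by exact_mod_cast this
    omega
  · intro v
    rw [hf4.m _, hf3.m _, hP₂ v]

/-! ### The program: reading the input -/

/-- Count an edge at the vertex `z`. -/
def touch (z : Var) : Code :=
  .ite (rd .vd (vr z)) .skip (.set .touched (vr .touched + 1)) ;;
  .put .vd (vr z) (rd .vd (vr z) + 1)

/-- Copy what the input says about the tree node `x`. -/
def readNode : Code :=
  .loadLo .d 0 (vr .x) ;; .put .deg (vr .x) (vr .d) ;;
  .loop .j (vr .d)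
    (.loadLo .y 1 (3 * vr .x + vr .j) ;; .put .nb (3 * vr .x + vr .j) (vr .y)) ;;
  .ite (2 - vr .d)
    (.set .root (vr .x) ;; .loadLo .u 2 (2 * vr .x) ;; .put .eu (vr .x) (vr .u) ;;
    .loadLo .v 2 (2 * vr .x + 1) ;; .put .ev (vr .x) (vr .v) ;; touch .u ;; touch .v) .skip

/-- Copy the input. -/
def readInput : Code := .loop .x (vr .N) readNode

variable {M : ℤ} {mm : ℕ → ℕ} {n N : ℕ} {s : Store}

/-- Variables and arrays stay bounded. -/
theorem Run.bounded {c : Code} {t : ℕ} {Q : Store → Prop}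
    (h : Run M mm c s t Q) : Bd M s → Run M mm c s t (fun s' => Q s' ∧ Bd M s') := by
  induction h with
  | skip h => exact fun hs => .skip ⟨h, hs⟩
  | set h h' => exact fun hs => .set h ⟨h', hs.setV _ h⟩
  | put h h' => exact fun hs => .put h ⟨h', hs.setM _ _ h⟩
  | loadLo h h' => exact fun hs => .loadLo h ⟨h', hs.setV _ h⟩
  | storeLo h => exact fun hs => .storeLo ⟨h, hs⟩
  | call N X Y h1 h2 h3 h4 h5 h6 h7 =>
    exact fun hs => .call N X Y h1 h2 h3 h4 h5 h6 fun lo hlo => ⟨h7 lo hlo, hs⟩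
  | seq h1 h2 ih1 ih2 => exact fun hs => .seq (ih1 hs) fun s' hs' => ih2 s' hs'.1 hs'.2
  | ite h1 h2 ih1 ih2 => exact fun hs => .ite (fun h => ih1 h hs) fun h => ih2 h hs
  | loop n Inv h1 h2 h3 h4 h5 ih =>
    refine fun hs => .loop n (fun i s' => Inv i s' ∧ Bd M s') h1 h2 ⟨h3, hs⟩
      (fun i hi s' hs' => ih i hi s' hs'.1 (hs'.2.setV _ ?_)) fun s' hs' => ⟨h5 s' hs'.1, hs'.2⟩
    rw [Nat.abs_cast]
    omega
  | conseq h1 h2 h3 ih => exact fun hs => .conseq (ih hs) h2 fun s' hs' => ⟨h3 s' hs'.1, hs'.2⟩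

theorem Run.loadLoThen {x : Var} {a : Fin 3} {i : Term} {q : Code}
    {t : ℕ} {Q : Store → Prop} (h : |s.lo a (i.eval s)| ≤ M)
    (h' : Run M mm q (s.setV x (s.lo a (i.eval s))) (t - 1) Q) (ht : 1 ≤ t := by omega) :
    Run M mm (.loadLo x a i ;; q) s t Q :=
  (Run.loadLo_seq h h').imp (by omega) fun _ h _ => h

theorem run_touch {z : Var} {f : Fin n → ℕ} {u : Fin n} (hz : s.v z = (u : ℕ))
    (hzt : z ≠ .touched) (hf : ∀ v : Fin n, s.m .vd (v : ℕ) = f v)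
    (ht : s.v .touched = #{v | 0 < f v}) (hfM : (f u : ℤ) + 1 ≤ M) (hn : (n : ℤ) + 1 ≤ M) :
    Run M mm (touch z) s 4 fun s' =>
      (∀ v : Fin n, s'.m .vd (v : ℕ) = (f v + if v = u then 1 else 0 : ℕ)) ∧
      s'.v .touched = #{v | 0 < f v + if v = u then 1 else 0} ∧ s'.lo = s.lo := by
  have hle : #{v | 0 < f v} ≤ n := (card_le_univ _).trans (by simp)
  refine Run.andThen (t1 := 2) (R := fun s' => s'.m = s.m ∧ s'.lo = s.lo ∧
    s'.v .touched = #{v | 0 < f v + if v = u then 1 else 0}) ?_ ?_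
  · refine Run.iteEnd (fun h => Run.skipEnd ⟨rfl, rfl, ?_⟩) fun h =>
      Run.setEnd ?_ ⟨rfl, rfl, ?_⟩
    · simp only [Ex.eval_rd, Ex.eval_var, hz, hf u] at h
      rw [ht]
      congr 2
      ext v
      by_cases hv : v = u
      · subst hv; simpa using h
      · simp [hv]
    · rw [Ex.eval_add, Ex.eval_var, Ex.eval_one, ht, abs_of_nonneg (by positivity)]
      omega
    · simp only [Ex.eval_rd, Ex.eval_var, hz, hf u] at h
      have : #{v | 0 < f v + if v = u then 1 else 0} = #{v | 0 < f v} + 1 := by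
        rw [← card_insert_of_notMem (a := u) (by simp; omega)]
        congr 1
        ext v
        by_cases hv : v = u <;> simp [hv]
      rw [St.setV_v_self, this]
      simp [ht]
  · intro s' ⟨hm, hlo, ht'⟩ hF
    have hz' : s'.v z = (u : ℕ) := by
      rw [hF.1 z (by simpa [Cmd.wv] using hzt), hz]
    refine Run.putEnd ?_ ⟨fun v => ?_, ht', hlo⟩
    · rw [Ex.eval_add, Ex.eval_one, Ex.eval_rd, Ex.eval_var, hz', hm, hf u,
        abs_of_nonneg (by positivity)]
      exact hfM
    · simp [hz', hm, St.setM_m_self, hf, Fin.val_inj]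
      by_cases hv : v = u <;> simp [hv]

/-- The data of a branch decomposition: neighbour lists and endpoints. -/
structure TreeData {G : SimpleGraph (Fin n)} (T : BranchDecomposition G (Fin N))
    (nbs : Fin N → List (Fin N)) (U W : Fin N → Fin n) : Prop where
  mem : ∀ x y, y ∈ nbs x ↔ T.tree.Adj x y
  nodup : ∀ x, (nbs x).Nodup
  edge : ∀ x (h : (T.tree.neighborSet x).ncard ≤ 1), (T.leafEdge ⟨x, h⟩ : Sym2 _) = s(U x, W x)

/-- The arrays hold the data of the first `i` nodes. -/
structure Loaded (nbs : Fin N → List (Fin N)) (U W : Fin N → Fin n) (i : ℕ) (s : Store) :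
    Prop where
  deg : ∀ x : Fin N, (x : ℕ) < i → s.m .deg (x : ℕ) = (nbs x).length
  nb : ∀ x : Fin N, (x : ℕ) < i → ∀ (j : ℕ) (h : j < (nbs x).length),
    s.m .nb (3 * (x : ℕ) + j) = (((nbs x)[j] : Fin N) : ℕ)
  eu : ∀ x : Fin N, (x : ℕ) < i → (nbs x).length ≤ 1 → s.m .eu (x : ℕ) = (U x : ℕ)
  ev : ∀ x : Fin N, (x : ℕ) < i → (nbs x).length ≤ 1 → s.m .ev (x : ℕ) = (W x : ℕ)
  root : (∃ x : Fin N, (x : ℕ) < i ∧ (nbs x).length ≤ 1) →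
    ∃ x : Fin N, (nbs x).length ≤ 1 ∧ s.v .root = (x : ℕ)
  vd : ∀ v : Fin n, s.m .vd (v : ℕ) =
    #{x : Fin N | (x : ℕ) < i ∧ (nbs x).length ≤ 1 ∧ v ∈ s(U x, W x)}
  touched : s.v .touched =
    #{v | 0 < #{x : Fin N | (x : ℕ) < i ∧ (nbs x).length ≤ 1 ∧ v ∈ s(U x, W x)}}

/-- The shared memories hold the data of a branch decomposition. -/
structure Given (nbs : Fin N → List (Fin N)) (U W : Fin N → Fin n) (lo : Fin 3 → ℤ → ℤ) :
    Prop where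
  deg : ∀ x : Fin N, lo 0 (x : ℕ) = (nbs x).length
  nb : ∀ x : Fin N, ∀ (j : ℕ) (h : j < (nbs x).length),
    lo 1 (3 * (x : ℕ) + j) = (((nbs x)[j] : Fin N) : ℕ)
  eu : ∀ x : Fin N, (nbs x).length ≤ 1 → lo 2 (2 * (x : ℕ)) = (U x : ℕ)
  ev : ∀ x : Fin N, (nbs x).length ≤ 1 → lo 2 (2 * (x : ℕ) + 1) = (W x : ℕ)
  le : ∀ x, (nbs x).length ≤ 3
  ne : ∀ x, (nbs x).length ≤ 1 → U x ≠ W x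

theorem card_lt_succ (p : Fin N → Prop) [DecidablePred p] {i : ℕ} (hi : i < N) :
    #{x : Fin N | (x : ℕ) < i + 1 ∧ p x} =
      #{x : Fin N | (x : ℕ) < i ∧ p x} + if p ⟨i, hi⟩ then 1 else 0 := by
  have h : ∀ x : Fin N, (x : ℕ) < i + 1 ↔ (x : ℕ) < i ∨ x = ⟨i, hi⟩ := fun x => by
    rw [Fin.ext_iff]; simp only; omega
  split_ifs with hp
  · rw [← card_insert_of_notMem (a := ⟨i, hi⟩) (by simp)]
    congr 1
    ext x
    simp only [h, mem_filter, mem_univ, true_and, mem_insert]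
    constructor
    · rintro ⟨h1 | h1, h2⟩
      exacts [Or.inr ⟨h1, h2⟩, Or.inl h1]
    · rintro (rfl | h1)
      exacts [⟨Or.inr rfl, hp⟩, ⟨Or.inl h1.1, h1.2⟩]
  · rw [add_zero]
    congr 1
    ext x
    simp only [h, mem_filter, mem_univ, true_and]
    constructor
    · rintro ⟨h1 | rfl, h2⟩
      exacts [⟨h1, h2⟩, absurd h2 hp]
    · exact fun h => ⟨Or.inl h.1, h.2⟩

theorem run_readNode {nbs : Fin N → List (Fin N)} {U W : Fin N → Fin n}
    (hg : Given nbs U W s.lo) {i : ℕ} (hi : i < N) (h : Loaded nbs U W i s) (hx : s.v .x = i)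
    (hn : (n : ℤ) + 1 ≤ M) (hN : (N : ℤ) + 1 ≤ M) (h3 : 3 ≤ M) :
    Run M mm readNode s 30 fun s' => Loaded nbs U W (i + 1) s' ∧ s'.lo = s.lo := by
  set X : Fin N := ⟨i, hi⟩ with hX
  have hd : s.lo 0 i = (nbs X).length := hg.deg X
  have hdl := hg.le X
  have hlt : ∀ x : Fin N, (x : ℕ) < i + 1 → (x : ℕ) < i ∨ x = X := fun x h => by
    rw [Fin.ext_iff, hX]; simp only; omega
  refine Run.loadLoThen (by rw [Ex.eval_var, hx, hd, Nat.abs_cast]; omega)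
    (Run.putThen (by simp [hx, hd]; omega) ?_)
  simp [hx, hd]
  set s₁ := (s.setV .d (nbs X).length).setM .deg i (nbs X).length with hs1
  have hv1 : ∀ x, x ≠ .d → s₁.v x = s.v x := fun x h => by simp [hs1, h]
  have hd1 : s₁.v .d = (nbs X).length := by simp [hs1]
  refine Run.andThen (t1 := 10) (R := fun s' => s'.lo = s.lo ∧
    (∀ x : Fin N, (x : ℕ) < i + 1 → ∀ (j : ℕ) (h : j < (nbs x).length),
      s'.m .nb (3 * (x : ℕ) + j) = (((nbs x)[j] : Fin N) : ℕ))) ?_ ?_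
  · refine Run.loop' (nbs X).length (fun j s' => s'.lo = s.lo ∧
      (∀ x : Fin N, (x : ℕ) < i + 1 → ∀ (j' : ℕ) (h : j' < (nbs x).length), (x = X → j' < j) →
      s'.m .nb (3 * (x : ℕ) + j') = (((nbs x)[j'] : Fin N) : ℕ))) (t := 2) hd1 (by omega)
      ⟨rfl, fun x hx j' hj' hj => ?_⟩ ?_ (by omega) ?_
    · rcases hlt x hx with hx' | hx'
      · exact h.nb x hx' j' hj'
      · exact absurd (hj hx') (by omega)
    · intro j hj s₂ ⟨hlo, hnb⟩ hf
      have hx₂ : s₂.v .x = i := by rw [hf.v .x, hv1 _ (by decide), hx]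
      have he : s₂.lo 1 (3 * i + j) = (((nbs X)[j] : Fin N) : ℕ) := hlo ▸ hg.nb X j hj
      have := (nbs X)[j].2
      refine Run.loadLoThen ?_ (Run.putEnd ?_ ⟨hlo, ?_⟩)
      · simp [hx₂, he]
        omega
      · simp only [Ex.eval_add, Ex.eval_mul, Ex.eval_three, Ex.eval_var, St.setV_v_self, ne_eq,
          reduceCtorEq, not_false_eq_true, St.setV_v_ne, hx₂, St.setV_lo, he, Nat.abs_cast]
        omega
      · intro x hx j' hj' hjj
        have := hg.le x
        simp [hx₂, he, St.setM_m_self]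
        by_cases hxX : x = X
        · subst hxX
          by_cases hj2 : j' = j
          · subst hj2
            rw [if_pos (by simp [hX])]
          · rw [if_neg (by simp [hX]; omega)]
            exact hnb X hx j' hj' fun _ => by have := hjj rfl; omega
        · have hxi : (x : ℕ) < i := (hlt x hx).resolve_right hxX
          rw [if_neg (by omega)]
          exact hnb x hx j' hj' fun h => absurd h hxX
    · exact fun s' ⟨h1, h2⟩ _ => ⟨h1, fun x hx j hj => h2 x hx j hj fun h => by subst h; exact hj⟩
  intro s₂ ⟨hlo2, hnb⟩ hf2
  have hv2 : ∀ x ∉ [Var.j, .y, .d], s₂.v x = s.v x := fun x hx => by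
    simp [not_or] at hx
    rw [hf2.1 x (by simp [Cmd.wv, hx]), hv1 x hx.2.2]
  have hd2 : s₂.v .d = (nbs X).length := by rw [hf2.v _, hd1]
  have hm2 : ∀ a ∉ [Arr.deg, .nb], s₂.m a = s.m a := fun a ha => by
    simp [not_or] at ha
    rw [hf2.2 a (by simp [Cmd.wa, ha]), hs1, St.setM_m_ne _ ha.1, St.setV_m]
  have hdeg : ∀ x : Fin N, (x : ℕ) < i + 1 → s₂.m .deg (x : ℕ) = (nbs x).length := fun x hx => by
    rw [hf2.m _, hs1, St.setM_m_self]
    rcases hlt x hx with hx' | hx'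
    · rw [if_neg (by omega)]
      exact h.deg x hx'
    · rw [if_pos (by rw [hx']), hx']
  have hcard : ∀ v : Fin n,
      #{x : Fin N | (x : ℕ) < i + 1 ∧ (nbs x).length ≤ 1 ∧ v ∈ s(U x, W x)} =
      #{x : Fin N | (x : ℕ) < i ∧ (nbs x).length ≤ 1 ∧ v ∈ s(U x, W x)} +
      if (nbs X).length ≤ 1 ∧ v ∈ s(U X, W X) then 1 else 0 := fun v => card_lt_succ _ hi
  refine Run.iteEnd (fun hp => ?_) fun hp => ?_
  · have hl : (nbs X).length ≤ 1 := by
      rw [Ex.eval_sub, Ex.eval_two, Ex.eval_var, hd2] at hp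
      omega
    have hu : s₂.lo 2 (2 * i) = (U X : ℕ) := hlo2 ▸ hg.eu X hl
    have hw : s₂.lo 2 (2 * i + 1) = (W X : ℕ) := hlo2 ▸ hg.ev X hl
    have hx₂ : s₂.v .x = i := by rw [hv2 _ (by decide), hx]
    have hU := (U X).2
    have hW := (W X).2
    refine Run.setThen ?_ (Run.loadLoThen ?_ (Run.putThen ?_ (Run.loadLoThen ?_ (Run.putThen ?_ ?_))))
    · rw [Ex.eval_var, hx₂, Nat.abs_cast]; omega
    all_goals simp [hx₂, hu, hw]
    · omega
    · omega
    · omega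
    · omega
    set s₃ := (((((s₂.setV .root i).setV .u (U X : ℕ)).setM .eu i (U X : ℕ)).setV .v
      (W X : ℕ)).setM .ev i (W X : ℕ)) with hs3
    have hm₃ : ∀ a ∉ [Arr.eu, .ev], s₃.m a = s₂.m a := fun a ha => by
      simp [not_or] at ha
      simp [hs3, ha]
    have hcN : ∀ v : Fin n,
        #{x : Fin N | (x : ℕ) < i ∧ (nbs x).length ≤ 1 ∧ v ∈ s(U x, W x)} ≤ i := fun v => by
      refine (card_le_card_of_injOn (t := range i) (Fin.val : Fin N → ℕ) (fun x hx => ?_)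
        Fin.val_injective.injOn).trans (card_range i).le
      simp only [coe_filter, mem_univ, true_and, Set.mem_ofPred_eq] at hx
      simpa using hx.1
    refine Run.andThen (run_touch (z := .u) (u := U X) (by simp [hs3]) (by decide)
      (f := fun v => #{x : Fin N | (x : ℕ) < i ∧ (nbs x).length ≤ 1 ∧ v ∈ s(U x, W x)})
      (fun v => by rw [hm₃ _ (by decide), hm2 _ (by decide)]; exact h.vd v) ?_
      (by have := hcN (U X); omega) hn) ?_
    · rw [← h.touched, ← hv2 .touched (by decide)]
      simp [hs3]
    intro s₄ ⟨hvd4, ht4, hlo4⟩ hf4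
    refine (run_touch (z := .v) (u := W X) (by rw [hf4.v _]; simp [hs3]) (by decide)
      hvd4 ht4 ?_ hn).imp (by norm_num) ?_
    · rw [if_neg (hg.ne X hl).symm]
      have := hcN (W X)
      omega
    intro s₅ ⟨hvd5, ht5, hlo5⟩ hf5
    have hm5 : ∀ a, a ≠ .vd → s₅.m a = s₃.m a := fun a ha => by
      rw [hf5.2 a (by simpa [touch, Cmd.wa] using ha), hf4.2 a (by simpa [touch, Cmd.wa] using ha)]
    have hsum : ∀ v : Fin n,
        #{x : Fin N | (x : ℕ) < i + 1 ∧ (nbs x).length ≤ 1 ∧ v ∈ s(U x, W x)} =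
        #{x : Fin N | (x : ℕ) < i ∧ (nbs x).length ≤ 1 ∧ v ∈ s(U x, W x)} +
        (if v = U X then 1 else 0) + if v = W X then 1 else 0 := fun v => by
      rw [hcard v, add_assoc]
      congr 1
      have := hg.ne X hl
      simp only [hl, true_and, Sym2.mem_iff]
      by_cases h1 : v = U X
      · rw [if_pos (Or.inl h1), if_pos h1, if_neg (h1 ▸ this)]
      · simp [h1]
    refine ⟨⟨fun x hx => ?_, fun x hx j hj => ?_, fun x hx hlx => ?_, fun x hx hlx => ?_,
      fun _ => ⟨X, hl, ?_⟩, fun v => ?_, ?_⟩, ?_⟩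
    · rw [hm5 _ (by decide), hm₃ _ (by decide), hdeg x hx]
    · rw [hm5 _ (by decide), hm₃ _ (by decide), hnb x hx j hj]
    · rw [hm5 _ (by decide), hs3, St.setM_m_ne _ (by decide), St.setV_m, St.setM_m_self]
      rcases hlt x hx with hx' | hx'
      · rw [if_neg (by omega), St.setV_m, St.setV_m, hm2 _ (by decide), h.eu x hx' hlx]
      · rw [if_pos (by rw [hx']), hx']
    · rw [hm5 _ (by decide), hs3, St.setM_m_self]
      rcases hlt x hx with hx' | hx'
      · rw [if_neg (by omega), St.setV_m, St.setM_m_ne _ (by decide), St.setV_m, St.setV_m,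
          hm2 _ (by decide), h.ev x hx' hlx]
      · rw [if_pos (by rw [hx']), hx']
    · rw [hf5.v _, hf4.v _]
      simp [hs3, hX]
    · rw [hvd5 v, hsum v]
    · rw [ht5]
      simp only [hsum]
    · rw [hlo5, hlo4, hs3]; exact hlo2
  · have hl : ¬ (nbs X).length ≤ 1 := by
      rw [Ex.eval_sub, Ex.eval_two, Ex.eval_var, hd2] at hp
      omega
    have hcard' : ∀ v : Fin n,
        #{x : Fin N | (x : ℕ) < i + 1 ∧ (nbs x).length ≤ 1 ∧ v ∈ s(U x, W x)} =
        #{x : Fin N | (x : ℕ) < i ∧ (nbs x).length ≤ 1 ∧ v ∈ s(U x, W x)} := fun v => by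
      rw [hcard v, if_neg fun h => hl h.1, add_zero]
    have hlx : ∀ x : Fin N, (x : ℕ) < i + 1 → (nbs x).length ≤ 1 → (x : ℕ) < i := fun x hx hxl =>
      (hlt x hx).resolve_right fun h => hl (h ▸ hxl)
    refine Run.skipEnd ⟨⟨hdeg, hnb, fun x hx hxl => ?_, fun x hx hxl => ?_, ?_, fun v => ?_, ?_⟩,
      hlo2⟩
    · rw [hm2 _ (by decide), h.eu x (hlx x hx hxl) hxl]
    · rw [hm2 _ (by decide), h.ev x (hlx x hx hxl) hxl]
    · rintro ⟨x, hx, hxl⟩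
      rw [hv2 _ (by decide)]
      exact h.root ⟨x, hlx x hx hxl, hxl⟩
    · rw [hcard', hm2 _ (by decide), h.vd]
    · rw [hv2 _ (by decide), h.touched]
      simp only [hcard']

theorem run_readInput {nbs : Fin N → List (Fin N)} {U W : Fin N → Fin n}
    (hg : Given nbs U W s.lo) (hv : ∀ a i, s.m a i = 0) (ht : s.v .touched = 0) (hsN : s.v .N = N)
    (hn : (n : ℤ) + 1 ≤ M) (hN : (N : ℤ) + 1 ≤ M) (h3 : 3 ≤ M) :
    Run M mm readInput s (31 * N + 1) fun s' => Loaded nbs U W N s' := by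
  refine Run.loop' N (fun i s' => Loaded nbs U W i s' ∧ s'.lo = s.lo) (t := 30) hsN (by omega)
    ⟨⟨by simp, by simp, by simp, by simp, by simp, by simp [hv], by simp [ht]⟩, rfl⟩ ?_ (by omega)
    fun s' h _ => h.1
  intro i hi s₁ ⟨h1, h2⟩ hf
  refine (run_readNode (i := i) (by rw [St.setV_lo, h2]; exact hg) hi ?_ (by simp) hn hN h3).imp
    le_rfl fun s' h _ => ⟨h.1, by rw [h.2, St.setV_lo, h2]⟩
  exact ⟨h1.deg, h1.nb, h1.eu, h1.ev, h1.root, h1.vd, h1.touched⟩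

/-! ### The program: breadth first search -/

/-- Append the unvisited neighbours of the node at position `p`. -/
def visit : Code :=
  .set .x (rd .ord (vr .p)) ;; .put .fk (vr .p) (vr .cnt) ;; .set .d (rd .par (vr .p)) ;;
  .loop .j (rd .deg (vr .x))
    (.set .y (rd .nb (3 * vr .x + vr .j)) ;;
    .ite ((vr .y - vr .d) * (vr .y - vr .d))
      (.put .ord (vr .cnt) (vr .y) ;; .put .par (vr .cnt) (vr .x) ;; .set .cnt (vr .cnt + 1)) .skip)

/-- List the nodes of the tree and their parents, starting from the root. -/
def search : Code :=
  .put .ord 0 (vr .root) ;; .put .par 0 (vr .root) ;; .set .cnt 1 ;;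
  .loop .p (vr .N) (.ite (vr .cnt - vr .p) visit .skip)

variable {M : ℤ} {mm : ℕ → ℕ} {n N : ℕ} {G : SimpleGraph (Fin n)}
  {T : BranchDecomposition G (Fin N)} {nbs : Fin N → List (Fin N)} {U W : Fin N → Fin n}

/-- The children of a node that is given with its parent. -/
def kids (nbs : Fin N → List (Fin N)) (x : Fin N × Fin N) : List (Fin N) :=
  (nbs x.1).filter fun y => y ≠ x.2

/-- The list `o` of nodes with their parents is the result of a search from `r` in which the first
`p` nodes have been visited; the children of the node at `a` are listed from position `kid a` on. -/
structure Found (T : BranchDecomposition G (Fin N)) (nbs : Fin N → List (Fin N)) (r : Fin N)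
    (o : List (Fin N × Fin N)) (kid : ℕ → ℕ) (p : ℕ) : Prop where
  head : o[0]? = some (r, r)
  nodup : (o.map Prod.fst).Nodup
  par : ∀ (i : ℕ) x, o[i]? = some x → 0 < i → ∃ a y, a < p ∧ o[a]? = some y ∧
    x.2 = y.1 ∧ T.tree.Adj x.1 x.2 ∧ T.tree.dist x.1 r = T.tree.dist x.2 r + 1
  kids : ∀ (a : ℕ) x, o[a]? = some x → a < p → a < kid a ∧
    ∀ (j : ℕ) c, (kids nbs x)[j]? = some c → o[kid a + j]? = some (c, x.1)

theorem mem_kids (hD : TreeData T nbs U W) {x : Fin N × Fin N} {c : Fin N} :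
    c ∈ kids nbs x ↔ T.tree.Adj x.1 c ∧ c ≠ x.2 := by
  simp [kids, hD.mem]

theorem Found.length_le {r : Fin N} {o : List (Fin N × Fin N)} {kid : ℕ → ℕ} {p : ℕ}
    (h : Found T nbs r o kid p) : o.length ≤ N := by
  have := h.nodup.length_le_card
  simpa using this

theorem Found.eq_of_fst {r : Fin N} {o : List (Fin N × Fin N)} {kid : ℕ → ℕ} {p : ℕ}
    (h : Found T nbs r o kid p) {i j : ℕ} {x y : Fin N × Fin N} (hi : o[i]? = some x)
    (hj : o[j]? = some y) (hxy : x.1 = y.1) : i = j := by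
  obtain ⟨hi', rfl⟩ := List.getElem?_eq_some_iff.1 hi
  obtain ⟨hj', rfl⟩ := List.getElem?_eq_some_iff.1 hj
  refine (List.Nodup.getElem_inj_iff h.nodup (hi := by simpa using hi')
    (hj := by simpa using hj')).1 ?_
  simpa using hxy

theorem Found.dist_kid (hD : TreeData T nbs U W) {r : Fin N} {o : List (Fin N × Fin N)}
    {kid : ℕ → ℕ} {p : ℕ} (h : Found T nbs r o kid p) {x : Fin N × Fin N} (hx : o[p]? = some x)
    {c : Fin N} (hc : c ∈ RAM.kids nbs x) : T.tree.dist c r = T.tree.dist x.1 r + 1 := by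
  rw [mem_kids hD] at hc
  refine (T.isTree.dist_lt_or hc.1 r).resolve_right fun hcr => ?_
  rcases Nat.eq_zero_or_pos p with rfl | hp
  · obtain rfl : (r, r) = x := Option.some_inj.1 (h.head ▸ hx)
    simp at hcr
  · obtain ⟨a, y, _, _, _, hadj, hd⟩ := h.par p x hx hp
    exact hc.2 (T.isTree.eq_of_adj_dist_lt hc.1 hadj (a := r) (by omega) (by omega))

theorem Found.visit (hD : TreeData T nbs U W) {r : Fin N} {o : List (Fin N × Fin N)}
    {kid : ℕ → ℕ} {p : ℕ} (h : Found T nbs r o kid p) {x : Fin N × Fin N} (hx : o[p]? = some x) :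
    Found T nbs r (o ++ (RAM.kids nbs x).map fun c => (c, x.1)) (Function.update kid p o.length)
      (p + 1) := by
  have hpo : p < o.length := (List.getElem?_eq_some_iff.1 hx).1
  have hl : ∀ {i : ℕ} {y}, o[i]? = some y →
      (o ++ (RAM.kids nbs x).map fun c => (c, x.1))[i]? = some y := fun {i y} hi => by
    rw [List.getElem?_append_left (List.getElem?_eq_some_iff.1 hi).1, hi]
  refine ⟨hl h.head, ?_, fun i z hz hi => ?_, fun a z hz ha => ?_⟩
  · rw [List.map_append, List.map_map]
    refine List.nodup_append'.2 ⟨h.nodup, ?_, fun c hc hc' => ?_⟩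
    · simpa [Function.comp_def, RAM.kids] using (hD.nodup x.1).filter _
    · replace hc' : c ∈ RAM.kids nbs x := by simpa [Function.comp_def] using hc'
      have hd := h.dist_kid hD hx hc'
      rw [mem_kids hD] at hc'
      obtain ⟨y, hy, rfl⟩ := List.mem_map.1 hc
      obtain ⟨i, hi⟩ := List.mem_iff_getElem?.1 hy
      rcases Nat.eq_zero_or_pos i with rfl | hi0
      · obtain rfl : (r, r) = y := Option.some_inj.1 (h.head ▸ hi)
        simp at hd
      · obtain ⟨a, z, ha, hz, hyz, hadj, hd'⟩ := h.par i y hi hi0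
        have := T.isTree.eq_of_adj_dist_lt hadj hc'.1.symm (a := r) (by omega) (by omega)
        have := h.eq_of_fst hz hx (hyz ▸ this)
        omega
  · rcases lt_or_ge i o.length with hio | hio
    · rw [List.getElem?_append_left hio] at hz
      obtain ⟨a, y, ha, hy, h'⟩ := h.par i z hz hi
      exact ⟨a, y, by omega, hl hy, h'⟩
    · rw [List.getElem?_append_right hio, List.getElem?_map] at hz
      obtain ⟨c, hc, rfl⟩ := Option.map_eq_some_iff.1 hz
      have hc' := List.mem_of_getElem? hc
      exact ⟨p, x, by omega, hl hx, rfl, ((mem_kids hD).1 hc').1.symm, h.dist_kid hD hx hc'⟩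
  · by_cases hap : a = p
    · subst hap
      obtain rfl : x = z := Option.some_inj.1 (hl hx ▸ hz)
      rw [Function.update_self]
      refine ⟨hpo, fun j c hj => ?_⟩
      rw [List.getElem?_append_right (by omega), Nat.add_sub_cancel_left, List.getElem?_map, hj]
      rfl
    · rw [Function.update_of_ne hap, List.getElem?_append_left (by omega)] at *
      obtain ⟨h1, h2⟩ := h.kids a z hz (by omega)
      exact ⟨h1, fun j c hj => hl (h2 j c hj)⟩

/-- The arrays hold the list `o`. -/
structure Stored (o : List (Fin N × Fin N)) (s : Store) : Prop where
  cnt : s.v .cnt = o.length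
  ord : ∀ (i : ℕ) x, o[i]? = some x → s.m .ord i = (x.1 : ℕ)
  par : ∀ (i : ℕ) x, o[i]? = some x → s.m .par i = (x.2 : ℕ)

theorem Stored.of_eq {o : List (Fin N × Fin N)} {s s' : Store} (h : Stored o s)
    (h₁ : s'.v .cnt = s.v .cnt) (h₂ : s'.m .ord = s.m .ord) (h₃ : s'.m .par = s.m .par) :
    Stored o s' :=
  ⟨h₁ ▸ h.cnt, h₂ ▸ h.ord, h₃ ▸ h.par⟩

theorem Stored.push {o : List (Fin N × Fin N)} {s : Store} (h : Stored o s)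
    (x : Fin N × Fin N) : Stored (o ++ [x])
      (((s.setM .ord o.length (x.1 : ℕ)).setM .par o.length (x.2 : ℕ)).setV .cnt
        (o.length + 1)) := by
  have key : ∀ (i : ℕ) y, (o ++ [x])[i]? = some y → (i = o.length ∧ y = x) ∨
      ((i : ℤ) ≠ o.length ∧ o[i]? = some y) := fun i y hy => by
    rcases lt_trichotomy i o.length with hi | hi | hi
    · rw [List.getElem?_append_left hi] at hy
      exact Or.inr ⟨by omega, hy⟩
    · subst hi
      simp at hy
      exact Or.inl ⟨rfl, hy.symm⟩
    · rw [List.getElem?_eq_none (by simp; omega)] at hy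
      cases hy
  refine ⟨by simp, fun i y hy => ?_, fun i y hy => ?_⟩ <;>
    simp only [St.setV_m, ne_eq, reduceCtorEq, not_false_eq_true, St.setM_m_ne, St.setM_m_self] <;>
    rcases key i y hy with ⟨rfl, rfl⟩ | ⟨hne, hi⟩
  · simp
  · rw [if_neg hne, h.ord i y hi]
  · simp
  · rw [if_neg hne, h.par i y hi]

theorem run_visit {s : Store} (hdeg : ∀ z : Fin N, s.m .deg (z : ℕ) = (nbs z).length)
    (hnb : ∀ (z : Fin N) (j : ℕ) (h : j < (nbs z).length),
      s.m .nb (3 * (z : ℕ) + j) = (((nbs z)[j] : Fin N) : ℕ)) (h3 : ∀ x, (nbs x).length ≤ 3)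
    {o : List (Fin N × Fin N)} (hS : Stored o s) {p : ℕ} (hp : s.v .p = p) {x : Fin N × Fin N}
    (hx : o[p]? = some x) (ho : o.length ≤ N) (hM : (N : ℤ) + 5 ≤ M) :
    Run M mm visit s 22 fun s' => Stored (o ++ (kids nbs x).map fun c => (c, x.1)) s' ∧
      ∀ a : ℕ, s'.m .fk a = if a = p then (o.length : ℤ) else s.m .fk a := by
  have e1 := hS.ord p x hx
  have e2 := hS.par p x hx
  have hx1 := x.1.2
  have hx2 := x.2.2
  have hx3 := h3 x.1
  refine Run.setThen ?_ (Run.putThen ?_ (Run.setThen ?_ ?_)) <;> simp [hp, e1, e2, hS.cnt]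
  · omega
  · omega
  · omega
  set s₁ := ((s.setV .x (x.1 : ℕ)).setM .fk p o.length).setV .d (x.2 : ℕ) with hs1
  refine Run.loop' (nbs x.1).length (fun j s' => Stored (o ++ (((nbs x.1).take j).filter
      fun y => y ≠ x.2).map fun c => (c, x.1)) s' ∧
      ∀ a : ℕ, s'.m .fk a = if a = p then (o.length : ℤ) else s.m .fk a) (t := 5) ?_ (by omega)
      ⟨?_, fun a => ?_⟩ ?_ (by omega) ?_
  · simp [hs1, hdeg x.1]
  · simpa using hS.of_eq (by simp [hs1]) (by simp [hs1]) (by simp [hs1])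
  · simp [hs1, St.setM_m_self]
  · intro j hj s₂ ⟨hS₂, hfk⟩ hf
    have hx₂ : s₂.v .x = (x.1 : ℕ) := by rw [hf.v .x]; simp [hs1]
    have hd2 : s₂.v .d = (x.2 : ℕ) := by rw [hf.v .d]; simp [hs1]
    have hy : (rd .nb (3 * vr .x + vr .j)).eval (s₂.setV .j j) = (((nbs x.1)[j] : Fin N) : ℕ) := by
      simp [hx₂]
      rw [hf.m .nb, ← hnb x.1 j hj]
      simp [hs1]
    have hyN := (nbs x.1)[j].2
    refine Run.setThen (by rw [hy, Nat.abs_cast]; omega) ?_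
    rw [hy, ← List.take_append_getElem hj, List.filter_append]
    have hS3 := hS₂.of_eq (s' := (s₂.setV .j j).setV .y (((nbs x.1)[j] : Fin N) : ℕ)) (by simp)
      rfl rfl
    set lj := ((nbs x.1).take j).filter fun y => y ≠ x.2 with hlj
    have hle : lj.length ≤ 3 := (List.length_filter_le _ _).trans (by simp; omega)
    refine Run.iteEnd (fun h => ?_) fun h => ?_ <;>
      simp only [Ex.eval_mul, Ex.eval_sub, Ex.eval_var, St.setV_v_self, ne_eq, reduceCtorEq,
        not_false_eq_true, St.setV_v_ne, hd2] at h
    · have hne : (nbs x.1)[j] ≠ x.2 := fun he => by simp [he] at h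
      refine Run.putThen ?_ (Run.putThen ?_ (Run.setEnd ?_ ?_)) <;> simp only [Ex.eval_add, Ex.eval_var, St.setV_v_self, ne_eq,
        reduceCtorEq, not_false_eq_true, St.setV_v_ne, St.setM_v, hx₂, hS₂.cnt, Ex.eval_one,
        Nat.abs_cast]
      · omega
      · omega
      · rw [abs_of_nonneg (by positivity)]
        simp only [List.length_append, List.length_map]
        omega
      · refine ⟨?_, fun a => ?_⟩
        · have := hS3.push ((nbs x.1)[j], x.1)
          simpa [hne] using this
        · simpa using hfk a
    · have he : (nbs x.1)[j] = x.2 := by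
        by_contra hne
        have : ((((nbs x.1)[j] : Fin N) : ℕ) : ℤ) - (x.2 : ℕ) ≠ 0 := by
          rw [sub_ne_zero]
          exact fun h => hne (Fin.ext (by exact_mod_cast h))
        exact h (mul_self_pos.2 this)
      exact Run.skipEnd ⟨by simpa [he] using hS3, hfk⟩
  · intro s' ⟨h1, h2⟩ _
    rw [List.take_length] at h1
    exact ⟨h1, h2⟩

theorem run_search (hD : TreeData T nbs U W) {s : Store} (hL : Loaded nbs U W N s)
    (h3 : ∀ x, (nbs x).length ≤ 3) (hsN : s.v .N = N) {r : Fin N} (hr : s.v .root = (r : ℕ))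
    (hM : (N : ℤ) + 5 ≤ M) :
    Run M mm search s (24 * N + 4) fun s' => ∃ o kid, Found T nbs r o kid N ∧ Stored o s' ∧
      ∀ a < o.length, s'.m .fk (a : ℕ) = kid a := by
  have hrN := r.2
  refine Run.putThen ?_ (Run.putThen ?_ (Run.setThen ?_ ?_)) <;>
    simp only [Ex.eval_var, Ex.eval_zero, Ex.eval_one, St.setM_v, hr, Nat.abs_cast, abs_one]
  · omega
  · omega
  · omega
  refine Run.loop' N (fun p s' => ∃ o kid, Found T nbs r o kid p ∧ Stored o s' ∧
    ∀ a < o.length, a < p → s'.m .fk (a : ℕ) = kid a) (t := 23) (by simp [hsN]) (by omega)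
    ⟨[(r, r)], fun _ => 0, ⟨rfl, by simp, fun i x hi hi0 => ?_, by simp⟩, ?_, by simp⟩ ?_
    (by omega) ?_
  · rw [List.getElem?_eq_none (by simp; omega)] at hi
    cases hi
  · have : Stored ([] : List (Fin N × Fin N)) (s.setV .cnt 0) := ⟨by simp, by simp, by simp⟩
    refine (this.push (r, r)).of_eq ?_ ?_ ?_ <;> simp
    all_goals rfl
  · intro p hp s₁ ⟨o, kid, hF, hS, hfk⟩ hf
    have hcnt : (vr .cnt - vr .p : Term).eval (s₁.setV .p p) = o.length - (p : ℤ) := by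
      simp [hS.cnt]
    refine Run.iteEnd (fun h => ?_) fun h => ?_ <;> rw [hcnt] at h
    · have hpo : p < o.length := by omega
      have hx : o[p]? = some o[p] := List.getElem?_eq_getElem hpo
      have hm : ∀ a ∉ [Arr.ord, .par, .fk], s₁.m a = s.m a := fun a ha => by
        rw [hf.2 a (by simpa [visit, Cmd.wa, and_assoc, and_comm, and_left_comm] using ha)]
        simp [not_or] at ha
        simp [ha]
      refine (run_visit (s := s₁.setV .p p) (nbs := nbs) (fun z => by rw [St.setV_m, hm _ (by decide), hL.deg z z.2])
        (fun z j hj => by rw [St.setV_m, hm _ (by decide), hL.nb z z.2 j hj]) h3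
        (o := o) (hS.of_eq (by simp) rfl rfl) (p := p) (by simp) hx hF.length_le hM).imp (by norm_num)
        fun s' ⟨hS', hfk'⟩ _ => ⟨_, _, hF.visit hD hx, hS', fun a ha hap => ?_⟩
      rw [hfk']
      by_cases h : a = p
      · subst h; simp
      · rw [if_neg h, Function.update_of_ne h, St.setV_m, hfk a (by omega) (by omega)]
    · refine Run.skipEnd ⟨o, kid, ⟨hF.head, hF.nodup, fun i x hi h0 => ?_, fun a x ha hap => ?_⟩,
        hS.of_eq (by simp) rfl rfl, fun a ha _ => hfk a ha (by omega)⟩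
      · obtain ⟨a, y, h1, h2⟩ := hF.par i x hi h0
        exact ⟨a, y, by omega, h2⟩
      · exact hF.kids a x ha (by have := (List.getElem?_eq_some_iff.1 ha).1; omega)
  · rintro s' ⟨o, kid, hF, hS, hfk⟩ _
    exact ⟨o, kid, hF, hS, fun a ha => hfk a ha (ha.trans_le hF.length_le)⟩

/-! ### The program: slots of leaves -/

/-- Append the vertex `z` to the list being written unless it is finished. -/
def leafVertex (z : Var) : Code :=
  .ite (rd .vd (vr z) - 1)
    (.put .LV (vr .ltop + vr .l) (vr z) ;; .put .LC (vr .ltop + vr .l) 1 ;;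
    .set .l (vr .l + 1)) .skip

/-- Write the table for a list of length `l` of endpoints of an edge. -/
def leafTable : Code :=
  .put .LN (vr .jc) (vr .l) ;; .put .LB (vr .jc) (vr .ltop) ;; .put .TB (vr .jc) (vr .top) ;;
  .put .TAB (vr .top) ((vr .l - 1) * (vr .l - 1)) ;; .put .TAB (vr .top + 1) (2 - vr .l) ;;
  .put .TAB (vr .top + 2) 0 ;; .put .TAB (vr .top + 3) 1 ;;
  .set .top (vr .top + 4) ;; .set .ltop (vr .ltop + 2)

/-- Fill the slot `jc` with the data of the leaf `x`. -/
def leafSlot : Code :=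
  .set .u (rd .eu (vr .x)) ;; .set .v (rd .ev (vr .x)) ;; .set .l 0 ;; leafVertex .u ;;
  leafVertex .v ;; leafTable

variable {M : ℤ} {mm : ℕ → ℕ} {n N : ℕ} {s : Store}

theorem ArrFrom.push {a : Arr} {i z k : ℤ} {l : List ℤ}
    (h : ArrFrom (s.m a) k l) (hi : i = k + l.length) :
    ArrFrom ((s.setM a i z).m a) k (l ++ [z]) := by
  subst hi
  refine ArrFrom.append (h.of_eq (z := k + l.length) le_rfl fun j hj => ?_) fun b hb => ?_
  · rw [St.setM_m_self, if_neg (by omega)]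
  · obtain rfl : b = 0 := by simpa using hb
    simp [St.setM_m_self]

/-- The list of the vertices of a leaf, as written so far. -/
structure LeafList (s : Store) (lt : ℕ) (l : List (Fin n)) : Prop where
  len : s.v .l = l.length
  LV : ArrFrom (s.m .LV) lt (l.map fun v : Fin n => ((v : ℕ) : ℤ))
  LC : ArrFrom (s.m .LC) lt (l.map fun _ => 1)

theorem run_leafVertex {z : Var} {lt : ℕ} {l : List (Fin n)} {u : Fin n}
    (h : LeafList s lt l) (hlt : s.v .ltop = lt) (hz : s.v z = (u : ℕ)) {d : ℕ}
    (hd : s.m .vd (u : ℕ) = d) (hl : (l.length : ℤ) + 1 ≤ M) (hn : (n : ℤ) ≤ M) :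
    Run M mm (leafVertex z) s 4 fun s' => LeafList s' lt (l ++ if 1 < d then [u] else []) ∧
      ∀ i < (lt : ℤ), s'.m .LV i = s.m .LV i ∧ s'.m .LC i = s.m .LC i := by
  have hu := u.2
  refine Run.iteEnd (fun hp => ?_) fun hp => ?_ <;>
    simp [hz, hd] at hp
  · refine Run.putThen ?_ (Run.putThen ?_ (Run.setEnd ?_ ?_)) <;> simp [hz, h.len, hlt]
    · omega
    · omega
    · rw [abs_of_nonneg (by positivity)]; exact hl
    · rw [if_pos (by omega)]
      refine ⟨⟨by simp, ?_, ?_⟩, fun i hi => ?_⟩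
      · simpa using h.LV.push (z := (u : ℕ)) (by simp)
      · simpa using ArrFrom.push (s := s.setM .LV (lt + l.length) (u : ℕ))
          (by simpa using h.LC) (z := 1) (by simp)
      · simp only [ne_eq, reduceCtorEq, not_false_eq_true, St.setM_m_ne,
          St.setM_m_self]
        rw [if_neg (by omega), if_neg (by omega)]
        exact ⟨rfl, rfl⟩
  · rw [if_neg (by omega), List.append_nil]
    exact Run.skipEnd ⟨h, fun _ _ => ⟨rfl, rfl⟩⟩

theorem pm_leaf {E0 : Finset (Sym2 (Fin n))} {u v : Fin n} (huv : u ≠ v) (he : s(u, v) ∈ E0)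
    {l : List (Fin n)} (hl : l = (if 1 < cnt E0 u then [u] else []) ++
      if 1 < cnt E0 v then [v] else []) :
    l.Nodup ∧ l.toFinset = bdry E0 {s(u, v)} ∧ l.length ≤ 2 ∧
      (∀ x ∈ l, cnt {s(u, v)} x = 1) ∧ ∀ q < 2 ^ l.length,
        (pm E0 {s(u, v)} (sub l q) : ℤ) = if q = 0 then ((l.length : ℤ) - 1) * (l.length - 1) else
          if q = 1 then 2 - l.length else if q = 2 then 0 else 1 := by
  have hc : ∀ x, cnt {s(u, v)} x = if x = u ∨ x = v then 1 else 0 := fun x => by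
    simp only [cnt, filter_singleton, Sym2.mem_iff]
    split_ifs <;> simp
  have hb : l.toFinset = bdry E0 {s(u, v)} := by
    ext x
    rw [mem_bdry, hc, List.mem_toFinset, hl, List.mem_append]
    by_cases hu : x = u
    · subst hu
      by_cases h1 : 1 < cnt E0 x <;> by_cases h2 : 1 < cnt E0 v <;> simp [h1, h2, huv]
    · by_cases hv : x = v
      · subst hv
        by_cases h1 : 1 < cnt E0 u <;> by_cases h2 : 1 < cnt E0 x <;> simp [h1, h2, hu]
      · by_cases h1 : 1 < cnt E0 u <;> by_cases h2 : 1 < cnt E0 v <;> simp [h1, h2, hu, hv]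
  have hn : l.Nodup := by
    rw [hl]
    by_cases h1 : 1 < cnt E0 u <;> by_cases h2 : 1 < cnt E0 v <;> simp [h1, h2, huv]
  refine ⟨hn, hb, ?_, fun x hx => ?_, fun q hq => ?_⟩
  · rw [hl]
    by_cases h1 : 1 < cnt E0 u <;> by_cases h2 : 1 < cnt E0 v <;> simp [h1, h2]
  · rw [← List.mem_toFinset, hb, mem_bdry, hc] at hx
    rw [hc, if_pos]
    by_contra h
    simp [h] at hx
  · rw [pm_singleton huv he (by rw [← hb]; exact sub_subset _ _), ← hb,
      List.toFinset_card_of_nodup hn]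
    have hA : sub l q = l.toFinset ↔ q = 2 ^ l.length - 1 := by
      have hf : sub l (2 ^ l.length - 1) = l.toFinset := by
        ext x
        rw [MatchCount.mem_sub, Nat.testBit_two_pow_sub_one, List.mem_toFinset]
        simp [List.idxOf_lt_length_iff]
      refine ⟨fun h => sub_injOn hn hq ?_ (h.trans hf.symm), fun h => h ▸ hf⟩
      exact Nat.sub_lt (by positivity) one_pos
    have hB : sub l q = ∅ ↔ q = 0 := by
      have hf : sub l 0 = ∅ := by
        ext x
        simp [MatchCount.mem_sub]
      exact ⟨fun h => sub_injOn hn hq (Nat.two_pow_pos _) (h.trans hf.symm), fun h => h ▸ hf⟩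
    simp only [hA, hB]
    have h2 : l.length ≤ 2 := by
      rw [hl]
      by_cases h1 : 1 < cnt E0 u <;> by_cases h2 : 1 < cnt E0 v <;> simp [h1, h2]
    generalize l.length = k at hq h2
    have h3 : q < 2 ^ 2 := hq.trans_le (Nat.pow_le_pow_right (by norm_num) h2)
    revert hq
    norm_num at h3
    interval_cases k <;> interval_cases q <;> simp

/-- The sizes that the bound `M` and the time `C` of a convolution allow for. -/
structure Fits (M : ℤ) (mm : ℕ → ℕ) (E0 : Finset (Sym2 (Fin n))) (N w C : ℕ) (μ : ℤ) : Prop where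
  two_le : 2 ≤ w
  one_le : 1 ≤ μ
  nM : (nM E0 : ℤ) ≤ μ
  tab : 2 ^ (10 * w) * μ ^ 2 ≤ M
  pow : (((N + 2) * 2 ^ (w + 1) : ℕ) : ℤ) ≤ M
  n : (n : ℤ) + 1 ≤ M
  N : (N : ℤ) + 5 ≤ M
  cnt : ∀ v, ((cnt E0 v : ℕ) : ℤ) ≤ M
  cost : ∀ i l f r, i + l + f ≤ w → i + r + f ≤ w → i + r + l ≤ w → convCost mm i l f r ≤ C

/-- The state is ready for writing the next slot after `i` slots. -/
structure Ready (M : ℤ) (E0 : Finset (Sym2 (Fin n))) (w i : ℕ) (s : Store) : Prop where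
  bd : Bd M s
  POS : ∀ v : Fin n, s.m .POS (v : ℕ) = 0
  ZERO : ∀ b : ℕ, s.m .ZERO b = 0
  vd : ∀ v : Fin n, s.m .vd (v : ℕ) = (cnt E0 v : ℕ)
  ltop : ∃ lt : ℕ, s.v .ltop = lt ∧ lt ≤ i * w
  top : ∃ tp : ℕ, s.v .top = tp ∧ tp ≤ i * 2 ^ w

theorem Ready.setV {E0 : Finset (Sym2 (Fin n))} {w i : ℕ}
    (h : Ready M E0 w i s) {x : Var} {z : ℤ} (hx : x ∉ [Var.ltop, .top]) (hz : |z| ≤ M) :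
    Ready M E0 w i (s.setV x z) := by
  simp [not_or] at hx
  refine ⟨⟨fun y => ?_, h.bd.2⟩, h.POS, h.ZERO, h.vd, ?_, ?_⟩
  · rw [St.setV_v]; split_ifs
    exacts [hz, h.bd.1 y]
  · simpa [Ne.symm hx.1] using h.ltop
  · simpa [Ne.symm hx.2] using h.top

variable {E0 : Finset (Sym2 (Fin n))} {w C i c : ℕ} {μ : ℤ}

theorem Ready.bounds (hf : Fits M mm E0 N w C μ) (hi : i ≤ N) {lt tp : ℕ} (hlt : lt ≤ i * w)
    (htp : tp ≤ i * 2 ^ w) :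
    ((lt + w : ℕ) : ℤ) + 2 ≤ M ∧ ((tp + 2 ^ w : ℕ) : ℤ) + 4 ≤ M ∧ 4 ≤ 2 ^ w := by
  have h1 : w < 2 ^ w := Nat.lt_two_pow_self
  have h4 : 2 ^ 2 ≤ 2 ^ w := Nat.pow_le_pow_right (by norm_num) hf.two_le
  have h5 : (i + 1) * 2 ^ w ≤ (N + 1) * 2 ^ w := Nat.mul_le_mul_right _ (by omega)
  have h6 : (i + 1) * w ≤ (i + 1) * 2 ^ w := Nat.mul_le_mul_left _ h1.le
  have h7 := hf.pow
  rw [pow_succ, show (N + 2) * (2 ^ w * 2) = 2 * ((N + 1) * 2 ^ w) + 2 * 2 ^ w by ring] at h7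
  rw [add_mul, one_mul] at h5 h6
  rw [add_mul, one_mul] at h6
  refine ⟨le_trans ?_ h7, le_trans ?_ h7, h4⟩ <;> norm_cast <;> omega

theorem run_join_ready (hf : Fits M mm E0 N w C μ) (h : Ready M E0 w i s) (hi : i ≤ N)
    {E1 E2 : Finset (Sym2 (Fin n))} {a b : ℕ} (ha : s.v .ja = a) (hb : s.v .jb = b)
    (hc : s.v .jc = c) (h₁ : HasSlot E0 s E1 a) (h₂ : HasSlot E0 s E2 b) (hE : Disjoint E1 E2)
    (h₀ : E1 ∪ E2 ⊆ E0) (hw1 : #(bdry E0 E1) ≤ w) (hw₂ : #(bdry E0 E2) ≤ w)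
    (hw : #(bdry E0 (E1 ∪ E2)) ≤ w) :
    Run M mm join s (C + 200 * (w + 1) ^ 2 * 2 ^ w) fun s' =>
      HasSlot E0 s' (E1 ∪ E2) c ∧ Grows c s s' ∧ Ready M E0 w (i + 1) s' := by
  obtain ⟨lt, hlt, hlt'⟩ := h.ltop
  obtain ⟨tp, htp, htp'⟩ := h.top
  obtain ⟨b1, b2, _⟩ := Ready.bounds hf hi hlt' htp'
  refine ((run_join ha hb hc hlt htp h₁ h₂ hE h₀ hw1 hw₂ hw h.vd h.POS h.ZERO hf.one_le hf.nM
    hf.tab (le_trans (by exact_mod_cast Nat.le_mul_of_pos_left _ (by omega)) hf.pow)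
    (by have := hf.n; omega) hf.cnt (by omega) (by omega) (h.bd.2 _) hf.cost).bounded h.bd).imp
    le_rfl ?_
  intro s' ⟨⟨g1, g2, g3, g4, g5⟩, hbd⟩ hF
  refine ⟨g1, g2, hbd, g5, fun b => by rw [hF.m _, h.ZERO],
    fun v => by rw [hF.m _, h.vd], ⟨(s'.v .ltop).toNat, ?_, ?_⟩,
    (s'.v .top).toNat, ?_, ?_⟩
  · have := g2.ltop; omega
  · rw [add_mul, one_mul]; omega
  · have := g2.top; omega
  · rw [add_mul, one_mul]; push_cast at g4 ⊢; zify at *; omega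

theorem run_leafTable {l : List (Fin n)} {lt tp : ℕ} {f : ℕ → ℤ} (hlt : s.v .ltop = lt)
    (htp : s.v .top = tp) (hc : s.v .jc = c) (hl : s.v .l = l.length) (hl2 : l.length ≤ 2)
    (hf : ∀ q < 2 ^ l.length, f q = if q = 0 then ((l.length : ℤ) - 1) * (l.length - 1) else
      if q = 1 then 2 - l.length else if q = 2 then 0 else 1)
    (hltM : (lt : ℤ) + 2 ≤ M) (htpM : (tp : ℤ) + 4 ≤ M) :
    Run M mm leafTable s 10 fun s' =>
      s'.m .LN c = l.length ∧ s'.m .LB c = lt ∧ s'.m .TB c = tp ∧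
      (∀ q : ℕ, q < 2 ^ l.length → s'.m .TAB ((tp : ℤ) + q) = f q) ∧ s'.v .ltop = lt + 2 ∧
      s'.v .top = tp + 4 ∧ (∀ a ∈ [Arr.LN, .LB, .TB], ∀ i : ℕ, i ≠ c → s'.m a i = s.m a i) ∧
      ∀ i < (tp : ℤ), s'.m .TAB i = s.m .TAB i := by
  have h4 : 2 ^ l.length ≤ 2 ^ 2 := Nat.pow_le_pow_right (by norm_num) hl2
  have h4e : ∀ s : Store, (4 : Term).eval s = 4 := fun _ => rfl
  have hsq : |((l.length : ℤ) - 1) * (l.length - 1)| ≤ 1 := by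
    generalize l.length = k at hl2
    interval_cases k <;> simp
  refine Run.putThen ?_ (Run.putThen ?_ (Run.putThen ?_
    (Run.putThen ?_ (Run.putThen ?_ (Run.putThen ?_
    (Run.putThen ?_ (Run.setThen ?_ (Run.setEnd ?_
    ?_))))))))
  all_goals simp only [Ex.eval_add, Ex.eval_sub, Ex.eval_mul, Ex.eval_var, St.setM_v, ne_eq,
    reduceCtorEq, not_false_eq_true, St.setV_v_ne, hlt, htp, hc, hl, Ex.eval_zero, Ex.eval_one,
    Ex.eval_two, Ex.eval_three, h4e, Nat.abs_cast, abs_zero, abs_one]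
  · omega
  · omega
  · omega
  · omega
  · rw [abs_le]; constructor <;> omega
  · omega
  · omega
  · rw [abs_of_nonneg (by positivity)]; exact htpM
  · rw [abs_of_nonneg (by positivity)]; exact hltM
  refine ⟨by simp [St.setM_m_self], by simp [St.setM_m_self], by simp [St.setM_m_self],
    fun q hq => ?_, by simp, by simp, fun a ha i hi => ?_, fun i hi => ?_⟩
  · rw [hf q hq]
    have : q < 4 := by omega
    interval_cases q <;> simp [St.setM_m_self]
  · have hi' : (i : ℤ) ≠ c := by exact_mod_cast hi
    simp only [List.mem_cons, List.not_mem_nil, or_false] at ha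
    rcases ha with rfl | rfl | rfl <;> simp [St.setM_m_self, hi']
  · simp [St.setM_m_self]
    rw [if_neg (by omega), if_neg (by omega), if_neg (by omega), if_neg (by omega)]

theorem run_leafSlot (hf : Fits M mm E0 N w C μ) (h : Ready M E0 w i s) (hi : i ≤ N) {u v : Fin n}
    (huv : u ≠ v) (he : s(u, v) ∈ E0) (hc : s.v .jc = c)
    (heu : (rd .eu (vr .x)).eval s = (u : ℕ)) (hev : (rd .ev (vr .x)).eval s = (v : ℕ)) :
    Run M mm leafSlot s 21 fun s' =>
      HasSlot E0 s' {s(u, v)} c ∧ Grows c s s' ∧ Ready M E0 w (i + 1) s' := by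
  obtain ⟨lt, hlt, hlt'⟩ := h.ltop
  obtain ⟨tp, htp, htp'⟩ := h.top
  obtain ⟨b1, b2, h4⟩ := Ready.bounds hf hi hlt' htp'
  have hn := hf.n
  have hN := hf.N
  have hu := u.2
  have hv := v.2
  push_cast at b1 b2
  have h2w : (0 : ℤ) ≤ 2 ^ w := by positivity
  have key : Run M mm leafSlot s 21 fun s' =>
      HasSlot E0 s' {s(u, v)} c ∧ Grows c s s' ∧ s'.v .ltop = lt + 2 ∧ s'.v .top = tp + 4 := by
    have hev' : (rd .ev (vr .x)).eval (s.setV .u (u : ℕ)) = (v : ℕ) := by simpa using hev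
    refine Run.setThen (by rw [heu, Nat.abs_cast]; omega) ?_
    rw [heu]
    refine Run.setThen (by rw [hev', Nat.abs_cast]; omega) ?_
    rw [hev']
    refine Run.setThen (by rw [Ex.eval_zero, abs_zero]; omega) ?_
    rw [Ex.eval_zero]
    set s₁ := ((s.setV .u (u : ℕ)).setV .v (v : ℕ)).setV .l 0 with hs1
    refine Run.andThen (run_leafVertex (l := []) (lt := lt) (u := u) (d := cnt E0 u)
      ⟨by simp [hs1], by intro b hb; simp at hb, by intro b hb; simp at hb⟩ (by simp [hs1, hlt])
      (by simp [hs1]) (h.vd u) (by simp; omega) (by omega)) ?_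
    intro s₂ ⟨hl₂, hlo2⟩ hF2
    refine Run.andThen (run_leafVertex (u := v) (d := cnt E0 v) hl₂
      (by rw [hF2.v _]; simp [hs1, hlt]) (by rw [hF2.v _]; simp [hs1])
      (by rw [hF2.m _]; exact h.vd v) (by split_ifs <;> simp <;> omega) (by omega)) ?_
    rw [List.nil_append]
    obtain ⟨l, hl⟩ : ∃ l, l = (if 1 < cnt E0 u then [u] else []) ++
      if 1 < cnt E0 v then [v] else [] := ⟨_, rfl⟩
    obtain ⟨p1, p2, p3, p4, p5⟩ := pm_leaf huv he hl
    rw [← hl]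
    intro s₃ ⟨hl3, hlo3⟩ hF3
    have hv3 : ∀ x ∈ [Var.ltop, .top, .jc], s₃.v x = s.v x := fun x hx => by
      rw [hF3.vs (by decide) _ hx, hF2.vs (by decide) _ hx]
      simp only [List.mem_cons, List.not_mem_nil, or_false] at hx
      rcases hx with rfl | rfl | rfl <;> simp [hs1]
    have hm₃ : ∀ a ∉ [Arr.LV, .LC], s₃.m a = s.m a := fun a ha => by
      rw [hF3.2 a (by simpa [leafVertex, Cmd.wa] using ha),
        hF2.2 a (by simpa [leafVertex, Cmd.wa] using ha), hs1]
      rfl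
    refine (run_leafTable (lt := lt) (tp := tp) (c := c) (l := l)
      (f := fun q => (pm E0 {s(u, v)} (sub l q) : ℤ)) (by rw [hv3 _ (by simp), hlt])
      (by rw [hv3 _ (by simp), htp]) (by rw [hv3 _ (by simp), hc]) hl3.len p3 p5 (by omega)
      (by omega)).imp (by norm_num) ?_
    intro s₄ ⟨g1, g2, g3, g4, g5, g6, g7, g8⟩ hF4
    have h2 : 2 ^ l.length ≤ 2 ^ 2 := Nat.pow_le_pow_right (by norm_num) p3
    have h2' : ((2 ^ l.length : ℕ) : ℤ) ≤ 4 := by exact_mod_cast h2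
    refine ⟨⟨l, lt, tp, ⟨p1, p2, g1, g2, g3, ?_, ?_, g4⟩, by rw [g5]; omega, by rw [g6]; omega⟩,
      ⟨by rw [g5, hlt]; omega, by rw [g6, htp]; omega, fun a ha i hi => ?_, fun a ha i hi => ?_,
        fun i hi => ?_⟩, g5, g6⟩
    · rw [hF4.m _]; exact hl3.LV
    · rw [hF4.m _, List.map_congr_left fun x hx => by rw [p4 x hx, Nat.cast_one]]
      exact hl3.LC
    · rw [g7 a ha i hi, hm₃ a (by revert a; decide)]
    · rw [hlt] at hi
      have e2 := hlo2 i hi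
      have e3 := hlo3 i hi
      rw [hF4.ms (by decide) _ ha]
      simp only [List.mem_cons, List.not_mem_nil, or_false] at ha
      rcases ha with rfl | rfl
      · rw [e3.1, e2.1]; rfl
      · rw [e3.2, e2.2]; rfl
    · rw [g8 i (htp ▸ hi), hm₃ _ (by decide)]
  refine (key.bounded h.bd).imp le_rfl ?_
  intro s' ⟨⟨g1, g2, g3, g4⟩, hbd⟩ hF
  have hw := hf.two_le
  refine ⟨g1, g2, hbd, fun v => by rw [hF.m _, h.POS],
    fun b => by rw [hF.m _, h.ZERO], fun v => by rw [hF.m _, h.vd],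
    ⟨lt + 2, by rw [g3]; rfl, ?_⟩, tp + 4, by rw [g4]; rfl, ?_⟩
  · rw [add_mul, one_mul]; omega
  · rw [add_mul, one_mul]; omega

/-! ### The program: the whole computation -/

/-- Fill the slots of all positions, children first. -/
def process : Code :=
  .loop .p (vr .cnt)
    (.set .jc (vr .cnt - 1 - vr .p) ;; .set .x (rd .ord (vr .jc)) ;;
    .ite (rd .deg (vr .x) - 1) (.set .ja (rd .fk (vr .jc)) ;; .set .jb (vr .ja + 1) ;; join)
      leafSlot)

/-- Combine the root with its child, and read off the result. -/
def finish : Code :=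
  .set .jc 0 ;;
  .ite (rd .deg (vr .root))
    (.set .ja (rd .fk 0) ;; .set .jb 0 ;; .set .jc (vr .cnt) ;; join) .skip ;;
  .set .res (rd .TAB (rd .TB (vr .jc)))

/-- The number of perfect matchings. -/
def main : Code :=
  readInput ;; .ite (vr .n - vr .touched) (.set .res 0) (search ;; process ;; finish)

variable {M : ℤ} {mm : ℕ → ℕ} {n N : ℕ} {G : SimpleGraph (Fin n)}
  {T : BranchDecomposition G (Fin N)} {nbs : Fin N → List (Fin N)} {U W : Fin N → Fin n}
  {E0 : Finset (Sym2 (Fin n))} {w C : ℕ} {μ : ℤ} {s : Store} {r : Fin N}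
  {o : List (Fin N × Fin N)} {kid : ℕ → ℕ}

/-- The set of edges described by the slot of a node. -/
noncomputable def part (T : BranchDecomposition G (Fin N)) (nbs : Fin N → List (Fin N)) (U W : Fin N → Fin n)
    (x : Fin N × Fin N) : Finset (Sym2 (Fin n)) :=
  if (nbs x.1).length ≤ 1 then {s(U x.1, W x.1)} else T.below x.1 x.2

theorem HasSlot.setV {E : Finset (Sym2 (Fin n))} {j : ℕ} (h : HasSlot E0 s E j) {x : Var} {z : ℤ}
    (hx : x ∉ [Var.ltop, .top]) : HasSlot E0 (s.setV x z) E j := by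
  simp [not_or] at hx
  obtain ⟨l, lb, tb, h, h1, h2⟩ := h
  exact ⟨l, lb, tb, h.of_eq fun _ _ => rfl, by rwa [St.setV_v_ne _ (Ne.symm hx.1)],
    by rwa [St.setV_v_ne _ (Ne.symm hx.2)]⟩

theorem TreeData.ncard (hD : TreeData T nbs U W) (x : Fin N) :
    (T.tree.neighborSet x).ncard = (nbs x).length := by
  rw [← List.toFinset_card_of_nodup (hD.nodup x), ← Set.ncard_coe_finset]
  congr 1
  ext y
  simp [hD.mem]

theorem TreeData.part_eq (hD : TreeData T nbs U W) {x : Fin N × Fin N}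
    (h : T.tree.Adj x.1 x.2) : part T nbs U W x = T.below x.1 x.2 := by
  rw [part, ← hD.ncard]
  split_ifs with hl
  · rw [T.below_leaf hl h, hD.edge]
  · rfl

theorem TreeData.part_join (hD : TreeData T nbs U W) {x : Fin N × Fin N}
    (h : T.tree.Adj x.1 x.2) (hl : ¬ (nbs x.1).length ≤ 1) :
    ∃ c₁ c₂, kids nbs x = [c₁, c₂] ∧ T.tree.Adj c₁ x.1 ∧ T.tree.Adj c₂ x.1 ∧
      part T nbs U W x = part T nbs U W (c₁, x.1) ∪ part T nbs U W (c₂, x.1) ∧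
      Disjoint (part T nbs U W (c₁, x.1)) (part T nbs U W (c₂, x.1)) := by
  have h3 : (nbs x.1).length = 3 := by
    have := T.degree x.1
    rw [hD.ncard] at this
    omega
  have hk : (kids nbs x).length = 2 := by
    have := List.length_erase_of_mem ((hD.mem x.1 x.2).2 h)
    rw [(hD.nodup x.1).erase_eq_filter, h3] at this
    rw [kids, show (fun y => decide (y ≠ x.2)) = fun y => y != x.2 by
      ext y; by_cases hy : y = x.2 <;> simp [hy]]
    exact this
  obtain ⟨c₁, c₂, hc⟩ := List.length_eq_two.1 hk
  have hmem : ∀ c, c = c₁ ∨ c = c₂ ↔ T.tree.Adj x.1 c ∧ c ≠ x.2 := fun c => by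
    rw [← mem_kids hD, hc]; simp
  have h1 := (hmem c₁).1 (Or.inl rfl)
  have h2 := (hmem c₂).1 (Or.inr rfl)
  have hne : c₁ ≠ c₂ := by
    have : (kids nbs x).Nodup := (hD.nodup _).filter _
    rw [hc] at this
    simpa using this
  have hN : T.tree.neighborSet x.1 = {x.2, c₁, c₂} := by
    ext c
    simp only [SimpleGraph.mem_neighborSet, Set.mem_insert_iff, Set.mem_singleton_iff, hmem]
    by_cases hcx : c = x.2
    · simp [hcx, h]
    · simp [hcx]
  refine ⟨c₁, c₂, hc, h1.1.symm, h2.1.symm, ?_⟩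
  rw [hD.part_eq h, hD.part_eq (x := (c₁, x.1)) h1.1.symm, hD.part_eq (x := (c₂, x.1)) h2.1.symm]
  exact T.below_inner hN h1.2 h2.2 hne (by rw [hD.ncard]; exact hl)

theorem run_process (hD : TreeData T nbs U W) (hE : ∀ e, e ∈ E0 ↔ e ∈ G.edgeSet)
    (hw : T.width ≤ w) (hf : Fits M mm E0 N w C μ) (hL : Loaded nbs U W N s)
    (hne : ∀ x, (nbs x).length ≤ 1 → U x ≠ W x) (hF : Found T nbs r o kid N) (hS : Stored o s)
    (hr : (nbs r).length ≤ 1) (hfk : ∀ a < o.length, s.m .fk (a : ℕ) = kid a)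
    (h : Ready M E0 w 0 s) :
    Run M mm process s (N * (C + 200 * (w + 1) ^ 2 * 2 ^ w + 30) + 1) fun s' =>
      Ready M E0 w o.length s' ∧
      ∀ (a : ℕ) x, o[a]? = some x → HasSlot E0 s' (part T nbs U W x) a := by
  have hoN := hF.length_le
  have hMN := hf.N
  refine Run.loop' o.length (fun p s' => Ready M E0 w p s' ∧ ∀ (a : ℕ) x, o.length ≤ a + p →
    o[a]? = some x → HasSlot E0 s' (part T nbs U W x) a)
    (t := C + 200 * (w + 1) ^ 2 * 2 ^ w + 29) hS.cnt (by omega) ⟨h, fun a x ha hx => ?_⟩ ?_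
    (by gcongr) fun s' hs' _ => ⟨hs'.1, fun a x hx => hs'.2 a x (by omega) hx⟩
  · have := (List.getElem?_eq_some_iff.1 hx).1
    omega
  intro p hp s₁ ⟨hR, hsl⟩ hf1
  obtain ⟨c, hc⟩ : ∃ c, c = o.length - 1 - p := ⟨_, rfl⟩
  have hco : c < o.length := by omega
  obtain ⟨x, hx⟩ : ∃ x, o[c]? = some x := ⟨_, List.getElem?_eq_getElem hco⟩
  have hx1 := x.1.2
  have e1 : (vr .cnt - 1 - vr .p : Term).eval (s₁.setV .p p) = c := by
    simp
    rw [hf1.v .cnt, hS.cnt]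
    omega
  refine Run.setThen (by rw [e1, Nat.abs_cast]; omega) ?_
  rw [e1]
  have e2 : (rd .ord (vr .jc)).eval ((s₁.setV .p p).setV .jc c) = (x.1 : ℕ) := by
    simp
    rw [hf1.m .ord, hS.ord c x hx]
  refine Run.setThen (by rw [e2, Nat.abs_cast]; omega) ?_
  rw [e2]
  have hR2 : Ready M E0 w p (((s₁.setV .p p).setV .jc c).setV .x (x.1 : ℕ)) :=
    ((hR.setV (by decide) (by rw [Nat.abs_cast]; omega)).setV (by decide)
      (by rw [Nat.abs_cast]; omega)).setV (by decide) (by rw [Nat.abs_cast]; omega)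
  set s₂ := ((s₁.setV .p p).setV .jc c).setV .x (x.1 : ℕ) with hs2
  have hm2 : ∀ a ∈ [Arr.deg, .fk, .eu, .ev], s₂.m a = s.m a := fun a ha =>
    hf1.ms (by decide) _ ha
  have hlast : ∀ {s'}, HasSlot E0 s' (part T nbs U W x) c → Grows c s₁ s' →
      ∀ (a : ℕ) y, o.length ≤ a + (p + 1) → o[a]? = some y →
        HasSlot E0 s' (part T nbs U W y) a := fun {s'} h₁ h₂ a y ha hy => by
    by_cases hac : a = c
    · subst hac
      obtain rfl : x = y := Option.some_inj.1 (hx ▸ hy)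
      exact h₁
    · exact (hsl a y (by omega) hy).of_grows h₂ hac
  have hdeg : (rd .deg (vr .x) - 1 : Term).eval s₂ = (nbs x.1).length - (1 : ℤ) := by
    rw [Ex.eval_sub, Ex.eval_rd, Ex.eval_var, hm2 _ (by simp), Ex.eval_one, hs2, St.setV_v_self,
      hL.deg x.1 hx1]
  refine Run.iteEnd (fun hl => ?_) fun hl => ?_ <;> rw [hdeg] at hl
  · have hc0 : 0 < c := by
      by_contra h0
      obtain rfl : c = 0 := by omega
      obtain rfl : (r, r) = x := Option.some_inj.1 (hF.head ▸ hx)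
      simp only at hl
      omega
    obtain ⟨_, _, _, _, _, hadj, _⟩ := hF.par c x hx hc0
    obtain ⟨c₁, c₂, hk, ha₁, ha₂, hun, hdis⟩ := hD.part_join hadj (by omega)
    obtain ⟨hck, hkid⟩ := hF.kids c x hx (by omega)
    have k₁ := hkid 0 c₁ (by rw [hk]; rfl)
    have k₂ := hkid 1 c₂ (by rw [hk]; rfl)
    have hk2 := (List.getElem?_eq_some_iff.1 k₂).1
    have e3 : (rd .fk (vr .jc)).eval s₂ = kid c := by
      rw [Ex.eval_rd, Ex.eval_var, hm2 _ (by simp), hs2, St.setV_v_ne _ (by decide),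
        St.setV_v_self, hfk c hco]
    have hsl' : ∀ {E j z z'}, HasSlot E0 s₁ E j → HasSlot E0 ((s₂.setV .ja z).setV .jb z') E j :=
      fun h => ((((h.setV (by decide)).setV (by decide)).setV (by decide)).setV (by decide)).setV
        (by decide)
    have hwd : ∀ y : Fin N × Fin N, T.tree.Adj y.1 y.2 → #(bdry E0 (part T nbs U W y)) ≤ w :=
      fun y hy => by rw [hD.part_eq hy]; exact (T.card_bdry_below_le hE hy).trans hw
    refine Run.setThen (by rw [e3, Nat.abs_cast]; omega) (Run.setThen ?_ ?_)
      <;> simp only [e3, Ex.eval_add, Ex.eval_var, Ex.eval_one, St.setV_v_self]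
    · rw [abs_of_nonneg (by positivity)]; omega
    refine (run_join_ready (c := c) (a := kid c) (b := kid c + 1)
      (E1 := part T nbs U W (c₁, x.1)) (E2 := part T nbs U W (c₂, x.1)) hf
      ((hR2.setV (by decide) (by rw [Nat.abs_cast]; omega)).setV (by decide)
        (by rw [abs_of_nonneg (by positivity)]; omega)) (by omega) (by simp) (by simp)
      (by simp [hs2]) (hsl' (hsl (kid c + 0) _ (by omega) k₁)) (hsl' (hsl _ _ (by omega) k₂)) hdis ?_
      (hwd _ ha₁) (hwd _ ha₂) (hun ▸ hwd x hadj)).imp (by omega) ?_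
    · rw [← hun, hD.part_eq hadj]
      exact T.below_subset hE _ _
    · intro s' ⟨g1, g2, g3⟩ _
      exact ⟨g3, hlast (hun ▸ g1) ⟨g2.ltop, g2.top, g2.dir, g2.lists, g2.TAB⟩⟩
  · have hl' : (nbs x.1).length ≤ 1 := by omega
    have hpart : part T nbs U W x = {s(U x.1, W x.1)} := if_pos hl'
    refine (run_leafSlot (c := c) hf hR2 (by omega) (hne _ hl') ?_ (by simp [hs2]) ?_ ?_).imp
      (by omega) fun s' ⟨g1, g2, g3⟩ _ =>
        ⟨g3, hlast (hpart ▸ g1) ⟨g2.ltop, g2.top, g2.dir, g2.lists, g2.TAB⟩⟩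
    · rw [hE, ← hD.edge x.1 (by rw [hD.ncard]; exact hl')]
      exact (T.leafEdge _).2
    · rw [Ex.eval_rd, Ex.eval_var, hm2 _ (by simp), hs2, St.setV_v_self, hL.eu x.1 hx1 hl']
    · rw [Ex.eval_rd, Ex.eval_var, hm2 _ (by simp), hs2, St.setV_v_self, hL.ev x.1 hx1 hl']

theorem HasSlot.result {c : ℕ} (h : HasSlot E0 s E0 c) :
    s.m .TAB (s.m .TB c) = (pm E0 E0 ∅ : ℕ) := by
  obtain ⟨l, lb, tb, h, _⟩ := h
  have hl := h.toFinset
  rw [BranchDecomposition.bdry_self, List.toFinset_eq_empty_iff] at hl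
  subst hl
  rw [h.TB]
  simpa using h.TAB 0 (by simp)

theorem run_finish (hD : TreeData T nbs U W) (hE : ∀ e, e ∈ E0 ↔ e ∈ G.edgeSet)
    (hw : T.width ≤ w) (hf : Fits M mm E0 N w C μ) (hdeg : s.m .deg (r : ℕ) = (nbs r).length)
    (hroot : s.v .root = (r : ℕ)) (hF : Found T nbs r o kid N) (hcnt : s.v .cnt = o.length)
    (hr : (nbs r).length ≤ 1) (hfk : s.m .fk 0 = kid 0) (h : Ready M E0 w o.length s)
    (hsl : ∀ (a : ℕ) x, o[a]? = some x → HasSlot E0 s (part T nbs U W x) a) :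
    Run M mm finish s (C + 200 * (w + 1) ^ 2 * 2 ^ w + 10) fun s' =>
      s'.v .res = (pm E0 E0 ∅ : ℕ) := by
  have hMN := hf.N
  have hoN := hF.length_le
  have h0 : 0 < o.length := (List.getElem?_eq_some_iff.1 hF.head).1
  have hpr : part T nbs U W (r, r) = {s(U r, W r)} := if_pos hr
  have hedge := hD.edge r (by rw [hD.ncard]; exact hr)
  have hr0 := h.setV (x := .jc) (z := 0) (by decide) (by rw [abs_zero]; omega)
  have hpmM : |((pm E0 E0 ∅ : ℕ) : ℤ)| ≤ M := by
    rw [Nat.abs_cast]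
    have h1 : ((pm E0 E0 ∅ : ℕ) : ℤ) ≤ μ := le_trans (by exact_mod_cast pm_le_nM subset_rfl ∅) hf.nM
    have h2 : (1 : ℤ) ≤ 2 ^ (10 * w) := one_le_pow₀ (by norm_num)
    have h3 := hf.one_le
    have h4 := hf.tab
    nlinarith
  refine Run.setThen (by rw [Ex.eval_zero, abs_zero]; omega) ?_
  rw [Ex.eval_zero]
  refine Run.andThen (t1 := C + 200 * (w + 1) ^ 2 * 2 ^ w + 5) (R := fun s' =>
    ∃ c : ℕ, s'.v .jc = c ∧ HasSlot E0 s' E0 c) ?_ ?_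
  · have hde : (rd .deg (vr .root)).eval (s.setV .jc 0) = (nbs r).length := by
      simp [hroot, hdeg]
    refine Run.iteEnd (fun hd => ?_) fun hd => ?_ <;> rw [hde] at hd
    · obtain ⟨c, hc⟩ := List.length_eq_one_iff.1 (show (nbs r).length = 1 by omega)
      have hadj : T.tree.Adj r c := by rw [← hD.mem, hc]; simp
      obtain ⟨hk0, hk⟩ := hF.kids 0 _ hF.head (by omega)
      have hkc := hk 0 c (by simp [kids, hc, hadj.ne.symm])
      have hko := (List.getElem?_eq_some_iff.1 hkc).1
      obtain ⟨hun, hdis⟩ := T.below_union hE hadj.symm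
      have e1 := hD.part_eq (x := (c, r)) hadj.symm
      have e2 : part T nbs U W (r, r) = T.below r c := by
        rw [hpr, ← hedge, T.below_leaf (by rw [hD.ncard]; exact hr) hadj]
      have e3 : (rd .fk 0).eval (s.setV .jc 0) = kid 0 := by simpa using hfk
      refine Run.setThen (by rw [e3, Nat.abs_cast]; omega) (Run.setThen ?_
        (Run.setThen ?_ ?_)) <;> simp only [e3, Ex.eval_zero, Ex.eval_var, ne_eq,
          reduceCtorEq, not_false_eq_true, St.setV_v_ne, hcnt, Nat.abs_cast, abs_zero]
      · omega
      · omega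
      have hsl' : ∀ {E j z z' z''}, HasSlot E0 s E j →
          HasSlot E0 ((((s.setV .jc 0).setV .ja z).setV .jb z').setV .jc z'') E j :=
        fun h => (((h.setV (by decide)).setV (by decide)).setV (by decide)).setV (by decide)
      refine (run_join_ready (c := o.length) (a := kid 0) (b := 0) (E1 := T.below c r)
        (E2 := T.below r c) hf (((hr0.setV (by decide) (by rw [Nat.abs_cast]; omega)).setV
        (by decide) (by rw [abs_zero]; omega)).setV (by decide) (by rw [Nat.abs_cast]; omega))
        hoN (by simp) (by simp) (by simp) (hsl' (e1 ▸ hsl (kid 0 + 0) _ hkc))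
        (hsl' (e2 ▸ hsl 0 _ hF.head)) hdis
        hun.subset ((T.card_bdry_below_le hE hadj.symm).trans hw)
        ((T.card_bdry_below_le hE hadj).trans hw) ?_).imp (by omega) fun s' ⟨g1, _⟩ hFr =>
        ⟨o.length, ?_, hun ▸ g1⟩
      · rw [hun, BranchDecomposition.bdry_self]; simp
      · rw [hFr.v _, St.setV_v_self]
    · refine Run.skipEnd ⟨0, by simp, ?_⟩
      have hnil : nbs r = [] := List.eq_nil_of_length_eq_zero (by omega)
      have hall : ∀ x : Fin N, x = r := fun x => by
        by_contra hx
        obtain ⟨c, hc, _⟩ := T.isTree.exists_adj_dist_lt (Ne.symm hx)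
        rw [← hD.mem, hnil] at hc
        cases hc
      have he := T.eq_singleton_of_no_adj hE ⟨r, by rw [hD.ncard]; exact hr⟩ hall
      rw [hedge, ← hpr] at he
      have := hsl 0 _ hF.head
      rw [← he] at this
      exact this.setV (by decide)
  · intro s' ⟨c, hc, hs⟩ _
    have : (rd .TAB (rd .TB (vr .jc))).eval s' = (pm E0 E0 ∅ : ℕ) := by
      rw [Ex.eval_rd, Ex.eval_rd, Ex.eval_var, hc, hs.result]
    exact Run.setEnd (by rw [this]; exact hpmM) (by rw [St.setV_v_self, this])

theorem run_main [Fintype G.edgeSet] (hD : TreeData T nbs U W) (hg : Given nbs U W s.lo)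
    (hE : ∀ e, e ∈ E0 ↔ e ∈ G.edgeSet) (hw : T.width ≤ w) (hf : Fits M mm E0 N w C μ)
    (hsn : s.v .n = n) (hsN : s.v .N = N) (hv : ∀ x, x ≠ .n → x ≠ .N → s.v x = 0)
    (hm : ∀ a i, s.m a i = 0) :
    Run M mm main s ((N + 1) * (C + 200 * (w + 1) ^ 2 * 2 ^ w + 100)) fun s' =>
      s'.v .res = numPerfectMatchings G := by
  have hMN := hf.N
  have hMn := hf.n
  have hbd : Bd M s := by
    refine ⟨fun x => ?_, fun a i => by rw [hm, abs_zero]; omega⟩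
    by_cases h1 : x = .n
    · rw [h1, hsn, Nat.abs_cast]; omega
    · by_cases h2 : x = .N
      · rw [h2, hsN, Nat.abs_cast]; omega
      · rw [hv x h1 h2, abs_zero]; omega
  obtain ⟨K, hK⟩ : ∃ K, K = C + 200 * (w + 1) ^ 2 * 2 ^ w := ⟨_, rfl⟩
  have ht : (N + 1) * (C + 200 * (w + 1) ^ 2 * 2 ^ w + 100) = N * K + 100 * N + K + 100 := by
    rw [hK]; ring
  rw [ht]
  have hcnt : ∀ v : Fin n, #{x : Fin N | (x : ℕ) < N ∧ (nbs x).length ≤ 1 ∧ v ∈ s(U x, W x)} =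
      cnt E0 v := fun v => by
    have hl : ∀ x, (nbs x).length ≤ 1 → (T.tree.neighborSet x).ncard ≤ 1 := fun x hx => by
      rwa [hD.ncard]
    refine card_bij (fun x _ => s(U x, W x)) (fun x hx => ?_) (fun x hx y hy hxy => ?_)
      fun e he => ?_
    · simp only [mem_filter, mem_univ, true_and] at hx ⊢
      refine ⟨?_, hx.2.2⟩
      rw [hE, ← hD.edge x (hl x hx.2.1)]
      exact (T.leafEdge _).2
    · simp only [mem_filter, mem_univ, true_and] at hx hy
      rw [← hD.edge x (hl x hx.2.1), ← hD.edge y (hl y hy.2.1)] at hxy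
      exact congrArg Subtype.val (T.leafEdge_injective hxy)
    · simp only [mem_filter] at he
      obtain ⟨⟨x, hx⟩, hxe⟩ := T.leafEdge.surjective ⟨e, (hE e).1 he.1⟩
      have he' : s(U x, W x) = e := by rw [← hD.edge x hx, hxe]
      exact ⟨x, by simpa [← hD.ncard, hx, he'] using he.2, he'⟩
  have hU : #{v : Fin n | 0 < cnt E0 v} ≤ n := (card_le_univ _).trans (by simp)
  refine Run.andThen ((run_readInput hg hm (hv _ (by decide) (by decide)) hsN hMn (by omega)
    (by omega)).bounded hbd) ?_
  intro s₁ ⟨hL, hbd1⟩ hf1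
  have htou := hL.touched
  simp only [hcnt] at htou
  have hv1 : ∀ x ∈ [Var.n, .N, .ltop, .top], s₁.v x = s.v x := fun x hx =>
    hf1.vs (by decide) _ hx
  refine Run.iteEnd (fun h => ?_) fun h => ?_ <;>
    rw [Ex.eval_sub, Ex.eval_var, Ex.eval_var, hv1 _ (by simp), hsn, htou] at h
  · refine Run.setEnd (by rw [Ex.eval_zero, abs_zero]; omega) ?_
    obtain ⟨v, hv⟩ : ∃ v : Fin n, cnt E0 v = 0 := by
      by_contra hcon
      push Not at hcon
      have : ({v : Fin n | 0 < cnt E0 v} : Finset _) = univ := by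
        ext v; simpa using Nat.pos_of_ne_zero (hcon v)
      rw [this, card_univ, Fintype.card_fin] at h
      omega
    rw [St.setV_v_self, Ex.eval_zero, numPerfectMatchings_eq_zero hE hv, Nat.cast_zero]
  · have hall : ∀ v, 0 < cnt E0 v := by
      have h1 : #{v : Fin n | 0 < cnt E0 v} = #(univ : Finset (Fin n)) := by
        rw [card_univ, Fintype.card_fin]; omega
      intro v
      have := (eq_of_subset_of_card_le (subset_univ _) h1.ge).ge (mem_univ v)
      simpa using this
    obtain ⟨x, hx⟩ := T.exists_leaf
    obtain ⟨r, hr, hroot⟩ := hL.root ⟨x, x.2, hD.ncard x ▸ hx⟩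
    refine Run.andThen ((run_search hD hL hg.le (by rw [hv1 _ (by simp), hsN]) hroot hMN).bounded
      hbd1) ?_
    intro s₂ ⟨⟨o, kid, hF, hS, hfk⟩, hbd2⟩ hf2
    have hv2 : ∀ x ∈ [Var.ltop, .top], s₂.v x = 0 := fun x hx => by
      rw [hf2.vs (by decide) _ hx, hf1.vs (by decide) _ hx]
      exact hv x (by rintro rfl; simp at hx) (by rintro rfl; simp at hx)
    have hm2 : ∀ a ∈ [Arr.deg, .nb, .eu, .ev, .vd], s₂.m a = s₁.m a := fun a ha =>
      hf2.ms (by decide) _ ha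
    have hroot2 : s₂.v .root = (r : ℕ) := by rw [hf2.v _, hroot]
    have hL2 : Loaded nbs U W N s₂ := by
      simp only [List.mem_cons, List.not_mem_nil, or_false, forall_eq_or_imp, forall_eq] at hm2
      obtain ⟨g1, g2, g3, g4, g5⟩ := hm2
      exact ⟨g1 ▸ hL.deg, g2 ▸ hL.nb, g3 ▸ hL.eu, g4 ▸ hL.ev, fun _ => ⟨r, hr, hroot2⟩,
        g5 ▸ hL.vd, by rw [hf2.v _]; exact hL.touched⟩
    have hm₀ : ∀ a ∈ [Arr.POS, .ZERO], ∀ i, s₂.m a i = 0 := fun a ha i => by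
      rw [hf2.ms (by decide) _ ha, hf1.ms (by decide) _ ha, hm]
    have hR : Ready M E0 w 0 s₂ := ⟨hbd2, fun v => hm₀ _ (by simp) _, fun b => hm₀ _ (by simp) _,
      fun v => by rw [hm2 _ (by simp), hL.vd, hcnt], ⟨0, by rw [hv2 _ (by simp)]; simp⟩,
      0, by rw [hv2 _ (by simp)]; simp⟩
    refine Run.andThen (run_process hD hE hw hf hL2 hg.ne hF hS hr hfk hR)
      ?_ (by rw [← hK, mul_add]; omega)
    intro s₃ ⟨hR3, hsl⟩ hf3
    refine (run_finish hD hE hw hf (by rw [hf3.m _, hL2.deg r r.2])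
      (by rw [hf3.v _, hroot2]) hF (by rw [hf3.v _, hS.cnt]) hr
      (by rw [hf3.m _]
          exact hfk 0 (List.getElem?_eq_some_iff.1 hF.head).1) hR3 hsl).imp
      (by rw [← hK, mul_add]; omega) fun s' hs' _ => ?_
    rw [hs', numPerfectMatchings_eq_pm hE hall]

/-! ### Multiplication routines, and bounds for times and numbers -/

/-- At unit costs, a program changes at most `t` cells of a memory in time `t`. -/
theorem Exec.exists_changed {p : Prog} {s s' : State} {t : ℕ}
    (h : Exec (fun _ => 1) (fun _ => 1) p s t s') (a : ℕ) :
    ∃ S : Finset ℤ, #S ≤ t ∧ ∀ i ∉ S, s'.mem a i = s.mem a i := by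
  induction h with
  | store s a' i x =>
    refine ⟨{s.reg i}, by simp, fun j hj => ?_⟩
    by_cases ha : a = a'
    · subst ha; simp [State.setMem, Function.update_of_ne (by simpa using hj : j ≠ s.reg i)]
    · simp [State.setMem, Function.update_of_ne ha]
  | seq _ _ h₁ h₂ | whileTrue _ _ _ h₁ h₂ =>
    obtain ⟨S1, hc₁, h₁⟩ := h₁
    obtain ⟨S2, hc₂, h₂⟩ := h₂
    exact ⟨S1 ∪ S2, (card_union_le _ _).trans (by omega), fun i hi => by
      rw [mem_union, not_or] at hi; rw [h₂ i hi.2, h₁ i hi.1]⟩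
  | ifTrue _ _ h | ifFalse _ _ h =>
    obtain ⟨S, hc, h⟩ := h
    exact ⟨S, by omega, h⟩
  | _ => exact ⟨∅, by simp, fun _ _ => rfl⟩

theorem MatMulTime.two_le {ω : ℝ} (h : MatMulTime ω) : 2 ≤ ω := by
  obtain ⟨P, hP⟩ := h
  obtain ⟨C, hC⟩ := hP 1
  have key : ∀ N : ℕ, 1 ≤ N → (N : ℝ) * N ≤ C * (N : ℝ) ^ ω := fun N hN => by
    obtain ⟨t, s', hex, hres, ht⟩ := hC (fun _ => 1) (fun _ => 1)
      ⟨monotone_const, by simp, by simp⟩ N 1 hN (.of fun _ _ => 1) (.of fun _ _ => 1)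
      (fun _ _ => by simp [bits]) ⟨fun _ => N, fun a _ => if a = 2 then 0 else 1⟩ rfl
      (by simp) (by simp)
    obtain ⟨S, hS, hmem⟩ := hex.exists_changed 2
    have hsub : (univ : Finset (Fin N × Fin N)).image
        (fun x => (N : ℤ) * (x.1 : ℕ) + (x.2 : ℕ)) ⊆ S := by
      intro z hz
      obtain ⟨⟨i, j⟩, _, rfl⟩ := mem_image.1 hz
      by_contra hc
      have := hmem _ hc
      rw [hres i j, Matrix.mul_apply] at this
      simp at this
      omega
    have hcard := card_le_card hsub
    rw [card_image_of_injective, card_univ, Fintype.card_prod, Fintype.card_fin] at hcard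
    · have : ((N * N : ℕ) : ℝ) ≤ t := by exact_mod_cast hcard.trans hS
      simpa using this.trans ht
    · rintro ⟨⟨i, hi⟩, ⟨j, hj⟩⟩ ⟨⟨i', hi'⟩, ⟨j', hj'⟩⟩ he
      have he' : N * i + j = N * i' + j' := by zify; exact he
      have h1 : i = i' := by
        have := congrArg (· / N) he'
        simpa [Nat.mul_add_div hN, Nat.div_eq_of_lt hj, Nat.div_eq_of_lt hj'] using this
      subst h1
      simpa using he'
  by_contra hlt
  push Not at hlt
  obtain ⟨N, h1, h2⟩ := (((tendsto_rpow_atTop (sub_pos.2 hlt)).comp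
    tendsto_natCast_atTop_atTop).eventually_gt_atTop C |>.and
      (Filter.eventually_ge_atTop 1)).exists
  have hN : (0 : ℝ) < N := by exact_mod_cast h2
  have h3 := key N h2
  rw [← sq, ← Real.rpow_natCast, show ((2 : ℕ) : ℝ) = (2 - ω) + ω by push_cast; ring,
    Real.rpow_add hN] at h3
  exact absurd (le_of_mul_le_mul_right h3 (Real.rpow_pos_of_pos hN _)) (not_le.2 h1)

theorem MatMulTime.exists_mulRoutine {ω : ℝ} (h : MatMulTime ω) : ∃ Q0 : Prog, ∀ D : ℕ,
    ∃ c : ℕ, ∀ ip im : ℕ → ℕ, RegularTimes D ip im → ∀ β W : ℕ, im β ≤ W →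
      MulRoutine ip im Q0 β W fun N => ⌈(c : ℝ) * (N : ℝ) ^ ω⌉₊ := by
  obtain ⟨P, hP⟩ := h
  refine ⟨P, fun D => ?_⟩
  obtain ⟨C, hC⟩ := hP D
  refine ⟨⌈C⌉₊ * D, fun ip im hT β W hW N X Y σ hN hNβ hXY h0 hX hY => ?_⟩
  obtain ⟨t, s', hex, hres, ht⟩ := hC ip im hT N β hN X Y hXY σ h0 hX hY
  refine ⟨t, s', hex, ?_, hres⟩
  have h1 : im (β + N.size) ≤ D * W :=
    ((hT.mono (by omega)).trans (hT.double β)).trans (Nat.mul_le_mul_left _ hW)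
  have h1' : (im (β + N.size) : ℝ) ≤ D * W := by exact_mod_cast h1
  have hp : (0 : ℝ) ≤ (N : ℝ) ^ ω := by positivity
  have : (t : ℝ) ≤ ⌈((⌈C⌉₊ * D : ℕ) : ℝ) * (N : ℝ) ^ ω⌉₊ * W := calc
    (t : ℝ) ≤ C * (N : ℝ) ^ ω * im (β + N.size) := ht
    _ ≤ ⌈C⌉₊ * (N : ℝ) ^ ω * (D * W) := by gcongr; exact Nat.le_ceil C
    _ = ((⌈C⌉₊ * D : ℕ) : ℝ) * (N : ℝ) ^ ω * W := by push_cast; ring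
    _ ≤ _ := by gcongr; exact Nat.le_ceil _
  exact_mod_cast this

theorem RegularTimes.mul_le {D : ℕ} {ip im : ℕ → ℕ} (h : RegularTimes D ip im) (c L : ℕ) :
    im (c * L) ≤ D ^ c * im L := by
  have h1 : ∀ j, im (2 ^ j * L) ≤ D ^ j * im L := fun j => by
    induction j with
    | zero => simp
    | succ j ih =>
      rw [pow_succ', pow_succ', mul_assoc, mul_assoc]
      exact (h.double _).trans (Nat.mul_le_mul_left _ ih)
  exact (h.mono (Nat.mul_le_mul_right _ Nat.lt_two_pow_self.le)).trans (h1 c)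

theorem mul_add_le_mul {n b T c e : ℝ} (hn : 1 ≤ n) (hT : 1 ≤ T) (he : 0 ≤ e) (hb : b ≤ c * T) :
    n * (b + e) ≤ (c + e) * (n * T) := by
  have : e ≤ e * T := le_mul_of_one_le_right he hT
  calc n * (b + e) ≤ n * (c * T + e * T) := by gcongr
    _ = _ := by ring

theorem convCost_le {ω c : ℝ} (hω : 2 ≤ ω) {mm : ℕ → ℕ}
    (hmm : ∀ p : ℕ, 1 ≤ p → (mm p : ℝ) ≤ c * (p : ℝ) ^ ω) {i l f r w : ℕ} (h₁ : i + l + f ≤ w)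
    (h₂ : i + r + f ≤ w) (h₃ : i + r + l ≤ w) (hc : 0 ≤ c) :
    (convCost mm i l f r : ℝ) ≤ (c + 33) * ((w + 1) ^ 2 * 2 ^ (ω / 2 * w)) := by
  unfold convCost productsCost productCost blockCost
  obtain ⟨q, hq⟩ : ∃ q, q = min (min l f) r := ⟨_, rfl⟩
  rw [← hq]
  obtain ⟨x, hx⟩ : ∃ x, x = l - q := ⟨_, rfl⟩
  obtain ⟨y, hy⟩ : ∃ y, y = f - q := ⟨_, rfl⟩
  obtain ⟨z, hz⟩ : ∃ z, z = r - q := ⟨_, rfl⟩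
  rw [← hx, ← hy, ← hz]
  have hs : i + x + y + z + 2 * q ≤ w := by omega
  have h2 : ∀ j : ℕ, (1 : ℝ) ≤ 2 ^ j := fun j => one_le_pow₀ (by norm_num)
  have hP : ((2 ^ q : ℕ) : ℝ) ^ ω = 2 ^ (ω * q) := by
    rw [mul_comm, Real.rpow_mul (by norm_num), Real.rpow_natCast]; push_cast; rfl
  have hP1 : (1 : ℝ) ≤ 2 ^ (ω * q) := Real.one_le_rpow (by norm_num) (by positivity)
  have hP2 : (2 : ℝ) ^ q * 2 ^ q ≤ 2 ^ (ω * q) := by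
    rw [← pow_add, ← Real.rpow_natCast]
    refine Real.rpow_le_rpow_of_exponent_le (by norm_num) ?_
    push_cast
    nlinarith [(Nat.cast_nonneg q : (0 : ℝ) ≤ q)]
  have hb : ((mm (2 ^ q) : ℝ) + 14 * (2 ^ q * 2 ^ q) + 4 + 1) ≤ (c + 19) * 2 ^ (ω * q) := by
    have := hmm (2 ^ q) Nat.one_le_two_pow
    rw [hP] at this
    linarith
  have hi : (1 : ℝ) ≤ (i : ℝ) + 1 := by simp
  have e1 : (1 : ℝ) ≤ 2 ^ y * 2 ^ (ω * q) := one_le_mul_of_one_le_of_one_le (h2 y) hP1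
  have e2 := one_le_mul_of_one_le_of_one_le (h2 z) e1
  have e3 := one_le_mul_of_one_le_of_one_le (h2 x) e2
  have e4 := one_le_mul_of_one_le_of_one_le (h2 i) e3
  have e5 := one_le_mul_of_one_le_of_one_le hi e4
  have e6 := one_le_mul_of_one_le_of_one_le hi e5
  have s1 := mul_add_le_mul (h2 y) hP1 le_rfl hb
  rw [add_zero, add_zero] at s1
  have s2 := mul_add_le_mul (h2 z) e1 zero_le_two s1
  have s3 := mul_add_le_mul (h2 x) e2 zero_le_two s2
  have s4 := mul_add_le_mul (h2 i) e3 (by norm_num : (0 : ℝ) ≤ 5)  s3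
  have s5 := mul_add_le_mul hi e4 zero_le_two s4
  have s6 := mul_add_le_mul hi e5 zero_le_two s5
  have hfin : ((i : ℝ) + 1) * ((i + 1) * (2 ^ i * (2 ^ x * (2 ^ z * (2 ^ y * 2 ^ (ω * q)))))) ≤
      (w + 1) ^ 2 * 2 ^ (ω / 2 * w) := by
    have hiw : (i : ℝ) ≤ w := by exact_mod_cast (by omega : i ≤ w)
    have : (2 : ℝ) ^ i * (2 ^ x * (2 ^ z * (2 ^ y * 2 ^ (ω * q)))) ≤ 2 ^ (ω / 2 * w) := by
      simp only [← Real.rpow_natCast, ← Real.rpow_add two_pos]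
      refine Real.rpow_le_rpow_of_exponent_le (by norm_num) ?_
      have hs' : (i : ℝ) + x + y + z + 2 * q ≤ w := by exact_mod_cast hs
      have hn : (0 : ℝ) ≤ (i : ℝ) + x + y + z := by positivity
      nlinarith
    calc _ ≤ ((w : ℝ) + 1) * ((w + 1) * 2 ^ (ω / 2 * w)) := by gcongr
      _ = _ := by ring
  calc _ ≤ (c + 33) * (((i : ℝ) + 1) * ((i + 1) * (2 ^ i * (2 ^ x * (2 ^ z *
        (2 ^ y * 2 ^ (ω * q))))))) := by push_cast; linarith
    _ ≤ _ := by gcongr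

theorem pow_le_two_pow_ceil {k : ℕ} (hk : 0 < k) (n : ℕ) :
    k ^ n ≤ 2 ^ ⌈(n : ℝ) * Real.logb 2 k⌉₊ := by
  have h : ((k ^ n : ℕ) : ℝ) ≤ ((2 ^ ⌈(n : ℝ) * Real.logb 2 k⌉₊ : ℕ) : ℝ) := by
    push_cast
    rw [← Real.rpow_natCast 2, ← Real.rpow_logb two_pos (by norm_num)
      (by exact_mod_cast hk : (0 : ℝ) < k), ← Real.rpow_natCast, ← Real.rpow_mul zero_le_two,
      Real.rpow_logb two_pos (by norm_num) (by exact_mod_cast hk)]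
    refine Real.rpow_le_rpow_of_exponent_le one_le_two ?_
    rw [mul_comm]
    exact Nat.le_ceil _
  exact_mod_cast h

theorem exists_scale {n k w μ ν : ℕ} (a : ℕ) (hn : 2 ≤ n) (hw : 2 ≤ w) (hwk : w ≤ k) (hwn : w ≤ n)
    (hμ : μ ≤ w ^ n * 2 ^ (5 * n)) (hν : μ ≤ ν) : ∃ L : ℕ, w ≤ L ∧ n ≤ 2 ^ L ∧
      μ ≤ 2 ^ ((a + 6) * L) ∧ L ≤ ⌈(n : ℝ) * Real.logb 2 k⌉₊ ∧
      (ν ≤ n ^ (a * k) → L ≤ ⌈(k : ℝ) * Real.logb 2 n⌉₊) := by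
  have hL₁ := pow_le_two_pow_ceil (by omega : 0 < k) n
  have hL2 := pow_le_two_pow_ceil (by omega : 0 < n) k
  generalize ⌈(n : ℝ) * Real.logb 2 k⌉₊ = L1 at *
  generalize ⌈(k : ℝ) * Real.logb 2 n⌉₊ = L2 at *
  have h₁ : n ≤ L1 := (Nat.pow_le_pow_iff_right (a := 2) (by omega)).1
    ((Nat.pow_le_pow_left (by omega) n).trans hL₁)
  have h₂ : k ≤ L2 := (Nat.pow_le_pow_iff_right (a := 2) (by omega)).1
    ((Nat.pow_le_pow_left hn k).trans hL2)
  have c₁ : n ≤ 2 ^ L1 ∧ μ ≤ 2 ^ ((a + 6) * L1) := by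
    refine ⟨h₁.trans Nat.lt_two_pow_self.le, hμ.trans ?_⟩
    calc w ^ n * 2 ^ (5 * n) ≤ 2 ^ L1 * 2 ^ (5 * L1) := Nat.mul_le_mul
          ((Nat.pow_le_pow_left hwk n).trans hL₁) (Nat.pow_le_pow_right two_pos (by omega))
      _ = 2 ^ (6 * L1) := by rw [← pow_add]; congr 1; ring
      _ ≤ _ := Nat.pow_le_pow_right two_pos (Nat.mul_le_mul_right _ (by omega))
  by_cases h : ν ≤ n ^ (a * k)
  · have c₂ : n ≤ 2 ^ L2 ∧ μ ≤ 2 ^ ((a + 6) * L2) := by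
      refine ⟨(Nat.le_self_pow (by omega) n).trans hL2, (hν.trans h).trans ?_⟩
      calc n ^ (a * k) = (n ^ k) ^ a := by rw [← pow_mul, mul_comm]
        _ ≤ (2 ^ L2) ^ a := Nat.pow_le_pow_left hL2 a
        _ = 2 ^ (a * L2) := by rw [← pow_mul, mul_comm]
        _ ≤ _ := Nat.pow_le_pow_right two_pos (Nat.mul_le_mul_right _ (by omega))
    rcases le_total L1 L2 with hl | hl
    · exact ⟨L1, by omega, c₁.1, c₁.2, le_rfl, fun _ => hl⟩
    · exact ⟨L2, by omega, c₂.1, c₂.2, hl, fun _ => le_rfl⟩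
  · exact ⟨L1, by omega, c₁.1, c₁.2, le_rfl, fun h' => absurd h' h⟩

theorem fits_two_pow {n N w L A C : ℕ} {E0 : Finset (Sym2 (Fin n))} {mm : ℕ → ℕ} (hw : 2 ≤ w)
    (hwL : w ≤ L) (hn : n ≤ 2 ^ L) (hN : N ≤ 3 * #E0) (hE : #E0 ≤ 2 * w * n)
    (hμ : nM E0 ≤ 2 ^ (A * L)) (hA : 6 ≤ A)
    (hC : ∀ i l f r, i + l + f ≤ w → i + r + f ≤ w → i + r + l ≤ w → convCost mm i l f r ≤ C) :
    Fits (2 ^ ((10 + 2 * A) * L)) mm E0 N w C (2 ^ (A * L)) := by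
  obtain ⟨x, hx⟩ : ∃ x, x = 2 ^ L := ⟨_, rfl⟩
  have hwx : w ≤ x := hwL.trans (hx ▸ Nat.lt_two_pow_self.le)
  rw [← hx] at hn
  have hx4 : 4 ≤ x := hx ▸ Nat.pow_le_pow_right (n := 2) two_pos (hw.trans hwL)
  have hx2 : 16 ≤ x ^ 2 := by nlinarith
  have hEx : #E0 ≤ 2 * x ^ 2 := by nlinarith [Nat.mul_le_mul hwx hn]
  have hx3 : 16 * x ^ 2 ≤ x ^ 4 := by nlinarith
  have hM : x ^ 22 ≤ 2 ^ ((10 + 2 * A) * L) := by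
    rw [hx, ← pow_mul, mul_comm L]
    exact Nat.pow_le_pow_right two_pos (Nat.mul_le_mul_right _ (by omega))
  have hM4 : x ^ 4 ≤ 2 ^ ((10 + 2 * A) * L) :=
    (Nat.pow_le_pow_right (by omega) (by norm_num)).trans hM
  have hpw : 2 ^ (w + 1) ≤ x * 2 := by
    rw [pow_succ, hx]
    exact Nat.mul_le_mul_right _ (Nat.pow_le_pow_right two_pos hwL)
  have hp : (N + 2) * 2 ^ (w + 1) ≤ 2 ^ ((10 + 2 * A) * L) := by
    refine le_trans ?_ ((Nat.pow_le_pow_right (by omega) (by norm_num : 6 ≤ 22)).trans hM)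
    calc (N + 2) * 2 ^ (w + 1) ≤ x ^ 4 * (x * 2) := Nat.mul_le_mul (by omega) hpw
      _ ≤ x ^ 4 * x ^ 2 := Nat.mul_le_mul_left _ (by nlinarith)
      _ = x ^ 6 := by ring
  refine ⟨hw, one_le_pow₀ (by norm_num), by exact_mod_cast hμ, ?_, by exact_mod_cast hp, ?_, ?_,
    fun v => ?_, hC⟩
  · rw [← pow_mul, ← pow_add]
    exact pow_le_pow_right₀ (by norm_num) (by nlinarith)
  · exact_mod_cast (by nlinarith : n + 1 ≤ x ^ 4).trans hM4
  · exact_mod_cast (by omega : N + 5 ≤ x ^ 4).trans hM4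
  · have : cnt E0 v ≤ #E0 := card_filter_le _ _
    exact_mod_cast (by omega : cnt E0 v ≤ x ^ 4).trans hM4

end RAM

open Finset MatchCount RAM

/-! ### The theorem -/

theorem MatchCount.Built.mono {V : Type*} [Fintype V] [DecidableEq V] {E0 E : Finset (Sym2 V)}
    {w w' : ℕ} (h : Built E0 w E) (hw : w ≤ w') : Built E0 w' E := by
  induction h with
  | single h₁ h₂ h₃ => exact .single h₁ h₂ (h₃.trans hw)
  | union _ _ h₁ h₂ h₃ h₄ => exact .union h₃ h₄ h₁ (h₂.trans hw)

theorem BranchDecomposition.width_le_card {V ι : Type*} [Fintype V] [Finite ι] {G : SimpleGraph V}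
    (T : BranchDecomposition G ι) : T.width ≤ Fintype.card V := by
  refine csSup_le' ?_
  rintro c ⟨x, y, _, rfl⟩
  exact (Set.ncard_le_card _).trans_eq Nat.card_eq_fintype_card

variable {n N : ℕ} {G : SimpleGraph (Fin n)} {T : BranchDecomposition G (Fin N)}

theorem IsInput.exists_treeData {s : State} (h : IsInput T s) :
    ∃ nbs U W, TreeData T nbs U W ∧ Given nbs U W fun a => s.mem a := by
  obtain ⟨x0, hx0⟩ := T.exists_leaf
  choose f hf hr hm using h.neighbours
  choose u v he hu hv using h.leaves
  have hlen : ∀ x, (List.ofFn (f x)).length = (T.tree.neighborSet x).ncard := by simp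
  let U : ({x // (T.tree.neighborSet x).ncard ≤ 1} → Fin n) → Fin N → Fin n := fun u x =>
    if hx : (T.tree.neighborSet x).ncard ≤ 1 then u ⟨x, hx⟩ else u ⟨x0, hx0⟩
  have hU : ∀ u x (hx : (T.tree.neighborSet x).ncard ≤ 1), U u x = u ⟨x, hx⟩ :=
    fun u x hx => dif_pos hx
  refine ⟨fun x => List.ofFn (f x), U u, U v,
    ⟨fun x y => ?_, fun x => List.nodup_ofFn.2 (hf x), fun x hx => ?_⟩,
    fun x => ?_, fun x j hj => ?_, fun x hx => ?_, fun x hx => ?_, fun x => ?_, fun x hx => ?_⟩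
  · rw [List.mem_ofFn', hr]; rfl
  · rw [hU _ _ hx, hU _ _ hx, he]
  · rw [hlen]; exact h.degree x
  · rw [hlen] at hj
    simpa using hm x ⟨j, hj⟩
  · rw [hlen] at hx
    rw [hU _ _ hx]; exact hu ⟨x, hx⟩
  · rw [hlen] at hx
    rw [hU _ _ hx]; exact hv ⟨x, hx⟩
  · rw [hlen]
    have := T.degree x
    omega
  · rw [hlen] at hx
    rw [hU _ _ hx, hU _ _ hx]
    have := (T.leafEdge ⟨x, hx⟩).2
    rw [he] at this
    exact G.ne_of_adj this

theorem Var.ctorIdx_injective : Function.Injective Var.ctorIdx :=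
  Function.LeftInverse.injective Var.ofNat_ctorIdx

theorem Arr.ctorIdx_injective : Function.Injective Arr.ctorIdx :=
  Function.LeftInverse.injective Arr.ofNat_ctorIdx

/-- The initial state of the program. -/
def initial (n N : ℕ) (lo : Fin 3 → ℤ → ℤ) : Store where
  v x := if x = .n then n else if x = .N then N else 0
  m _ _ := 0
  lo := lo

theorem IsInput.rep {s : State} (h : IsInput T s) {K : ℕ} (hK : 3 ≤ K) :
    Rep Var.ctorIdx Arr.ctorIdx K
      ((s.setReg (own Var.ctorIdx K .n) n).setReg (own Var.ctorIdx K .N) N)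
      (initial n N fun a => s.mem a) := by
  refine ⟨fun x => ?_, fun a => funext fun i => ?_, fun a => rfl⟩
  · have hinj : ∀ y z, own Var.ctorIdx K y = own Var.ctorIdx K z → y = z := fun y z hyz =>
      Var.ctorIdx_injective (by unfold own at hyz; omega)
    by_cases h1 : x = .N
    · subst h1; simp [initial]
    · rw [State.setReg_reg_ne _ fun hx => h1 (hinj _ _ hx)]
      by_cases h2 : x = .n
      · subst h2; simp [initial]
      · rw [State.setReg_reg_ne _ fun hx => h2 (hinj _ _ hx), h.reg_zero _ (by unfold own; omega)]
        simp [initial, h1, h2]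
  · exact h.mem_zero _ (by omega) i

theorem total_time_le {ω : ℝ} (hω : 2 ≤ ω) {c w k m N Λ t W C : ℕ} (hw : w ≤ k) (hk : 1 ≤ k)
    (hm : 1 ≤ m) (hN : N ≤ 3 * m) (hC : C = ⌈(c + 34 : ℝ) * ((w + 1) ^ 2 * 2 ^ (ω / 2 * w))⌉₊)
    (ht : t ≤ 6 * W + (N + 1) * (C + 200 * (w + 1) ^ 2 * 2 ^ w + 100) * (Λ * W)) :
    (t : ℝ) ≤ (6 + 16 * (c + 335) * Λ) * m * k ^ 2 * 2 ^ (ω / 2 * k) * W := by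
  obtain ⟨Y, hY⟩ : ∃ Y : ℝ, Y = (w + 1) ^ 2 * 2 ^ (ω / 2 * w) := ⟨_, rfl⟩
  obtain ⟨X, hX⟩ : ∃ X : ℝ, X = k ^ 2 * 2 ^ (ω / 2 * k) := ⟨_, rfl⟩
  have hk' : (1 : ℝ) ≤ k := by exact_mod_cast hk
  have hw' : (w : ℝ) ≤ k := by exact_mod_cast hw
  have hm' : (1 : ℝ) ≤ m := by exact_mod_cast hm
  have hN' : (N : ℝ) + 1 ≤ 4 * m := by exact_mod_cast (by omega : N + 1 ≤ 4 * m)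
  have hw2 : (2 : ℝ) ^ w ≤ 2 ^ (ω / 2 * w) := by
    rw [← Real.rpow_natCast]
    refine Real.rpow_le_rpow_of_exponent_le one_le_two ?_
    nlinarith [(Nat.cast_nonneg w : (0 : ℝ) ≤ w)]
  have h1w : (1 : ℝ) ≤ 2 ^ w := one_le_pow₀ one_le_two
  have hY1 : 1 ≤ Y := by
    rw [hY]
    exact one_le_mul_of_one_le_of_one_le (one_le_pow₀ (by simp)) (h1w.trans hw2)
  have hX1 : 1 ≤ X := by
    rw [hX]
    exact one_le_mul_of_one_le_of_one_le (one_le_pow₀ hk')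
      (Real.one_le_rpow one_le_two (by positivity))
  have hYX : Y ≤ 4 * X := by
    have : (2 : ℝ) ^ (ω / 2 * w) ≤ 2 ^ (ω / 2 * k) :=
      Real.rpow_le_rpow_of_exponent_le one_le_two (by gcongr)
    calc Y ≤ (2 * k) ^ 2 * 2 ^ (ω / 2 * k) := by rw [hY]; gcongr; linarith
      _ = 4 * X := by rw [hX]; ring
  have hCY : (C : ℝ) ≤ (c + 34) * Y + 1 := by
    rw [hC, ← hY]; exact (Nat.ceil_lt_add_one (by positivity)).le
  have h200 : 200 * ((w : ℝ) + 1) ^ 2 * 2 ^ w ≤ 200 * Y := by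
    rw [hY, mul_assoc]; gcongr
  have hK : (C : ℝ) + 200 * (w + 1) ^ 2 * 2 ^ w + 100 ≤ (c + 335) * (4 * X) := calc
    _ ≤ (c + 335) * Y := by linarith
    _ ≤ _ := by gcongr
  have ht' : (t : ℝ) ≤ 6 * W + (N + 1) * (C + 200 * (w + 1) ^ 2 * 2 ^ w + 100) * (Λ * W) := by
    exact_mod_cast ht
  have hmX : 1 ≤ m * X := one_le_mul_of_one_le_of_one_le hm' hX1
  calc (t : ℝ) ≤ 6 * (1 * W) + 4 * m * ((c + 335) * (4 * X)) * (Λ * W) := by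
        rw [one_mul]; refine ht'.trans ?_; gcongr
    _ ≤ 6 * (m * X * W) + 4 * m * ((c + 335) * (4 * X)) * (Λ * W) := by gcongr
    _ = _ := by rw [hX]; ring

theorem mainTheorem8 (ω : ℝ) (hω : RAM.MatMulTime ω) :
    ∃ P : RAM.Prog, ∀ D a : ℕ, ∃ C : ℝ, ∀ ip im : ℕ → ℕ, RAM.RegularTimes D ip im →
      ∀ (n N : ℕ) (G : SimpleGraph (Fin n)) (T : BranchDecomposition G (Fin N)) (k : ℕ),
        2 ≤ k → T.width ≤ k → ∀ s : RAM.State, IsInput T s →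
          ∃ (t : ℕ) (s' : RAM.State), RAM.Exec ip im P s t s' ∧
            s'.reg 0 = numPerfectMatchings G ∧
            (t : ℝ) ≤ C * G.edgeSet.ncard * (k : ℝ) ^ 2 * (2 : ℝ) ^ (ω / 2 * k) *
              (im ⌈(n : ℝ) * Real.logb 2 k⌉₊ : ℝ) ∧
            (numMatchings G ≤ n ^ (a * k) →
              (t : ℝ) ≤ C * G.edgeSet.ncard * (k : ℝ) ^ 2 * (2 : ℝ) ^ (ω / 2 * k) *
                (im ⌈(k : ℝ) * Real.logb 2 n⌉₊ : ℝ)) := by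
  classical
  have hω2 := hω.two_le
  obtain ⟨Q0, hQ0⟩ := hω.exists_mulRoutine
  obtain ⟨K, hK⟩ : ∃ K, K = Q0.names + 3 := ⟨_, rfl⟩
  obtain ⟨ow, how⟩ : ∃ ow, ow = own Var.ctorIdx K := ⟨_, rfl⟩
  have hown : ∀ x, 3 ≤ ow x := fun x => by rw [how]; unfold own; omega
  refine ⟨.seq (mov (ow .n) 0) (.seq (mov (ow .N) 1)
    (.seq (main.comp Var.ctorIdx Arr.ctorIdx K Q0 0) (mov 0 (ow .res)))), fun D a => ?_⟩
  obtain ⟨c, hc⟩ := hQ0 D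
  obtain ⟨A, hA⟩ : ∃ A, A = a + 6 := ⟨_, rfl⟩
  obtain ⟨j, hj⟩ : ∃ j, j = (main.bd + 1) * (11 + 2 * A) := ⟨_, rfl⟩
  refine ⟨(6 + 16 * (c + 335) * main.len) * ((D + 1) * D ^ j), ?_⟩
  intro ip im hT n N G T k hk hTk s hs
  obtain ⟨nbs, U, W', hD, hg⟩ := hs.exists_treeData
  obtain ⟨E0, hE0⟩ : ∃ E0, E0 = G.edgeFinset := ⟨_, rfl⟩
  have hE : ∀ e, e ∈ E0 ↔ e ∈ G.edgeSet := by simp [hE0]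
  have hm : G.edgeSet.ncard = #E0 := by
    rw [hE0, ← Set.ncard_coe_finset, SimpleGraph.coe_edgeFinset]
  obtain ⟨x0, hx0⟩ := T.exists_leaf
  have hm1 : 1 ≤ #E0 := card_pos.2 ⟨_, (hE _).2 (T.leafEdge ⟨x0, hx0⟩).2⟩
  have hn : 2 ≤ n := by
    obtain ⟨u, v, huv, _⟩ := T.exists_leafEdge_eq ⟨x0, hx0⟩
    omega
  have hwn : T.width ≤ n := T.width_le_card.trans_eq (Fintype.card_fin n)
  obtain ⟨w, hw⟩ : ∃ w, w = max 2 T.width := ⟨_, rfl⟩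
  have hEn : #E0 ≤ 2 * w * n := by
    have := ((T.built_univ hE).mono (by omega : T.width ≤ w)).card_edges_le (by omega)
    rwa [Fintype.card_fin] at this
  have hN : N ≤ 3 * #E0 := by simpa using T.card_le_three_mul hE
  have hμ := nM_le_pow E0 (by omega : 2 ≤ w) (by rwa [Fintype.card_fin])
  rw [Fintype.card_fin] at hμ
  obtain ⟨L, hwL, hnL, hμL, hL₁, hL2⟩ := exists_scale a hn (by omega : 2 ≤ w)
    (by omega : w ≤ k) (by omega) hμ (nM_le_numMatchings hE)
  rw [← hA] at hμL
  obtain ⟨β, hβ⟩ : ∃ β, β = (10 + 2 * A) * L + 1 := ⟨_, rfl⟩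
  obtain ⟨b, hb⟩ : ∃ b, b = (main.bd + 1) * β := ⟨_, rfl⟩
  obtain ⟨W, hWd⟩ : ∃ W, W = (D + 1) * (D ^ j * im L) := ⟨_, rfl⟩
  have hbj : b ≤ j * L := by
    rw [hb, hj, mul_assoc]
    refine Nat.mul_le_mul_left _ ?_
    have : (11 + 2 * A) * L = (10 + 2 * A) * L + L := by ring
    omega
  have himb : im b ≤ D ^ j * im L := (hT.mono hbj).trans (hT.mul_le j L)
  have hW : ∀ x ≤ b, ip x ≤ W ∧ im x ≤ W := fun x hx => by
    have h1 := (hT.mono hx).trans himb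
    have h2 := (hT.add_le x).trans (Nat.mul_le_mul_left D h1)
    rw [hWd, add_mul]
    omega
  have hβb : β ≤ b := hb ▸ Nat.le_mul_of_pos_left _ (by omega)
  obtain ⟨C, hC⟩ : ∃ C, C = ⌈(c + 34 : ℝ) * ((w + 1) ^ 2 * 2 ^ (ω / 2 * w))⌉₊ := ⟨_, rfl⟩
  have hcost : ∀ p : ℕ, 1 ≤ p → ((⌈(c : ℝ) * (p : ℝ) ^ ω⌉₊ : ℕ) : ℝ) ≤ (c + 1) * (p : ℝ) ^ ω :=
    fun p hp => by
      have h1 : (1 : ℝ) ≤ (p : ℝ) ^ ω := Real.one_le_rpow (by exact_mod_cast hp) (by linarith)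
      have := (Nat.ceil_lt_add_one (by positivity : (0 : ℝ) ≤ c * (p : ℝ) ^ ω)).le
      linarith
  have hfit := fits_two_pow (C := C) (E0 := E0) (mm := fun N => ⌈(c : ℝ) * (N : ℝ) ^ ω⌉₊)
    (by omega : 2 ≤ w) hwL hnL hN hEn hμL (by omega) fun i l f r h₁ h₂ h₃ => by
      have h := (convCost_le hω2 hcost h₁ h₂ h₃ (by positivity)).trans_eq
        (by ring : _ = (c + 34 : ℝ) * ((w + 1) ^ 2 * 2 ^ (ω / 2 * w)))
      rw [hC]
      exact_mod_cast h.trans (Nat.le_ceil _)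
  have hMβ : bits (2 ^ ((10 + 2 * A) * L)) ≤ β := by
    rw [bits_le, Int.natAbs_pow, hβ]
    exact Nat.pow_lt_pow_right one_lt_two (by omega)
  have hrun := run_main (s := initial n N fun a => s.mem a) hD hg hE
    (by omega : T.width ≤ w) hfit (by simp [initial]) (by simp [initial])
    (fun x h1 h2 => by simp [initial, h1, h2]) fun _ _ => rfl
  have hM1 := hfit.n
  have hM2 := hfit.N
  have hle : ∀ {z}, |z| ≤ 2 ^ ((10 + 2 * A) * L) → bits z ≤ b := fun hz =>
    ((bits_le_of_abs_le hz).trans hMβ).trans hβb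
  have hbd : Bd (2 ^ ((10 + 2 * A) * L)) (initial n N fun a => s.mem a) := by
    refine ⟨fun x => ?_, fun _ _ => ?_⟩
    · unfold initial
      dsimp only
      split_ifs
      · rw [Nat.abs_cast]; omega
      · rw [Nat.abs_cast]; omega
      · rw [abs_zero]; omega
    · rw [show (initial n N fun a => s.mem a).m _ _ = 0 from rfl, abs_zero]; omega
  obtain ⟨t1, ex1, ht₁⟩ := exec_mov hW (r := ow .n) (x := 0) (σ := s)
    (by have := hown .n; omega) (hle (by rw [hs.vertices, Nat.abs_cast]; omega))
  have hr1 : (s.setReg (ow .n) (s.reg 0)).reg 1 = N := by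
    rw [State.setReg_reg_ne _ (by have := hown .n; omega), hs.nodes]
  obtain ⟨t2, ex2, ht₂⟩ := exec_mov hW (r := ow .N) (x := 1)
    (σ := s.setReg (ow .n) (s.reg 0)) (by have := hown .N; omega)
    (hle (by rw [hr1, Nat.abs_cast]; omega))
  rw [hr1, hs.vertices, how] at ex2
  obtain ⟨t3, σ3, ex3, ht₃, _, s₃, hrep, hbd3, hres⟩ := hrun.sound Var.ctorIdx_injective
    Arr.ctorIdx_injective (by omega : 3 ≤ K) (by omega) hW (by omega) hMβ
    (hc ip im hT β W ((hT.mono hβb).trans (hW b le_rfl).2)) hbd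
    (by rw [hb]; exact Nat.mul_le_mul_right _ (by omega)) le_rfl 0 _ (hs.rep (by omega))
  have hreg := hrep.reg .res
  rw [← how] at hreg
  obtain ⟨t4, ex4, ht4⟩ := exec_mov hW (r := 0) (x := ow .res) (σ := σ3)
    (by have := hown .res; omega) (hle (by rw [hreg]; exact hbd3.1 _))
  rw [hs.vertices] at ex1
  rw [← how] at ex2 ex3
  have ht := total_time_le (t := t1 + (t2 + (t3 + t4))) (Λ := main.len) (W := W) hω2
    (by omega : w ≤ k) (by omega) hm1 hN hC (by linarith)
  have hfinal : ∀ L', L ≤ L' → ((t1 + (t2 + (t3 + t4)) : ℕ) : ℝ) ≤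
      (6 + 16 * (c + 335) * main.len) * ((D + 1) * D ^ j) * G.edgeSet.ncard * (k : ℝ) ^ 2 *
        (2 : ℝ) ^ (ω / 2 * k) * im L' := fun L' hL' => by
    have him : (im L : ℝ) ≤ im L' := by exact_mod_cast hT.mono hL'
    refine ht.trans ?_
    rw [hWd, hm]
    push_cast
    calc _ = (6 + 16 * (c + 335) * main.len) * ((D + 1) * D ^ j) * #E0 * (k : ℝ) ^ 2 *
        (2 : ℝ) ^ (ω / 2 * k) * im L := by ring
      _ ≤ _ := by gcongr
  exact ⟨_, _, ex1.seq (ex2.seq (ex3.seq ex4)), by rw [State.setReg_reg_self, hreg, hres],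
    hfinal _ hL₁, fun h => hfinal _ (hL2 h)⟩
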